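/- Let $d\ge 3$, $s\in(0,1)$, and let $b:[-1,1]\to[0,\infty)$ satisfy $b(1)>0$ and $\tilde b(z)/(1-z)^{1+s}\in L^1(-1,1)$, where $\tilde b(z)=b(z)-b(1)$. Put $$b_s(\theta,\theta')=\frac{b(\theta\cdot\theta')}{(1-\theta\cdot\theta')^{\frac{d-1}{2}+s}},\qquad \theta,\theta'\in\mathbb S^{d-1},$$ and let the scattering operator $\mathcal I_{b_s}$ be defined weakly: for all smooth $\psi$ on $\mathbb S^{d-1}$, $$\int_{\mathbb S^{d-1}}\mathcal I_{b_s}(f)\,\psi\,d\theta=\lim_{\epsilon\to0^+}\int_{\mathbb S^{d-1}}f(\theta)\int_{\{1-\theta\cdot\theta'\ge\epsilon\}}\big(\psi(\theta')-\psi(\theta)\big)\,b_s(\theta,\theta')\,d\theta'\,d\theta .$$ Let $T>0$ and let $0\le u_o\in L^1(\mathbb R^d\times\mathbb S^{d-1})$, with mass $m_0=\int_{\mathbb R^d}\int_{\mathbb S^{d-1}}u_o\,d\theta\,dx$. A weak solution on $[0,T)$ with initial state $u_o$ is a nonnegative $u\in L^\infty([0,T);L^1_{x,\theta})\cap C([0,T);L^1_{loc})$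 with $u(0)=u_o$, whose weak derivatives $\partial_t u$, $\nabla_x u$ and $\mathcal I_{b_s}(u)$ belong to $L^2([t_0,T);L^2_{x,\theta})$ for every $t_0\in(0,T)$, and for which $\partial_t u+\theta\cdot\nabla_x u=\mathcal I_{b_s}(u)$ almost everywhere in $(0,T)\times\mathbb R^d\times\mathbb S^{d-1}$. Let $\delta\in(0,1)$ be arbitrary if $d=3$, and $\delta=0$ if $d\ge4$. Let $$q=\frac{d-1}{1-s},\qquad \beta_1=\frac{2(1-\delta)}{q},\qquad \beta=\frac{2}{5-\beta_1},\qquad 0<s'\le 2\beta\ (<1),$$ $$\frac1{p_s}=\frac12-\frac{s}{d-1},\qquad \frac1{q_2}=\frac12-\frac{s'}{d},\qquad \alpha_1=\frac{2q_2-2}{p_sq_2-2},\qquad r=p_s\alpha_1+(1-\alpha_1),\qquad \omega=\frac{2(r-1)}{r}.$$ Then $\omega>1$, and there is a function $c_3:[0,\infty)\to\mathbb R$, strictly increasing and depending only on $d,s,s',\delta$ and $b$, such that for every $T>0$, every such $u_o$ and every weak solution $u$ on $[0,T)$ with initial state $u_o$: $u(t)\in L^2(\mathbb R^d\times\mathbb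 S^{d-1})$ and $$\|u(t)\|_{L^2_{x,\theta}}\le c_3(m_0)\;t^{-\frac1{\omega-1}}\qquad\text{for all }0<t<\min\{T,1\}.$$ -/

import Mathlib

open MeasureTheory Filter Topology Set
open scoped ContDiff

namespace RadiativeTransfer

/-! ### Phase space -/

/-- The physical space `ℝ^d`. -/
abbrev Space (d : ℕ) : Type := EuclideanSpace ℝ (Fin d)

/-- The unit sphere `𝕊^{d-1}` of `ℝ^d`. -/
abbrev Sphere (d : ℕ) : Type := Metric.sphere (0 : Space d) 1

/-- The surface measure `dθ` on `𝕊^{d-1}`. -/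
noncomputable abbrev surface (d : ℕ) : Measure (Sphere d) :=
  (volume : Measure (Space d)).toSphere

/-- The measure `dx dθ` on `ℝ^d × 𝕊^{d-1}`. -/
noncomputable abbrev phase (d : ℕ) : Measure (Space d × Sphere d) :=
  (volume : Measure (Space d)).prod (surface d)

/-- The measure `dt dx dθ` on `(a, b) × ℝ^d × 𝕊^{d-1}`. -/
noncomputable abbrev slab (d : ℕ) (a b : ℝ) : Measure (ℝ × Space d × Sphere d) :=
  ((volume : Measure ℝ).restrict (Ioo a b)).prod (phase d)

/-! ### The scattering kernel and the scattering operator -/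

/-- The assumptions on the function `b` in the kernel
`b(θ·θ') / (1 - θ·θ')^{(d-1)/2+s}`: it is nonnegative on `[-1,1]`, its value at `1` is positive
(forward peak), and `b̃ = b - b(1)` satisfies `b̃(z) / (1-z)^{1+s} ∈ L¹(-1,1)`. -/
structure IsForwardPeaked (s : ℝ) (b : ℝ → ℝ) : Prop where
  nonneg : ∀ z ∈ Icc (-1 : ℝ) 1, 0 ≤ b z
  peak_pos : 0 < b 1
  integrable : IntegrableOn (fun z : ℝ => (b z - b 1) / (1 - z) ^ (1 + s)) (Ioo (-1) 1)

/-- The scattering kernel `b_s(θ,θ') = b(θ·θ') / (1 - θ·θ')^{(d-1)/2+s}`. -/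
noncomputable def kernel (d : ℕ) (s : ℝ) (b : ℝ → ℝ) (θ θ' : Sphere d) : ℝ :=
  b (inner ℝ (θ : Space d) (θ' : Space d)) /
    (1 - inner ℝ (θ : Space d) (θ' : Space d)) ^ (((d : ℝ) - 1) / 2 + s)

/-- The truncated scattering operator applied to a test function,
`∫_{1 - θ·θ' ≥ ε} (ψ(θ') - ψ(θ)) b_s(θ,θ') dθ'`. -/
noncomputable def truncatedScattering (d : ℕ) (s : ℝ) (b : ℝ → ℝ) (ε : ℝ)
    (ψ : Space d → ℝ) (θ : Sphere d) : ℝ :=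
  ∫ θ' in {θ' : Sphere d | ε ≤ 1 - inner ℝ (θ : Space d) (θ' : Space d)},
    (ψ (θ' : Space d) - ψ (θ : Space d)) * kernel d s b θ θ' ∂(surface d)

/-- `F = 𝓘_{b_s}(f)` on the sphere, in the weak sense: for every smooth `ψ`,
`∫ F ψ dθ = lim_{ε → 0} ∫ f(θ) ∫_{1 - θ·θ' ≥ ε} (ψ(θ') - ψ(θ)) b_s(θ,θ') dθ' dθ`.
The smooth functions on the sphere are the restrictions of the smooth functions on `ℝ^d`. -/
def IsScattering (d : ℕ) (s : ℝ) (b : ℝ → ℝ) (f F : Sphere d → ℝ) : Prop :=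
  ∀ ψ : Space d → ℝ, ContDiff ℝ ∞ ψ →
    Tendsto (fun ε : ℝ => ∫ θ, f θ * truncatedScattering d s b ε ψ θ ∂(surface d))
      (𝓝[>] 0) (𝓝 (∫ θ, F θ * ψ (θ : Space d) ∂(surface d)))

/-! ### Solutions of the transport equation -/

/-- `g` is the weak derivative of `u` on `(0,T) × ℝ^d × 𝕊^{d-1}` in the direction `w` of the
variables `(t,x)`. Test functions on `(0,T) × ℝ^d × 𝕊^{d-1}` are restrictions of
smooth functions of `(t,x,θ) ∈ ℝ × ℝ^d × ℝ^d`. -/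
def HasWeakDeriv (d : ℕ) (T : ℝ) (w : ℝ × Space d) (u g : ℝ × Space d × Sphere d → ℝ) : Prop :=
  ∀ φ : ℝ × Space d × Space d → ℝ, ContDiff ℝ ∞ φ → HasCompactSupport φ →
    tsupport φ ⊆ {p | p.1 ∈ Ioo 0 T} →
    ∫ p, u p * fderiv ℝ φ (p.1, p.2.1, (p.2.2 : Space d)) (w.1, w.2, 0) ∂(slab d 0 T) =
      - ∫ p, g p * φ (p.1, p.2.1, (p.2.2 : Space d)) ∂(slab d 0 T)

/-- `u` is a solution on `[0,T)` of `∂ₜu + θ·∇ₓu = 𝓘_{b_s}(u)`, `u(0) = u₀`: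
`0 ≤ u ∈ L^∞([0,T); L¹) ∩ C([0,T); L¹_loc)`, the weak derivatives `∂ₜu`, `∇ₓu` and `𝓘_{b_s}(u)`
belong to `L²([t₀,T); L²)` for every `t₀ > 0`, and the equation holds almost everywhere. -/
structure IsSolution (d : ℕ) (s : ℝ) (b : ℝ → ℝ) (T : ℝ) (u₀ : Space d × Sphere d → ℝ)
    (u : ℝ → Space d × Sphere d → ℝ) : Prop where
  nonneg : ∀ t ∈ Ico 0 T, 0 ≤ᵐ[phase d] u t
  measurable : AEStronglyMeasurable (fun p : ℝ × Space d × Sphere d => u p.1 p.2) (slab d 0 T)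
  bounded : ∃ M : ℝ, ∀ᵐ t ∂((volume : Measure ℝ).restrict (Ioo 0 T)),
    Integrable (u t) (phase d) ∧ ∫ z, |u t z| ∂(phase d) ≤ M
  locallyIntegrable : ∀ t ∈ Ico 0 T, LocallyIntegrable (u t) (phase d)
  continuous : ∀ t ∈ Ico 0 T, ∀ K : Set (Space d × Sphere d), IsCompact K →
    Tendsto (fun τ : ℝ => ∫ z in K, |u τ z - u t z| ∂(phase d)) (𝓝[Ico 0 T] t) (𝓝 0)
  initial : u 0 =ᵐ[phase d] u₀
  equation : ∃ (ut : ℝ × Space d × Sphere d → ℝ) (Du : ℝ × Space d × Sphere d → Space d)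
      (Iu : ℝ × Space d × Sphere d → ℝ),
    (∀ t₀ ∈ Ioo 0 T, MemLp ut 2 (slab d t₀ T) ∧ MemLp Du 2 (slab d t₀ T) ∧
      MemLp Iu 2 (slab d t₀ T)) ∧
    HasWeakDeriv d T (1, 0) (fun p => u p.1 p.2) ut ∧
    (∀ e : Space d, HasWeakDeriv d T (0, e) (fun p => u p.1 p.2) (fun p => inner ℝ (Du p) e)) ∧
    (∀ᵐ q ∂(((volume : Measure ℝ).restrict (Ioo 0 T)).prod (volume : Measure (Space d))),
      IsScattering d s b (fun θ => u q.1 (q.2, θ)) (fun θ => Iu (q.1, q.2, θ))) ∧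
    ∀ᵐ p ∂(slab d 0 T), ut p + inner ℝ (p.2.2 : Space d) (Du p) = Iu p

/-! ### The exponents -/

/-- The parameter `δ`: arbitrary in `(0,1)` if `d = 3`, and `0` if `d ≥ 4`. -/
def IsDelta (d : ℕ) (δ : ℝ) : Prop :=
  (d = 3 ∧ δ ∈ Ioo (0 : ℝ) 1) ∨ (4 ≤ d ∧ δ = 0)

/-- The exponent `β = 2 / (5 - β₁)` of the averaging regularity `(-Δₓ)^β ρ ∈ L²` of
`ρ = ∫ u dθ`, where `β₁ = 2 (1-δ) / q` and `q = (d-1) / (1-s)`. -/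
noncomputable def beta (d : ℕ) (s δ : ℝ) : ℝ :=
  2 / (5 - 2 * (1 - δ) / (((d : ℝ) - 1) / (1 - s)))

/-- `1/p_s = 1/2 - s/(d-1)`. -/
noncomputable def pExp (d : ℕ) (s : ℝ) : ℝ := 1 / (1 / 2 - s / ((d : ℝ) - 1))

/-- `1/q₂ = 1/2 - s'/d`. -/
noncomputable def qExp (d : ℕ) (s' : ℝ) : ℝ := 1 / (1 / 2 - s' / (d : ℝ))

/-- `α₁ = (2 q₂ - 2) / (p_s q₂ - 2)`. -/
noncomputable def alphaOne (d : ℕ) (s s' : ℝ) : ℝ :=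
  (2 * qExp d s' - 2) / (pExp d s * qExp d s' - 2)

/-- `r = p_s α₁ + (1 - α₁)`. -/
noncomputable def rExp (d : ℕ) (s s' : ℝ) : ℝ :=
  pExp d s * alphaOne d s s' + (1 - alphaOne d s s')

/-- `ω = 2 (r-1) / r`. -/
noncomputable def omegaExp (d : ℕ) (s s' : ℝ) : ℝ := 2 * (rExp d s s' - 1) / rExp d s s'

end RadiativeTransfer

/-! The estimate is proved one spatial frequency at a time. Let `W(t,θ)` be the Fourier transform of
`u(t,·,θ)` in `x` at frequency `ξ`. It solves `∂ₜW + 2πi(θ·ξ)W = 𝓘(W)` and, because `u ≥ 0` and the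
mass does not increase, `‖W(t)‖_{L¹(dθ)} ≤ m₀` for every `ξ`. Multiplication by a cutoff `η(t)` and
a Fourier transform in time turn the equation into a resolvent equation on the sphere, `𝓘(f) = i a f
- g`, with `a = 2π(τ + θ·ξ)`, `f = 𝓕(ηW)` and `g = 𝓕(η'W)`. The term `i a f` is skew, so the
dissipation of `f` is exactly `Re ∫ g conj f`. Estimates proved for `f` and `g` return to the time
variable by Plancherel.

Smoothing in angle: the dissipation, together with `‖f‖²`, bounds the integral of `|f(θ) - f(θ')|²`
over pairs at distance comparable to `μ`, with a factor `μ^(2s+d-1)`. A Nash inequality at scale `μ`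
compares this with the `L²` norm and with the `L¹` norm, and the latter is at most `m₀`. An
absorption argument over nested time intervals then bounds the time integral of `‖W‖²` at time
resolution `ρ` by `m₀² ρ^(-(d-1)/(2s))` times the length of the interval
(`IsKernel.exists_fiber_decay`).

Gain at high frequency: pairing the resolvent equation with a smooth bounded odd function of `a`
times `f` recovers the mass of `f` off the resonant strip `|a| ≲ |ξ|ε`. The commutator of this
multiplier with `𝓘` costs `ε^(-2s)`. Inside the strip angular smoothing takes over: the sphere is
curved, so it cannot stay in a slab of thickness of order `ε` over a distance of order `√ε`, and a
fixed proportion of each annulus of that size lies off the strip. The balance `|ξ| ε^(1+3s/2) = 1`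
yields `‖f‖ ≤ C ε^s ‖g‖` (`IsKernel.exists_resolvent_gain`). Iterating this over cutoffs gives decay
in `ξ` of any prescribed polynomial order, hence integrability over `ξ`.

Summing with Plancherel in `x` bounds the energy integrated over a window before `t` by `C m₀²
t^(1-P)`, with `P = (d-1)/(2s) + d(1/s + 3/2)`. The inequality `0 ≤ ∫ η η' ‖W‖²` says that the
energy of each mode does not increase, so the bound is carried to times just after `t`. Lower
semicontinuity in `L¹_loc` brings it to `t` itself. The result is `‖u(t)‖ ≤ C m₀ t^(-P/2)`. A closed
form of `ω - 1` shows `P/2 ≤ 1/(ω-1)`, and for `t < 1` this is at least as strong as the claim, with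
a linear `c₃`.

Two points of rigour shape the argument. The operator `𝓘` is only defined weakly, so functions on
the sphere are first mollified by polynomials in `θ·θ'`, an operation that commutes with every zonal
operator. Square integrability of `W` is not assumed: it is proved first for the mollified spatial
average of `u` (the mode `ξ = 0`), uniformly in the mollification, and then holds for every `ξ`
because `|W|` at frequency `ξ` is at most `W` at frequency `0`. -/

namespace RadiativeTransfer

/-! ### Plancherel's theorem for integrable functions -/

section

open scoped FourierTransform ENNReal in
/-- The Fourier transform is self-adjoint, tested on Schwartz functions. -/
theorem integral_schwartz_smul_fourier {V : Type*} [NormedAddCommGroup V] [InnerProductSpace ℝ V]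
    [FiniteDimensional ℝ V] [MeasurableSpace V] [BorelSpace V] {F : V → ℂ} (hF : Integrable F)
    (g : SchwartzMap V ℂ) : ∫ x, (𝓕 g) x * F x = ∫ x, g x * 𝓕 F x := by
  have h := VectorFourier.integral_fourierIntegral_smul_eq_flip (μ := (volume : Measure V))
    (ν := (volume : Measure V)) (e := Real.fourierChar) (L := innerₗ V) (f := (g : V → ℂ)) (g := F)
    Real.continuous_fourierChar continuous_inner g.integrable hF
  simp only [smul_eq_mul, flip_innerₗ] at h
  exact h

open scoped FourierTransform ENNReal in
theorem ae_eq_of_integral_schwartz {V : Type*} [NormedAddCommGroup V] [InnerProductSpace ℝ V]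
    [FiniteDimensional ℝ V] [MeasurableSpace V] [BorelSpace V] {F G : V → ℂ}
    (hF : LocallyIntegrable F) (hG : LocallyIntegrable G)
    (h : ∀ g : SchwartzMap V ℂ, ∫ x, g x * F x = ∫ x, g x * G x) : F =ᵐ[volume] G := by
  refine ae_eq_of_integral_contDiff_smul_eq hF hG fun g hg hc => ?_
  have hc' : HasCompactSupport (fun x => (g x : ℂ)) := hc.comp_left (g := ((↑) : ℝ → ℂ)) (by simp)
  have hg' : ContDiff ℝ ∞ (fun x => (g x : ℂ)) := Complex.ofRealCLM.contDiff.comp hg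
  have := h (hc'.toSchwartzMap hg')
  simpa [Complex.real_smul] using this

open scoped FourierTransform ENNReal in
/-- **Plancherel's theorem** for integrable functions, without any assumption of square
integrability. -/
theorem eLpNorm_fourier_eq {V : Type*} [NormedAddCommGroup V] [InnerProductSpace ℝ V]
    [FiniteDimensional ℝ V] [MeasurableSpace V] [BorelSpace V] {F : V → ℂ} (hF : Integrable F) :
    eLpNorm (𝓕 F) 2 volume = eLpNorm F 2 volume := by
  have hcont : Continuous (𝓕 F) :=
    VectorFourier.fourierIntegral_continuous Real.continuous_fourierChar continuous_inner hF
  by_cases h2 : MemLp F 2 volume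
  · set G : Lp ℂ 2 (volume : Measure V) := 𝓕 (h2.toLp F)
    have hG : (G : V → ℂ) =ᵐ[volume] 𝓕 F := by
      refine ae_eq_of_integral_schwartz ((Lp.memLp G).locallyIntegrable (by norm_num))
        hcont.locallyIntegrable fun g => ?_
      have h1 := congrArg (fun D => D g) (Lp.fourier_toTemperedDistribution_eq (h2.toLp F))
      simp only [TemperedDistribution.fourier_apply, Lp.toTemperedDistribution_apply,
        smul_eq_mul] at h1
      rw [← integral_schwartz_smul_fourier hF, ← h1]
      refine integral_congr_ae ?_
      filter_upwards [h2.coeFn_toLp] with x hx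
      rw [hx]
    rw [← eLpNorm_congr_ae hG, ← eLpNorm_congr_ae h2.coeFn_toLp, ← Lp.enorm_def, ← Lp.enorm_def,
      ← ofReal_norm, ← ofReal_norm, Lp.norm_fourier_eq]
  -- If `𝓕 F` were square integrable, its `L²` inverse transform would coincide with `F` as a
  -- distribution. Hence neither function is in `L²`, and both norms are infinite.
  · have h3 : ¬ MemLp (𝓕 F) 2 volume := by
      intro h3
      apply h2
      set G : Lp ℂ 2 (volume : Measure V) := 𝓕⁻ (h3.toLp (𝓕 F))
      have hG : (G : V → ℂ) =ᵐ[volume] F := by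
        refine ae_eq_of_integral_schwartz ((Lp.memLp G).locallyIntegrable (by norm_num))
          hF.locallyIntegrable fun g => ?_
        have h1 := congrArg (fun D => D g) (Lp.fourierInv_toTemperedDistribution_eq (h3.toLp (𝓕 F)))
        simp only [TemperedDistribution.fourierInv_apply, Lp.toTemperedDistribution_apply,
          smul_eq_mul] at h1
        rw [← h1]
        have h4 := integral_schwartz_smul_fourier hF (𝓕⁻ g)
        rw [FourierTransform.fourier_fourierInv_eq] at h4
        rw [h4]
        refine integral_congr_ae ?_
        filter_upwards [h3.coeFn_toLp] with x hx
        rw [hx]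
      exact (memLp_congr_ae hG).1 (Lp.memLp G)
    have e1 : eLpNorm F 2 volume = ⊤ := by
      by_contra h
      exact h2 ⟨hF.aestronglyMeasurable, lt_top_iff_ne_top.2 h⟩
    have e2 : eLpNorm (𝓕 F) 2 volume = ⊤ := by
      by_contra h
      exact h3 ⟨hcont.aestronglyMeasurable, lt_top_iff_ne_top.2 h⟩
    rw [e1, e2]

theorem eLpNorm_two_sq {α : Type*} [MeasurableSpace α] {μ : Measure α} {E : Type*}
    [NormedAddCommGroup E] (f : α → E) : eLpNorm f 2 μ ^ 2 = ∫⁻ x, ‖f x‖ₑ ^ 2 ∂μ := by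
  have := eLpNorm_nnreal_pow_eq_lintegral (μ := μ) (f := f) (p := 2) (by norm_num)
  simpa using this

open scoped FourierTransform ENNReal in
theorem lintegral_fourier_sq {V : Type*} [NormedAddCommGroup V] [InnerProductSpace ℝ V]
    [FiniteDimensional ℝ V] [MeasurableSpace V] [BorelSpace V] {F : V → ℂ} (hF : Integrable F) :
    ∫⁻ x, ‖𝓕 F x‖ₑ ^ 2 = ∫⁻ x, ‖F x‖ₑ ^ 2 := by
  rw [← eLpNorm_two_sq, ← eLpNorm_two_sq, eLpNorm_fourier_eq hF]


end

/-! ### Rotations, polar coordinates and slices of the sphere -/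

section

open scoped ENNReal Pointwise

/-- The action of a linear isometry on the sphere. -/
noncomputable def rot {d : ℕ} (L : Space d ≃ₗᵢ[ℝ] Space d) (θ : Sphere d) : Sphere d :=
  ⟨L θ, by simp⟩

@[simp] theorem coe_rot {d : ℕ} (L : Space d ≃ₗᵢ[ℝ] Space d) (θ : Sphere d) :
    (rot L θ : Space d) = L θ := rfl

theorem norm_sphere {d : ℕ} (θ : Sphere d) : ‖(θ : Space d)‖ = 1 := by
  simp

theorem continuous_rot {d : ℕ} (L : Space d ≃ₗᵢ[ℝ] Space d) : Continuous (rot L) :=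
  Continuous.subtype_mk (L.continuous.comp continuous_subtype_val) _

/-- The surface measure is invariant under linear isometries. -/
theorem measurePreserving_rot {d : ℕ} (L : Space d ≃ₗᵢ[ℝ] Space d) :
    MeasurePreserving (rot L) (surface d) (surface d) := by
  refine ⟨(continuous_rot L).measurable, Measure.ext fun s hs => ?_⟩
  rw [Measure.map_apply (continuous_rot L).measurable hs, Measure.toSphere_apply' _ hs,
    Measure.toSphere_apply' _ ((continuous_rot L).measurable hs)]
  congr 1
  rw [← L.measurePreserving.measure_preimage_emb L.toMeasurableEquiv.measurableEmbedding
    (Ioo (0 : ℝ) 1 • (((↑) : Sphere d → Space d) '' s))]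
  congr 1
  ext x
  simp only [mem_preimage, Set.mem_smul, mem_image, exists_exists_and_eq_and]
  constructor
  · rintro ⟨r, hr, θ, hθ, rfl⟩
    exact ⟨r, hr, rot L θ, hθ, by simp⟩
  · rintro ⟨r, hr, θ, hθ, h⟩
    have hi : rot L (rot L.symm θ) = θ := Subtype.ext (by simp)
    refine ⟨r, hr, rot L.symm θ, by rw [hi]; exact hθ, ?_⟩
    apply L.injective
    simpa using h

/-- An integral over the space in polar coordinates. -/
theorem lintegral_polar {E : Type*} [NormedAddCommGroup E] [NormedSpace ℝ E] [Nontrivial E]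
    [MeasurableSpace E] [BorelSpace E] [FiniteDimensional ℝ E] (μ : Measure E)
    [μ.IsAddHaarMeasure] {g : E → ℝ≥0∞} (hg : Measurable g) :
    ∫⁻ x, g x ∂μ = ∫⁻ θ : Metric.sphere (0 : E) 1, (∫⁻ r in Ioi (0 : ℝ),
      ENNReal.ofReal (r ^ (Module.finrank ℝ E - 1)) * g (r • (θ : E))) ∂μ.toSphere := by
  have h1 : ∫⁻ x, g x ∂μ = ∫⁻ x : ({0}ᶜ : Set E), g x ∂(μ.comap (↑)) := by
    rw [lintegral_subtype_comap (measurableSet_singleton _).compl, restrict_compl_singleton]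
  have h2 := μ.measurePreserving_homeomorphUnitSphereProd.lintegral_comp
    (f := fun p => g (p.2.1 • (p.1 : E))) (by fun_prop)
  rw [h1]
  have h3 : ∀ x : ({0}ᶜ : Set E), ((homeomorphUnitSphereProd E x).2 : ℝ) •
      ((homeomorphUnitSphereProd E x).1 : E) = x := by
    intro x
    have hx : ‖(x : E)‖ ≠ 0 := norm_ne_zero_iff.2 x.2
    simp [smul_smul, mul_inv_cancel₀ hx]
  simp only [h3] at h2
  rw [h2, lintegral_prod _ (by fun_prop)]
  refine lintegral_congr fun θ => ?_
  rw [Measure.volumeIoiPow, lintegral_withDensity_eq_lintegral_mul _ (by fun_prop) (by fun_prop),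
    ← lintegral_subtype_comap measurableSet_Ioi]
  rfl

theorem lintegral_polar_norm {E : Type*} [NormedAddCommGroup E] [NormedSpace ℝ E] [Nontrivial E]
    [MeasurableSpace E] [BorelSpace E] [FiniteDimensional ℝ E] (μ : Measure E)
    [μ.IsAddHaarMeasure] {g : ℝ → ℝ≥0∞} (hg : Measurable g) :
    ∫⁻ x, g ‖x‖ ∂μ = μ.toSphere univ * ∫⁻ r in Ioi (0 : ℝ),
      ENNReal.ofReal (r ^ (Module.finrank ℝ E - 1)) * g r := by
  rw [lintegral_polar μ (by fun_prop : Measurable fun x : E => g ‖x‖), mul_comm, ← lintegral_const]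
  refine lintegral_congr fun θ => setLIntegral_congr_fun measurableSet_Ioi fun r hr => ?_
  have : ‖(θ : E)‖ = 1 := by simp
  simp [norm_smul, this, abs_of_pos (show 0 < r from hr)]

/-- Splitting off the first coordinate. -/
theorem lintegral_space_succ {n : ℕ} (g : ℝ → ℝ → ℝ≥0∞) (hg : Measurable (Function.uncurry g)) :
    ∫⁻ x : Space (n + 1), g (x 0) ‖x‖ =
      ∫⁻ a : ℝ, ∫⁻ y : Space n, g a (Real.sqrt (a ^ 2 + ‖y‖ ^ 2)) := by
  have h1 := (volume_preserving_piFinSuccAbove (fun _ : Fin (n + 1) => ℝ) 0).comp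
    (PiLp.volume_preserving_ofLp (Fin (n + 1)))
  have h2 : MeasurePreserving (fun p : ℝ × Space n => (p.1, (WithLp.ofLp p.2 : Fin n → ℝ)))
      (volume.prod volume) (volume.prod volume) :=
    (MeasurePreserving.id _).prod (PiLp.volume_preserving_ofLp (Fin n))
  have hm : Measurable (fun p : ℝ × (Fin n → ℝ) =>
      g p.1 (Real.sqrt (p.1 ^ 2 + ∑ i, p.2 i ^ 2))) := by
    apply hg.comp (f := fun p : ℝ × (Fin n → ℝ) => (p.1, Real.sqrt (p.1 ^ 2 + ∑ i, p.2 i ^ 2)))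
    fun_prop
  have e1 := h1.lintegral_comp hm
  have e2 := h2.lintegral_comp hm
  have hm2 : Measurable (fun p : ℝ × Space n => g p.1 (Real.sqrt (p.1 ^ 2 + ‖p.2‖ ^ 2))) := by
    apply hg.comp (f := fun p : ℝ × Space n => (p.1, Real.sqrt (p.1 ^ 2 + ‖p.2‖ ^ 2)))
    fun_prop
  rw [lintegral_lintegral (f := fun a y => g a (Real.sqrt (a ^ 2 + ‖y‖ ^ 2))) hm2.aemeasurable]
  have e3 : ∀ y : Space n, ∑ i, (WithLp.ofLp y i) ^ 2 = ‖y‖ ^ 2 := fun y => by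
    rw [EuclideanSpace.norm_sq_eq]; simp
  simp only [e3] at e2
  rw [e2]
  refine Eq.trans (lintegral_congr fun x => ?_) e1
  have : ‖x‖ = Real.sqrt ((x 0) ^ 2 + ∑ i : Fin n, x i.succ ^ 2) := by
    rw [EuclideanSpace.norm_eq, Fin.sum_univ_succ]; simp
  simp [this, MeasurableEquiv.piFinSuccAbove, Fin.tail]

/-- The half plane in polar coordinates. -/
theorem lintegral_halfplane (g : ℝ → ℝ → ℝ≥0∞) (hg : Measurable (Function.uncurry g)) :
    ∫⁻ a : ℝ, ∫⁻ ρ in Ioi (0 : ℝ), g a ρ =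
      ∫⁻ r in Ioi (0 : ℝ), ∫⁻ α in Ioo 0 Real.pi,
        ENNReal.ofReal r * g (r * Real.cos α) (r * Real.sin α) := by
  set f : ℝ × ℝ → ℝ≥0∞ := (univ ×ˢ Ioi (0 : ℝ)).indicator (Function.uncurry g) with hf
  have hfm : Measurable f := hg.indicator (MeasurableSet.univ.prod measurableSet_Ioi)
  have h1 : ∫⁻ a : ℝ, ∫⁻ ρ in Ioi (0 : ℝ), g a ρ = ∫⁻ p, f p := by
    rw [Measure.volume_eq_prod, lintegral_prod _ hfm.aemeasurable]
    refine lintegral_congr fun a => ?_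
    rw [← lintegral_indicator measurableSet_Ioi]
    refine lintegral_congr fun ρ => ?_
    by_cases h : 0 < ρ <;> simp [hf, Set.indicator, h]
  rw [h1, ← lintegral_comp_polarCoord_symm, polarCoord_target, Measure.volume_eq_prod,
    ← Measure.prod_restrict, lintegral_prod]
  · refine setLIntegral_congr_fun measurableSet_Ioi fun r hr => ?_
    have hr : 0 < r := hr
    rw [← lintegral_indicator measurableSet_Ioo, ← lintegral_indicator measurableSet_Ioo]
    refine lintegral_congr fun α => ?_
    simp only [polarCoord_symm_apply, Set.indicator, hf, smul_eq_mul, mem_prod, mem_univ,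
      mem_Ioi, true_and, Function.uncurry, mem_Ioo]
    by_cases h0 : 0 < α
    · by_cases h1 : α < Real.pi
      · have hs := Real.sin_pos_of_pos_of_lt_pi h0 h1
        have : -Real.pi < α := by linarith [Real.pi_pos]
        simp [h0, h1, this, mul_pos hr hs]
      · simp [h1]
    · by_cases h1 : -Real.pi < α
      · have hs := Real.sin_nonpos_of_nonpos_of_neg_pi_le (not_lt.1 h0) h1.le
        have : ¬ 0 < r * Real.sin α := not_lt.2 (mul_nonpos_of_nonneg_of_nonpos hr.le hs)
        simp [h0, this]
      · simp [h0, h1]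
  · apply Measurable.aemeasurable
    have : Measurable fun p : ℝ × ℝ => f (polarCoord.symm p) := by
      have h : Measurable fun p : ℝ × ℝ => (p.1 * Real.cos p.2, p.1 * Real.sin p.2) := by fun_prop
      exact hfm.comp h
    simp only [smul_eq_mul]
    fun_prop

/-- Substitution `z = cos α`. One factor `sin α` is the Jacobian; the remaining `n` factors are `(1
- z²)^(n/2)`. -/
theorem lintegral_cos_sin {n : ℕ} (φ : ℝ → ℝ≥0∞) :
    ∫⁻ α in Ioo 0 Real.pi, ENNReal.ofReal (Real.sin α ^ (n + 1)) * φ (Real.cos α) =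
      ∫⁻ z in Ioo (-1 : ℝ) 1, ENNReal.ofReal ((1 - z ^ 2) ^ ((n : ℝ) / 2)) * φ z := by
  have him : Real.cos '' Ioo 0 Real.pi = Ioo (-1) 1 := by
    ext z
    constructor
    · rintro ⟨α, ⟨h0, h1⟩, rfl⟩
      have hs := Real.sin_pos_of_pos_of_lt_pi h0 h1
      have := Real.sin_sq_add_cos_sq α
      constructor <;> nlinarith
    · rintro ⟨h0, h1⟩
      exact ⟨Real.arccos z, ⟨Real.arccos_pos.2 h1, Real.arccos_lt_pi.2 h0⟩,
        Real.cos_arccos h0.le h1.le⟩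
  rw [← him, lintegral_image_eq_lintegral_abs_deriv_mul measurableSet_Ioo
    (fun x _ => (Real.hasDerivAt_cos x).hasDerivWithinAt)
    (Real.injOn_cos.mono Ioo_subset_Icc_self)]
  refine setLIntegral_congr_fun measurableSet_Ioo fun α hα => ?_
  have hs := Real.sin_pos_of_pos_of_lt_pi hα.1 hα.2
  rw [← mul_assoc, ← ENNReal.ofReal_mul (abs_nonneg _), abs_neg, abs_of_pos hs]
  congr 2
  have : 1 - Real.cos α ^ 2 = Real.sin α ^ 2 := by rw [← Real.sin_sq_add_cos_sq α]; ring
  rw [this, ← Real.rpow_natCast (Real.sin α) 2, ← Real.rpow_mul hs.le, pow_succ']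
  congr 1
  rw [← Real.rpow_natCast]
  congr 1
  push_cast
  ring

/-- **Slicing the sphere**: the law of `θ·θ'` under the surface measure. -/
theorem exists_lintegral_slice {d : ℕ} (hd : 3 ≤ d) : ∃ c : ℝ≥0∞, c ≠ 0 ∧ c ≠ ⊤ ∧
    ∀ (θ : Sphere d) (φ : ℝ → ℝ≥0∞), Measurable φ →
      ∫⁻ θ' : Sphere d, φ (inner ℝ (θ : Space d) (θ' : Space d)) ∂(surface d) =
        c * ∫⁻ z in Ioo (-1 : ℝ) 1, ENNReal.ofReal ((1 - z ^ 2) ^ (((d : ℝ) - 3) / 2)) * φ z := by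
  obtain ⟨n, rfl⟩ : ∃ n, d = n + 3 := ⟨d - 3, by omega⟩
  -- The constant is the area of `𝕊^{d-2}`, the unit sphere of `ℝ^{n+2}` since `d = n + 3`.
  refine ⟨surface (n + 2) univ, ?_, measure_ne_top _ _, ?_⟩
  · have : Nontrivial (Space (n + 2)) := inferInstance
    simp only [surface, ne_eq, Measure.measure_univ_eq_zero]
    exact Measure.toSphere_ne_zero _
  set e : Sphere (n + 3) := ⟨EuclideanSpace.single 0 1, by simp⟩ with he
  have key : ∀ φ : ℝ → ℝ≥0∞, Measurable φ →
      ∫⁻ θ' : Sphere (n + 3), φ ((θ' : Space (n + 3)) 0) ∂(surface (n + 3)) =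
        surface (n + 2) univ * ∫⁻ z in Ioo (-1 : ℝ) 1,
          ENNReal.ofReal ((1 - z ^ 2) ^ ((n : ℝ) / 2)) * φ z := by
    intro φ hφ
    -- The function `x ↦ φ(x₀/‖x‖)` on the unit ball is integrated in two ways: in polar
    -- coordinates, and by splitting off `x₀`, using polar coordinates in the other variables and
    -- then in the half plane. Both computations contain the radial factor `K`, which is finite and
    -- nonzero and cancels.
    set G : ℝ → ℝ → ℝ≥0∞ := fun a r => φ (a / r) * (Iio (1 : ℝ)).indicator 1 r with hG
    have hind : Measurable ((Iio (1 : ℝ)).indicator (1 : ℝ → ℝ≥0∞)) :=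
      measurable_one.indicator measurableSet_Iio
    have hGm : Measurable (Function.uncurry G) := by
      simp only [hG, Function.uncurry_def]
      fun_prop
    set K : ℝ≥0∞ := ∫⁻ r in Ioi (0 : ℝ), ENNReal.ofReal (r ^ (n + 2)) * (Iio (1 : ℝ)).indicator 1 r
      with hK
    have hKval : K = ENNReal.ofReal (1 / ((n : ℝ) + 3)) := by
      have h1 : K = ∫⁻ r in Ioc (0 : ℝ) 1, ENNReal.ofReal (r ^ (n + 2)) := by
        rw [hK, ← setLIntegral_congr (Ioo_ae_eq_Ioc (a := (0 : ℝ)) (b := 1)),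
          ← lintegral_indicator measurableSet_Ioi, ← lintegral_indicator measurableSet_Ioo]
        refine lintegral_congr fun r => ?_
        by_cases h0 : 0 < r <;> by_cases h1 : r < 1 <;> simp [Set.indicator, h0, h1]
      rw [h1, ← ofReal_integral_eq_lintegral_ofReal, ← intervalIntegral.integral_of_le (by norm_num),
        integral_pow]
      · congr 1
        push_cast
        simp
        ring
      · exact (intervalIntegral.intervalIntegrable_pow (n + 2)).1
      · filter_upwards [ae_restrict_mem measurableSet_Ioc] with r hr
        exact pow_nonneg hr.1.le _
    have hK0 : K ≠ 0 := by rw [hKval]; simp; positivity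
    have hKt : K ≠ ⊤ := by rw [hKval]; exact ENNReal.ofReal_ne_top
    have e1 : ∫⁻ x : Space (n + 3), G (x 0) ‖x‖ =
        (∫⁻ θ' : Sphere (n + 3), φ ((θ' : Space (n + 3)) 0) ∂(surface (n + 3))) * K := by
      have hm : Measurable fun x : Space (n + 3) => G (x 0) ‖x‖ :=
        hGm.comp (f := fun x : Space (n + 3) => (x 0, ‖x‖)) (by fun_prop)
      rw [lintegral_polar volume hm, ← lintegral_mul_const _ (by fun_prop)]
      refine lintegral_congr fun θ => ?_
      rw [hK, ← lintegral_const_mul _ (by fun_prop)]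
      refine setLIntegral_congr_fun measurableSet_Ioi fun r hr => ?_
      have hr : 0 < r := hr
      simp only [hG, norm_smul, norm_sphere, mul_one, Real.norm_eq_abs, abs_of_pos hr,
        PiLp.smul_apply, smul_eq_mul, finrank_euclideanSpace, Fintype.card_fin]
      rw [mul_div_cancel_left₀ _ hr.ne', show n + 3 - 1 = n + 2 by omega]
      ring
    have e2 : ∫⁻ x : Space (n + 3), G (x 0) ‖x‖ = (surface (n + 2) univ *
        ∫⁻ z in Ioo (-1 : ℝ) 1, ENNReal.ofReal ((1 - z ^ 2) ^ ((n : ℝ) / 2)) * φ z) * K := by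
      rw [lintegral_space_succ G hGm]
      have h1 : ∀ a : ℝ, ∫⁻ y : Space (n + 2), G a (Real.sqrt (a ^ 2 + ‖y‖ ^ 2)) =
          surface (n + 2) univ * ∫⁻ ρ in Ioi (0 : ℝ),
            ENNReal.ofReal (ρ ^ (n + 1)) * G a (Real.sqrt (a ^ 2 + ρ ^ 2)) := by
        intro a
        have hm : Measurable fun ρ : ℝ => G a (Real.sqrt (a ^ 2 + ρ ^ 2)) :=
          hGm.comp (f := fun ρ : ℝ => (a, Real.sqrt (a ^ 2 + ρ ^ 2))) (by fun_prop)
        rw [lintegral_polar_norm volume hm]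
        simp
      have hm : Measurable (Function.uncurry fun a ρ : ℝ =>
          ENNReal.ofReal (ρ ^ (n + 1)) * G a (Real.sqrt (a ^ 2 + ρ ^ 2))) := by
        have : Measurable fun p : ℝ × ℝ => G p.1 (Real.sqrt (p.1 ^ 2 + p.2 ^ 2)) :=
          hGm.comp (f := fun p : ℝ × ℝ => (p.1, Real.sqrt (p.1 ^ 2 + p.2 ^ 2))) (by fun_prop)
        simp only [Function.uncurry_def]
        fun_prop
      simp only [h1]
      have hm' : Measurable fun a : ℝ => ∫⁻ ρ in Ioi (0 : ℝ),
          ENNReal.ofReal (ρ ^ (n + 1)) * G a (Real.sqrt (a ^ 2 + ρ ^ 2)) :=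
        hm.lintegral_prod_right'
      rw [lintegral_const_mul _ hm', lintegral_halfplane _ hm, mul_assoc]
      congr 1
      rw [← lintegral_cos_sin, mul_comm, hK, ← lintegral_mul_const _ (by fun_prop)]
      refine setLIntegral_congr_fun measurableSet_Ioi fun r hr => ?_
      have hr : 0 < r := hr
      rw [← lintegral_const_mul _ (by fun_prop)]
      refine setLIntegral_congr_fun measurableSet_Ioo fun α hα => ?_
      have hs := Real.sin_pos_of_pos_of_lt_pi hα.1 hα.2
      have hsq : Real.sqrt ((r * Real.cos α) ^ 2 + (r * Real.sin α) ^ 2) = r := by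
        rw [show (r * Real.cos α) ^ 2 + (r * Real.sin α) ^ 2 = r ^ 2 by
          nlinarith [Real.sin_sq_add_cos_sq α]]
        exact Real.sqrt_sq hr.le
      simp only [hsq, hG]
      rw [mul_div_cancel_left₀ _ hr.ne', mul_pow, ENNReal.ofReal_mul (by positivity),
        pow_succ' r (n + 1), ENNReal.ofReal_mul hr.le]
      ring
    exact (ENNReal.mul_left_inj hK0 hKt).1 (e1.symm.trans e2)
  intro θ φ hφ
  set L : Space (n + 3) ≃ₗᵢ[ℝ] Space (n + 3) :=
    Submodule.reflection (Submodule.span ℝ {(θ : Space (n + 3)) - e})ᗮ with hL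
  have hLθ : L θ = e := Submodule.reflection_sub (by rw [norm_sphere, norm_sphere])
  have h1 : ∀ θ' : Sphere (n + 3), φ (inner ℝ (θ : Space (n + 3)) (θ' : Space (n + 3))) =
      φ ((rot L θ' : Space (n + 3)) 0) := by
    intro θ'
    rw [← L.inner_map_map, hLθ]
    simp [he, EuclideanSpace.inner_single_left]
  have h2 := (measurePreserving_rot L).lintegral_comp
    (f := fun θ' : Sphere (n + 3) => φ ((θ' : Space (n + 3)) 0)) (by fun_prop)
  simp only [h1]
  rw [h2, key φ hφ]
  congr 4 with z
  push_cast
  ring_nf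


end

/-! ### The scattering kernel as a function of `1 - θ·θ'` -/

section

open scoped ENNReal

/-- `1 - θ·θ'`, half of the squared distance. -/
noncomputable def gap {d : ℕ} (θ θ' : Sphere d) : ℝ := 1 - inner ℝ (θ : Space d) (θ' : Space d)

theorem gap_comm {d : ℕ} (θ θ' : Sphere d) : gap θ θ' = gap θ' θ := by
  rw [gap, gap, real_inner_comm]

theorem norm_sub_sq_eq_gap {d : ℕ} (θ θ' : Sphere d) :
    ‖(θ : Space d) - θ'‖ ^ 2 = 2 * gap θ θ' := by
  rw [@norm_sub_sq_real, norm_sphere, norm_sphere, gap]; ring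

theorem gap_nonneg {d : ℕ} (θ θ' : Sphere d) : 0 ≤ gap θ θ' := by
  have := norm_sub_sq_eq_gap θ θ'; nlinarith [sq_nonneg ‖(θ : Space d) - θ'‖]

@[fun_prop] theorem continuous_gap {d : ℕ} :
    Continuous fun p : Sphere d × Sphere d => gap p.1 p.2 := by
  unfold gap; fun_prop

@[fun_prop] theorem continuous_gap_left {d : ℕ} (θ : Sphere d) :
    Continuous fun θ' : Sphere d => gap θ θ' := by
  unfold gap; fun_prop

theorem gap_rot {d : ℕ} (L : Space d ≃ₗᵢ[ℝ] Space d) (θ θ' : Sphere d) :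
    gap (rot L θ) (rot L θ') = gap θ θ' := by
  simp [gap]

/-- With `z = 1 - w` one has `1 - z² = w(2 - w)`. The factor `2 - w` is at most `2`, and at least
`1` for `w ≤ 1`, which gives the two one-sided forms below. -/
theorem exists_lintegral_gap {d : ℕ} (hd : 3 ≤ d) : ∃ c : ℝ≥0∞, c ≠ 0 ∧ c ≠ ⊤ ∧
    ∀ (θ : Sphere d) (φ : ℝ → ℝ≥0∞), Measurable φ →
      ∫⁻ θ' : Sphere d, φ (gap θ θ') ∂(surface d) =
        c * ∫⁻ w in Ioo (0 : ℝ) 2,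
          ENNReal.ofReal ((w * (2 - w)) ^ (((d : ℝ) - 3) / 2)) * φ w := by
  obtain ⟨c, h0, ht, h⟩ := exists_lintegral_slice hd
  refine ⟨c, h0, ht, fun θ φ hφ => ?_⟩
  have h1 := h θ (fun z => φ (1 - z)) (by fun_prop)
  unfold gap
  rw [h1]
  congr 1
  have hmp : MeasurePreserving (fun w : ℝ => 1 - w) volume volume :=
    Measure.measurePreserving_sub_left volume 1
  have he : MeasurableEmbedding (fun w : ℝ => 1 - w) := (MeasurableEquiv.subLeft (1 : ℝ)).measurableEmbedding
  rw [← hmp.setLIntegral_comp_preimage_emb he]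
  have hs : (fun w : ℝ => 1 - w) ⁻¹' Ioo (-1) 1 = Ioo 0 2 := by
    ext w; simp only [mem_preimage, mem_Ioo]; constructor <;> rintro ⟨h1, h2⟩ <;> constructor <;> linarith
  rw [hs]
  refine lintegral_congr fun w => ?_
  congr 3
  · ring
  · ring

theorem exists_lintegral_gap_le {d : ℕ} (hd : 3 ≤ d) : ∃ C : ℝ≥0∞, C ≠ ⊤ ∧
    ∀ (θ : Sphere d) (φ : ℝ → ℝ≥0∞), Measurable φ →
      ∫⁻ θ' : Sphere d, φ (gap θ θ') ∂(surface d) ≤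
        C * ∫⁻ w in Ioo (0 : ℝ) 2, ENNReal.ofReal (w ^ (((d : ℝ) - 3) / 2)) * φ w := by
  obtain ⟨c, h0, ht, h⟩ := exists_lintegral_gap hd
  have hp : 0 ≤ ((d : ℝ) - 3) / 2 := by
    have : (3 : ℝ) ≤ d := by exact_mod_cast hd
    linarith
  refine ⟨c * ENNReal.ofReal (2 ^ (((d : ℝ) - 3) / 2)),
    ENNReal.mul_ne_top ht ENNReal.ofReal_ne_top, fun θ φ hφ => ?_⟩
  rw [h θ φ hφ, mul_assoc]
  refine mul_le_mul' le_rfl ?_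
  rw [← lintegral_const_mul _ (by fun_prop)]
  refine (setLIntegral_mono' measurableSet_Ioo fun w hw => ?_)
  rw [← mul_assoc, ← ENNReal.ofReal_mul (by positivity)]
  gcongr
  rw [← Real.mul_rpow (by norm_num) hw.1.le]
  refine Real.rpow_le_rpow (by nlinarith [hw.1, hw.2]) (by nlinarith [hw.1, hw.2]) hp

theorem exists_le_lintegral_gap {d : ℕ} (hd : 3 ≤ d) : ∃ c : ℝ≥0∞, c ≠ 0 ∧ c ≠ ⊤ ∧
    ∀ (θ : Sphere d) (φ : ℝ → ℝ≥0∞), Measurable φ →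
      c * ∫⁻ w in Ioo (0 : ℝ) 1, ENNReal.ofReal (w ^ (((d : ℝ) - 3) / 2)) * φ w ≤
      ∫⁻ θ' : Sphere d, φ (gap θ θ') ∂(surface d) := by
  obtain ⟨c, h0, ht, h⟩ := exists_lintegral_gap hd
  have hp : 0 ≤ ((d : ℝ) - 3) / 2 := by
    have : (3 : ℝ) ≤ d := by exact_mod_cast hd
    linarith
  refine ⟨c, h0, ht, fun θ φ hφ => ?_⟩
  rw [h θ φ hφ]
  refine mul_le_mul' le_rfl ((setLIntegral_mono' measurableSet_Ioo fun w hw => ?_).trans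
    (lintegral_mono_set (Ioo_subset_Ioo_right (by norm_num))))
  gcongr
  · exact hw.1.le
  · nlinarith [hw.1, hw.2]

theorem lintegral_rpow_Ioo {a δ : ℝ} (ha : -1 < a) (hδ : 0 ≤ δ) :
    ∫⁻ w in Ioo (0 : ℝ) δ, ENNReal.ofReal (w ^ a) = ENNReal.ofReal (δ ^ (a + 1) / (a + 1)) := by
  rw [setLIntegral_congr Ioo_ae_eq_Ioc, ← ofReal_integral_eq_lintegral_ofReal,
    ← intervalIntegral.integral_of_le hδ, integral_rpow (Or.inl ha)]
  · rw [Real.zero_rpow (by linarith), sub_zero]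
  · exact (intervalIntegral.intervalIntegrable_rpow' ha).1
  · filter_upwards [ae_restrict_mem measurableSet_Ioc] with r hr
    exact Real.rpow_nonneg hr.1.le _

theorem lintegral_rpow_Ioi {a δ : ℝ} (ha : a < -1) (hδ : 0 < δ) :
    ∫⁻ w in Ioi δ, ENNReal.ofReal (w ^ a) = ENNReal.ofReal (-δ ^ (a + 1) / (a + 1)) := by
  rw [← ofReal_integral_eq_lintegral_ofReal, integral_Ioi_rpow_of_lt ha hδ]
  · exact integrableOn_Ioi_rpow_of_lt ha hδ
  · filter_upwards [ae_restrict_mem measurableSet_Ioi] with r hr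
    exact Real.rpow_nonneg (hδ.trans hr).le _

/-- A nonnegative kernel `k(1 - θ·θ')` whose singular part is `c₁ (1 - θ·θ')^{-(d-1)/2-s}` and
whose remainder `e` is integrable on the sphere. -/
structure IsKernel (d : ℕ) (s c₁ M : ℝ) (k e : ℝ → ℝ) : Prop where
  s_pos : 0 < s
  s_lt : s < 1
  dim : 3 ≤ d
  c_pos : 0 < c₁
  M_nonneg : 0 ≤ M
  measurable_k : Measurable k
  measurable_e : Measurable e
  nonneg : ∀ w, 0 ≤ k w
  eq : ∀ w, 0 < w → k w = c₁ * w ^ (-(((d : ℝ) - 1) / 2 + s)) + e w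
  rem : ∀ θ : Sphere d, ∫⁻ θ', ‖e (gap θ θ')‖ₑ ∂(surface d) ≤ ENNReal.ofReal M

/-- The law of `gap θ ·` is absolutely continuous on `(0,2)`, so null sets of profiles pull back to
null sets of the sphere. -/
theorem ae_gap {d : ℕ} (hd : 3 ≤ d) {P : ℝ → Prop}
    (h : ∀ᵐ w ∂((volume : Measure ℝ).restrict (Ioo 0 2)), P w) (θ : Sphere d) :
    ∀ᵐ θ' ∂(surface d), P (gap θ θ') := by
  obtain ⟨C, -, hC⟩ := exists_lintegral_gap_le hd
  obtain ⟨t, hst, htm, ht0⟩ := exists_measurable_superset_of_null (ae_iff.1 h)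
  have h1 := hC θ (t.indicator 1) (measurable_one.indicator htm)
  have h2 : ∫⁻ w in Ioo (0 : ℝ) 2, ENNReal.ofReal (w ^ (((d : ℝ) - 3) / 2)) *
      t.indicator (1 : ℝ → ℝ≥0∞) w = 0 := by
    rw [lintegral_eq_zero_iff (by
      have := (measurable_one (α := ℝ≥0∞) (β := ℝ)).indicator htm
      fun_prop)]
    filter_upwards [measure_eq_zero_iff_ae_notMem.1 ht0] with w hw
    simp [hw]
  rw [h2, mul_zero, nonpos_iff_eq_zero, lintegral_eq_zero_iff
    (f := fun θ' => t.indicator (1 : ℝ → ℝ≥0∞) (gap θ θ'))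
    ((measurable_one.indicator htm).comp (continuous_gap_left θ).measurable)] at h1
  filter_upwards [h1] with θ' hθ'
  by_contra hP
  have : gap θ θ' ∈ t := hst hP
  simp [this] at hθ'

theorem ae_gap_pos {d : ℕ} (hd : 3 ≤ d) (θ : Sphere d) : ∀ᵐ θ' ∂(surface d), 0 < gap θ θ' :=
  ae_gap hd (P := fun w => 0 < w) ((ae_restrict_mem measurableSet_Ioo).mono fun _ h => h.1) θ

/-- Only the quotient `b̃(z)/(1-z)^(1+s)` is known to be a.e. measurable, so the profile is rebuilt
from a measurable representative `g` of it. The maximum with `0` makes the profile nonnegative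
everywhere, and `e` is defined by difference so that the splitting is exact. The density
`w^((d-3)/2)` of the slices compensates the power in `e` exactly, which leaves the integrable
function `g`. -/
theorem exists_isKernel {d : ℕ} (hd : 3 ≤ d) {s : ℝ} (hs : s ∈ Ioo (0 : ℝ) 1) {b : ℝ → ℝ}
    (hb : IsForwardPeaked s b) : ∃ (M : ℝ) (k e : ℝ → ℝ), IsKernel d s (b 1) M k e ∧
      ∀ θ : Sphere d, ∀ᵐ θ' ∂(surface d), kernel d s b θ θ' = k (gap θ θ') := by
  obtain ⟨C, hCt, hC⟩ := exists_lintegral_gap_le hd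
  set γ : ℝ := ((d : ℝ) - 1) / 2 + s with hγ
  set G : ℝ → ℝ := fun w => (b (1 - w) - b 1) / w ^ (1 + s) with hG
  have hmp : MeasurePreserving (fun w : ℝ => 1 - w) volume volume :=
    Measure.measurePreserving_sub_left volume 1
  have hemb : MeasurableEmbedding (fun w : ℝ => 1 - w) :=
    (MeasurableEquiv.subLeft (1 : ℝ)).measurableEmbedding
  have hpre : (fun w : ℝ => 1 - w) ⁻¹' Ioo (-1) 1 = Ioo 0 2 := by
    ext w; simp only [mem_preimage, mem_Ioo]; constructor <;> rintro ⟨h1, h2⟩ <;> constructor <;> linarith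
  have hGi : IntegrableOn G (Ioo 0 2) := by
    have := (hmp.integrableOn_comp_preimage hemb).2 hb.integrable
    rw [hpre] at this
    refine this.congr_fun (fun w _ => ?_) measurableSet_Ioo
    simp [hG]
  obtain ⟨g, hgm, hgG⟩ := hGi.aestronglyMeasurable
  set e₀ : ℝ → ℝ := fun w => g w * w ^ (1 + s - γ) with he₀
  set k : ℝ → ℝ := fun w => max (b 1 * w ^ (-γ) + e₀ w) 0 with hk
  set e : ℝ → ℝ := fun w => k w - b 1 * w ^ (-γ) with he
  have hgm' : Measurable g := hgm.measurable
  have hem₀ : Measurable e₀ := by fun_prop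
  have hkm : Measurable k := by fun_prop
  have hae : ∀ᵐ w ∂((volume : Measure ℝ).restrict (Ioo 0 2)),
      k w = b (1 - w) / w ^ γ ∧ e w = e₀ w := by
    filter_upwards [hgG, ae_restrict_mem measurableSet_Ioo] with w hw hw2
    have hw0 : 0 < w := hw2.1
    have h1 : e₀ w = (b (1 - w) - b 1) * w ^ (-γ) := by
      rw [he₀]
      simp only
      rw [← hw, hG, div_mul_eq_mul_div, mul_div_assoc, ← Real.rpow_sub hw0]
      congr 2
      ring
    have h2 : b 1 * w ^ (-γ) + e₀ w = b (1 - w) / w ^ γ := by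
      rw [h1, Real.rpow_neg hw0.le]; ring
    have h3 : 0 ≤ b (1 - w) / w ^ γ :=
      div_nonneg (hb.nonneg _ ⟨by linarith [hw2.2], by linarith⟩) (Real.rpow_nonneg hw0.le _)
    have h4 : k w = b (1 - w) / w ^ γ := by rw [hk]; simp only; rw [h2, max_eq_left h3]
    exact ⟨h4, by rw [he]; simp only; rw [h4, ← h2]; ring⟩
  have hrem : ∫⁻ w in Ioo (0 : ℝ) 2, ENNReal.ofReal (w ^ (((d : ℝ) - 3) / 2)) * ‖e w‖ₑ =
      ∫⁻ w in Ioo (0 : ℝ) 2, ‖G w‖ₑ := by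
    refine lintegral_congr_ae ?_
    filter_upwards [hgG, ae_restrict_mem measurableSet_Ioo, hae] with w hw hw2 hw3
    have hw0 : 0 < w := hw2.1
    rw [hw3.2, hw, he₀, ← ofReal_norm, ← ofReal_norm, ← ENNReal.ofReal_mul (by positivity)]
    congr 1
    rw [norm_mul, Real.norm_of_nonneg (Real.rpow_nonneg hw0.le (1 + s - γ)), mul_left_comm,
      ← Real.rpow_add hw0, show ((d : ℝ) - 3) / 2 + (1 + s - γ) = 0 by rw [hγ]; ring,
      Real.rpow_zero, mul_one]
  have hfin : C * ∫⁻ w in Ioo (0 : ℝ) 2, ‖G w‖ₑ ≠ ⊤ := ENNReal.mul_ne_top hCt hGi.2.ne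
  refine ⟨(C * ∫⁻ w in Ioo (0 : ℝ) 2, ‖G w‖ₑ).toReal, k, e,
    { s_pos := hs.1, s_lt := hs.2, dim := hd, c_pos := hb.peak_pos, M_nonneg := ENNReal.toReal_nonneg
      measurable_k := hkm
      measurable_e := by fun_prop
      nonneg := fun w => le_max_right _ _
      eq := fun w _ => by rw [he]; ring
      rem := fun θ => ?_ }, fun θ => ?_⟩
  · rw [ENNReal.ofReal_toReal hfin, ← hrem]
    exact hC θ (fun w => ‖e w‖ₑ) (by fun_prop)
  · filter_upwards [ae_gap hd hae θ] with θ' hθ'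
    rw [hθ'.1, kernel, gap, sub_sub_cancel]


end

/-! ### Moments of the kernel, caps and annuli -/

section

open scoped ENNReal

namespace IsKernel

variable {d : ℕ} {s c₁ M : ℝ} {k e : ℝ → ℝ}

theorem dim_real (h : IsKernel d s c₁ M k e) : (3 : ℝ) ≤ d := by exact_mod_cast h.dim

theorem le (h : IsKernel d s c₁ M k e) {w : ℝ} (hw : 0 < w) :
    k w ≤ c₁ * w ^ (-(((d : ℝ) - 1) / 2 + s)) + ‖e w‖ := by
  rw [h.eq w hw]; gcongr; exact le_abs_self _

/-- Splitting a weighted kernel integral into the singular part and the remainder. -/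
theorem lintegral_weight_le (h : IsKernel d s c₁ M k e) {C : ℝ≥0∞}
    (hC : ∀ (θ : Sphere d) (φ : ℝ → ℝ≥0∞), Measurable φ →
      ∫⁻ θ' : Sphere d, φ (gap θ θ') ∂(surface d) ≤
        C * ∫⁻ w in Ioo (0 : ℝ) 2, ENNReal.ofReal (w ^ (((d : ℝ) - 3) / 2)) * φ w)
    {m : ℝ → ℝ} (hm : Measurable m) (hm0 : ∀ w, 0 < w → 0 ≤ m w) {B : ℝ} (hB0 : 0 ≤ B)
    (hB : ∀ w, m w ≤ B) (θ : Sphere d) :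
    ∫⁻ θ', ENNReal.ofReal (m (gap θ θ') * k (gap θ θ')) ∂(surface d) ≤
      C * ENNReal.ofReal c₁ * (∫⁻ w in Ioo (0 : ℝ) 2, ENNReal.ofReal (m w * w ^ (-1 - s))) +
        ENNReal.ofReal (B * M) := by
  have hkm := h.measurable_k
  have hem := h.measurable_e
  have h1 : ∫⁻ θ', ENNReal.ofReal (m (gap θ θ') * k (gap θ θ')) ∂(surface d) ≤
      ∫⁻ θ', (ENNReal.ofReal (m (gap θ θ') * (c₁ * gap θ θ' ^ (-(((d : ℝ) - 1) / 2 + s)))) +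
        ENNReal.ofReal B * ‖e (gap θ θ')‖ₑ) ∂(surface d) := by
    refine lintegral_mono_ae ?_
    filter_upwards [ae_gap_pos h.dim θ] with θ' hθ'
    have hm0' := hm0 _ hθ'
    rw [← ofReal_norm, ← ENNReal.ofReal_mul hB0, ← ENNReal.ofReal_add
      (mul_nonneg hm0' (mul_nonneg h.c_pos.le (Real.rpow_nonneg hθ'.le _))) (by positivity)]
    apply ENNReal.ofReal_le_ofReal
    calc m (gap θ θ') * k (gap θ θ') ≤
          m (gap θ θ') * (c₁ * gap θ θ' ^ (-(((d : ℝ) - 1) / 2 + s)) + ‖e (gap θ θ')‖) :=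
          mul_le_mul_of_nonneg_left (h.le hθ') hm0'
      _ ≤ _ := by
        rw [mul_add]
        gcongr
        exact hB _
  refine h1.trans ?_
  have hmeas : Measurable fun θ' : Sphere d => ENNReal.ofReal B * ‖e (gap θ θ')‖ₑ := by
    have : Measurable fun θ' : Sphere d => gap θ θ' := (continuous_gap_left θ).measurable
    fun_prop
  rw [lintegral_add_right _ hmeas]
  refine add_le_add ?_ ?_
  · refine (hC θ (fun w => ENNReal.ofReal (m w * (c₁ * w ^ (-(((d : ℝ) - 1) / 2 + s)))))
      (by fun_prop)).trans ?_
    rw [mul_assoc]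
    refine mul_le_mul' le_rfl ?_
    rw [← lintegral_const_mul _ (by fun_prop)]
    refine setLIntegral_mono' measurableSet_Ioo fun w hw => ?_
    have hw0 : 0 < w := hw.1
    rw [← ENNReal.ofReal_mul (by positivity), ← ENNReal.ofReal_mul h.c_pos.le]
    apply ENNReal.ofReal_le_ofReal
    rw [show w ^ (((d : ℝ) - 3) / 2) * (m w * (c₁ * w ^ (-(((d : ℝ) - 1) / 2 + s)))) =
      c₁ * (m w * (w ^ (((d : ℝ) - 3) / 2) * w ^ (-(((d : ℝ) - 1) / 2 + s)))) by ring,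
      ← Real.rpow_add hw0]
    apply le_of_eq
    congr 3
    ring
  · rw [lintegral_const_mul' _ _ ENNReal.ofReal_ne_top, ENNReal.ofReal_mul hB0]
    exact mul_le_mul' le_rfl (h.rem θ)

/-- Away from the diagonal the singular density `w^(-1-s)` is at most `ε^(-1-s)`, so the truncated
kernel has bounded mass and every truncated integral converges absolutely. -/
theorem exists_lintegral_trunc_le (h : IsKernel d s c₁ M k e) {ε : ℝ} (hε : 0 < ε) :
    ∃ C : ℝ, 0 ≤ C ∧ ∀ θ : Sphere d,
      ∫⁻ θ', ENNReal.ofReal ((Ici ε).indicator k (gap θ θ')) ∂(surface d) ≤ ENNReal.ofReal C := by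
  obtain ⟨C, hCt, hC⟩ := exists_lintegral_gap_le h.dim
  set D := C * ENNReal.ofReal c₁ * (∫⁻ w in Ioo (0 : ℝ) 2,
      ENNReal.ofReal ((Ici ε).indicator 1 w * w ^ (-1 - s))) + ENNReal.ofReal (1 * M) with hD
  have hDt : D ≠ ⊤ := by
    refine ENNReal.add_ne_top.2 ⟨ENNReal.mul_ne_top (ENNReal.mul_ne_top hCt ENNReal.ofReal_ne_top)
      ?_, ENNReal.ofReal_ne_top⟩
    refine ((setLIntegral_mono' (g := fun _ => ENNReal.ofReal (ε ^ (-1 - s)))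
      measurableSet_Ioo fun w hw => ?_).trans_lt ?_).ne
    · apply ENNReal.ofReal_le_ofReal
      by_cases hw2 : ε ≤ w
      · simp only [Set.indicator, mem_Ici, hw2, if_true, Pi.one_apply, one_mul]
        exact Real.rpow_le_rpow_of_nonpos hε hw2 (by linarith [h.s_pos])
      · simp [Set.indicator, hw2]; positivity
    · simp [ENNReal.mul_lt_top_iff]
  refine ⟨D.toReal, ENNReal.toReal_nonneg, fun θ => ?_⟩
  rw [ENNReal.ofReal_toReal hDt]
  refine le_trans (le_of_eq ?_) (h.lintegral_weight_le hC (m := (Ici ε).indicator 1)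
    (measurable_one.indicator measurableSet_Ici) (fun w _ => Set.indicator_nonneg (by simp) w)
    zero_le_one (fun w => Set.indicator_le_self' (by simp) w) θ)
  refine lintegral_congr fun θ' => ?_
  by_cases hw2 : ε ≤ gap θ θ' <;> simp [Set.indicator, hw2]

/-- The weight bounds `(χ(θ) - χ(θ'))²` for a multiplier `χ` with values in `[-1,1]` and Lipschitz
constant `L`, so this integral is the cost of commuting with `χ`. Splitting at `w = L⁻²`, where
`L²w` and `1` balance, each side contributes `L^(2s)`; the remainder contributes `4M`, absorbed
since `L ≥ 1`. -/
theorem exists_lintegral_min_le (h : IsKernel d s c₁ M k e) : ∃ C : ℝ, 0 < C ∧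
    ∀ (L : ℝ), 1 ≤ L → ∀ θ : Sphere d,
      ∫⁻ θ', ENNReal.ofReal (min 4 (2 * L ^ 2 * gap θ θ') * k (gap θ θ')) ∂(surface d) ≤
        ENNReal.ofReal (C * L ^ (2 * s)) := by
  obtain ⟨C, hCt, hC⟩ := exists_lintegral_gap_le h.dim
  have hs := h.s_pos
  have hs1 := h.s_lt
  refine ⟨C.toReal * c₁ * (2 / (1 - s) + 4 / s) + 4 * M + 1, ?_, fun L hL θ => ?_⟩
  · have := h.c_pos; have := h.M_nonneg
    have : 0 < 1 - s := by linarith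
    positivity
  have hL0 : 0 < L := by linarith
  have hLs : 1 ≤ L ^ (2 * s) := Real.one_le_rpow hL (by linarith)
  refine (h.lintegral_weight_le hC (m := fun w => min 4 (2 * L ^ 2 * w)) (by fun_prop)
    (fun w hw => by positivity) (by norm_num : (0 : ℝ) ≤ 4) (fun w => min_le_left _ _) θ).trans ?_
  set δ : ℝ := L ^ (-2 : ℝ) with hδ
  have hδ0 : 0 < δ := by positivity
  have e1 : ∫⁻ w in Ioo (0 : ℝ) δ, ENNReal.ofReal (min 4 (2 * L ^ 2 * w) * w ^ (-1 - s)) ≤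
      ENNReal.ofReal (2 / (1 - s) * L ^ (2 * s)) := by
    calc _ ≤ ∫⁻ w in Ioo (0 : ℝ) δ, ENNReal.ofReal (2 * L ^ 2) * ENNReal.ofReal (w ^ (-s)) := by
          refine setLIntegral_mono' measurableSet_Ioo fun w hw => ?_
          rw [← ENNReal.ofReal_mul (by positivity)]
          apply ENNReal.ofReal_le_ofReal
          have hw0 : 0 < w := hw.1
          calc _ ≤ (2 * L ^ 2 * w) * w ^ (-1 - s) := by gcongr; exact min_le_right _ _
            _ = 2 * L ^ 2 * (w ^ (1 : ℝ) * w ^ (-1 - s)) := by rw [Real.rpow_one]; ring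
            _ = _ := by rw [← Real.rpow_add hw0]; congr 2; ring
      _ = _ := by
          rw [lintegral_const_mul _ (by fun_prop), lintegral_rpow_Ioo (by linarith) hδ0.le,
            ← ENNReal.ofReal_mul (by positivity)]
          congr 1
          rw [hδ, ← Real.rpow_mul hL0.le, ← Real.rpow_natCast L 2,
            show (-s + 1) = 1 - s by ring, mul_assoc, ← mul_div_assoc,
            ← Real.rpow_add hL0]
          rw [show ((2 : ℕ) : ℝ) + -2 * (1 - s) = 2 * s by push_cast; ring]
          ring
  have e2 : ∫⁻ w in Ici δ, ENNReal.ofReal (min 4 (2 * L ^ 2 * w) * w ^ (-1 - s)) ≤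
      ENNReal.ofReal (4 / s * L ^ (2 * s)) := by
    rw [setLIntegral_congr Ioi_ae_eq_Ici.symm]
    calc _ ≤ ∫⁻ w in Ioi δ, ENNReal.ofReal 4 * ENNReal.ofReal (w ^ (-1 - s)) := by
          refine setLIntegral_mono' measurableSet_Ioi fun w hw => ?_
          have hw0 : 0 < w := hδ0.trans hw
          rw [← ENNReal.ofReal_mul (by positivity)]
          apply ENNReal.ofReal_le_ofReal
          gcongr
          exact min_le_left _ _
      _ = _ := by
          rw [lintegral_const_mul _ (by fun_prop), lintegral_rpow_Ioi (by linarith) hδ0,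
            ← ENNReal.ofReal_mul (by positivity)]
          congr 1
          rw [hδ, ← Real.rpow_mul hL0.le, show (-1 - s + 1) = -s by ring, neg_div_neg_eq]
          rw [show (-2 : ℝ) * -s = 2 * s by ring]
          ring
  have e3 : ∫⁻ w in Ioo (0 : ℝ) 2, ENNReal.ofReal (min 4 (2 * L ^ 2 * w) * w ^ (-1 - s)) ≤
      ENNReal.ofReal ((2 / (1 - s) + 4 / s) * L ^ (2 * s)) := by
    have hsub : Ioo (0 : ℝ) 2 ⊆ Ioo 0 δ ∪ Ici δ := fun w hw => by
      by_cases hwδ : w < δ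
      · exact Or.inl ⟨hw.1, hwδ⟩
      · exact Or.inr (not_lt.1 hwδ)
    have h1s : 0 < 1 - s := by linarith
    rw [add_mul, ENNReal.ofReal_add (by positivity) (by positivity)]
    exact (lintegral_mono_set hsub).trans ((lintegral_union_le _ _ _).trans (add_le_add e1 e2))
  have h1s : 0 < 1 - s := by linarith
  have hc := h.c_pos
  have hM := h.M_nonneg
  calc _ ≤ ENNReal.ofReal C.toReal * ENNReal.ofReal c₁ *
        ENNReal.ofReal ((2 / (1 - s) + 4 / s) * L ^ (2 * s)) + ENNReal.ofReal (4 * M) := by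
        rw [ENNReal.ofReal_toReal hCt]; gcongr
    _ = ENNReal.ofReal (C.toReal * c₁ * ((2 / (1 - s) + 4 / s) * L ^ (2 * s)) + 4 * M) := by
        rw [← ENNReal.ofReal_mul ENNReal.toReal_nonneg, ← ENNReal.ofReal_mul (by positivity),
          ← ENNReal.ofReal_add (by positivity) (by positivity)]
    _ ≤ _ := by
        apply ENNReal.ofReal_le_ofReal
        have : 4 * M ≤ 4 * M * L ^ (2 * s) := le_mul_of_one_le_right (by positivity) hLs
        nlinarith

/-- The first moment of the kernel near the diagonal is of order `∫₀^δ w^(-s) dw`. It gives the rate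
at which the truncated operators converge on smooth functions. -/
theorem exists_lintegral_small_le (h : IsKernel d s c₁ M k e) : ∃ C : ℝ, 0 ≤ C ∧
    ∀ δ ∈ Ioo (0 : ℝ) 1, ∀ θ : Sphere d,
      ∫⁻ θ', ENNReal.ofReal ((Iio δ).indicator id (gap θ θ') * k (gap θ θ')) ∂(surface d) ≤
        ENNReal.ofReal (C * δ ^ (1 - s)) := by
  obtain ⟨C, hCt, hC⟩ := exists_lintegral_gap_le h.dim
  have hs := h.s_pos
  have h1s : 0 < 1 - s := by linarith [h.s_lt]
  have hc := h.c_pos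
  have hM := h.M_nonneg
  refine ⟨C.toReal * c₁ * (1 / (1 - s)) + M, by positivity, fun δ hδ θ => ?_⟩
  have hδ0 : 0 < δ := hδ.1
  refine (h.lintegral_weight_le hC (m := (Iio δ).indicator id)
    (measurable_id.indicator measurableSet_Iio)
    (fun w hw => ?_) hδ0.le (fun w => ?_) θ).trans ?_
  · by_cases hwδ : w < δ <;> simp [Set.indicator, hwδ, hw.le]
  · by_cases hw : w < δ <;> simp [Set.indicator, hw, hδ0.le, le_of_lt]
  have e1 : ∫⁻ w in Ioo (0 : ℝ) 2, ENNReal.ofReal ((Iio δ).indicator id w * w ^ (-1 - s)) ≤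
      ENNReal.ofReal (1 / (1 - s) * δ ^ (1 - s)) := by
    calc _ ≤ ∫⁻ w in Ioo (0 : ℝ) δ, ENNReal.ofReal (w ^ (-s)) := by
          rw [← lintegral_indicator measurableSet_Ioo, ← lintegral_indicator measurableSet_Ioo]
          refine lintegral_mono fun w => ?_
          by_cases h0 : 0 < w
          · by_cases hw : w < δ
            · simp only [Set.indicator, mem_Ioo, mem_Iio, h0, hw, true_and, if_true, id]
              split_ifs
              · apply le_of_eq
                congr 1
                nth_rewrite 1 [← Real.rpow_one w]
                rw [← Real.rpow_add h0]; congr 1; ring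
              · exact zero_le
            · simp [Set.indicator, hw]
          · simp [Set.indicator, h0]
      _ = _ := by
          rw [lintegral_rpow_Ioo (by linarith [h.s_lt]) hδ0.le]
          congr 1
          rw [show -s + 1 = 1 - s by ring]; ring
  calc _ ≤ ENNReal.ofReal C.toReal * ENNReal.ofReal c₁ *
        ENNReal.ofReal (1 / (1 - s) * δ ^ (1 - s)) + ENNReal.ofReal (δ * M) := by
        rw [ENNReal.ofReal_toReal hCt]; gcongr
    _ = ENNReal.ofReal (C.toReal * c₁ * (1 / (1 - s) * δ ^ (1 - s)) + δ * M) := by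
        rw [← ENNReal.ofReal_mul ENNReal.toReal_nonneg, ← ENNReal.ofReal_mul (by positivity),
          ← ENNReal.ofReal_add (by positivity) (by positivity)]
    _ ≤ _ := by
        apply ENNReal.ofReal_le_ofReal
        have : δ ≤ δ ^ (1 - s) := by
          nth_rewrite 1 [← Real.rpow_one δ]
          exact Real.rpow_le_rpow_of_exponent_ge hδ0 hδ.2.le (by linarith)
        nlinarith

end IsKernel

/-- Upper bound for the measure of a cap. -/
theorem exists_surface_cap_le {d : ℕ} (hd : 3 ≤ d) : ∃ C : ℝ, 0 < C ∧ ∀ r : ℝ, 0 < r →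
    ∀ θ : Sphere d, surface d {θ' | gap θ θ' < r} ≤ ENNReal.ofReal (C * r ^ (((d : ℝ) - 1) / 2)) := by
  obtain ⟨C, hCt, hC⟩ := exists_lintegral_gap_le hd
  have hd' : (3 : ℝ) ≤ d := by exact_mod_cast hd
  refine ⟨C.toReal * (2 / ((d : ℝ) - 1)) + 1, ?_, fun r hr θ => ?_⟩
  · have : 0 < (d : ℝ) - 1 := by linarith
    positivity
  have h1 := hC θ ((Iio r).indicator 1) (measurable_one.indicator measurableSet_Iio)
  have h2 : ∫⁻ θ', (Iio r).indicator (1 : ℝ → ℝ≥0∞) (gap θ θ') ∂(surface d) =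
      surface d {θ' | gap θ θ' < r} := by
    rw [← lintegral_indicator_one
      (measurableSet_lt (continuous_gap_left θ).measurable measurable_const)]
    rfl
  rw [h2] at h1
  refine h1.trans ?_
  have h3 : ∫⁻ w in Ioo (0 : ℝ) 2, ENNReal.ofReal (w ^ (((d : ℝ) - 3) / 2)) *
      (Iio r).indicator (1 : ℝ → ℝ≥0∞) w ≤ ENNReal.ofReal (r ^ (((d : ℝ) - 1) / 2) * (2 / ((d : ℝ) - 1))) := by
    calc _ ≤ ∫⁻ w in Ioo (0 : ℝ) r, ENNReal.ofReal (w ^ (((d : ℝ) - 3) / 2)) := by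
          rw [← lintegral_indicator measurableSet_Ioo, ← lintegral_indicator measurableSet_Ioo]
          refine lintegral_mono fun w => ?_
          by_cases h0 : 0 < w <;> by_cases hw : w < r <;> by_cases h2 : w < 2 <;>
            simp [Set.indicator, h0, hw, h2]
      _ = _ := by
          rw [lintegral_rpow_Ioo (by linarith) hr.le,
            show ((d : ℝ) - 3) / 2 + 1 = ((d : ℝ) - 1) / 2 by ring]
          congr 1
          field_simp
  refine (mul_le_mul' le_rfl h3).trans ?_
  rw [← ENNReal.ofReal_toReal hCt, ← ENNReal.ofReal_mul ENNReal.toReal_nonneg,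
    ENNReal.toReal_ofReal ENNReal.toReal_nonneg]
  apply ENNReal.ofReal_le_ofReal
  have : 0 ≤ r ^ (((d : ℝ) - 1) / 2) := by positivity
  nlinarith

/-- Lower bound for the measure of an annulus. -/
theorem exists_le_surface_annulus {d : ℕ} (hd : 3 ≤ d) : ∃ c : ℝ, 0 < c ∧ ∀ r : ℝ, 0 < r → r ≤ 1 →
    ∀ θ : Sphere d, ENNReal.ofReal (c * r ^ (((d : ℝ) - 1) / 2)) ≤
      surface d {θ' | gap θ θ' ∈ Ioo (r / 4) r} := by
  obtain ⟨c, hc0, hct, hC⟩ := exists_le_lintegral_gap hd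
  have hd' : (3 : ℝ) ≤ d := by exact_mod_cast hd
  refine ⟨c.toReal * (3 / 4 * (1 / 4) ^ (((d : ℝ) - 3) / 2)), ?_, fun r hr hr1 θ => ?_⟩
  · have := ENNReal.toReal_pos hc0 hct
    positivity
  have h1 := hC θ ((Ioo (r / 4) r).indicator 1) (measurable_one.indicator measurableSet_Ioo)
  have h2 : ∫⁻ θ', (Ioo (r / 4) r).indicator (1 : ℝ → ℝ≥0∞) (gap θ θ') ∂(surface d) =
      surface d {θ' | gap θ θ' ∈ Ioo (r / 4) r} := by
    have : MeasurableSet {θ' : Sphere d | gap θ θ' ∈ Ioo (r / 4) r} :=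
      (continuous_gap_left θ).measurable measurableSet_Ioo
    rw [← lintegral_indicator_one this]
    rfl
  rw [h2] at h1
  refine le_trans ?_ h1
  have h3 : ENNReal.ofReal ((r / 4) ^ (((d : ℝ) - 3) / 2)) * ENNReal.ofReal (r - r / 4) ≤
      ∫⁻ w in Ioo (0 : ℝ) 1, ENNReal.ofReal (w ^ (((d : ℝ) - 3) / 2)) *
        (Ioo (r / 4) r).indicator (1 : ℝ → ℝ≥0∞) w := by
    calc _ = ∫⁻ w in Ioo (r / 4) r, ENNReal.ofReal ((r / 4) ^ (((d : ℝ) - 3) / 2)) := by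
          rw [lintegral_const, Measure.restrict_apply_univ, Real.volume_Ioo]
      _ ≤ _ := by
          rw [← lintegral_indicator measurableSet_Ioo, ← lintegral_indicator measurableSet_Ioo]
          refine lintegral_mono fun w => ?_
          by_cases hw : w ∈ Ioo (r / 4) r
          · have hw1 : w ∈ Ioo (0 : ℝ) 1 := ⟨by linarith [hw.1], by linarith [hw.2]⟩
            simp only [Set.indicator, hw, hw1, if_true, Pi.one_apply, mul_one]
            gcongr
            exact hw.1.le
          · simp [Set.indicator, hw]
  refine le_trans ?_ (mul_le_mul' le_rfl h3)
  rw [← ENNReal.ofReal_toReal hct, ← ENNReal.ofReal_mul (by positivity),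
    ← ENNReal.ofReal_mul ENNReal.toReal_nonneg, ENNReal.toReal_ofReal ENNReal.toReal_nonneg]
  apply ENNReal.ofReal_le_ofReal
  apply le_of_eq
  rw [show ((d : ℝ) - 1) / 2 = ((d : ℝ) - 3) / 2 + 1 by ring, Real.rpow_add hr, Real.rpow_one,
    show r / 4 = r * (1 / 4) by ring, Real.mul_rpow hr.le (by norm_num)]
  ring


end

/-! ### Difference operators and the pointwise scattering operator -/

section

open scoped ENNReal

/-- A nonnegative zonal kernel with uniformly bounded integral. -/
structure IsZonal (d : ℕ) (K : ℝ → ℝ) (C : ℝ) : Prop where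
  measurable : Measurable K
  nonneg : ∀ w, 0 ≤ K w
  const_nonneg : 0 ≤ C
  lintegral_le : ∀ θ : Sphere d,
    ∫⁻ θ', ENNReal.ofReal (K (gap θ θ')) ∂(surface d) ≤ ENNReal.ofReal C

theorem IsKernel.exists_isZonal {d : ℕ} {s c₁ M : ℝ} {k e : ℝ → ℝ} (h : IsKernel d s c₁ M k e)
    {ε : ℝ} (hε : 0 < ε) : ∃ C, IsZonal d ((Ici ε).indicator k) C := by
  obtain ⟨C, hC0, hC⟩ := h.exists_lintegral_trunc_le hε
  exact ⟨C, h.measurable_k.indicator measurableSet_Ici,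
    fun w => Set.indicator_nonneg (fun w _ => h.nonneg w) w, hC0, hC⟩

namespace IsZonal

variable {d : ℕ} {K : ℝ → ℝ} {C : ℝ}

theorem integrable (h : IsZonal d K C) (θ : Sphere d) :
    Integrable (fun θ' => K (gap θ θ')) (surface d) := by
  refine ⟨(h.measurable.comp (continuous_gap_left θ).measurable).aestronglyMeasurable, ?_⟩
  rw [hasFiniteIntegral_iff_ofReal (ae_of_all _ fun θ' => h.nonneg _)]
  exact (h.lintegral_le θ).trans_lt ENNReal.ofReal_lt_top

theorem integral_le (h : IsZonal d K C) (θ : Sphere d) :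
    ∫ θ', K (gap θ θ') ∂(surface d) ≤ C := by
  rw [integral_eq_lintegral_of_nonneg_ae (ae_of_all _ fun θ' => h.nonneg _)
    (h.integrable θ).aestronglyMeasurable]
  exact ENNReal.toReal_le_of_le_ofReal h.const_nonneg (h.lintegral_le θ)

theorem measurable_prod (h : IsZonal d K C) :
    Measurable fun p : Sphere d × Sphere d => K (gap p.1 p.2) :=
  h.measurable.comp continuous_gap.measurable

theorem integrable_prod (h : IsZonal d K C) :
    Integrable (fun p : Sphere d × Sphere d => K (gap p.1 p.2)) ((surface d).prod (surface d)) := by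
  refine ⟨h.measurable_prod.aestronglyMeasurable, ?_⟩
  rw [hasFiniteIntegral_iff_ofReal (ae_of_all _ fun θ' => h.nonneg _),
    lintegral_prod _ (h.measurable_prod.ennreal_ofReal).aemeasurable]
  calc _ ≤ ∫⁻ _, ENNReal.ofReal C ∂(surface d) := lintegral_mono fun θ => h.lintegral_le θ
    _ < ⊤ := by
      rw [lintegral_const]
      exact ENNReal.mul_lt_top ENNReal.ofReal_lt_top (measure_lt_top _ _)

theorem integrable_mul (h : IsZonal d K C) {g : Sphere d → ℂ} (hg : Continuous g) (θ : Sphere d) :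
    Integrable (fun θ' => (K (gap θ θ') : ℂ) * g θ') (surface d) := by
  obtain ⟨B, hB⟩ := isCompact_univ.exists_bound_of_continuousOn hg.continuousOn
  exact (h.integrable θ).ofReal.mul_bdd hg.aestronglyMeasurable
    (ae_of_all _ fun θ' => hB θ' (mem_univ _))

end IsZonal

/-- The difference operator with a zonal kernel. -/
noncomputable def zonalDiff (d : ℕ) (K : ℝ → ℝ) (ψ : Sphere d → ℂ) (θ : Sphere d) : ℂ :=
  ∫ θ', (K (gap θ θ') : ℂ) * (ψ θ' - ψ θ) ∂(surface d)

/-- The regularised scattering operator. -/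
noncomputable def scat (d : ℕ) (k : ℝ → ℝ) (ε : ℝ) (ψ : Sphere d → ℂ) (θ : Sphere d) : ℂ :=
  zonalDiff d ((Ici ε).indicator k) ψ θ

/-- The scattering operator. -/
noncomputable def Scat (d : ℕ) (k : ℝ → ℝ) (ψ : Sphere d → ℂ) (θ : Sphere d) : ℂ :=
  limUnder (𝓝[>] (0 : ℝ)) fun ε => scat d k ε ψ θ

/-- Taylor expansion at `x`: the remainders are quadratic, by the Lipschitz bound `L` for the
derivative, and the linear terms combine into the derivative, bounded by `B`, applied to `y + z -
2x`. -/
theorem continuous_second_difference {d : ℕ} {ψ : Space d → ℂ} (hψ : ContDiff ℝ 2 ψ) :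
    ∃ C : ℝ, 0 ≤ C ∧ ∀ x y z : Space d, ‖x‖ ≤ 1 → ‖y‖ ≤ 1 → ‖z‖ ≤ 1 →
      ‖ψ y + ψ z - 2 * ψ x‖ ≤ C * (‖y - x‖ ^ 2 + ‖z - x‖ ^ 2 + ‖y + z - (2 : ℝ) • x‖) := by
  have hd : ContDiff ℝ 1 (fderiv ℝ ψ) := hψ.fderiv_right (by norm_num)
  have hball : IsCompact (Metric.closedBall (0 : Space d) 1) := isCompact_closedBall _ _
  obtain ⟨L, hL⟩ := hd.contDiffOn.exists_lipschitzOnWith one_ne_zero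
    (convex_closedBall (0 : Space d) 1) hball
  obtain ⟨B, hB⟩ := hball.exists_bound_of_continuousOn hd.continuous.continuousOn
  have hB0 : 0 ≤ B := (norm_nonneg _).trans (hB 0 (by simp))
  refine ⟨L + B, by positivity, fun x y z hx hy hz => ?_⟩
  have hT : ∀ y : Space d, ‖y‖ ≤ 1 → ‖ψ y - ψ x - fderiv ℝ ψ x (y - x)‖ ≤ L * ‖y - x‖ ^ 2 := by
    intro y hy
    have hseg : segment ℝ x y ⊆ Metric.closedBall (0 : Space d) 1 :=
      (convex_closedBall _ _).segment_subset (by simpa using hx) (by simpa using hy)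
    have := (convex_segment x y).norm_image_sub_le_of_norm_fderiv_le' (f := ψ) (φ := fderiv ℝ ψ x)
      (C := L * ‖y - x‖) (fun p _ => (hψ.differentiable (by norm_num)).differentiableAt)
      (fun p hp => ?_) (left_mem_segment ℝ x y) (right_mem_segment ℝ x y)
    · rw [pow_two, ← mul_assoc]; exact this
    · rw [← dist_eq_norm]
      refine (hL.dist_le_mul _ (hseg hp) _ (by simpa using hx)).trans ?_
      gcongr
      rw [dist_comm, dist_eq_norm]
      have := norm_sub_le_of_mem_segment hp
      rwa [norm_sub_rev] at this
  have e : ψ y + ψ z - 2 * ψ x = (ψ y - ψ x - fderiv ℝ ψ x (y - x)) +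
      (ψ z - ψ x - fderiv ℝ ψ x (z - x)) + fderiv ℝ ψ x (y + z - (2 : ℝ) • x) := by
    simp only [map_sub, map_add, map_smul, Complex.real_smul]
    push_cast
    ring
  rw [e]
  have h3 : ‖fderiv ℝ ψ x (y + z - (2 : ℝ) • x)‖ ≤ B * ‖y + z - (2 : ℝ) • x‖ :=
    (ContinuousLinearMap.le_opNorm _ _).trans (by gcongr; exact hB x (by simpa using hx))
  calc _ ≤ L * ‖y - x‖ ^ 2 + L * ‖z - x‖ ^ 2 + B * ‖y + z - (2 : ℝ) • x‖ :=
        (norm_add₃_le).trans (add_le_add (add_le_add (hT y hy) (hT z hz)) h3)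
    _ ≤ _ := by
        have : 0 ≤ (L : ℝ) := L.2
        nlinarith [sq_nonneg ‖y - x‖, sq_nonneg ‖z - x‖, norm_nonneg (y + z - (2 : ℝ) • x),
          mul_nonneg hB0 (sq_nonneg ‖y - x‖), mul_nonneg hB0 (sq_nonneg ‖z - x‖),
          mul_nonneg this (norm_nonneg (y + z - (2 : ℝ) • x))]

/-- The reflection across the axis through `θ`. -/
noncomputable def axisReflection {d : ℕ} (θ : Sphere d) : Space d ≃ₗᵢ[ℝ] Space d :=
  Submodule.reflection (Submodule.span ℝ {(θ : Space d)})

theorem axisReflection_apply {d : ℕ} (θ : Sphere d) (x : Space d) :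
    axisReflection θ x = (2 * inner ℝ (θ : Space d) x) • (θ : Space d) - x := by
  rw [axisReflection, Submodule.reflection_apply,
    Submodule.starProjection_unit_singleton ℝ (norm_sphere θ), two_smul, ← add_smul, two_mul]

theorem rot_axisReflection_self {d : ℕ} (θ : Sphere d) : rot (axisReflection θ) θ = θ := by
  apply Subtype.ext
  rw [coe_rot, axisReflection_apply, real_inner_self_eq_norm_sq, norm_sphere]
  module

theorem gap_axisReflection {d : ℕ} (θ θ' : Sphere d) :
    gap θ (rot (axisReflection θ) θ') = gap θ θ' := by
  conv_lhs => rw [← rot_axisReflection_self θ, rot_axisReflection_self θ]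
  have := gap_rot (axisReflection θ) θ θ'
  rwa [rot_axisReflection_self] at this

/-- For a point and its image under the reflection across the axis `θ`, the two squared distances to
`θ` and the norm of the vector second difference all equal `2 gap`; this is where the factor `6`
comes from. -/
theorem exists_second_difference_le {d : ℕ} {ψ : Space d → ℂ} (hψ : ContDiff ℝ 2 ψ) :
    ∃ C : ℝ, 0 ≤ C ∧ ∀ θ θ' : Sphere d,
      ‖ψ θ' + ψ (rot (axisReflection θ) θ') - 2 * ψ θ‖ ≤ C * gap θ θ' := by
  obtain ⟨C, hC0, hC⟩ := continuous_second_difference hψ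
  refine ⟨C * 6, by positivity, fun θ θ' => ?_⟩
  refine (hC θ θ' (rot (axisReflection θ) θ') (norm_sphere _).le (norm_sphere _).le
    (norm_sphere _).le).trans ?_
  have h1 : ‖(θ' : Space d) - θ‖ ^ 2 = 2 * gap θ θ' := by
    rw [norm_sub_sq_eq_gap, gap_comm]
  have h2 : ‖(rot (axisReflection θ) θ' : Space d) - θ‖ ^ 2 = 2 * gap θ θ' := by
    rw [norm_sub_sq_eq_gap, gap_comm, gap_axisReflection]
  have h3 : ‖(θ' : Space d) + rot (axisReflection θ) θ' - (2 : ℝ) • (θ : Space d)‖ =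
      2 * gap θ θ' := by
    rw [coe_rot, axisReflection_apply]
    have : (θ' : Space d) + ((2 * inner ℝ (θ : Space d) (θ' : Space d)) • (θ : Space d) - θ') -
        (2 : ℝ) • (θ : Space d) = (-(2 * gap θ θ')) • (θ : Space d) := by
      rw [gap]; module
    rw [this, norm_smul, norm_sphere, mul_one, norm_neg, Real.norm_of_nonneg]
    have := gap_nonneg θ θ'
    positivity
  rw [h1, h2, h3]
  apply le_of_eq
  ring

theorem continuous_restrict {d : ℕ} {ψ : Space d → ℂ} (hψ : Continuous ψ) :
    Continuous fun θ : Sphere d => ψ θ := hψ.comp continuous_subtype_val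

/-- The axis reflection preserves the surface measure and the kernel, so averaging over it turns
first differences, of size `gap^(1/2)`, into second differences, of size `gap`. This cancellation
covers the whole range `s < 1`, not only `s < 1/2`. -/
theorem IsZonal.zonalDiff_eq_half {d : ℕ} {K : ℝ → ℝ} {C : ℝ} (h : IsZonal d K C)
    {ψ : Sphere d → ℂ} (hψ : Continuous ψ) (θ : Sphere d) :
    2 * zonalDiff d K ψ θ = ∫ θ', (K (gap θ θ') : ℂ) *
      (ψ θ' + ψ (rot (axisReflection θ) θ') - 2 * ψ θ) ∂(surface d) := by
  set R := rot (axisReflection θ) with hR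
  have hRc : Continuous R := continuous_rot _
  have h1 : zonalDiff d K ψ θ = ∫ θ', (K (gap θ θ') : ℂ) * (ψ (R θ') - ψ θ) ∂(surface d) := by
    have hm : AEStronglyMeasurable (fun θ' => (K (gap θ θ') : ℂ) * (ψ θ' - ψ θ)) (surface d) :=
      (h.integrable_mul (hψ.sub continuous_const) θ).aestronglyMeasurable
    have h2 := (measurePreserving_rot (axisReflection θ)).map_eq
    rw [zonalDiff]
    conv_lhs => rw [← h2]
    rw [integral_map hRc.measurable.aemeasurable (by rw [h2]; exact hm)]
    simp only [hR, gap_axisReflection]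
  rw [two_mul]
  nth_rewrite 2 [h1]
  rw [zonalDiff, ← integral_add (h.integrable_mul (g := fun θ' => ψ θ' - ψ θ) (by fun_prop) θ)
    (h.integrable_mul (g := fun θ' => ψ (R θ') - ψ θ) (by fun_prop) θ)]
  congr 1
  ext θ'
  ring

/-- Uniform convergence of the regularised scattering operator on smooth functions. -/
theorem IsKernel.exists_norm_scat_sub_le {d : ℕ} {s c₁ M : ℝ} {k e : ℝ → ℝ}
    (h : IsKernel d s c₁ M k e) {ψ : Space d → ℂ} (hψ : ContDiff ℝ 2 ψ) :
    ∃ C : ℝ, 0 ≤ C ∧ ∀ ε δ : ℝ, 0 < ε → ε ≤ δ → δ < 1 → ∀ θ : Sphere d,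
      ‖scat d k ε (fun θ => ψ θ) θ - scat d k δ (fun θ => ψ θ) θ‖ ≤ C * δ ^ (1 - s) := by
  obtain ⟨C₁, hC₁0, hC₁⟩ := exists_second_difference_le hψ
  obtain ⟨C₂, hC₂0, hC₂⟩ := h.exists_lintegral_small_le
  refine ⟨C₁ * C₂, by positivity, fun ε δ hε hεδ hδ θ => ?_⟩
  have hδ0 : 0 < δ := hε.trans_le hεδ
  have hψc : Continuous fun θ : Sphere d => ψ θ := continuous_restrict hψ.continuous
  obtain ⟨A₁, hA₁⟩ := h.exists_isZonal hε
  obtain ⟨A₂, hA₂⟩ := h.exists_isZonal hδ0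
  -- The difference of two truncations is the operator whose kernel is supported on `ε ≤ gap < δ`,
  -- where the small-scale moment bound applies.
  have hK : IsZonal d ((Ico ε δ).indicator k) A₁ :=
    { measurable := h.measurable_k.indicator measurableSet_Ico
      nonneg := fun w => Set.indicator_nonneg (fun w _ => h.nonneg w) w
      const_nonneg := hA₁.const_nonneg
      lintegral_le := fun θ => (lintegral_mono fun θ' => ENNReal.ofReal_le_ofReal
        (Set.indicator_le_indicator_of_subset Ico_subset_Ici_self h.nonneg _)).trans
          (hA₁.lintegral_le θ) }
  have hsplit : ∀ w, (Ici ε).indicator k w =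
      (Ico ε δ).indicator k w + (Ici δ).indicator k w := by
    intro w
    by_cases h1 : ε ≤ w
    · by_cases h2 : w < δ
      · simp [Set.indicator, h1, h2, not_le.2 h2]
      · simp [Set.indicator, h1, h2, not_lt.1 h2]
    · have h2 : ¬ δ ≤ w := fun h2 => h1 (hεδ.trans h2)
      simp [Set.indicator, h1, h2]
  have e1 : scat d k ε (fun θ => ψ θ) θ - scat d k δ (fun θ => ψ θ) θ =
      zonalDiff d ((Ico ε δ).indicator k) (fun θ => ψ θ) θ := by
    rw [scat, scat, zonalDiff, zonalDiff, zonalDiff, sub_eq_iff_eq_add,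
      ← integral_add (hK.integrable_mul (g := fun θ' : Sphere d => ψ θ' - ψ θ) (by fun_prop) θ)
        (hA₂.integrable_mul (g := fun θ' : Sphere d => ψ θ' - ψ θ) (by fun_prop) θ)]
    congr 1
    ext θ'
    rw [hsplit]
    push_cast
    ring
  have e2 := hK.zonalDiff_eq_half hψc θ
  have e3 : ‖2 * zonalDiff d ((Ico ε δ).indicator k) (fun θ => ψ θ) θ‖ ≤
      C₁ * (C₂ * δ ^ (1 - s)) := by
    rw [e2]
    have hs1 : 0 < 1 - s := by linarith [h.s_lt]
    refine norm_integral_le_lintegral_norm _ |>.trans ?_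
    refine ENNReal.toReal_le_of_le_ofReal (by positivity) ?_
    rw [ENNReal.ofReal_mul hC₁0]
    refine le_trans ?_ (mul_le_mul' le_rfl (hC₂ δ ⟨hδ0, hδ⟩ θ))
    rw [← lintegral_const_mul' _ _ ENNReal.ofReal_ne_top]
    refine lintegral_mono fun θ' => ?_
    rw [← ENNReal.ofReal_mul hC₁0]
    apply ENNReal.ofReal_le_ofReal
    rw [norm_mul, Complex.norm_real, Real.norm_of_nonneg (hK.nonneg _)]
    have hg := gap_nonneg θ θ'
    have hk := h.nonneg (gap θ θ')
    by_cases h2 : gap θ θ' < δ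
    · have : (Ico ε δ).indicator k (gap θ θ') ≤ k (gap θ θ') :=
        Set.indicator_le_self' (fun _ _ => hk) _
      simp only [Set.indicator, mem_Iio, h2, if_true, id] at this ⊢
      calc _ ≤ k (gap θ θ') * (C₁ * gap θ θ') := mul_le_mul this (hC₁ θ θ') (norm_nonneg _) hk
        _ = _ := by ring
    · simp [Set.indicator, h2]
  rw [e1]
  rw [norm_mul] at e3
  have h2 : ‖(2 : ℂ)‖ = 2 := by simp
  rw [h2] at e3
  have := norm_nonneg (zonalDiff d ((Ico ε δ).indicator k) (fun θ : Sphere d => ψ θ) θ)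
  nlinarith

theorem tendsto_rpow_nhdsGT_zero {a : ℝ} (ha : 0 < a) :
    Tendsto (fun δ : ℝ => δ ^ a) (𝓝[>] 0) (𝓝 0) := by
  have := (Real.continuousAt_rpow_const 0 a (Or.inr ha.le)).tendsto
  rw [Real.zero_rpow ha.ne'] at this
  exact this.mono_left nhdsWithin_le_nhds

/-- The truncations form a Cauchy family, so `limUnder` in `Scat` is a genuine limit and not a
default value; the uniform rate survives in the limit. -/
theorem IsKernel.exists_norm_scat_sub_Scat_le {d : ℕ} {s c₁ M : ℝ} {k e : ℝ → ℝ}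
    (h : IsKernel d s c₁ M k e) {ψ : Space d → ℂ} (hψ : ContDiff ℝ 2 ψ) :
    ∃ C : ℝ, 0 ≤ C ∧ ∀ δ ∈ Ioo (0 : ℝ) 1, ∀ θ : Sphere d,
      ‖scat d k δ (fun θ => ψ θ) θ - Scat d k (fun θ => ψ θ) θ‖ ≤ C * δ ^ (1 - s) := by
  obtain ⟨C, hC0, hC⟩ := h.exists_norm_scat_sub_le hψ
  have hs1 : 0 < 1 - s := by linarith [h.s_lt]
  refine ⟨C, hC0, fun δ hδ θ => ?_⟩
  have hcauchy : Cauchy (map (fun ε => scat d k ε (fun θ => ψ θ) θ) (𝓝[>] (0 : ℝ))) := by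
    rw [Metric.cauchy_iff]
    refine ⟨by infer_instance, fun η hη => ?_⟩
    have h1 : ∀ᶠ δ in 𝓝[>] (0 : ℝ), C * δ ^ (1 - s) < η / 2 := by
      have := (tendsto_rpow_nhdsGT_zero hs1).const_mul C
      rw [mul_zero] at this
      exact this.eventually_lt_const (by positivity)
    obtain ⟨δ₀, hδ₀, hδ₀'⟩ := (h1.and (Ioo_mem_nhdsGT (zero_lt_one' ℝ))).exists
    refine ⟨_, image_mem_map (Ioo_mem_nhdsGT hδ₀'.1), ?_⟩
    rintro _ ⟨a, ha, rfl⟩ _ ⟨b, hb, rfl⟩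
    have ha' := hC a δ₀ ha.1 ha.2.le hδ₀'.2 θ
    have hb' := hC b δ₀ hb.1 hb.2.le hδ₀'.2 θ
    calc _ ≤ dist (scat d k a (fun θ => ψ θ) θ) (scat d k δ₀ (fun θ => ψ θ) θ) +
          dist (scat d k b (fun θ => ψ θ) θ) (scat d k δ₀ (fun θ => ψ θ) θ) := dist_triangle_right _ _ _
      _ < η := by rw [dist_eq_norm, dist_eq_norm]; linarith
  obtain ⟨y, hy⟩ := cauchy_iff_exists_le_nhds.1 hcauchy
  have hlim : Tendsto (fun ε => scat d k ε (fun θ => ψ θ) θ) (𝓝[>] (0 : ℝ)) (𝓝 y) := hy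
  rw [Scat, hlim.limUnder_eq, norm_sub_rev]
  refine le_of_tendsto (hlim.sub_const _).norm ?_
  filter_upwards [Ioo_mem_nhdsGT hδ.1] with ε hε
  exact hC ε δ hε.1 hε.2.le hδ.2 θ


end

/-! ### Symmetry and commutation of zonal operators -/

section

open scoped ENNReal

/-- The reflection in the hyperplane orthogonal to `θ - θ'` exchanges the two points. All symmetries
of zonal kernels used below come from it. -/
theorem exists_rot_swap {d : ℕ} (θ θ' : Sphere d) :
    ∃ L : Space d ≃ₗᵢ[ℝ] Space d, rot L θ = θ' ∧ rot L θ' = θ := by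
  refine ⟨Submodule.reflection (Submodule.span ℝ {(θ : Space d) - θ'})ᗮ, ?_⟩
  have h : Submodule.reflection (Submodule.span ℝ {(θ : Space d) - θ'})ᗮ (θ : Space d) = θ' :=
    Submodule.reflection_sub (by rw [norm_sphere, norm_sphere])
  refine ⟨Subtype.ext h, Subtype.ext ?_⟩
  rw [coe_rot]
  exact (congrArg _ h.symm).trans (Submodule.reflection_reflection _ _)

theorem integral_comp_rot {d : ℕ} (L : Space d ≃ₗᵢ[ℝ] Space d) (f : Sphere d → ℂ)
    (hf : AEStronglyMeasurable f (surface d)) :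
    ∫ θ, f (rot L θ) ∂(surface d) = ∫ θ, f θ ∂(surface d) := by
  have h2 := (measurePreserving_rot L).map_eq
  conv_rhs => rw [← h2]
  rw [integral_map (continuous_rot L).measurable.aemeasurable (by rwa [h2])]

/-- Integration against a zonal kernel. -/
noncomputable def zonalInt (d : ℕ) (J : ℝ → ℝ) (f : Sphere d → ℂ) (θ : Sphere d) : ℂ :=
  ∫ θ', (J (gap θ θ') : ℂ) * f θ' ∂(surface d)

theorem integral_zonal_const {d : ℕ} {J : ℝ → ℝ} (hJ : Measurable J) (θ θ' : Sphere d) :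
    ∫ α, (J (gap θ α) : ℂ) ∂(surface d) = ∫ α, (J (gap θ' α) : ℂ) ∂(surface d) := by
  obtain ⟨L, h1, h2⟩ := exists_rot_swap θ θ'
  rw [← integral_comp_rot L]
  · rw [← h2]
    simp only [gap_rot]
  · have := (continuous_gap_left θ).measurable
    exact (Complex.measurable_ofReal.comp (hJ.comp this)).aestronglyMeasurable

/-- Exchanging the end points by an isometry exchanges the roles of the two kernels; thus the
composition of zonal kernels is commutative. -/
theorem integral_zonal_symm {d : ℕ} {J K : ℝ → ℝ} (hJ : Measurable J) (hK : Measurable K)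
    (θ θ' : Sphere d) :
    ∫ α, (K (gap θ α) : ℂ) * J (gap α θ') ∂(surface d) =
      ∫ α, (J (gap θ α) : ℂ) * K (gap α θ') ∂(surface d) := by
  obtain ⟨L, h1, h2⟩ := exists_rot_swap θ θ'
  rw [← integral_comp_rot L]
  · have e1 : ∀ α, gap θ (rot L α) = gap α θ' := fun α => by
      nth_rewrite 1 [← h2]; rw [gap_rot, gap_comm]
    have e2 : ∀ α, gap (rot L α) θ' = gap θ α := fun α => by
      nth_rewrite 1 [← h1]; rw [gap_rot, gap_comm]
    simp only [e1, e2]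
    congr 1
    ext α
    ring
  · have h1 := (continuous_gap_left θ).measurable
    have h2 : Measurable fun α => gap α θ' := by
      simp only [gap_comm _ θ']; exact (continuous_gap_left θ').measurable
    exact ((Complex.measurable_ofReal.comp (hK.comp h1)).mul
      (Complex.measurable_ofReal.comp (hJ.comp h2))).aestronglyMeasurable

/-- A continuous zonal kernel is symmetric for the `L²` pairing. -/
theorem integral_zonalInt_mul {d : ℕ} {J : ℝ → ℝ} (hJ : Continuous J) {f g : Sphere d → ℂ}
    (hf : Integrable f (surface d)) (hg : Integrable g (surface d)) :
    ∫ θ, zonalInt d J f θ * g θ ∂(surface d) = ∫ θ, f θ * zonalInt d J g θ ∂(surface d) := by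
  have hc : Continuous fun p : Sphere d × Sphere d => (J (gap p.1 p.2) : ℂ) := by fun_prop
  obtain ⟨B, hB⟩ := isCompact_univ.exists_bound_of_continuousOn hc.continuousOn
  have hi : Integrable (fun p : Sphere d × Sphere d => (J (gap p.1 p.2) : ℂ) * (g p.1 * f p.2))
      ((surface d).prod (surface d)) :=
    (hg.mul_prod hf).bdd_mul hc.aestronglyMeasurable (ae_of_all _ fun p => hB p (mem_univ _))
  have h1 : ∫ θ, zonalInt d J f θ * g θ ∂(surface d) =
      ∫ θ, ∫ θ', (J (gap θ θ') : ℂ) * (g θ * f θ') ∂(surface d) ∂(surface d) := by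
    congr 1
    ext θ
    rw [zonalInt, ← integral_mul_const]
    congr 1
    ext θ'
    ring
  rw [h1, integral_integral_swap hi]
  congr 1
  ext θ'
  rw [zonalInt, ← integral_const_mul]
  congr 1
  ext θ
  rw [gap_comm]
  ring

/-- Zonal operators commute. -/
theorem zonalDiff_zonalInt {d : ℕ} {J K : ℝ → ℝ} {C : ℝ} (hJ : Continuous J) (hK : IsZonal d K C)
    {ψ : Sphere d → ℂ} (hψ : Continuous ψ) (θ : Sphere d) :
    zonalDiff d K (zonalInt d J ψ) θ = zonalInt d J (zonalDiff d K ψ) θ := by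
  have hc : Continuous fun p : Sphere d × Sphere d => (J (gap p.1 p.2) : ℂ) := by fun_prop
  obtain ⟨B, hB⟩ := isCompact_univ.exists_bound_of_continuousOn hc.continuousOn
  obtain ⟨B', hB'⟩ := isCompact_univ.exists_bound_of_continuousOn hψ.continuousOn
  have hψi : Integrable ψ (surface d) := hψ.integrable_of_hasCompactSupport
    (HasCompactSupport.of_compactSpace ψ)
  have hKi : ∀ θ : Sphere d, Integrable (fun θ' => (K (gap θ θ') : ℂ)) (surface d) :=
    fun θ => (hK.integrable θ).ofReal
  have hcont : Continuous (zonalInt d J ψ) := by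
    refine continuous_of_dominated (bound := fun _ => B * B') (fun θ => ?_) (fun θ => ?_)
      (integrable_const _) (ae_of_all _ fun θ' => ?_)
    · exact (by fun_prop : Continuous fun θ' => (J (gap θ θ') : ℂ) * ψ θ').aestronglyMeasurable
    · exact ae_of_all _ fun θ' => by
        rw [norm_mul]
        exact mul_le_mul (hB (θ, θ') (mem_univ _)) (hB' θ' (mem_univ _)) (norm_nonneg _)
          ((norm_nonneg _).trans (hB (θ, θ') (mem_univ _)))
    · have : Continuous fun θ : Sphere d => (J (gap θ θ') : ℂ) := by
        exact hc.comp (by fun_prop : Continuous fun θ : Sphere d => (θ, θ'))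
      fun_prop
  -- The total mass `κ` of the kernel does not depend on the base point, so the difference operator
  -- is integration against `K` minus `κ` times the identity. Only the commutation of two zonal
  -- integrals remains.
  set κ : ℂ := ∫ α, (K (gap θ α) : ℂ) ∂(surface d) with hκ
  have hdiff : ∀ θ', zonalDiff d K ψ θ' = (∫ α, (K (gap θ' α) : ℂ) * ψ α ∂(surface d)) - κ * ψ θ' := by
    intro θ'
    rw [zonalDiff, hκ, integral_zonal_const hK.measurable θ θ', ← integral_mul_const, ← integral_sub
      (hK.integrable_mul hψ θ') ((hKi θ').mul_const _)]
    congr 1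
    ext α
    ring
  have h1 : zonalDiff d K (zonalInt d J ψ) θ =
      (∫ α, (K (gap θ α) : ℂ) * zonalInt d J ψ α ∂(surface d)) - κ * zonalInt d J ψ θ := by
    rw [zonalDiff, hκ, ← integral_mul_const, ← integral_sub
      (hK.integrable_mul hcont θ) ((hKi θ).mul_const _)]
    congr 1
    ext α
    ring
  have hKψm : AEStronglyMeasurable (fun θ' => ∫ α, (K (gap θ' α) : ℂ) * ψ α ∂(surface d))
      (surface d) := by
    have : StronglyMeasurable fun p : Sphere d × Sphere d => (K (gap p.1 p.2) : ℂ) * ψ p.2 :=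
      ((Complex.measurable_ofReal.comp hK.measurable_prod).mul
        (hψ.measurable.comp measurable_snd)).stronglyMeasurable
    exact this.integral_prod_right.aestronglyMeasurable
  have hKψb : ∀ θ', ‖∫ α, (K (gap θ' α) : ℂ) * ψ α ∂(surface d)‖ ≤ C * B' := by
    intro θ'
    refine (norm_integral_le_of_norm_le ((hK.integrable θ').mul_const B')
      (ae_of_all _ fun α => ?_)).trans ?_
    · rw [norm_mul, Complex.norm_real, Real.norm_of_nonneg (hK.nonneg _)]
      exact mul_le_mul_of_nonneg_left (hB' _ (mem_univ _)) (hK.nonneg _)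
    · rw [integral_mul_const]
      exact mul_le_mul_of_nonneg_right (hK.integral_le θ')
        ((norm_nonneg _).trans (hB' θ' (mem_univ _)))
  have hKψi : Integrable (fun θ' => ∫ α, (K (gap θ' α) : ℂ) * ψ α ∂(surface d)) (surface d) :=
    Integrable.of_bound hKψm (C * B') (ae_of_all _ hKψb)
  have hJi : ∀ {g : Sphere d → ℂ}, Integrable g (surface d) →
      Integrable (fun α => (J (gap θ α) : ℂ) * g α) (surface d) := fun {g} hg =>
    hg.bdd_mul (hc.comp (by fun_prop : Continuous fun α : Sphere d => (θ, α))).aestronglyMeasurable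
      (ae_of_all _ fun α => hB (θ, α) (mem_univ _))
  have h2 : zonalInt d J (zonalDiff d K ψ) θ =
      (∫ α, (J (gap θ α) : ℂ) * (∫ β, (K (gap α β) : ℂ) * ψ β ∂(surface d)) ∂(surface d)) -
        κ * zonalInt d J ψ θ := by
    rw [zonalInt, zonalInt, ← integral_const_mul, ← integral_sub (hJi hKψi) ((hJi hψi).const_mul κ)]
    congr 1
    ext α
    rw [hdiff]
    ring
  rw [h1, h2]
  congr 1
  have hψ2 : Integrable (fun p : Sphere d × Sphere d => (K (gap θ p.1) : ℂ) * ψ p.2)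
      ((surface d).prod (surface d)) := (hKi θ).mul_prod hψi
  have hi1 : Integrable (Function.uncurry fun α β => (K (gap θ α) : ℂ) * ((J (gap α β) : ℂ) * ψ β))
      ((surface d).prod (surface d)) := by
    have := hψ2.bdd_mul hc.aestronglyMeasurable (ae_of_all _ fun p => hB p (mem_univ _))
    refine this.congr (ae_of_all _ fun p => ?_)
    simp only [Function.uncurry]
    ring
  have hi2 : Integrable (Function.uncurry fun α β => (J (gap θ α) : ℂ) * ((K (gap α β) : ℂ) * ψ β))
      ((surface d).prod (surface d)) := by
    have h3 : Integrable (fun p : Sphere d × Sphere d => (K (gap p.1 p.2) : ℂ) * ψ p.2)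
        ((surface d).prod (surface d)) :=
      hK.integrable_prod.ofReal.mul_bdd (hψ.comp continuous_snd).aestronglyMeasurable
        (ae_of_all _ fun p => hB' p.2 (mem_univ _))
    have hc2 : Continuous fun p : Sphere d × Sphere d => (J (gap θ p.1) : ℂ) :=
      hc.comp (by fun_prop : Continuous fun p : Sphere d × Sphere d => (θ, p.1))
    exact h3.bdd_mul hc2.aestronglyMeasurable (ae_of_all _ fun p => hB (θ, p.1) (mem_univ _))
  simp only [zonalInt, ← integral_const_mul]
  rw [integral_integral_swap hi1, integral_integral_swap hi2]
  congr 1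
  ext β
  have := congrArg (fun z => z * ψ β) (integral_zonal_symm hJ.measurable hK.measurable θ β)
  simp only [← integral_mul_const] at this
  simpa only [mul_assoc] using this


end

/-! ### Polynomial mollification on the sphere -/

section

open scoped ENNReal

theorem gap_le_two {d : ℕ} (θ θ' : Sphere d) : gap θ θ' ≤ 2 := by
  have := abs_real_inner_le_norm (θ : Space d) θ'
  rw [norm_sphere, norm_sphere, one_mul] at this
  rw [gap]
  linarith [(abs_le.1 this).1]

/-- The normalised polynomial kernel `c (1 + θ·θ')ⁿ`. -/
noncomputable def molKernel (d n : ℕ) (w : ℝ) : ℝ :=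
  ((∫ θ, ∫ θ', (1 - gap θ θ' / 2) ^ n ∂(surface d) ∂(surface d)) / (surface d).real univ)⁻¹ *
    (1 - w / 2) ^ n

/-- Mollification on the sphere by polynomials. -/
noncomputable def mol (d n : ℕ) (f : Sphere d → ℂ) : Sphere d → ℂ := zonalInt d (molKernel d n) f

@[fun_prop] theorem continuous_molKernel (d n : ℕ) : Continuous (molKernel d n) := by
  unfold molKernel; fun_prop

section

variable {d : ℕ}

/-- By rotation invariance the normalising integral is the same at every point, so the average over
the sphere in the definition equals its value at any `θ`. The average spares the choice of a base
point. -/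
theorem molKernel_eq (n : ℕ) (θ : Sphere d) (w : ℝ) :
    molKernel d n w = (∫ θ', (1 - gap θ θ' / 2) ^ n ∂(surface d))⁻¹ * (1 - w / 2) ^ n := by
  have h : ∀ α : Sphere d, ∫ θ', (1 - gap α θ' / 2) ^ n ∂(surface d) =
      ∫ θ', (1 - gap θ θ' / 2) ^ n ∂(surface d) := by
    intro α
    have := integral_zonal_const (d := d) (J := fun w => (1 - w / 2) ^ n)
      (by fun_prop) α θ
    rw [integral_complex_ofReal, integral_complex_ofReal] at this
    exact_mod_cast this
  have hne : (surface d).real univ ≠ 0 := by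
    have : (surface d) univ ≠ 0 := by
      rw [ne_eq, Measure.measure_univ_eq_zero]
      intro h0
      have : IsOpen (univ : Set (Sphere d)) := isOpen_univ
      have := this.measure_ne_zero (surface d) ⟨θ, mem_univ _⟩
      simp only [surface] at h0
      rw [surface, h0] at this
      simp at this
    exact (ENNReal.toReal_pos this (measure_ne_top _ _)).ne'
  simp only [molKernel, h, integral_const, smul_eq_mul]
  rw [mul_div_cancel_left₀ _ hne]

theorem base_nonneg (θ θ' : Sphere d) : 0 ≤ 1 - gap θ θ' / 2 := by
  linarith [gap_le_two θ θ']

theorem integral_pow_pos (n : ℕ) (θ : Sphere d) :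
    0 < ∫ θ', (1 - gap θ θ' / 2) ^ n ∂(surface d) := by
  have hc : Continuous fun θ' : Sphere d => (1 - gap θ θ' / 2) ^ n := by fun_prop
  refine hc.integral_pos_of_hasCompactSupport_nonneg_nonzero
    (HasCompactSupport.of_compactSpace _) (fun θ' => pow_nonneg (base_nonneg θ θ') n) (x := θ) ?_
  have : gap θ θ = 0 := by rw [gap, real_inner_self_eq_norm_sq, norm_sphere]; ring
  simp [this]

theorem molKernel_nonneg (n : ℕ) (θ θ' : Sphere d) : 0 ≤ molKernel d n (gap θ θ') := by
  rw [molKernel_eq n θ]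
  exact mul_nonneg (inv_nonneg.2 (integral_pow_pos n θ).le) (pow_nonneg (base_nonneg θ θ') n)

theorem integral_molKernel (n : ℕ) (θ : Sphere d) :
    ∫ θ', molKernel d n (gap θ θ') ∂(surface d) = 1 := by
  simp only [molKernel_eq n θ]
  rw [integral_const_mul, inv_mul_cancel₀ (integral_pow_pos n θ).ne']

theorem lintegral_molKernel (n : ℕ) (θ : Sphere d) :
    ∫⁻ θ', ENNReal.ofReal (molKernel d n (gap θ θ')) ∂(surface d) = 1 := by
  have hc : Continuous fun θ' : Sphere d => molKernel d n (gap θ θ') := by fun_prop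
  rw [← ofReal_integral_eq_lintegral_ofReal (hc.integrable_of_hasCompactSupport
    (HasCompactSupport.of_compactSpace _)) (ae_of_all _ fun θ' => molKernel_nonneg n θ θ'),
    integral_molKernel, ENNReal.ofReal_one]

/-- Induction on the power: one factor `1 + x·θ'` is expanded in coordinates and the coordinates of
`θ'` are absorbed into `f`. The function is thus a polynomial in `x`. -/
theorem exists_contDiff_integral_pow (n : ℕ) {f : Sphere d → ℂ} (hf : Integrable f (surface d)) :
    ContDiff ℝ ∞ fun x : Space d =>
      ∫ θ' : Sphere d, ((1 + inner ℝ x (θ' : Space d) : ℝ) : ℂ) ^ n * f θ' ∂(surface d) := by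
  induction n generalizing f with
  | zero => simp only [pow_zero]; exact contDiff_const
  | succ n ih =>
    have hi : ∀ i : Fin d, Integrable (fun θ' : Sphere d => (((θ' : Space d) i : ℝ) : ℂ) * f θ')
        (surface d) := by
      intro i
      refine hf.bdd_mul (c := 1) (by fun_prop : Continuous fun θ' : Sphere d =>
        (((θ' : Space d) i : ℝ) : ℂ)).aestronglyMeasurable (ae_of_all _ fun θ' => ?_)
      rw [Complex.norm_real]
      exact (PiLp.norm_apply_le (θ' : Space d) i).trans (norm_sphere θ').le
    have hpow : ∀ x : Space d, ∀ {g : Sphere d → ℂ}, Integrable g (surface d) → Integrable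
        (fun θ' : Sphere d => ((1 + inner ℝ x (θ' : Space d) : ℝ) : ℂ) ^ n * g θ') (surface d) := by
      intro x g hg
      have hc : Continuous fun θ' : Sphere d => ((1 + inner ℝ x (θ' : Space d) : ℝ) : ℂ) ^ n := by
        fun_prop
      obtain ⟨B, hB⟩ := isCompact_univ.exists_bound_of_continuousOn hc.continuousOn
      exact hg.bdd_mul hc.aestronglyMeasurable (ae_of_all _ fun θ' => hB θ' (mem_univ _))
    have e : (fun x : Space d =>
        ∫ θ' : Sphere d, ((1 + inner ℝ x (θ' : Space d) : ℝ) : ℂ) ^ (n + 1) * f θ' ∂(surface d)) =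
        fun x => (∫ θ' : Sphere d, ((1 + inner ℝ x (θ' : Space d) : ℝ) : ℂ) ^ n * f θ' ∂(surface d)) +
          ∑ i, ((x i : ℝ) : ℂ) * ∫ θ' : Sphere d, ((1 + inner ℝ x (θ' : Space d) : ℝ) : ℂ) ^ n *
            ((((θ' : Space d) i : ℝ) : ℂ) * f θ') ∂(surface d) := by
      ext x
      simp only [← integral_const_mul]
      rw [← integral_finsetSum _ fun i _ => (hpow x (hi i)).const_mul _, ← integral_add (hpow x hf)
        (integrable_finsetSum _ fun i _ => (hpow x (hi i)).const_mul _)]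
      congr 1
      ext θ'
      have : ((inner ℝ x (θ' : Space d) : ℝ) : ℂ) =
          ∑ i, ((x i : ℝ) : ℂ) * (((θ' : Space d) i : ℝ) : ℂ) := by
        rw [PiLp.inner_apply]
        push_cast
        refine Finset.sum_congr rfl fun i _ => ?_
        simp [mul_comm]
      have e2 : ∑ i, ((x i : ℝ) : ℂ) * (((1 + inner ℝ x (θ' : Space d) : ℝ) : ℂ) ^ n *
          ((((θ' : Space d) i : ℝ) : ℂ) * f θ')) =
          ((1 + inner ℝ x (θ' : Space d) : ℝ) : ℂ) ^ n * f θ' *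
            ((inner ℝ x (θ' : Space d) : ℝ) : ℂ) := by
        rw [this, Finset.mul_sum]
        refine Finset.sum_congr rfl fun i _ => ?_
        ring
      rw [e2, pow_succ]
      push_cast
      ring
    rw [e]
    refine (ih hf).add (ContDiff.sum fun i _ => ContDiff.mul ?_ (ih (hi i)))
    exact Complex.ofRealCLM.contDiff.comp (by fun_prop)

/-- Since `1 - gap/2 = (1 + θ·θ')/2`, a mollified function is the restriction of a polynomial on
`ℝ^d`, hence an admissible test function in the weak formulation. -/
theorem exists_contDiff_mol (n : ℕ) {f : Sphere d → ℂ} (hf : Integrable f (surface d)) :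
    ∃ ψ : Space d → ℂ, ContDiff ℝ ∞ ψ ∧ mol d n f = fun θ : Sphere d => ψ θ := by
  set c : ℝ := ((∫ θ, ∫ θ', (1 - gap θ θ' / 2) ^ n ∂(surface d) ∂(surface d)) /
    (surface d).real univ)⁻¹ with hc
  refine ⟨fun x => ((c / 2 ^ n : ℝ) : ℂ) *
    ∫ θ' : Sphere d, ((1 + inner ℝ x (θ' : Space d) : ℝ) : ℂ) ^ n * f θ' ∂(surface d),
    contDiff_const.mul (exists_contDiff_integral_pow n hf), ?_⟩
  ext θ
  simp only [mol, zonalInt]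
  rw [← integral_const_mul]
  congr 1
  ext θ'
  rw [molKernel, ← hc, ← mul_assoc]
  congr 1
  have : 1 - gap θ θ' / 2 = (1 + inner ℝ (θ : Space d) (θ' : Space d)) / 2 := by rw [gap]; ring
  rw [this, div_pow]
  push_cast
  ring

theorem continuous_mol (n : ℕ) {f : Sphere d → ℂ} (hf : Integrable f (surface d)) :
    Continuous (mol d n f) := by
  obtain ⟨ψ, hψ, h⟩ := exists_contDiff_mol n hf
  rw [h]
  exact continuous_restrict hψ.continuous

theorem mol_sub (n : ℕ) {f g : Sphere d → ℂ} (hf : Integrable f (surface d))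
    (hg : Integrable g (surface d)) : mol d n (f - g) = mol d n f - mol d n g := by
  ext θ
  have hc : Continuous fun θ' : Sphere d => (molKernel d n (gap θ θ') : ℂ) := by fun_prop
  obtain ⟨B, hB⟩ := isCompact_univ.exists_bound_of_continuousOn hc.continuousOn
  have hi : ∀ {g : Sphere d → ℂ}, Integrable g (surface d) →
      Integrable (fun θ' => (molKernel d n (gap θ θ') : ℂ) * g θ') (surface d) := fun hg =>
    hg.bdd_mul hc.aestronglyMeasurable (ae_of_all _ fun θ' => hB θ' (mem_univ _))
  simp only [Pi.sub_apply, mol, zonalInt]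
  rw [← integral_sub (hi hf) (hi hg)]
  congr 1
  ext θ'
  ring

theorem enorm_mol_le (n : ℕ) (f : Sphere d → ℂ) (θ : Sphere d) :
    ‖mol d n f θ‖ₑ ≤ ∫⁻ θ', ENNReal.ofReal (molKernel d n (gap θ θ')) * ‖f θ'‖ₑ ∂(surface d) := by
  refine (enorm_integral_le_lintegral_enorm _).trans (lintegral_mono fun θ' => ?_)
  rw [enorm_mul]
  apply le_of_eq
  congr 1
  rw [← ofReal_norm, Complex.norm_real, Real.norm_of_nonneg (molKernel_nonneg n θ θ')]

/-- Tonelli: the kernel is symmetric and has unit mass in each variable. -/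
theorem lintegral_mol_kernel_mul (n : ℕ) {g : Sphere d → ℝ≥0∞} (hg : AEMeasurable g (surface d)) :
    ∫⁻ θ, ∫⁻ θ', ENNReal.ofReal (molKernel d n (gap θ θ')) * g θ' ∂(surface d) ∂(surface d) =
      ∫⁻ θ, g θ ∂(surface d) := by
  have hm : Measurable fun p : Sphere d × Sphere d => ENNReal.ofReal (molKernel d n (gap p.1 p.2)) := by
    have : Continuous fun p : Sphere d × Sphere d => molKernel d n (gap p.1 p.2) := by fun_prop
    exact this.measurable.ennreal_ofReal
  rw [lintegral_lintegral_swap (hm.aemeasurable.mul hg.comp_snd)]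
  refine lintegral_congr fun θ' => ?_
  rw [lintegral_mul_const]
  · simp only [gap_comm _ θ', lintegral_molKernel, one_mul]
  · have : Continuous fun θ : Sphere d => molKernel d n (gap θ θ') := by
      simp only [gap_comm _ θ']; fun_prop
    exact this.measurable.ennreal_ofReal

theorem eLpNorm_one_mol_le (n : ℕ) {f : Sphere d → ℂ} (hf : AEStronglyMeasurable f (surface d)) :
    eLpNorm (mol d n f) 1 (surface d) ≤ eLpNorm f 1 (surface d) := by
  rw [eLpNorm_one_eq_lintegral_enorm, eLpNorm_one_eq_lintegral_enorm]
  exact (lintegral_mono (enorm_mol_le n f)).trans (lintegral_mol_kernel_mul n hf.enorm).le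

end

/-- The Cauchy–Schwarz inequality for a weighted integral. -/
theorem sq_lintegral_mul_le {α : Type*} [MeasurableSpace α] {μ : Measure α} {w g : α → ℝ≥0∞}
    (hw : AEMeasurable w μ) (hg : AEMeasurable g μ) :
    (∫⁻ x, w x * g x ∂μ) ^ 2 ≤ (∫⁻ x, w x ∂μ) * ∫⁻ x, w x * g x ^ 2 ∂μ := by
  have h := ENNReal.lintegral_mul_le_Lp_mul_Lq μ Real.HolderConjugate.two_two
    (f := fun x => w x ^ (1 / 2 : ℝ)) (g := fun x => w x ^ (1 / 2 : ℝ) * g x)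
    (hw.pow_const _) ((hw.pow_const _).mul hg)
  have e1 : ∀ x, w x ^ (1 / 2 : ℝ) * (w x ^ (1 / 2 : ℝ) * g x) = w x * g x := fun x => by
    rw [← mul_assoc, ← ENNReal.rpow_add_of_nonneg _ _ (by norm_num) (by norm_num)]
    norm_num
  have e2 : ∀ x, (w x ^ (1 / 2 : ℝ)) ^ (2 : ℝ) = w x := fun x => by
    rw [← ENNReal.rpow_mul]; norm_num
  have e3 : ∀ x, (w x ^ (1 / 2 : ℝ) * g x) ^ (2 : ℝ) = w x * g x ^ 2 := fun x => by
    rw [ENNReal.mul_rpow_of_nonneg _ _ (by norm_num), e2]; norm_num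
  simp only [Pi.mul_apply, e1, e2, e3] at h
  calc _ ≤ ((∫⁻ x, w x ∂μ) ^ (1 / 2 : ℝ) * (∫⁻ x, w x * g x ^ 2 ∂μ) ^ (1 / 2 : ℝ)) ^ 2 := by gcongr
    _ = _ := by
      rw [mul_pow, ← ENNReal.rpow_natCast, ← ENNReal.rpow_natCast, ← ENNReal.rpow_mul,
        ← ENNReal.rpow_mul]
      norm_num

section

variable {d : ℕ}

/-- The Cauchy–Schwarz inequality against a probability kernel, followed by Tonelli. -/
theorem eLpNorm_two_mol_le (n : ℕ) {f : Sphere d → ℂ} (hf : AEStronglyMeasurable f (surface d)) :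
    eLpNorm (mol d n f) 2 (surface d) ≤ eLpNorm f 2 (surface d) := by
  have h : eLpNorm (mol d n f) 2 (surface d) ^ 2 ≤ eLpNorm f 2 (surface d) ^ 2 := by
    rw [eLpNorm_two_sq, eLpNorm_two_sq]
    refine (lintegral_mono fun θ => ?_).trans (lintegral_mol_kernel_mul n (hf.enorm.pow_const 2)).le
    have hm : Measurable fun θ' : Sphere d => ENNReal.ofReal (molKernel d n (gap θ θ')) := by
      have : Continuous fun θ' : Sphere d => molKernel d n (gap θ θ') := by fun_prop
      exact this.measurable.ennreal_ofReal
    calc _ ≤ (∫⁻ θ', ENNReal.ofReal (molKernel d n (gap θ θ')) * ‖f θ'‖ₑ ∂(surface d)) ^ 2 := by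
          gcongr; exact enorm_mol_le n f θ
      _ ≤ _ := sq_lintegral_mul_le hm.aemeasurable hf.enorm
      _ = _ := by rw [lintegral_molKernel, one_mul]
  by_contra hcon
  exact absurd h (not_le.2 (ENNReal.pow_lt_pow_left two_ne_zero (not_le.1 hcon)))

/-- The base `1 - gap θ θ'/2` has its unique maximum at `θ' = θ`, so its normalised powers
concentrate there. -/
theorem tendsto_mol_apply {f : Sphere d → ℂ} (hf : Continuous f) (θ : Sphere d) :
    Tendsto (fun n => mol d n f θ) atTop (𝓝 (f θ)) := by
  have h := tendsto_setIntegral_pow_smul_of_unique_maximum_of_isCompact_of_continuousOn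
    (μ := surface d) (x₀ := θ) (g := f) (isCompact_univ)
    (c := fun θ' => 1 - gap θ θ' / 2) (by fun_prop) (fun y _ hy => ?_)
    (fun y _ => base_nonneg θ y) ?_ (by simp) hf.continuousOn
  · refine h.congr fun n => ?_
    simp only [Measure.restrict_univ]
    rw [mol, zonalInt, ← integral_smul]
    congr 1
    ext θ'
    rw [molKernel_eq n θ, Complex.real_smul, Complex.real_smul]
    push_cast
    ring
  · have h0 : gap θ θ = 0 := by rw [gap, real_inner_self_eq_norm_sq, norm_sphere]; ring
    have h1 : 0 < gap θ y := by
      have := norm_sub_sq_eq_gap θ y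
      have h2 : 0 < ‖(θ : Space d) - y‖ := by
        rw [norm_pos_iff, sub_ne_zero]
        exact fun h => hy (Subtype.ext h.symm)
      nlinarith
    linarith
  · have h0 : gap θ θ = 0 := by rw [gap, real_inner_self_eq_norm_sq, norm_sphere]; ring
    simp [h0]

theorem norm_mol_le {f : Sphere d → ℂ} {B : ℝ} (hB : ∀ θ, ‖f θ‖ ≤ B) (n : ℕ) (θ : Sphere d) :
    ‖mol d n f θ‖ ≤ B := by
  have hc : Continuous fun θ' : Sphere d => molKernel d n (gap θ θ') := by fun_prop
  have hi := hc.integrable_of_hasCompactSupport (μ := surface d) (HasCompactSupport.of_compactSpace _)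
  refine (norm_integral_le_of_norm_le (hi.mul_const B) (ae_of_all _ fun θ' => ?_)).trans ?_
  · rw [norm_mul, Complex.norm_real, Real.norm_of_nonneg (molKernel_nonneg n θ θ')]
    exact mul_le_mul_of_nonneg_left (hB θ') (molKernel_nonneg n θ θ')
  · rw [integral_mul_const, integral_molKernel, one_mul]

/-- Mollification converges in any `Lᵖ` space in which it is a contraction. -/
theorem tendsto_eLpNorm_mol {p : ℝ≥0∞} (hp1 : 1 ≤ p) (hpt : p ≠ ⊤)
    (hcon : ∀ n, ∀ f : Sphere d → ℂ, AEStronglyMeasurable f (surface d) →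
      eLpNorm (mol d n f) p (surface d) ≤ eLpNorm f p (surface d))
    {f : Sphere d → ℂ} (hf : MemLp f p (surface d)) :
    Tendsto (fun n => eLpNorm (mol d n f - f) p (surface d)) atTop (𝓝 0) := by
  rw [ENNReal.tendsto_nhds_zero]
  intro ε hε
  by_cases hεt : ε = ⊤
  · simp [hεt]
  obtain ⟨g, -, hgε, hgc, hgL⟩ := hf.exists_hasCompactSupport_eLpNorm_sub_le hpt
    (ε := ε / 3) (ENNReal.div_pos hε.ne' (by norm_num)).ne'
  obtain ⟨B, hB⟩ := isCompact_univ.exists_bound_of_continuousOn hgc.continuousOn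
  have hgi : Integrable g (surface d) := hgL.integrable hp1
  have hfi : Integrable f (surface d) := hf.integrable hp1
  -- For continuous `g` the convergence is pointwise and the mollified functions share the sup bound
  -- of `g`, so uniform integrability is automatic. The general case follows by density and
  -- contractivity.
  have hg : Tendsto (fun n => eLpNorm (mol d n g - g) p (surface d)) atTop (𝓝 0) := by
    refine tendsto_Lp_finite_of_tendsto_ae hp1 hpt
      (fun n => (continuous_mol n hgi).aestronglyMeasurable) hgL ?_
      (ae_of_all _ fun θ => tendsto_mol_apply hgc θ)
    refine unifIntegrable_of hp1 hpt (fun n => (continuous_mol n hgi).aestronglyMeasurable)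
      fun η hη => ⟨(B + 1).toNNReal, fun n => ?_⟩
    have : {x | (B + 1).toNNReal ≤ ‖mol d n g x‖₊} = ∅ := by
      ext x
      simp only [mem_ofPred_eq, mem_empty_iff_false, iff_false, not_le]
      rw [← NNReal.coe_lt_coe, coe_nnnorm]
      have hb := norm_mol_le (fun θ => hB θ (mem_univ _)) n x
      exact (lt_of_le_of_lt hb (lt_add_one B)).trans_le (Real.le_coe_toNNReal _)
    simp [this]
  filter_upwards [(ENNReal.tendsto_nhds_zero.1 hg) (ε / 3)
    (ENNReal.div_pos hε.ne' (by norm_num))] with n hn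
  have e : mol d n f - f = mol d n (f - g) + (mol d n g - g) + (g - f) := by
    rw [mol_sub n hfi hgi]; abel
  have hm1 := (continuous_mol n (hfi.sub hgi)).aestronglyMeasurable (μ := surface d)
  have hm2 : AEStronglyMeasurable (mol d n g - g) (surface d) :=
    ((continuous_mol n hgi).sub hgc).aestronglyMeasurable
  have hm3 : AEStronglyMeasurable (g - f) (surface d) := (hgi.sub hfi).aestronglyMeasurable
  calc eLpNorm (mol d n f - f) p (surface d)
      ≤ eLpNorm (mol d n (f - g)) p (surface d) + eLpNorm (mol d n g - g) p (surface d) +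
        eLpNorm (g - f) p (surface d) := by
        rw [e]
        exact (eLpNorm_add_le (hm1.add hm2) hm3 hp1).trans
          (add_le_add (eLpNorm_add_le hm1 hm2 hp1) le_rfl)
    _ ≤ ε / 3 + ε / 3 + ε / 3 := by
        gcongr
        · exact (hcon n _ (hfi.sub hgi).aestronglyMeasurable).trans hgε
        · rw [eLpNorm_sub_comm]; exact hgε
    _ = ε := ENNReal.add_thirds ε

end


end

/-! ### The weak scattering operator, its Dirichlet form and commutators -/

section

open scoped ENNReal ComplexConjugate

section

variable {d : ℕ} {s c₁ M : ℝ} {k e : ℝ → ℝ}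

theorem IsZonal.measurable_zonalDiff {K : ℝ → ℝ} {C : ℝ} (hK : IsZonal d K C) {ψ : Sphere d → ℂ}
    (hψ : Continuous ψ) : Measurable (zonalDiff d K ψ) := by
  have : StronglyMeasurable fun p : Sphere d × Sphere d => (K (gap p.1 p.2) : ℂ) * (ψ p.2 - ψ p.1) :=
    ((Complex.measurable_ofReal.comp hK.measurable_prod).mul
      ((hψ.measurable.comp measurable_snd).sub (hψ.measurable.comp measurable_fst))).stronglyMeasurable
  exact this.integral_prod_right.measurable

theorem IsZonal.norm_zonalDiff_le {K : ℝ → ℝ} {C : ℝ} (hK : IsZonal d K C) {ψ : Sphere d → ℂ}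
    {B : ℝ} (hB : ∀ θ, ‖ψ θ‖ ≤ B) (θ : Sphere d) : ‖zonalDiff d K ψ θ‖ ≤ C * (2 * B) := by
  have hB0 : 0 ≤ B := (norm_nonneg _).trans (hB θ)
  refine (norm_integral_le_of_norm_le ((hK.integrable θ).mul_const (2 * B))
    (ae_of_all _ fun α => ?_)).trans ?_
  · rw [norm_mul, Complex.norm_real, Real.norm_of_nonneg (hK.nonneg _)]
    refine mul_le_mul_of_nonneg_left ?_ (hK.nonneg _)
    calc _ ≤ ‖ψ α‖ + ‖ψ θ‖ := norm_sub_le _ _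
      _ ≤ _ := by linarith [hB α, hB θ]
  · rw [integral_mul_const]
    exact mul_le_mul_of_nonneg_right (hK.integral_le θ) (by positivity)

theorem exists_bound_restrict {ψ : Space d → ℂ} (hψ : Continuous ψ) :
    ∃ B : ℝ, 0 ≤ B ∧ ∀ θ : Sphere d, ‖ψ θ‖ ≤ B := by
  obtain ⟨B, hB⟩ := isCompact_univ.exists_bound_of_continuousOn
    (continuous_restrict (d := d) hψ).continuousOn
  exact ⟨max B 0, le_max_right _ _, fun θ => (hB θ (mem_univ _)).trans (le_max_left _ _)⟩

theorem IsKernel.tendsto_scat (h : IsKernel d s c₁ M k e) {ψ : Space d → ℂ} (hψ : ContDiff ℝ 2 ψ)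
    (θ : Sphere d) : Tendsto (fun ε => scat d k ε (fun θ => ψ θ) θ) (𝓝[>] 0)
      (𝓝 (Scat d k (fun θ => ψ θ) θ)) := by
  obtain ⟨C, hC0, hC⟩ := h.exists_norm_scat_sub_Scat_le hψ
  have hs1 : 0 < 1 - s := by linarith [h.s_lt]
  rw [tendsto_iff_norm_sub_tendsto_zero]
  have h0 := (tendsto_rpow_nhdsGT_zero hs1).const_mul C
  rw [mul_zero] at h0
  refine squeeze_zero' (Eventually.of_forall fun _ => norm_nonneg _) ?_ h0
  filter_upwards [Ioo_mem_nhdsGT (zero_lt_one' ℝ)] with ε hε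
  exact hC ε hε θ

theorem IsKernel.measurable_Scat (h : IsKernel d s c₁ M k e) {ψ : Space d → ℂ}
    (hψ : ContDiff ℝ 2 ψ) : Measurable (Scat d k fun θ => ψ θ) := by
  have hu : Tendsto (fun n : ℕ => 1 / ((n : ℝ) + 1)) atTop (𝓝[>] 0) := by
    rw [tendsto_nhdsWithin_iff]
    exact ⟨tendsto_one_div_add_atTop_nhds_zero_nat, Eventually.of_forall fun n => by
      simp only [mem_Ioi]; positivity⟩
  refine measurable_of_tendsto_metrizable (f := fun n : ℕ => scat d k (1 / ((n : ℝ) + 1))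
    fun θ => ψ θ) (fun n => ?_) (tendsto_pi_nhds.2 fun θ => (h.tendsto_scat hψ θ).comp hu)
  obtain ⟨C, hC⟩ := h.exists_isZonal (show 0 < 1 / ((n : ℝ) + 1) by positivity)
  exact hC.measurable_zonalDiff (continuous_restrict hψ.continuous)

theorem IsKernel.exists_norm_Scat_le (h : IsKernel d s c₁ M k e) {ψ : Space d → ℂ}
    (hψ : ContDiff ℝ 2 ψ) : ∃ B : ℝ, 0 ≤ B ∧
      (∀ θ : Sphere d, ‖Scat d k (fun θ => ψ θ) θ‖ ≤ B) ∧
      ∀ ε ∈ Ioo (0 : ℝ) 1, ∀ θ : Sphere d, ‖scat d k ε (fun θ => ψ θ) θ‖ ≤ B := by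
  obtain ⟨C, hC0, hC⟩ := h.exists_norm_scat_sub_Scat_le hψ
  obtain ⟨B, hB0, hB⟩ := exists_bound_restrict (d := d) hψ.continuous
  obtain ⟨A, hA⟩ := h.exists_isZonal (show (0 : ℝ) < 1 / 2 by norm_num)
  have hs1 : 0 < 1 - s := by linarith [h.s_lt]
  have h1 : ∀ ε ∈ Ioo (0 : ℝ) 1, ε ^ (1 - s) ≤ 1 := fun ε hε =>
    Real.rpow_le_one hε.1.le hε.2.le hs1.le
  have h2 : ∀ θ : Sphere d, ‖Scat d k (fun θ => ψ θ) θ‖ ≤ A * (2 * B) + C := by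
    intro θ
    have e1 := hC (1 / 2) ⟨by norm_num, by norm_num⟩ θ
    have e2 := hA.norm_zonalDiff_le hB θ
    have e3 : ‖scat d k (1 / 2) (fun θ => ψ θ) θ‖ ≤ A * (2 * B) := e2
    have e4 := norm_sub_norm_le (Scat d k (fun θ => ψ θ) θ) (scat d k (1 / 2) (fun θ => ψ θ) θ)
    rw [norm_sub_rev] at e4
    have e5 := mul_le_mul_of_nonneg_left (h1 (1 / 2) ⟨by norm_num, by norm_num⟩) hC0
    linarith
  have hA0 := hA.const_nonneg
  refine ⟨A * (2 * B) + C + C, by positivity, fun θ => (h2 θ).trans (by linarith),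
    fun ε hε θ => ?_⟩
  have e1 := hC ε hε θ
  have e4 := norm_sub_norm_le (scat d k ε (fun θ => ψ θ) θ) (Scat d k (fun θ => ψ θ) θ)
  have e5 := mul_le_mul_of_nonneg_left (h1 ε hε) hC0
  linarith [h2 θ]

/-- Passing to the limit in the pairing with an integrable function. -/
theorem IsKernel.tendsto_integral_scat (h : IsKernel d s c₁ M k e) {ψ : Space d → ℂ}
    (hψ : ContDiff ℝ 2 ψ) {f : Sphere d → ℂ} (hf : Integrable f (surface d)) :
    Tendsto (fun ε => ∫ θ, f θ * scat d k ε (fun θ => ψ θ) θ ∂(surface d)) (𝓝[>] 0)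
      (𝓝 (∫ θ, f θ * Scat d k (fun θ => ψ θ) θ ∂(surface d))) := by
  obtain ⟨B, hB0, hB1, hB2⟩ := h.exists_norm_Scat_le hψ
  refine tendsto_integral_filter_of_dominated_convergence (fun θ => ‖f θ‖ * B) ?_ ?_
    (hf.norm.mul_const B) (ae_of_all _ fun θ => (h.tendsto_scat hψ θ).const_mul _)
  · filter_upwards [self_mem_nhdsWithin] with ε hε
    obtain ⟨C, hC⟩ := h.exists_isZonal hε
    exact hf.aestronglyMeasurable.mul
      (hC.measurable_zonalDiff (continuous_restrict hψ.continuous)).aestronglyMeasurable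
  · filter_upwards [Ioo_mem_nhdsGT (zero_lt_one' ℝ)] with ε hε
    refine ae_of_all _ fun θ => ?_
    rw [norm_mul]
    exact mul_le_mul_of_nonneg_left (hB2 ε hε θ) (norm_nonneg _)

theorem IsKernel.integrable_Scat (h : IsKernel d s c₁ M k e) {ψ : Space d → ℂ}
    (hψ : ContDiff ℝ 2 ψ) : Integrable (Scat d k fun θ => ψ θ) (surface d) := by
  obtain ⟨B, hB0, hB1, hB2⟩ := h.exists_norm_Scat_le hψ
  exact Integrable.of_bound (h.measurable_Scat hψ).aestronglyMeasurable B (ae_of_all _ hB1)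

/-- Each truncation commutes with mollification, both being zonal. Mollification contracts the sup
norm and the truncations converge uniformly on smooth functions, so the limit commutes as well. -/
theorem IsKernel.Scat_mol (h : IsKernel d s c₁ M k e) {ψ : Space d → ℂ} (hψ : ContDiff ℝ 2 ψ)
    (n : ℕ) : Scat d k (mol d n fun θ => ψ θ) = mol d n (Scat d k fun θ => ψ θ) := by
  obtain ⟨C, hC0, hC⟩ := h.exists_norm_scat_sub_Scat_le hψ
  have hψc := continuous_restrict (d := d) hψ.continuous
  have hs1 : 0 < 1 - s := by linarith [h.s_lt]
  ext θ
  have h1 : Tendsto (fun ε => mol d n (scat d k ε fun θ => ψ θ) θ) (𝓝[>] 0)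
      (𝓝 (mol d n (Scat d k fun θ => ψ θ) θ)) := by
    rw [tendsto_iff_norm_sub_tendsto_zero]
    have h0 := (tendsto_rpow_nhdsGT_zero hs1).const_mul C
    rw [mul_zero] at h0
    refine squeeze_zero' (Eventually.of_forall fun _ => norm_nonneg _) ?_ h0
    filter_upwards [Ioo_mem_nhdsGT (zero_lt_one' ℝ)] with ε hε
    obtain ⟨A, hA⟩ := h.exists_isZonal hε.1
    obtain ⟨B, hB0, hB1, hB2⟩ := h.exists_norm_Scat_le hψ
    have hi : Integrable (scat d k ε fun θ => ψ θ) (surface d) :=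
      Integrable.of_bound (hA.measurable_zonalDiff hψc).aestronglyMeasurable B
        (ae_of_all _ (hB2 ε hε))
    have e := congrFun (mol_sub n hi (h.integrable_Scat hψ)) θ
    rw [Pi.sub_apply] at e
    rw [← e]
    exact norm_mol_le (fun θ => hC ε hε θ) n θ
  refine Tendsto.limUnder_eq (h1.congr' ?_)
  filter_upwards [self_mem_nhdsWithin] with ε hε
  obtain ⟨A, hA⟩ := h.exists_isZonal hε
  exact (zonalDiff_zonalInt (continuous_molKernel d n) hA hψc θ).symm

end

/-- `𝓘(f) = H` on the sphere in the weak sense, for complex-valued functions. -/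
def WeakScat (d : ℕ) (k : ℝ → ℝ) (f H : Sphere d → ℂ) : Prop :=
  ∀ ψ : Space d → ℂ, ContDiff ℝ ∞ ψ →
    ∫ θ, f θ * Scat d k (fun θ => ψ θ) θ ∂(surface d) = ∫ θ, H θ * ψ θ ∂(surface d)

section

variable {d : ℕ} {s c₁ M : ℝ} {k e : ℝ → ℝ}

/-- By symmetry the mollifier moves onto the test function, which stays smooth, and it commutes with
`Scat`. -/
theorem WeakScat.mol (hk : IsKernel d s c₁ M k e) {f H : Sphere d → ℂ}
    (hf : Integrable f (surface d)) (hH : Integrable H (surface d)) (h : WeakScat d k f H) (n : ℕ) :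
    WeakScat d k (mol d n f) (mol d n H) := by
  intro ψ hψ
  have hψ2 : ContDiff ℝ 2 ψ := (contDiff_infty.1 hψ 2)
  have hψi : Integrable (fun θ : Sphere d => ψ θ) (surface d) :=
    (continuous_restrict hψ.continuous).integrable_of_hasCompactSupport
      (HasCompactSupport.of_compactSpace _)
  obtain ⟨φ, hφ, hφe⟩ := exists_contDiff_mol n hψi
  have h1 := h φ hφ
  rw [← hφe, hk.Scat_mol hψ2] at h1
  have h2 : ∀ θ : Sphere d, φ θ = RadiativeTransfer.mol d n (fun θ => ψ θ) θ :=
    fun θ => (congrFun hφe θ).symm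
  simp only [h2] at h1
  rw [RadiativeTransfer.mol, RadiativeTransfer.mol,
    integral_zonalInt_mul (continuous_molKernel d n) hf (hk.integrable_Scat hψ2),
    integral_zonalInt_mul (continuous_molKernel d n) hH hψi]
  exact h1

/-- The Dirichlet form of the regularised operator. -/
theorem IsZonal.integral_mul_zonalDiff {K : ℝ → ℝ} {C : ℝ} (hK : IsZonal d K C)
    {f ψ : Sphere d → ℂ} (hf : Continuous f) (hψ : Continuous ψ) :
    2 * ∫ θ, f θ * zonalDiff d K ψ θ ∂(surface d) =
      - ∫ p : Sphere d × Sphere d, (K (gap p.1 p.2) : ℂ) * ((f p.1 - f p.2) * (ψ p.1 - ψ p.2))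
        ∂((surface d).prod (surface d)) := by
  have hi : ∀ g : Sphere d × Sphere d → ℂ, Continuous g →
      Integrable (fun p : Sphere d × Sphere d => (K (gap p.1 p.2) : ℂ) * g p)
        ((surface d).prod (surface d)) := fun g hg => by
    obtain ⟨B, hB⟩ := isCompact_univ.exists_bound_of_continuousOn hg.continuousOn
    exact hK.integrable_prod.ofReal.mul_bdd hg.aestronglyMeasurable
      (ae_of_all _ fun p => hB p (mem_univ _))
  have h1 : ∫ θ, f θ * zonalDiff d K ψ θ ∂(surface d) =
      ∫ p : Sphere d × Sphere d, (K (gap p.1 p.2) : ℂ) * (f p.1 * (ψ p.2 - ψ p.1))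
        ∂((surface d).prod (surface d)) := by
    rw [integral_prod _ (hi (fun p => f p.1 * (ψ p.2 - ψ p.1)) (by fun_prop))]
    congr 1
    ext θ
    rw [zonalDiff, ← integral_const_mul]
    congr 1
    ext θ'
    ring
  have h2 : ∫ p : Sphere d × Sphere d, (K (gap p.1 p.2) : ℂ) * (f p.1 * (ψ p.2 - ψ p.1))
        ∂((surface d).prod (surface d)) =
      ∫ p : Sphere d × Sphere d, (K (gap p.1 p.2) : ℂ) * (f p.2 * (ψ p.1 - ψ p.2))
        ∂((surface d).prod (surface d)) := by
    rw [← integral_prod_swap]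
    congr 1
    ext p
    simp only [Prod.fst_swap, Prod.snd_swap]
    rw [gap_comm]
  rw [two_mul]
  nth_rewrite 2 [h1]
  rw [h2, h1, ← integral_add (hi (fun p => f p.1 * (ψ p.2 - ψ p.1)) (by fun_prop))
    (hi (fun p => f p.2 * (ψ p.1 - ψ p.2)) (by fun_prop)), ← integral_neg]
  congr 1
  ext p
  ring

/-- The energy `∬ K |f(θ) - f(θ')|²`. -/
noncomputable def energy (d : ℕ) (K : ℝ → ℝ) (f : Sphere d → ℂ) : ℝ :=
  ∫ p : Sphere d × Sphere d, K (gap p.1 p.2) * ‖f p.1 - f p.2‖ ^ 2 ∂((surface d).prod (surface d))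

theorem IsZonal.energy_nonneg {K : ℝ → ℝ} {C : ℝ} (hK : IsZonal d K C) (f : Sphere d → ℂ) :
    0 ≤ energy d K f :=
  integral_nonneg fun _ => mul_nonneg (hK.nonneg _) (sq_nonneg _)

theorem IsZonal.integrable_mul_continuous {K : ℝ → ℝ} {C : ℝ} (hK : IsZonal d K C)
    {g : Sphere d × Sphere d → ℝ} (hg : Continuous g) :
    Integrable (fun p : Sphere d × Sphere d => K (gap p.1 p.2) * g p)
        ((surface d).prod (surface d)) := by
  obtain ⟨B, hB⟩ := isCompact_univ.exists_bound_of_continuousOn hg.continuousOn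
  exact hK.integrable_prod.mul_bdd hg.aestronglyMeasurable
      (ae_of_all _ fun p => hB p (mem_univ _))

theorem IsZonal.integral_mul_zonalDiff_conj {K : ℝ → ℝ} {C : ℝ} (hK : IsZonal d K C)
    {f : Sphere d → ℂ} (hf : Continuous f) :
    2 * ∫ θ, f θ * zonalDiff d K (fun θ => conj (f θ)) θ ∂(surface d) = -(energy d K f : ℂ) := by
  rw [hK.integral_mul_zonalDiff hf (by fun_prop), energy, ← integral_complex_ofReal]
  congr 2
  ext p
  rw [← map_sub, Complex.mul_conj, Complex.normSq_eq_norm_sq]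
  push_cast
  ring

/-- The commutator of the Dirichlet form with a multiplier. -/
theorem IsZonal.abs_im_integral_mul_zonalDiff_le {K : ℝ → ℝ} {C : ℝ} (hK : IsZonal d K C)
    {f : Sphere d → ℂ} (hf : Continuous f) {χ : Sphere d → ℝ} (hχ : Continuous χ) {X : ℝ}
    (hX : ∀ θ, ∫ θ', K (gap θ θ') * (χ θ - χ θ') ^ 2 ∂(surface d) ≤ X) {l : ℝ} (hl : 0 < l) :
    |(∫ θ, f θ * zonalDiff d K (fun θ => conj ((χ θ : ℂ) * f θ)) θ ∂(surface d)).im| ≤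
      l / 2 * energy d K f + X / l * ∫ θ, ‖f θ‖ ^ 2 ∂(surface d) := by
  have h1 := hK.integral_mul_zonalDiff hf (ψ := fun θ => conj ((χ θ : ℂ) * f θ)) (by fun_prop)
  -- The integrand splits into the real quantity `χ|f - f'|²` and a term carrying the difference of
  -- `χ`. Only the latter has an imaginary part.
  have h2 : ∀ p : Sphere d × Sphere d,
      (f p.1 - f p.2) * (conj ((χ p.1 : ℂ) * f p.1) - conj ((χ p.2 : ℂ) * f p.2)) =
      ((χ p.1 * ‖f p.1 - f p.2‖ ^ 2 : ℝ) : ℂ) +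
        ((χ p.1 - χ p.2 : ℝ) : ℂ) * ((f p.1 - f p.2) * conj (f p.2)) := by
    intro p
    have e1 : ((‖f p.1 - f p.2‖ ^ 2 : ℝ) : ℂ) = (f p.1 - f p.2) * conj (f p.1 - f p.2) := by
      rw [Complex.mul_conj, Complex.normSq_eq_norm_sq]
    rw [Complex.ofReal_mul, e1]
    simp only [map_mul, map_sub, Complex.conj_ofReal]
    push_cast
    ring
  have hint : Integrable (fun p : Sphere d × Sphere d => (K (gap p.1 p.2) : ℂ) *
      ((f p.1 - f p.2) * (conj ((χ p.1 : ℂ) * f p.1) - conj ((χ p.2 : ℂ) * f p.2))))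
        ((surface d).prod (surface d)) := by
    have hg : Continuous fun p : Sphere d × Sphere d =>
      ((f p.1 - f p.2) * (conj ((χ p.1 : ℂ) * f p.1) - conj ((χ p.2 : ℂ) * f p.2))) := by fun_prop
    obtain ⟨B, hB⟩ := isCompact_univ.exists_bound_of_continuousOn hg.continuousOn
    exact hK.integrable_prod.ofReal.mul_bdd hg.aestronglyMeasurable
      (ae_of_all _ fun p => hB p (mem_univ _))
  have h3 := congrArg Complex.im h1
  have h4 : (∫ p : Sphere d × Sphere d, (K (gap p.1 p.2) : ℂ) *
      ((f p.1 - f p.2) * (conj ((χ p.1 : ℂ) * f p.1) - conj ((χ p.2 : ℂ) * f p.2)))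
        ∂((surface d).prod (surface d))).im = ∫ p : Sphere d × Sphere d, ((K (gap p.1 p.2) : ℂ) *
      ((f p.1 - f p.2) * (conj ((χ p.1 : ℂ) * f p.1) - conj ((χ p.2 : ℂ) * f p.2)))).im
        ∂((surface d).prod (surface d)) := (integral_im hint).symm
  rw [Complex.neg_im, h4] at h3
  have hA : Integrable (fun p : Sphere d × Sphere d => K (gap p.1 p.2) * ‖f p.1 - f p.2‖ ^ 2)
      ((surface d).prod (surface d)) := hK.integrable_mul_continuous (by fun_prop)
  have hB : Integrable (fun p : Sphere d × Sphere d =>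
      K (gap p.1 p.2) * ((χ p.1 - χ p.2) ^ 2 * ‖f p.2‖ ^ 2))
      ((surface d).prod (surface d)) := hK.integrable_mul_continuous (by fun_prop)
  have h5 : |∫ p : Sphere d × Sphere d, ((K (gap p.1 p.2) : ℂ) *
      ((f p.1 - f p.2) * (conj ((χ p.1 : ℂ) * f p.1) - conj ((χ p.2 : ℂ) * f p.2)))).im
        ∂((surface d).prod (surface d))| ≤
      ∫ p : Sphere d × Sphere d, (l * (K (gap p.1 p.2) * ‖f p.1 - f p.2‖ ^ 2) +
        1 / l * (K (gap p.1 p.2) * ((χ p.1 - χ p.2) ^ 2 * ‖f p.2‖ ^ 2)))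
        ∂((surface d).prod (surface d)) := by
    rw [← Real.norm_eq_abs]
    refine norm_integral_le_of_norm_le ((hA.const_mul l).add (hB.const_mul (1 / l)))
      (ae_of_all _ fun p => ?_)
    rw [h2, Real.norm_eq_abs, Complex.im_ofReal_mul, Complex.add_im,
      Complex.ofReal_im, zero_add, Complex.im_ofReal_mul, abs_mul, abs_mul,
      abs_of_nonneg (hK.nonneg _)]
    have e1 : |((f p.1 - f p.2) * conj (f p.2)).im| ≤ ‖f p.1 - f p.2‖ * ‖f p.2‖ := by
      refine (Complex.abs_im_le_norm _).trans ?_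
      rw [norm_mul, RCLike.norm_conj]
    -- Young's inequality with weight `l`, kept free so that it can be optimised in the resolvent
    -- estimate.
    have e2 : |χ p.1 - χ p.2| * (‖f p.1 - f p.2‖ * ‖f p.2‖) ≤
        l * ‖f p.1 - f p.2‖ ^ 2 + 1 / l * ((χ p.1 - χ p.2) ^ 2 * ‖f p.2‖ ^ 2) := by
      rw [← sq_abs (χ p.1 - χ p.2)]
      set a := ‖f p.1 - f p.2‖
      set b := |χ p.1 - χ p.2| * ‖f p.2‖ with hb
      have hab : a * b ≤ l * a ^ 2 + 1 / l * b ^ 2 := by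
        have hll : l * (1 / l) = 1 := by field_simp
        have h0 : 0 ≤ 1 / l := by positivity
        have ha0 : 0 ≤ a := norm_nonneg _
        have hb0 : 0 ≤ b := by positivity
        have : 0 ≤ (l * a - b) ^ 2 * (1 / l) := by positivity
        have e3 : (l * a - b) ^ 2 * (1 / l) = l * a ^ 2 + 1 / l * b ^ 2 - 2 * (a * b) := by
          field_simp
          ring
        have := mul_nonneg ha0 hb0
        linarith
      calc _ = a * b := by rw [hb]; ring
        _ ≤ _ := hab
        _ = _ := by rw [hb]; ring
    calc _ ≤ K (gap p.1 p.2) * (|χ p.1 - χ p.2| * (‖f p.1 - f p.2‖ * ‖f p.2‖)) := by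
          gcongr
          exact hK.nonneg _
      _ ≤ K (gap p.1 p.2) * (l * ‖f p.1 - f p.2‖ ^ 2 +
          1 / l * ((χ p.1 - χ p.2) ^ 2 * ‖f p.2‖ ^ 2)) :=
          mul_le_mul_of_nonneg_left e2 (hK.nonneg _)
      _ = _ := by ring
  rw [integral_add (hA.const_mul l) (hB.const_mul (1 / l)), integral_const_mul,
    integral_const_mul] at h5
  have h6 : ∫ p : Sphere d × Sphere d, K (gap p.1 p.2) * ((χ p.1 - χ p.2) ^ 2 * ‖f p.2‖ ^ 2)
      ∂((surface d).prod (surface d)) ≤ X * ∫ θ, ‖f θ‖ ^ 2 ∂(surface d) := by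
    rw [integral_prod_symm _ hB, ← integral_const_mul]
    have hfi : Integrable (fun θ : Sphere d => ‖f θ‖ ^ 2) (surface d) :=
      (by fun_prop : Continuous fun θ : Sphere d => ‖f θ‖ ^ 2).integrable_of_hasCompactSupport
        (HasCompactSupport.of_compactSpace _)
    refine integral_mono hB.integral_prod_right (hfi.const_mul X) fun θ => ?_
    have : ∀ α : Sphere d, K (gap α θ) * ((χ α - χ θ) ^ 2 * ‖f θ‖ ^ 2) =
        K (gap θ α) * (χ θ - χ α) ^ 2 * ‖f θ‖ ^ 2 := fun α => by rw [gap_comm]; ring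
    simp only [this]
    rw [integral_mul_const]
    exact mul_le_mul_of_nonneg_right (hX θ) (sq_nonneg _)
  have h7 : |2 * (∫ θ, f θ * zonalDiff d K (fun θ => conj ((χ θ : ℂ) * f θ)) θ ∂(surface d)).im| ≤
      l * energy d K f + 1 / l * (X * ∫ θ, ‖f θ‖ ^ 2 ∂(surface d)) := by
    have : (2 * ∫ θ, f θ * zonalDiff d K (fun θ => conj ((χ θ : ℂ) * f θ)) θ ∂(surface d)).im =
        2 * (∫ θ, f θ * zonalDiff d K (fun θ => conj ((χ θ : ℂ) * f θ)) θ ∂(surface d)).im := by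
      simp
    rw [← this, h3, abs_neg]
    refine h5.trans (add_le_add le_rfl ?_)
    gcongr
  rw [abs_mul, abs_two] at h7
  have h8 : 0 ≤ X * ∫ θ, ‖f θ‖ ^ 2 ∂(surface d) :=
    le_trans (integral_nonneg fun p => mul_nonneg (hK.nonneg _) (by positivity)) h6
  have h9 : 0 ≤ 1 / l * (X * ∫ θ, ‖f θ‖ ^ 2 ∂(surface d)) := by positivity
  have h10 : X / l * ∫ θ, ‖f θ‖ ^ 2 ∂(surface d) =
      1 / l * (X * ∫ θ, ‖f θ‖ ^ 2 ∂(surface d)) := by ring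
  rw [h10]
  linarith

end


end

/-! ### Energy and commutator bounds for smooth functions -/

section

open scoped ENNReal ComplexConjugate

theorem tendsto_integral_conj_mul {α : Type*} [MeasurableSpace α] {μ : Measure α}
    {a b : α → ℂ} {A B : ℕ → α → ℂ} (ha : MemLp a 2 μ) (hb : MemLp b 2 μ)
    (hA : ∀ n, MemLp (A n) 2 μ) (hB : ∀ n, MemLp (B n) 2 μ)
    (hAa : Tendsto (fun n => eLpNorm (A n - a) 2 μ) atTop (𝓝 0))
    (hBb : Tendsto (fun n => eLpNorm (B n - b) 2 μ) atTop (𝓝 0)) :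
    Tendsto (fun n => ∫ x, B n x * conj (A n x) ∂μ) atTop (𝓝 (∫ x, b x * conj (a x) ∂μ)) := by
  have h1 := (Lp.tendsto_Lp_iff_tendsto_eLpNorm'' A hA a ha).2 hAa
  have h2 := (Lp.tendsto_Lp_iff_tendsto_eLpNorm'' B hB b hb).2 hBb
  have key : ∀ {u v : α → ℂ} (hu : MemLp u 2 μ) (hv : MemLp v 2 μ),
      inner ℂ (hu.toLp u) (hv.toLp v) = ∫ x, v x * conj (u x) ∂μ := by
    intro u v hu hv
    rw [L2.inner_def]
    refine integral_congr_ae ?_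
    filter_upwards [hu.coeFn_toLp, hv.coeFn_toLp] with x hx hy
    rw [hx, hy]
    rfl
  have h3 := h1.inner (𝕜 := ℂ) h2
  rw [key ha hb] at h3
  exact h3.congr fun n => key (hA n) (hB n)

section

variable {d : ℕ} {s c₁ M : ℝ} {k e : ℝ → ℝ}

/-- The dissipation `-Re ∫ H conj f`. -/
noncomputable def dissip (d : ℕ) (f H : Sphere d → ℂ) : ℝ :=
  -(∫ θ, H θ * conj (f θ) ∂(surface d)).re

theorem IsZonal.energy_le {K : ℝ → ℝ} {C : ℝ} (hK : IsZonal d K C) {f : Sphere d → ℂ}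
    (hf : Continuous f) : energy d K f ≤ 4 * C * ∫ θ, ‖f θ‖ ^ 2 ∂(surface d) := by
  have h1 : Integrable (fun p : Sphere d × Sphere d => K (gap p.1 p.2) * ‖f p.1‖ ^ 2)
      ((surface d).prod (surface d)) := hK.integrable_mul_continuous (by fun_prop)
  have h2 : Integrable (fun p : Sphere d × Sphere d => K (gap p.1 p.2) * ‖f p.2‖ ^ 2)
      ((surface d).prod (surface d)) := hK.integrable_mul_continuous (by fun_prop)
  have h3 : ∫ p : Sphere d × Sphere d, K (gap p.1 p.2) * ‖f p.1‖ ^ 2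
      ∂((surface d).prod (surface d)) ≤ C * ∫ θ, ‖f θ‖ ^ 2 ∂(surface d) := by
    rw [integral_prod _ h1, ← integral_const_mul]
    have hfi : Integrable (fun θ : Sphere d => ‖f θ‖ ^ 2) (surface d) :=
      (by fun_prop : Continuous fun θ : Sphere d => ‖f θ‖ ^ 2).integrable_of_hasCompactSupport
        (HasCompactSupport.of_compactSpace _)
    refine integral_mono h1.integral_prod_left (hfi.const_mul C) fun θ => ?_
    simp only
    rw [integral_mul_const]
    exact mul_le_mul_of_nonneg_right (hK.integral_le θ) (sq_nonneg _)
  have h4 : ∫ p : Sphere d × Sphere d, K (gap p.1 p.2) * ‖f p.2‖ ^ 2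
      ∂((surface d).prod (surface d)) = ∫ p : Sphere d × Sphere d, K (gap p.1 p.2) * ‖f p.1‖ ^ 2
      ∂((surface d).prod (surface d)) := by
    rw [← integral_prod_swap]
    congr 1
    ext p
    simp only [Prod.fst_swap, Prod.snd_swap]
    rw [gap_comm]
  have h5 : energy d K f ≤ ∫ p : Sphere d × Sphere d, (2 * (K (gap p.1 p.2) * ‖f p.1‖ ^ 2) +
      2 * (K (gap p.1 p.2) * ‖f p.2‖ ^ 2)) ∂((surface d).prod (surface d)) := by
    refine integral_mono (hK.integrable_mul_continuous (by fun_prop))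
      ((h1.const_mul 2).add (h2.const_mul 2)) fun p => ?_
    have e1 := norm_sub_le (f p.1) (f p.2)
    have e2 : ‖f p.1 - f p.2‖ ^ 2 ≤ 2 * ‖f p.1‖ ^ 2 + 2 * ‖f p.2‖ ^ 2 := by
      nlinarith [norm_nonneg (f p.1 - f p.2), sq_nonneg (‖f p.1‖ - ‖f p.2‖)]
    have := mul_le_mul_of_nonneg_left e2 (hK.nonneg (gap p.1 p.2))
    simp only
    linarith
  rw [integral_add (h1.const_mul 2) (h2.const_mul 2), integral_const_mul, integral_const_mul,
    h4] at h5
  linarith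

theorem IsZonal.energy_mono {K K' : ℝ → ℝ} {C C' : ℝ} (hK : IsZonal d K C) (hK' : IsZonal d K' C')
    (h : ∀ w, K w ≤ K' w) {f : Sphere d → ℂ} (hf : Continuous f) :
    energy d K f ≤ energy d K' f :=
  integral_mono (hK.integrable_mul_continuous (by fun_prop))
    (hK'.integrable_mul_continuous (by fun_prop)) fun p =>
    mul_le_mul_of_nonneg_right (h _) (sq_nonneg _)

theorem IsZonal.add {K K' : ℝ → ℝ} {C C' : ℝ} (hK : IsZonal d K C) (hK' : IsZonal d K' C') :
    IsZonal d (fun w => K w + K' w) (C + C') := by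
  refine ⟨hK.measurable.add hK'.measurable, fun w => add_nonneg (hK.nonneg w) (hK'.nonneg w),
    add_nonneg hK.const_nonneg hK'.const_nonneg, fun θ => ?_⟩
  have e1 : ∀ w, ENNReal.ofReal (K w + K' w) = ENNReal.ofReal (K w) + ENNReal.ofReal (K' w) :=
    fun w => ENNReal.ofReal_add (hK.nonneg w) (hK'.nonneg w)
  have hm : Measurable fun θ' => ENNReal.ofReal (K' (gap θ θ')) :=
    (hK'.measurable.comp (continuous_gap_left θ).measurable).ennreal_ofReal
  simp only [e1]
  rw [lintegral_add_right _ hm, ENNReal.ofReal_add hK.const_nonneg hK'.const_nonneg]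
  exact add_le_add (hK.lintegral_le θ) (hK'.lintegral_le θ)

theorem IsZonal.const_mul {K : ℝ → ℝ} {C Q : ℝ} (hK : IsZonal d K C) (hQ : 0 ≤ Q) :
    IsZonal d (fun w => Q * K w) (Q * C) := by
  refine ⟨hK.measurable.const_mul Q, fun w => mul_nonneg hQ (hK.nonneg w),
    mul_nonneg hQ hK.const_nonneg, fun θ => ?_⟩
  have hm : Measurable fun θ' => ENNReal.ofReal (K (gap θ θ')) :=
    (hK.measurable.comp (continuous_gap_left θ).measurable).ennreal_ofReal
  simp only [ENNReal.ofReal_mul hQ]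
  rw [lintegral_const_mul _ hm]
  exact mul_le_mul_right (hK.lintegral_le θ) _

theorem IsZonal.energy_add {K K' : ℝ → ℝ} {C C' : ℝ} (hK : IsZonal d K C) (hK' : IsZonal d K' C')
    {f : Sphere d → ℂ} (hf : Continuous f) :
    energy d (fun w => K w + K' w) f = energy d K f + energy d K' f := by
  rw [energy, energy, energy, ← integral_add (hK.integrable_mul_continuous (by fun_prop))
    (hK'.integrable_mul_continuous (by fun_prop))]
  simp only [add_mul]

theorem energy_const_mul (K : ℝ → ℝ) (c : ℝ) (f : Sphere d → ℂ) :
    energy d (fun w => c * K w) f = c * energy d K f := by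
  rw [energy, energy, ← integral_const_mul]
  simp only [mul_assoc]

/-- The absolute remainder is a bounded zonal kernel, so its energy is at most `4M‖f‖²` and acts as
a lower-order term. -/
theorem IsKernel.isZonal_rem (h : IsKernel d s c₁ M k e) : IsZonal d (fun w => ‖e w‖) M :=
  ⟨h.measurable_e.norm, fun _ => norm_nonneg _, h.M_nonneg, fun θ => by
    simpa only [ofReal_norm] using h.rem θ⟩

theorem isZonal_indicator (d : ℕ) (a b : ℝ) :
    IsZonal d ((Icc a b).indicator 1) ((surface d).real univ) := by
  refine ⟨measurable_one.indicator measurableSet_Icc,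
    fun w => Set.indicator_nonneg (fun _ _ => zero_le_one) w, measureReal_nonneg, fun θ => ?_⟩
  calc _ ≤ ∫⁻ _, 1 ∂(surface d) := by
        refine lintegral_mono fun θ' => ?_
        rw [← ENNReal.ofReal_one]
        exact ENNReal.ofReal_le_ofReal (Set.indicator_le_self' (fun _ _ => zero_le_one) _)
    _ = _ := by
        rw [lintegral_one, measureReal_def, ENNReal.ofReal_toReal (measure_ne_top _ _)]

/-- The regularised energies converge to the dissipation. -/
theorem WeakScat.tendsto_energy (hk : IsKernel d s c₁ M k e) {f H : Sphere d → ℂ}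
    (h : WeakScat d k f H) {φ : Space d → ℂ} (hφ : ContDiff ℝ ∞ φ) (hφf : f = fun θ : Sphere d => φ θ) :
    Tendsto (fun ε => energy d ((Ici ε).indicator k) f) (𝓝[>] 0) (𝓝 (2 * dissip d f H)) := by
  have hfc : Continuous f := hφf ▸ continuous_restrict hφ.continuous
  have hfi : Integrable f (surface d) :=
    hfc.integrable_of_hasCompactSupport (HasCompactSupport.of_compactSpace _)
  have hψ : ContDiff ℝ ∞ fun x => conj (φ x) := Complex.conjCLE.contDiff.comp hφ
  have h1 := hk.tendsto_integral_scat (contDiff_infty.1 hψ 2) hfi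
  rw [h _ hψ] at h1
  have h2 := ((Complex.continuous_re.tendsto _).comp h1).const_mul (-2)
  have h3 : -2 * (∫ θ, H θ * conj (φ θ) ∂(surface d)).re = 2 * dissip d f H := by
    rw [dissip, hφf]; ring
  rw [h3] at h2
  refine h2.congr' ?_
  filter_upwards [self_mem_nhdsWithin] with ε hε
  obtain ⟨C, hC⟩ := hk.exists_isZonal hε
  have h4 := congrArg Complex.re (hC.integral_mul_zonalDiff_conj hfc)
  rw [Complex.neg_re, Complex.ofReal_re] at h4
  have h5 : (2 * ∫ θ, f θ * zonalDiff d ((Ici ε).indicator k) (fun θ => conj (f θ)) θ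
      ∂(surface d)).re = 2 * (∫ θ, f θ * zonalDiff d ((Ici ε).indicator k)
        (fun θ => conj (f θ)) θ ∂(surface d)).re := by simp
  rw [h5] at h4
  simp only [Function.comp_apply, scat]
  subst hφf
  linarith

theorem WeakScat.dissip_nonneg_of_smooth (hk : IsKernel d s c₁ M k e) {f H : Sphere d → ℂ}
    (h : WeakScat d k f H) {φ : Space d → ℂ} (hφ : ContDiff ℝ ∞ φ) (hφf : f = fun θ : Sphere d => φ θ) :
    0 ≤ dissip d f H := by
  have h1 : 0 ≤ 2 * dissip d f H := by
    refine ge_of_tendsto (h.tendsto_energy hk hφ hφf) ?_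
    filter_upwards [self_mem_nhdsWithin] with ε hε
    obtain ⟨C, hC⟩ := hk.exists_isZonal hε
    exact hC.energy_nonneg f
  linarith

/-- On the annulus the singular part of the kernel is at least `c₁(8μ²)^(-γ)`, so the indicator is
at most `Q(k + |e|)` with `Q = (8μ²)^γ/c₁`, a multiple of `μ^(2s+d-1)`. The term `|e|` compensates a
possibly negative remainder. Letting the truncation vanish replaces the energy of `k` by twice the
dissipation. -/
theorem IsKernel.exists_energy_annulus_le_of_smooth (hk : IsKernel d s c₁ M k e) :
    ∃ C : ℝ, 0 < C ∧ ∀ {f H : Sphere d → ℂ}, WeakScat d k f H → ∀ {φ : Space d → ℂ},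
      ContDiff ℝ ∞ φ → (f = fun θ : Sphere d => φ θ) → ∀ μ ∈ Ioc (0 : ℝ) 1,
      energy d ((Icc (μ ^ 2 / 8) (8 * μ ^ 2)).indicator 1) f ≤
        C * μ ^ (2 * s + ((d : ℝ) - 1)) * (dissip d f H + ∫ θ, ‖f θ‖ ^ 2 ∂(surface d)) := by
  have hc := hk.c_pos
  have hM := hk.M_nonneg
  set γ : ℝ := ((d : ℝ) - 1) / 2 + s with hγ
  have hγ0 : 0 < γ := by have := hk.dim_real; have := hk.s_pos; rw [hγ]; linarith
  refine ⟨8 ^ γ / c₁ * (2 + 4 * M), by positivity, fun {f H} h {φ} hφ hφf μ hμ => ?_⟩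
  have hfc : Continuous f := hφf ▸ continuous_restrict hφ.continuous
  have hμ2 : 0 < μ ^ 2 := pow_pos hμ.1 2
  set Q : ℝ := (8 * μ ^ 2) ^ γ / c₁ with hQ
  have hQ0 : 0 ≤ Q := by positivity
  have hX : 0 ≤ ∫ θ, ‖f θ‖ ^ 2 ∂(surface d) := integral_nonneg fun _ => sq_nonneg _
  have hD := h.dissip_nonneg_of_smooth hk hφ hφf
  have key : ∀ ε ∈ Ioo 0 (μ ^ 2 / 8), energy d ((Icc (μ ^ 2 / 8) (8 * μ ^ 2)).indicator 1) f ≤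
      Q * (energy d ((Ici ε).indicator k) f + 4 * M * ∫ θ, ‖f θ‖ ^ 2 ∂(surface d)) := by
    intro ε hε
    obtain ⟨C, hC⟩ := hk.exists_isZonal hε.1
    have hz := hC.add hk.isZonal_rem
    have hz' := hz.const_mul hQ0
    have h1 : energy d ((Icc (μ ^ 2 / 8) (8 * μ ^ 2)).indicator 1) f ≤
        energy d (fun w => Q * ((Ici ε).indicator k w + ‖e w‖)) f := by
      refine (isZonal_indicator d _ _).energy_mono hz' (fun w => ?_) hfc
      by_cases hw : w ∈ Icc (μ ^ 2 / 8) (8 * μ ^ 2)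
      · have hw0 : 0 < w := by linarith [hw.1]
        rw [indicator_of_mem hw, indicator_of_mem (show w ∈ Ici ε from (hε.2.le.trans hw.1)),
          Pi.one_apply, hk.eq w hw0]
        have e1 : c₁ * (8 * μ ^ 2) ^ (-γ) ≤ c₁ * w ^ (-γ) :=
          mul_le_mul_of_nonneg_left
            (Real.rpow_le_rpow_of_nonpos hw0 hw.2 (by linarith)) hc.le
        have e2 : Q * (c₁ * (8 * μ ^ 2) ^ (-γ)) = 1 := by
          rw [hQ, Real.rpow_neg (by positivity)]
          have : (8 * μ ^ 2) ^ γ ≠ 0 := by positivity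
          field_simp
        refine e2.symm.le.trans (mul_le_mul_of_nonneg_left ?_ hQ0)
        have := neg_abs_le (e w)
        rw [Real.norm_eq_abs]
        linarith
      · rw [indicator_of_notMem hw]
        exact hz'.nonneg w
    rw [energy_const_mul, hC.energy_add hk.isZonal_rem hfc] at h1
    refine h1.trans (mul_le_mul_of_nonneg_left ?_ hQ0)
    linarith [hk.isZonal_rem.energy_le hfc]
  have h2 : energy d ((Icc (μ ^ 2 / 8) (8 * μ ^ 2)).indicator 1) f ≤
      Q * (2 * dissip d f H + 4 * M * ∫ θ, ‖f θ‖ ^ 2 ∂(surface d)) := by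
    refine ge_of_tendsto (((h.tendsto_energy hk hφ hφf).add_const _).const_mul Q) ?_
    filter_upwards [Ioo_mem_nhdsGT (show 0 < μ ^ 2 / 8 by positivity)] with ε hε
    exact key ε hε
  have h3 : Q = 8 ^ γ / c₁ * μ ^ (2 * s + ((d : ℝ) - 1)) := by
    rw [hQ, Real.mul_rpow (by norm_num) hμ2.le, ← Real.rpow_natCast μ 2, ← Real.rpow_mul hμ.1.le,
      hγ]
    have : ((2 : ℕ) : ℝ) * (((d : ℝ) - 1) / 2 + s) = 2 * s + ((d : ℝ) - 1) := by push_cast; ring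
    rw [this]
    ring
  refine h2.trans ?_
  have h4 : 2 * dissip d f H + 4 * M * ∫ θ, ‖f θ‖ ^ 2 ∂(surface d) ≤
      (2 + 4 * M) * (dissip d f H + ∫ θ, ‖f θ‖ ^ 2 ∂(surface d)) := by
    nlinarith [mul_nonneg hM hD]
  calc _ ≤ Q * ((2 + 4 * M) * (dissip d f H + ∫ θ, ‖f θ‖ ^ 2 ∂(surface d))) :=
        mul_le_mul_of_nonneg_left h4 hQ0
    _ = _ := by rw [h3]; ring

/-- The commutator bound for the truncated kernels holds with a constant of order `L^(2s)`
independent of the truncation, thanks to `exists_lintegral_min_le`; the truncation is then removed.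
-/
theorem IsKernel.exists_commutator_le_of_smooth (hk : IsKernel d s c₁ M k e) :
    ∃ C : ℝ, 0 < C ∧ ∀ {f H : Sphere d → ℂ}, WeakScat d k f H → ∀ {φ : Space d → ℂ},
      ContDiff ℝ ∞ φ → (f = fun θ : Sphere d => φ θ) → ∀ {χ : Space d → ℝ}, ContDiff ℝ ∞ χ →
      ∀ L : ℝ, 1 ≤ L → (∀ θ θ' : Sphere d, (χ θ - χ θ') ^ 2 ≤ min 4 (2 * L ^ 2 * gap θ θ')) →
      ∀ l : ℝ, 0 < l → |(∫ θ, H θ * conj ((χ θ : ℂ) * f θ) ∂(surface d)).im| ≤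
        l * dissip d f H + C * L ^ (2 * s) / l * ∫ θ, ‖f θ‖ ^ 2 ∂(surface d) := by
  obtain ⟨C, hC0, hC⟩ := hk.exists_lintegral_min_le
  refine ⟨C, hC0, fun {f H} h {φ} hφ hφf {χ} hχ L hL hχL l hl => ?_⟩
  have hfc : Continuous f := hφf ▸ continuous_restrict hφ.continuous
  have hfi : Integrable f (surface d) :=
    hfc.integrable_of_hasCompactSupport (HasCompactSupport.of_compactSpace _)
  have hχc : Continuous fun θ : Sphere d => χ θ := hχ.continuous.comp continuous_subtype_val
  have hψ : ContDiff ℝ ∞ fun x => conj ((χ x : ℂ) * φ x) :=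
    Complex.conjCLE.contDiff.comp ((Complex.ofRealCLM.contDiff.comp hχ).mul hφ)
  have h1 := hk.tendsto_integral_scat (contDiff_infty.1 hψ 2) hfi
  rw [h _ hψ] at h1
  have h2 := ((Complex.continuous_im.tendsto _).comp h1).abs
  have h3 : (∫ θ, H θ * conj ((χ θ : ℂ) * φ θ) ∂(surface d)).im =
      (∫ θ, H θ * conj ((χ θ : ℂ) * f θ) ∂(surface d)).im := by rw [hφf]
  rw [h3] at h2
  have h4 := ((h.tendsto_energy hk hφ hφf).const_mul (l / 2)).add_const
    (C * L ^ (2 * s) / l * ∫ θ, ‖f θ‖ ^ 2 ∂(surface d))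
  have h5 : l / 2 * (2 * dissip d f H) = l * dissip d f H := by ring
  rw [h5] at h4
  refine le_of_tendsto_of_tendsto h2 h4 ?_
  filter_upwards [self_mem_nhdsWithin] with ε hε
  obtain ⟨C', hC'⟩ := hk.exists_isZonal hε
  have hfe : ∀ θ : Sphere d, φ θ = f θ := fun θ => (congrFun hφf θ).symm
  simp only [Function.comp_apply, scat, hfe]
  refine hC'.abs_im_integral_mul_zonalDiff_le hfc hχc (fun θ => ?_) hl
  have hnn : ∀ θ' : Sphere d, 0 ≤ (Ici ε).indicator k (gap θ θ') * (χ θ - χ θ') ^ 2 :=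
    fun θ' => mul_nonneg (hC'.nonneg _) (sq_nonneg _)
  have hm : AEStronglyMeasurable (fun θ' : Sphere d =>
      (Ici ε).indicator k (gap θ θ') * (χ θ - χ θ') ^ 2) (surface d) :=
    (hC'.integrable θ).aestronglyMeasurable.mul
      (by fun_prop : Continuous fun θ' : Sphere d => (χ θ - χ θ') ^ 2).aestronglyMeasurable
  rw [integral_eq_lintegral_of_nonneg_ae (ae_of_all _ hnn) hm]
  refine ENNReal.toReal_le_of_le_ofReal (by positivity) ((lintegral_mono fun θ' => ?_).trans
    (hC L hL θ))
  refine ENNReal.ofReal_le_ofReal ?_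
  rw [mul_comm]
  have e1 : (Ici ε).indicator k (gap θ θ') ≤ k (gap θ θ') :=
    Set.indicator_le_self' (fun w _ => hk.nonneg w) _
  exact mul_le_mul (hχL θ θ') e1 (hC'.nonneg _) ((sq_nonneg _).trans (hχL θ θ'))

end

end

/-! ### Extension of the bounds to square-integrable weak solutions -/

section

open scoped ENNReal ComplexConjugate

section

variable {d : ℕ} {s c₁ M : ℝ} {k e : ℝ → ℝ}

/-- Square-integrable weak solutions are limits of smooth ones. -/
structure SmoothApprox (d : ℕ) (k : ℝ → ℝ) (f H : Sphere d → ℂ) (F G : ℕ → Sphere d → ℂ) :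
    Prop where
  memLp_f : MemLp f 2 (surface d)
  memLp_H : MemLp H 2 (surface d)
  weak : ∀ n, WeakScat d k (F n) (G n)
  smooth : ∀ n, ∃ φ : Space d → ℂ, ContDiff ℝ ∞ φ ∧ F n = fun θ : Sphere d => φ θ
  memLp_F : ∀ n, MemLp (F n) 2 (surface d)
  memLp_G : ∀ n, MemLp (G n) 2 (surface d)
  tendsto_F : Tendsto (fun n => eLpNorm (F n - f) 2 (surface d)) atTop (𝓝 0)
  tendsto_G : Tendsto (fun n => eLpNorm (G n - H) 2 (surface d)) atTop (𝓝 0)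

theorem memLp_mol (n : ℕ) {f : Sphere d → ℂ} (hf : MemLp f 2 (surface d)) :
    MemLp (mol d n f) 2 (surface d) :=
  ⟨(continuous_mol n (hf.integrable one_le_two)).aestronglyMeasurable,
    (eLpNorm_two_mol_le n hf.1).trans_lt hf.2⟩

theorem tendsto_eLpNorm_two_mol {f : Sphere d → ℂ} (hf : MemLp f 2 (surface d)) :
    Tendsto (fun n => eLpNorm (mol d n f - f) 2 (surface d)) atTop (𝓝 0) :=
  tendsto_eLpNorm_mol one_le_two (by simp) (fun n _ hg => eLpNorm_two_mol_le n hg) hf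

theorem WeakScat.smoothApprox (hk : IsKernel d s c₁ M k e) {f H : Sphere d → ℂ}
    (h : WeakScat d k f H) (hf : MemLp f 2 (surface d)) (hH : MemLp H 2 (surface d)) :
    SmoothApprox d k f H (fun n => RadiativeTransfer.mol d n f)
      (fun n => RadiativeTransfer.mol d n H) where
  memLp_f := hf
  memLp_H := hH
  weak n := h.mol hk (hf.integrable one_le_two) (hH.integrable one_le_two) n
  smooth n := exists_contDiff_mol n (hf.integrable one_le_two)
  memLp_F n := memLp_mol n hf
  memLp_G n := memLp_mol n hH
  tendsto_F := tendsto_eLpNorm_two_mol hf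
  tendsto_G := tendsto_eLpNorm_two_mol hH

namespace SmoothApprox

variable {f H : Sphere d → ℂ} {F G : ℕ → Sphere d → ℂ}

theorem tendsto_dissip (h : SmoothApprox d k f H F G) :
    Tendsto (fun n => dissip d (F n) (G n)) atTop (𝓝 (dissip d f H)) :=
  ((Complex.continuous_re.tendsto _).comp (tendsto_integral_conj_mul h.memLp_f h.memLp_H h.memLp_F
    h.memLp_G h.tendsto_F h.tendsto_G)).neg

theorem integral_norm_sq {α : Type*} [MeasurableSpace α] {μ : Measure α} (g : α → ℂ) :
    (∫ x, g x * conj (g x) ∂μ).re = ∫ x, ‖g x‖ ^ 2 ∂μ := by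
  have : ∀ x, g x * conj (g x) = ((‖g x‖ ^ 2 : ℝ) : ℂ) := fun x => by
    rw [Complex.mul_conj, Complex.normSq_eq_norm_sq]
  simp only [this]
  rw [integral_complex_ofReal, Complex.ofReal_re]

theorem tendsto_norm_sq (h : SmoothApprox d k f H F G) :
    Tendsto (fun n => ∫ θ, ‖F n θ‖ ^ 2 ∂(surface d)) atTop (𝓝 (∫ θ, ‖f θ‖ ^ 2 ∂(surface d))) := by
  have := (Complex.continuous_re.tendsto _).comp (tendsto_integral_conj_mul h.memLp_f h.memLp_f
    h.memLp_F h.memLp_F h.tendsto_F h.tendsto_F)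
  rw [integral_norm_sq] at this
  exact this.congr fun n => integral_norm_sq _

theorem tendsto_mul (h : SmoothApprox d k f H F G) {χ : Sphere d → ℝ} (hχ : Continuous χ) :
    Tendsto (fun n => ∫ θ, G n θ * conj ((χ θ : ℂ) * F n θ) ∂(surface d)) atTop
      (𝓝 (∫ θ, H θ * conj ((χ θ : ℂ) * f θ) ∂(surface d))) := by
  have hχc : Continuous fun θ => (χ θ : ℂ) := by fun_prop
  obtain ⟨B, hB⟩ := isCompact_univ.exists_bound_of_continuousOn hχc.continuousOn
  have hb : ∀ {g : Sphere d → ℂ}, MemLp g 2 (surface d) →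
      MemLp (fun θ => (χ θ : ℂ) * g θ) 2 (surface d) := fun hg =>
    hg.mul (MemLp.of_bound hχc.aestronglyMeasurable B (ae_of_all _ fun θ => hB θ (mem_univ _)) :
      MemLp _ ⊤ (surface d))
  refine tendsto_integral_conj_mul (hb h.memLp_f) h.memLp_H (fun n => hb (h.memLp_F n)) h.memLp_G
    ?_ h.tendsto_G
  have h0 := ENNReal.Tendsto.const_mul h.tendsto_F (a := ENNReal.ofReal B)
    (Or.inr ENNReal.ofReal_ne_top)
  rw [mul_zero] at h0
  refine tendsto_of_tendsto_of_tendsto_of_le_of_le tendsto_const_nhds h0 (fun _ => zero_le) fun n => ?_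
  refine eLpNorm_le_mul_eLpNorm_of_ae_le_mul (ae_of_all _ fun θ => ?_) 2
  rw [Pi.sub_apply, Pi.sub_apply, ← mul_sub, norm_mul]
  exact mul_le_mul_of_nonneg_right (hB θ (mem_univ _)) (norm_nonneg _)

theorem memLp_diff {f : Sphere d → ℂ} (hf : MemLp f 2 (surface d)) :
    MemLp (fun p : Sphere d × Sphere d => f p.1 - f p.2) 2 ((surface d).prod (surface d)) :=
  (hf.comp_fst (surface d)).sub (hf.comp_snd (surface d))

theorem eLpNorm_comp_fst_le {g : Sphere d → ℂ} (hg : MemLp g 2 (surface d)) :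
    eLpNorm (fun p : Sphere d × Sphere d => g p.1) 2 ((surface d).prod (surface d)) =
      surface d univ ^ (1 / (2 : ℝ≥0∞)).toReal * eLpNorm g 2 (surface d) := by
  have h1 := eLpNorm_map_measure (μ := (surface d).prod (surface d)) (f := Prod.fst) (g := g)
    (p := 2) (by
      rw [Measure.map_fst_prod]
      exact hg.1.smul_measure _) measurable_fst.aemeasurable
  rw [Measure.map_fst_prod, eLpNorm_smul_measure_of_ne_top (by simp), smul_eq_mul] at h1
  exact h1.symm

theorem eLpNorm_comp_snd_le {g : Sphere d → ℂ} (hg : MemLp g 2 (surface d)) :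
    eLpNorm (fun p : Sphere d × Sphere d => g p.2) 2 ((surface d).prod (surface d)) =
      surface d univ ^ (1 / (2 : ℝ≥0∞)).toReal * eLpNorm g 2 (surface d) := by
  have h1 := eLpNorm_map_measure (μ := (surface d).prod (surface d)) (f := Prod.snd) (g := g)
    (p := 2) (by
      rw [Measure.map_snd_prod]
      exact hg.1.smul_measure _) measurable_snd.aemeasurable
  rw [Measure.map_snd_prod, eLpNorm_smul_measure_of_ne_top (by simp), smul_eq_mul] at h1
  exact h1.symm

theorem tendsto_eLpNorm_diff (h : SmoothApprox d k f H F G) :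
    Tendsto (fun n => eLpNorm ((fun p : Sphere d × Sphere d => F n p.1 - F n p.2) -
      fun p => f p.1 - f p.2) 2 ((surface d).prod (surface d))) atTop (𝓝 0) := by
  set c := surface d univ ^ (1 / (2 : ℝ≥0∞)).toReal with hc
  have hct : c ≠ ⊤ := ENNReal.rpow_ne_top_of_nonneg ENNReal.toReal_nonneg (measure_ne_top _ _)
  have h0 := ENNReal.Tendsto.const_mul h.tendsto_F (a := c) (Or.inr hct)
  have h1 := h0.add h0
  rw [mul_zero, add_zero] at h1
  refine tendsto_of_tendsto_of_tendsto_of_le_of_le tendsto_const_nhds h1 (fun _ => zero_le) fun n => ?_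
  have hs := (h.memLp_F n).sub h.memLp_f
  have e : ((fun p : Sphere d × Sphere d => F n p.1 - F n p.2) - fun p => f p.1 - f p.2) =
      (fun p => (F n - f) p.1) - fun p => (F n - f) p.2 := by
    ext p; simp only [Pi.sub_apply]; ring
  simp only
  rw [e, ← eLpNorm_comp_fst_le hs]
  refine (eLpNorm_sub_le (hs.comp_fst _).1 (hs.comp_snd _).1 one_le_two).trans ?_
  rw [eLpNorm_comp_snd_le hs, eLpNorm_comp_fst_le hs]

/-- For a bounded kernel the energy is a continuous quadratic form on `L²`. The annulus indicators
qualify, while the singular kernel does not; this is why the smoothing estimate is expressed through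
annuli. -/
theorem tendsto_energy (h : SmoothApprox d k f H F G) {K : ℝ → ℝ} (hK : Measurable K)
    (hK1 : ∀ w, |K w| ≤ 1) : Tendsto (fun n => energy d K (F n)) atTop (𝓝 (energy d K f)) := by
  have hm : AEStronglyMeasurable (fun p : Sphere d × Sphere d => (K (gap p.1 p.2) : ℂ))
      ((surface d).prod (surface d)) :=
    (Complex.measurable_ofReal.comp (hK.comp continuous_gap.measurable)).aestronglyMeasurable
  have hKb : MemLp (fun p : Sphere d × Sphere d => (K (gap p.1 p.2) : ℂ)) ⊤
      ((surface d).prod (surface d)) := MemLp.of_bound hm 1 (ae_of_all _ fun p => by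
        rw [Complex.norm_real]; exact hK1 _)
  have h1 : ∀ {g : Sphere d × Sphere d → ℂ}, MemLp g 2 ((surface d).prod (surface d)) →
      MemLp (fun p => (K (gap p.1 p.2) : ℂ) * g p) 2 ((surface d).prod (surface d)) :=
    fun hg => hg.mul hKb
  have h2 := tendsto_integral_conj_mul (h1 (memLp_diff h.memLp_f)) (memLp_diff h.memLp_f)
    (fun n => h1 (memLp_diff (h.memLp_F n))) (fun n => memLp_diff (h.memLp_F n)) ?_
    h.tendsto_eLpNorm_diff
  · have e : ∀ g : Sphere d → ℂ, (∫ p : Sphere d × Sphere d, (g p.1 - g p.2) *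
        conj ((K (gap p.1 p.2) : ℂ) * (g p.1 - g p.2)) ∂((surface d).prod (surface d))).re =
        energy d K g := by
      intro g
      have : ∀ p : Sphere d × Sphere d, (g p.1 - g p.2) *
          conj ((K (gap p.1 p.2) : ℂ) * (g p.1 - g p.2)) =
          ((K (gap p.1 p.2) * ‖g p.1 - g p.2‖ ^ 2 : ℝ) : ℂ) := fun p => by
        rw [map_mul, Complex.conj_ofReal, mul_left_comm, Complex.mul_conj,
          Complex.normSq_eq_norm_sq, ← Complex.ofReal_mul]
      simp only [this]
      rw [integral_complex_ofReal, Complex.ofReal_re, energy]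
    have h3 := (Complex.continuous_re.tendsto _).comp h2
    rw [e] at h3
    exact h3.congr fun n => e _
  · refine tendsto_of_tendsto_of_tendsto_of_le_of_le tendsto_const_nhds h.tendsto_eLpNorm_diff
      (fun _ => zero_le) fun n => ?_
    refine eLpNorm_mono fun p => ?_
    simp only [Pi.sub_apply]
    rw [← mul_sub, norm_mul, Complex.norm_real]
    exact mul_le_of_le_one_left (norm_nonneg _) (hK1 _)

end SmoothApprox

theorem WeakScat.dissip_nonneg (hk : IsKernel d s c₁ M k e) {f H : Sphere d → ℂ}
    (h : WeakScat d k f H) (hf : MemLp f 2 (surface d)) (hH : MemLp H 2 (surface d)) :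
    0 ≤ dissip d f H := by
  have ha := h.smoothApprox hk hf hH
  refine ge_of_tendsto' ha.tendsto_dissip fun n => ?_
  obtain ⟨φ, hφ, e⟩ := ha.smooth n
  exact (ha.weak n).dissip_nonneg_of_smooth hk hφ e

theorem abs_indicator_one_le (A : Set ℝ) (w : ℝ) : |A.indicator (1 : ℝ → ℝ) w| ≤ 1 := by
  by_cases h : w ∈ A <;> simp [h]

theorem IsKernel.exists_energy_annulus_le (hk : IsKernel d s c₁ M k e) :
    ∃ C : ℝ, 0 < C ∧ ∀ {f H : Sphere d → ℂ}, WeakScat d k f H → MemLp f 2 (surface d) →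
      MemLp H 2 (surface d) → ∀ μ ∈ Ioc (0 : ℝ) 1,
      energy d ((Icc (μ ^ 2 / 8) (8 * μ ^ 2)).indicator 1) f ≤
        C * μ ^ (2 * s + ((d : ℝ) - 1)) * (dissip d f H + ∫ θ, ‖f θ‖ ^ 2 ∂(surface d)) := by
  obtain ⟨C, hC0, hC⟩ := hk.exists_energy_annulus_le_of_smooth
  refine ⟨C, hC0, fun {f H} h hf hH μ hμ => ?_⟩
  have ha := h.smoothApprox hk hf hH
  refine le_of_tendsto_of_tendsto' (ha.tendsto_energy (measurable_one.indicator measurableSet_Icc)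
    (abs_indicator_one_le _)) ((ha.tendsto_dissip.add ha.tendsto_norm_sq).const_mul _) fun n => ?_
  obtain ⟨φ, hφ, e⟩ := ha.smooth n
  exact hC (ha.weak n) hφ e μ hμ

theorem IsKernel.exists_commutator_le (hk : IsKernel d s c₁ M k e) :
    ∃ C : ℝ, 0 < C ∧ ∀ {f H : Sphere d → ℂ}, WeakScat d k f H → MemLp f 2 (surface d) →
      MemLp H 2 (surface d) → ∀ {χ : Space d → ℝ}, ContDiff ℝ ∞ χ →
      ∀ L : ℝ, 1 ≤ L → (∀ θ θ' : Sphere d, (χ θ - χ θ') ^ 2 ≤ min 4 (2 * L ^ 2 * gap θ θ')) →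
      ∀ l : ℝ, 0 < l → |(∫ θ, H θ * conj ((χ θ : ℂ) * f θ) ∂(surface d)).im| ≤
        l * dissip d f H + C * L ^ (2 * s) / l * ∫ θ, ‖f θ‖ ^ 2 ∂(surface d) := by
  obtain ⟨C, hC0, hC⟩ := hk.exists_commutator_le_of_smooth
  refine ⟨C, hC0, fun {f H} h hf hH χ hχ L hL hχL l hl => ?_⟩
  have ha := h.smoothApprox hk hf hH
  refine le_of_tendsto_of_tendsto'
    (((Complex.continuous_im.tendsto _).comp (ha.tendsto_mul (χ := fun θ => χ θ)
      (hχ.continuous.comp continuous_subtype_val))).abs)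
    ((ha.tendsto_dissip.const_mul l).add (ha.tendsto_norm_sq.const_mul _)) fun n => ?_
  obtain ⟨φ, hφ, e⟩ := ha.smooth n
  exact hC (ha.weak n) hφ e hχ L hL hχL l hl

end

end

/-! ### Nash inequality and mass off an exceptional set -/

section

open scoped ENNReal ComplexConjugate

section

variable {d : ℕ}

/-- The annulus of radius comparable to `μ`. -/
noncomputable def annulus (μ w : ℝ) : ℝ := (Icc (μ ^ 2 / 8) (8 * μ ^ 2)).indicator 1 w

theorem measurable_annulus (μ : ℝ) : Measurable (annulus μ) :=
  measurable_one.indicator measurableSet_Icc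

theorem annulus_nonneg (μ w : ℝ) : 0 ≤ annulus μ w :=
  Set.indicator_nonneg (fun _ _ => zero_le_one) w

theorem annulus_le_one (μ w : ℝ) : annulus μ w ≤ 1 :=
  Set.indicator_le_self' (fun _ _ => zero_le_one) w

theorem measurable_annulus_gap (μ : ℝ) :
    Measurable fun p : Sphere d × Sphere d => annulus μ (gap p.1 p.2) :=
  (measurable_annulus μ).comp continuous_gap.measurable

theorem sq_rpow_half {μ : ℝ} (hμ : 0 < μ) (a : ℝ) : (μ ^ 2) ^ (a / 2) = μ ^ a := by
  rw [← Real.rpow_natCast μ 2, ← Real.rpow_mul hμ.le]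
  congr 1
  push_cast
  ring

theorem exists_integral_annulus_bounds (hd : 3 ≤ d) : ∃ c C : ℝ, 0 < c ∧ 0 < C ∧
    ∀ μ ∈ Ioc (0 : ℝ) 1, ∀ θ : Sphere d,
      c * μ ^ ((d : ℝ) - 1) ≤ ∫ θ', annulus μ (gap θ θ') ∂(surface d) ∧
      ∫ θ', annulus μ (gap θ θ') ∂(surface d) ≤ C * μ ^ ((d : ℝ) - 1) := by
  obtain ⟨c, hc0, hc⟩ := exists_le_surface_annulus hd
  obtain ⟨C, hC0, hC⟩ := exists_surface_cap_le hd
  refine ⟨c, C * 16 ^ (((d : ℝ) - 1) / 2), hc0, by positivity, fun μ hμ θ => ?_⟩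
  have hμ2 : 0 < μ ^ 2 := pow_pos hμ.1 2
  have hms : MeasurableSet {θ' : Sphere d | gap θ θ' ∈ Icc (μ ^ 2 / 8) (8 * μ ^ 2)} :=
    (continuous_gap_left θ).measurable measurableSet_Icc
  have h0 : ∫ θ', annulus μ (gap θ θ') ∂(surface d) =
      (surface d).real {θ' : Sphere d | gap θ θ' ∈ Icc (μ ^ 2 / 8) (8 * μ ^ 2)} := by
    rw [← integral_indicator_one hms]
    rfl
  rw [h0]
  constructor
  · have h1 := hc (μ ^ 2) hμ2 (pow_le_one₀ hμ.1.le hμ.2) θ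
    rw [sq_rpow_half hμ.1] at h1
    rw [measureReal_def, ← ENNReal.ofReal_le_iff_le_toReal (measure_ne_top _ _)]
    refine h1.trans (measure_mono fun θ' h => ⟨?_, ?_⟩)
    · have := h.1; linarith
    · have := h.2; linarith
  · have h1 := hC (16 * μ ^ 2) (by positivity) θ
    rw [Real.mul_rpow (by norm_num) hμ2.le, sq_rpow_half hμ.1, ← mul_assoc] at h1
    rw [measureReal_def]
    refine ENNReal.toReal_le_of_le_ofReal (mul_nonneg (by positivity) (Real.rpow_nonneg hμ.1.le _))
      ((measure_mono fun θ' h => ?_).trans h1)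
    have := h.2
    show gap θ θ' < 16 * μ ^ 2
    linarith

theorem integrable_mul_sq_fst {f : Sphere d → ℂ} (hf : MemLp f 2 (surface d))
    {q : Sphere d × Sphere d → ℝ} (hq : Measurable q) (hq1 : ∀ p, |q p| ≤ 1) :
    Integrable (fun p => q p * ‖f p.1‖ ^ 2) ((surface d).prod (surface d)) :=
  ((hf.comp_fst (surface d)).integrable_norm_pow two_ne_zero).bdd_mul hq.aestronglyMeasurable
    (ae_of_all _ hq1)

theorem integrable_mul_sq_snd {f : Sphere d → ℂ} (hf : MemLp f 2 (surface d))
    {q : Sphere d × Sphere d → ℝ} (hq : Measurable q) (hq1 : ∀ p, |q p| ≤ 1) :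
    Integrable (fun p => q p * ‖f p.2‖ ^ 2) ((surface d).prod (surface d)) :=
  ((hf.comp_snd (surface d)).integrable_norm_pow two_ne_zero).bdd_mul hq.aestronglyMeasurable
    (ae_of_all _ hq1)

theorem integrable_mul_sq_diff {f : Sphere d → ℂ} (hf : MemLp f 2 (surface d))
    {q : Sphere d × Sphere d → ℝ} (hq : Measurable q) (hq1 : ∀ p, |q p| ≤ 1) :
    Integrable (fun p => q p * ‖f p.1 - f p.2‖ ^ 2) ((surface d).prod (surface d)) :=
  ((SmoothApprox.memLp_diff hf).integrable_norm_pow two_ne_zero).bdd_mul hq.aestronglyMeasurable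
    (ae_of_all _ hq1)

theorem abs_annulus_le_one (μ w : ℝ) : |annulus μ w| ≤ 1 := abs_indicator_one_le _ _

/-- A Nash-type inequality on the sphere. -/
theorem exists_nash (hd : 3 ≤ d) : ∃ c : ℝ, 0 < c ∧ ∀ {f : Sphere d → ℂ},
    MemLp f 2 (surface d) → ∀ μ ∈ Ioc (0 : ℝ) 1,
      c * μ ^ ((d : ℝ) - 1) * ∫ θ, ‖f θ‖ ^ 2 ∂(surface d) ≤
        energy d (annulus μ) f / 2 + (∫ θ, ‖f θ‖ ∂(surface d)) ^ 2 := by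
  obtain ⟨c, C, hc0, hC0, h⟩ := exists_integral_annulus_bounds hd
  refine ⟨c, hc0, fun {f} hf μ hμ => ?_⟩
  have hq := measurable_annulus_gap (d := d) μ
  have hq1 : ∀ p : Sphere d × Sphere d, |annulus μ (gap p.1 p.2)| ≤ 1 :=
    fun p => abs_annulus_le_one _ _
  have i1 := integrable_mul_sq_fst hf hq hq1
  have i2 := integrable_mul_sq_snd hf hq hq1
  have i3 := integrable_mul_sq_diff hf hq hq1
  have hfi := hf.integrable one_le_two
  have i4 : Integrable (fun p : Sphere d × Sphere d => ‖f p.1‖ * ‖f p.2‖)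
      ((surface d).prod (surface d)) := hfi.norm.mul_prod hfi.norm
  have e1 : c * μ ^ ((d : ℝ) - 1) * ∫ θ, ‖f θ‖ ^ 2 ∂(surface d) ≤
      ∫ p : Sphere d × Sphere d, annulus μ (gap p.1 p.2) * ‖f p.1‖ ^ 2
        ∂((surface d).prod (surface d)) := by
    rw [integral_prod _ i1, ← integral_const_mul]
    refine integral_mono ((hf.integrable_norm_pow two_ne_zero).const_mul _) i1.integral_prod_left
      fun θ => ?_
    simp only
    rw [integral_mul_const]
    exact mul_le_mul_of_nonneg_right (h μ hμ θ).1 (sq_nonneg _)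
  have e2 : ∫ p : Sphere d × Sphere d, annulus μ (gap p.1 p.2) * ‖f p.2‖ ^ 2
        ∂((surface d).prod (surface d)) = ∫ p : Sphere d × Sphere d,
          annulus μ (gap p.1 p.2) * ‖f p.1‖ ^ 2 ∂((surface d).prod (surface d)) := by
    rw [← integral_prod_swap]
    simp only [Prod.fst_swap, Prod.snd_swap, gap_comm]
  have e3 : ∫ p : Sphere d × Sphere d, (annulus μ (gap p.1 p.2) * ‖f p.1‖ ^ 2 +
      annulus μ (gap p.1 p.2) * ‖f p.2‖ ^ 2) ∂((surface d).prod (surface d)) ≤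
      ∫ p : Sphere d × Sphere d, (annulus μ (gap p.1 p.2) * ‖f p.1 - f p.2‖ ^ 2 +
        2 * (‖f p.1‖ * ‖f p.2‖)) ∂((surface d).prod (surface d)) := by
    refine integral_mono (i1.add i2) (i3.add (i4.const_mul 2)) fun p => ?_
    have a0 := annulus_nonneg μ (gap p.1 p.2)
    have a1 := annulus_le_one μ (gap p.1 p.2)
    -- Expanding this square bounds `|f|² + |f'|²` by `|f - f'|² + 2|f||f'|`. Since the weight is at
    -- most `1`, the product term integrates to at most the square of the `L¹` norm.
    have a2 : (‖f p.1‖ - ‖f p.2‖) ^ 2 ≤ ‖f p.1 - f p.2‖ ^ 2 :=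
      sq_le_sq' (by linarith [norm_sub_norm_le (f p.2) (f p.1), norm_sub_rev (f p.1) (f p.2)])
        (norm_sub_norm_le _ _)
    have a3 := mul_le_mul_of_nonneg_left a2 a0
    have a4 := mul_le_mul_of_nonneg_right a1
      (mul_nonneg (norm_nonneg (f p.1)) (norm_nonneg (f p.2)))
    simp only
    nlinarith
  rw [integral_add i1 i2, e2, integral_add i3 (i4.const_mul 2), integral_const_mul,
    integral_prod_mul (fun θ => ‖f θ‖) (fun θ => ‖f θ‖)] at e3
  rw [energy]
  linarith [sq (∫ θ, ‖f θ‖ ∂(surface d))]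

/-- If a fixed proportion of every annulus lies off `Z`, the mass on `Z` is controlled by the mass
off `Z` and the energy. -/
theorem exists_integral_le_off (hd : 3 ≤ d) {c : ℝ} (hc : 0 < c) : ∃ C : ℝ, 0 < C ∧
    ∀ {f : Sphere d → ℂ}, MemLp f 2 (surface d) → ∀ μ ∈ Ioc (0 : ℝ) 1, ∀ Z : Set (Sphere d),
      MeasurableSet Z → (∀ θ, c * μ ^ ((d : ℝ) - 1) ≤
        ∫ θ', annulus μ (gap θ θ') * Zᶜ.indicator 1 θ' ∂(surface d)) →
      ∫ θ, ‖f θ‖ ^ 2 ∂(surface d) ≤ C * (∫ θ in Zᶜ, ‖f θ‖ ^ 2 ∂(surface d)) +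
        C * μ ^ (-((d : ℝ) - 1)) * energy d (annulus μ) f := by
  obtain ⟨c', C, -, hC0, h⟩ := exists_integral_annulus_bounds hd
  refine ⟨2 * C / c + 2 / c, by positivity, fun {f} hf μ hμ Z hZ hc' => ?_⟩
  have hμd : 0 < μ ^ ((d : ℝ) - 1) := Real.rpow_pos_of_pos hμ.1 _
  -- The weight keeps pairs whose second point lies off `Z`. The value at the first point is
  -- compared with the value at the second at the price of the energy.
  set q : Sphere d × Sphere d → ℝ := fun p => annulus μ (gap p.1 p.2) * Zᶜ.indicator 1 p.2 with hqd
  have hq : Measurable q := (measurable_annulus_gap μ).mul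
    ((measurable_one.indicator hZ.compl).comp measurable_snd)
  have hz0 : ∀ θ, 0 ≤ Zᶜ.indicator (1 : Sphere d → ℝ) θ :=
    fun θ => Set.indicator_nonneg (fun _ _ => zero_le_one) θ
  have hz1 : ∀ θ, Zᶜ.indicator (1 : Sphere d → ℝ) θ ≤ 1 :=
    fun θ => Set.indicator_le_self' (fun _ _ => zero_le_one) θ
  have hq1 : ∀ p, |q p| ≤ 1 := fun p => by
    rw [abs_of_nonneg (mul_nonneg (annulus_nonneg _ _) (hz0 _))]
    exact mul_le_one₀ (annulus_le_one _ _) (hz0 _) (hz1 _)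
  have i1 := integrable_mul_sq_fst hf hq hq1
  have i2 := integrable_mul_sq_snd hf hq hq1
  have i3 := integrable_mul_sq_diff hf (measurable_annulus_gap μ) fun p => abs_annulus_le_one _ _
  have hf2 := hf.integrable_norm_pow two_ne_zero
  have e1 : c * μ ^ ((d : ℝ) - 1) * ∫ θ, ‖f θ‖ ^ 2 ∂(surface d) ≤
      ∫ p, q p * ‖f p.1‖ ^ 2 ∂((surface d).prod (surface d)) := by
    rw [integral_prod _ i1, ← integral_const_mul]
    refine integral_mono (hf2.const_mul _) i1.integral_prod_left fun θ => ?_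
    simp only
    rw [integral_mul_const]
    exact mul_le_mul_of_nonneg_right (hc' θ) (sq_nonneg _)
  have e2 : ∫ p, q p * ‖f p.1‖ ^ 2 ∂((surface d).prod (surface d)) ≤
      ∫ p, (2 * (annulus μ (gap p.1 p.2) * ‖f p.1 - f p.2‖ ^ 2) + 2 * (q p * ‖f p.2‖ ^ 2))
        ∂((surface d).prod (surface d)) := by
    refine integral_mono i1 ((i3.const_mul 2).add (i2.const_mul 2)) fun p => ?_
    have b1 : ‖f p.1‖ ^ 2 ≤ 2 * ‖f p.1 - f p.2‖ ^ 2 + 2 * ‖f p.2‖ ^ 2 := by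
      have := norm_sub_norm_le (f p.1) (f p.2)
      nlinarith [norm_nonneg (f p.1), norm_nonneg (f p.2), norm_nonneg (f p.1 - f p.2),
        sq_nonneg (‖f p.1 - f p.2‖ - ‖f p.2‖)]
    have b2 : 0 ≤ q p := mul_nonneg (annulus_nonneg _ _) (hz0 _)
    have b3 : q p ≤ annulus μ (gap p.1 p.2) :=
      mul_le_of_le_one_right (annulus_nonneg _ _) (hz1 _)
    have b4 := mul_le_mul_of_nonneg_left b1 b2
    have b5 := mul_le_mul_of_nonneg_right b3 (sq_nonneg ‖f p.1 - f p.2‖)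
    simp only
    linarith
  have e3 : ∫ p, q p * ‖f p.2‖ ^ 2 ∂((surface d).prod (surface d)) ≤
      C * μ ^ ((d : ℝ) - 1) * ∫ θ in Zᶜ, ‖f θ‖ ^ 2 ∂(surface d) := by
    rw [integral_prod_symm _ i2, ← integral_const_mul, ← integral_indicator hZ.compl]
    refine integral_mono i2.integral_prod_right ((hf2.const_mul _).indicator hZ.compl) fun θ => ?_
    simp only [hqd]
    by_cases hθ : θ ∈ Zᶜ
    · rw [indicator_of_mem hθ, indicator_of_mem hθ, Pi.one_apply]
      simp only [mul_one]
      rw [integral_mul_const]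
      refine mul_le_mul_of_nonneg_right ?_ (sq_nonneg _)
      simp only [gap_comm _ θ]
      exact (h μ hμ θ).2
    · rw [indicator_of_notMem hθ, indicator_of_notMem hθ]
      simp
  rw [integral_add (i3.const_mul 2) (i2.const_mul 2), integral_const_mul, integral_const_mul] at e2
  have e4 : c * μ ^ ((d : ℝ) - 1) * ∫ θ, ‖f θ‖ ^ 2 ∂(surface d) ≤
      2 * energy d (annulus μ) f + 2 * (C * μ ^ ((d : ℝ) - 1) *
        ∫ θ in Zᶜ, ‖f θ‖ ^ 2 ∂(surface d)) := by
    rw [energy]; linarith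
  have hE : 0 ≤ energy d (annulus μ) f :=
    integral_nonneg fun p => mul_nonneg (annulus_nonneg _ _) (sq_nonneg _)
  have hO : 0 ≤ ∫ θ in Zᶜ, ‖f θ‖ ^ 2 ∂(surface d) := integral_nonneg fun _ => sq_nonneg _
  rw [Real.rpow_neg hμ.1.le]
  have e5 : ∫ θ, ‖f θ‖ ^ 2 ∂(surface d) ≤ 2 / c * (μ ^ ((d : ℝ) - 1))⁻¹ * energy d (annulus μ) f +
      2 * C / c * ∫ θ in Zᶜ, ‖f θ‖ ^ 2 ∂(surface d) := by
    rw [← mul_le_mul_iff_right₀ (mul_pos hc hμd)]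
    refine e4.trans (le_of_eq ?_)
    field_simp
  refine e5.trans ?_
  have f1 : 0 ≤ 2 / c * ∫ θ in Zᶜ, ‖f θ‖ ^ 2 ∂(surface d) := by positivity
  have f2 : 0 ≤ 2 * C / c * (μ ^ ((d : ℝ) - 1))⁻¹ * energy d (annulus μ) f := by positivity
  linarith

end

end

/-! ### A curved sphere leaves thin strips -/

section

open scoped ENNReal ComplexConjugate

section

variable {d : ℕ}

theorem exists_orthogonal_decomposition (hd : 3 ≤ d) (θ e : Sphere d) :
    ∃ v : Sphere d, inner ℝ (θ : Space d) (v : Space d) = 0 ∧ ∃ z w : ℝ, 0 ≤ w ∧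
      (e : Space d) = z • (θ : Space d) + w • (v : Space d) := by
  set z := inner ℝ (θ : Space d) (e : Space d) with hz
  set u : Space d := (e : Space d) - z • (θ : Space d) with hu
  have hort : inner ℝ (θ : Space d) u = 0 := by
    rw [hu, inner_sub_right, inner_smul_right, real_inner_self_eq_norm_sq, norm_sphere, ← hz]
    ring
  have key : ∀ u' : Space d, u' ≠ 0 → inner ℝ (θ : Space d) u' = 0 →
      ∃ v : Sphere d, inner ℝ (θ : Space d) (v : Space d) = 0 ∧ u' = ‖u'‖ • (v : Space d) := by
    intro u' h0 h1
    have hn : ‖u'‖ ≠ 0 := norm_ne_zero_iff.2 h0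
    refine ⟨⟨‖u'‖⁻¹ • u', ?_⟩, ?_, ?_⟩
    · rw [mem_sphere_zero_iff_norm, norm_smul, norm_inv, norm_norm, inv_mul_cancel₀ hn]
    · simp only [inner_smul_right, h1, mul_zero]
    · simp only [smul_smul, mul_inv_cancel₀ hn, one_smul]
  by_cases h0 : u = 0
  · have hne : (Submodule.span ℝ {(θ : Space d)})ᗮ ≠ ⊥ := by
      intro hb
      rw [Submodule.orthogonal_eq_bot_iff] at hb
      have h1 := finrank_span_le_card (R := ℝ) ({(θ : Space d)} : Set (Space d))
      rw [hb, finrank_top, finrank_euclideanSpace_fin] at h1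
      simp at h1
      omega
    obtain ⟨u', hu', hu0⟩ := Submodule.exists_mem_ne_zero_of_ne_bot hne
    obtain ⟨v, hv, -⟩ := key u' hu0 (Submodule.mem_orthogonal_singleton_iff_inner_right.1 hu')
    refine ⟨v, hv, z, 0, le_rfl, ?_⟩
    rw [zero_smul, add_zero]
    exact sub_eq_zero.1 h0
  · obtain ⟨v, hv, hv'⟩ := key u h0 hort
    exact ⟨v, hv, z, ‖u‖, norm_nonneg _, by rw [← hv', hu]; abel⟩

/-- In an orthonormal frame of the plane of `θ` and `e`, `(a,b)` is the centre of a cap, `(x,y)` the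
projection of a point of the cap and `(z,w)` the vector `e`. In the frame turned towards the centre,
`1 - X < μ²/8192` forces `|Y| ≤ μ/64` because `X² + Y² ≤ 1`. The transverse displacement enters only
through `Y(aw - bz)`, which is small where `e` is nearly parallel to `θ`. -/
theorem rotation_perturbation {μ a b z w x y : ℝ} (hμ : 0 < μ) (hab : a ^ 2 + b ^ 2 = 1)
    (ha : 0 ≤ a) (hb : |b| ≤ 2 * μ) (hzw : z ^ 2 + w ^ 2 = 1) (hw : 0 ≤ w)
    (hxy : x ^ 2 + y ^ 2 ≤ 1) (hX : 1 - (a * x + b * y) < μ ^ 2 / 8192) :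
    |z * x + w * y - (a * z + b * w)| ≤ μ ^ 2 / 8192 + μ / 64 * (w + 2 * μ) ∧
      |x - a| ≤ μ ^ 2 / 8192 + μ / 64 * (2 * μ) := by
  set X := a * x + b * y with hXd
  set Y := a * y - b * x with hYd
  have hXY : X ^ 2 + Y ^ 2 = x ^ 2 + y ^ 2 := by
    have : X ^ 2 + Y ^ 2 = (a ^ 2 + b ^ 2) * (x ^ 2 + y ^ 2) := by rw [hXd, hYd]; ring
    rw [this, hab, one_mul]
  have hX1 : X ≤ 1 := (abs_le.1 ((sq_le_one_iff_abs_le_one X).1 (by linarith [sq_nonneg Y]))).2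
  have hY : |Y| ≤ μ / 64 := by
    refine abs_le_of_sq_le_sq ?_ (by positivity)
    have h1 : (μ / 64) ^ 2 = 2 * (μ ^ 2 / 8192) := by ring
    have h2 := sq_nonneg (X - 1)
    have h3 : (X - 1) ^ 2 = X ^ 2 - 2 * X + 1 := by ring
    linarith
  have ha1 : a ≤ 1 := (abs_le.1 ((sq_le_one_iff_abs_le_one a).1 (by linarith [sq_nonneg b]))).2
  have hz1 : |z| ≤ 1 := (sq_le_one_iff_abs_le_one z).1 (by linarith [sq_nonneg w])
  have e1 : z * x + w * y - (a * z + b * w) = (a * z + b * w) * (X - 1) + (a * w - b * z) * Y := by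
    have : z * x + w * y = (a ^ 2 + b ^ 2) * (z * x + w * y) := by rw [hab, one_mul]
    rw [this, hXd, hYd]; ring
  have e2 : x - a = a * (X - 1) - b * Y := by
    have : x = (a ^ 2 + b ^ 2) * x := by rw [hab, one_mul]
    rw [hXd, hYd]; linear_combination this
  have h1 : |X - 1| ≤ μ ^ 2 / 8192 := by rw [abs_le]; constructor <;> linarith [sq_nonneg μ]
  have h2 : |a * z + b * w| ≤ 1 := by
    refine (sq_le_one_iff_abs_le_one _).1 ?_
    have : (a * z + b * w) ^ 2 + (a * w - b * z) ^ 2 =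
      (a ^ 2 + b ^ 2) * (z ^ 2 + w ^ 2) := by ring
    rw [hab, hzw] at this
    linarith [sq_nonneg (a * w - b * z)]
  have h3 : |a * w - b * z| ≤ w + 2 * μ := by
    refine (abs_sub _ _).trans ?_
    rw [abs_mul, abs_mul, abs_of_nonneg ha, abs_of_nonneg hw]
    have := mul_le_mul hb hz1 (abs_nonneg _) (by positivity)
    have := mul_le_mul_of_nonneg_right ha1 hw
    linarith
  constructor
  · rw [e1]
    refine (abs_add_le _ _).trans ?_
    rw [abs_mul, abs_mul]
    have := mul_le_mul h2 h1 (abs_nonneg _) zero_le_one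
    have := mul_le_mul h3 hY (abs_nonneg _) (by positivity)
    linarith
  · rw [e2]
    refine (abs_sub _ _).trans ?_
    rw [abs_mul, abs_mul, abs_of_nonneg ha]
    have := mul_le_mul ha1 h1 (abs_nonneg _) zero_le_one
    have := mul_le_mul hb hY (abs_nonneg _) (by positivity)
    linarith

theorem one_sub_bounds {a b : ℝ} (hab : a ^ 2 + b ^ 2 = 1) (ha : 0 ≤ a) :
    b ^ 2 / 2 ≤ 1 - a ∧ 1 - a ≤ b ^ 2 := by
  have h1 : a ≤ 1 := by nlinarith [sq_nonneg b]
  have h2 : b ^ 2 = (1 - a) * (1 + a) := by linarith [hab, (by ring : (1 - a) * (1 + a) = 1 - a ^ 2)]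
  have h3 : 0 ≤ 1 - a := by linarith
  rw [h2]
  constructor <;> nlinarith

/-- Four centres are tested: `b = ±μ` and `b = ±2μ`. If all of them lie close to the strip,
comparing opposite signs makes `w` small compared with `μ`, and comparing the two radii, whose
heights differ by at least `(3/2)μ²` through curvature, makes `|z|` less than `1/6`. This is
incompatible with `z² + w² = 1`. -/
theorem strip_contradiction {μ z w τ : ℝ} (hμ : 0 < μ) (hμ1 : μ ≤ 1 / 2)
    (hzw : z ^ 2 + w ^ 2 = 1) (hw : 0 ≤ w)
    (key : ∀ a b : ℝ, a ^ 2 + b ^ 2 = 1 → 0 ≤ a → |b| ≤ 2 * μ → μ ^ 2 / 2 ≤ 1 - a →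
      1 - a ≤ 4 * μ ^ 2 →
      |a * z + b * w - τ| < μ ^ 2 / 64 + (μ ^ 2 / 8192 + μ / 64 * (w + 2 * μ))) : False := by
  have hμ2 : 0 < μ ^ 2 := by positivity
  have hμ3 : μ ^ 2 ≤ 1 / 4 := by nlinarith
  obtain ⟨a₁, hn1, hs1⟩ : ∃ a : ℝ, 0 ≤ a ∧ a ^ 2 + μ ^ 2 = 1 :=
    ⟨Real.sqrt (1 - μ ^ 2), Real.sqrt_nonneg _, by rw [Real.sq_sqrt (by linarith)]; ring⟩
  obtain ⟨a₂, hn2, hs2⟩ : ∃ a : ℝ, 0 ≤ a ∧ a ^ 2 + (2 * μ) ^ 2 = 1 :=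
    ⟨Real.sqrt (1 - (2 * μ) ^ 2), Real.sqrt_nonneg _, by rw [Real.sq_sqrt (by linarith)]; ring⟩
  obtain ⟨b1, b2⟩ := one_sub_bounds hs1 hn1
  obtain ⟨b3, b4⟩ := one_sub_bounds hs2 hn2
  have b5 : (2 * μ) ^ 2 = 4 * μ ^ 2 := by ring
  rw [b5] at b3 b4
  have p1 := key a₁ μ hs1 hn1 (by rw [abs_of_pos hμ]; linarith) b1 (by linarith)
  have p2 := key a₁ (-μ) (by rw [neg_sq]; exact hs1) hn1
    (by rw [abs_neg, abs_of_pos hμ]; linarith) b1 (by linarith)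
  have p3 := key a₂ (2 * μ) hs2 hn2 (by rw [abs_of_pos (by linarith)]) (by linarith) b4
  have p4 := key a₂ (-(2 * μ)) (by rw [neg_sq]; exact hs2) hn2
    (by rw [abs_neg, abs_of_pos (by linarith)]) (by linarith) b4
  clear key
  rw [abs_lt] at p1 p2 p3 p4
  obtain ⟨p11, p12⟩ := p1
  obtain ⟨p21, p22⟩ := p2
  obtain ⟨p31, p32⟩ := p3
  obtain ⟨p41, p42⟩ := p4
  have q1 : w * 127 < 8 * μ := by
    have : μ * (w * 127) < μ * (8 * μ) := by linarith
    exact lt_of_mul_lt_mul_left this hμ.le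
  have q2 : μ * w ≤ μ * (μ / 8) := mul_le_mul_of_nonneg_left (by linarith) hμ.le
  have q3 : 3 / 2 * μ ^ 2 ≤ a₁ - a₂ := by
    have h1 : (a₁ - a₂) * (a₁ + a₂) = 3 * μ ^ 2 := by linarith [(by ring :
      (a₁ - a₂) * (a₁ + a₂) = a₁ ^ 2 - a₂ ^ 2)]
    have h2 : 0 ≤ a₁ - a₂ := by
      by_contra! h
      nlinarith
    have h3 : a₁ + a₂ ≤ 2 := by linarith
    nlinarith [mul_le_mul_of_nonneg_left h3 h2]
  have q4 : (a₁ - a₂) * |z| < 1 / 4 * μ ^ 2 := by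
    rcases abs_cases z with ⟨h, -⟩ | ⟨h, -⟩ <;> rw [h] <;> linarith
  have q5 : μ ^ 2 * (3 / 2 * |z|) < μ ^ 2 * (1 / 4) := by
    have := mul_le_mul_of_nonneg_right q3 (abs_nonneg z)
    linarith
  have q6 := lt_of_mul_lt_mul_left q5 hμ2.le
  have q7 : |z| ^ 2 ≤ (1 / 6) ^ 2 := pow_le_pow_left₀ (abs_nonneg z) (by linarith) 2
  rw [sq_abs] at q7
  have q8 : w ^ 2 ≤ (1 / 8) ^ 2 := pow_le_pow_left₀ hw (by linarith) 2
  linarith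

/-- Near every point of the sphere, at distance comparable to `μ`, there is a cap of radius
comparable to `μ` off a given strip of width comparable to `μ²`. -/
theorem exists_cap_off_strip (hd : 3 ≤ d) (θ e : Sphere d) (τ : ℝ) {μ : ℝ} (hμ : 0 < μ)
    (hμ1 : μ ≤ 1 / 2) : ∃ p : Sphere d, ∀ θ' : Sphere d, gap p θ' < μ ^ 2 / 8192 →
      gap θ θ' ∈ Icc (μ ^ 2 / 8) (8 * μ ^ 2) ∧
      μ ^ 2 / 64 ≤ |inner ℝ (θ' : Space d) (e : Space d) - τ| := by
  obtain ⟨v, hv, z, w, hw, he⟩ := exists_orthogonal_decomposition hd θ e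
  have hθθ : inner ℝ (θ : Space d) (θ : Space d) = (1 : ℝ) := by
    rw [real_inner_self_eq_norm_sq, norm_sphere]; norm_num
  have hvv : inner ℝ (v : Space d) (v : Space d) = (1 : ℝ) := by
    rw [real_inner_self_eq_norm_sq, norm_sphere]; norm_num
  have hv' : inner ℝ (v : Space d) (θ : Space d) = 0 := by rw [real_inner_comm, hv]
  have hzw : z ^ 2 + w ^ 2 = 1 := by
    have h1 : inner ℝ (e : Space d) (e : Space d) = (1 : ℝ) := by
      rw [real_inner_self_eq_norm_sq, norm_sphere]; norm_num
    rw [he] at h1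
    simp only [inner_add_left, inner_add_right, inner_smul_left, inner_smul_right, hθθ, hvv, hv,
      hv', conj_trivial] at h1
    linarith
  by_contra! hcon
  -- If no cap works, the cap around each centre `aθ + bv` contains a point of the strip. The bounds
  -- on `1 - a` keep the whole cap inside the annulus, so the failure concerns the strip, and the
  -- centre itself must be near it.
  have key : ∀ a b : ℝ, a ^ 2 + b ^ 2 = 1 → 0 ≤ a → |b| ≤ 2 * μ → μ ^ 2 / 2 ≤ 1 - a →
      1 - a ≤ 4 * μ ^ 2 →
      |a * z + b * w - τ| < μ ^ 2 / 64 + (μ ^ 2 / 8192 + μ / 64 * (w + 2 * μ)) := by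
    intro a b hab ha hb h1 h2
    have hp : a • (θ : Space d) + b • (v : Space d) ∈ Metric.sphere (0 : Space d) 1 := by
      rw [mem_sphere_zero_iff_norm, ← sq_eq_sq₀ (norm_nonneg _) zero_le_one,
        ← real_inner_self_eq_norm_sq]
      simp only [inner_add_left, inner_add_right, inner_smul_left, inner_smul_right, hθθ, hvv, hv,
        hv', conj_trivial]
      linarith
    obtain ⟨θ', hg, hθ'⟩ := hcon ⟨_, hp⟩
    set x := inner ℝ (θ : Space d) (θ' : Space d) with hx
    set y := inner ℝ (v : Space d) (θ' : Space d) with hy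
    have hg' : gap (⟨_, hp⟩ : Sphere d) θ' = 1 - (a * x + b * y) := by
      rw [gap]
      simp only [inner_add_left, inner_smul_left, conj_trivial, hx, hy]
    have hxy : x ^ 2 + y ^ 2 ≤ 1 := by
      have h3 := real_inner_self_nonneg
        (x := (θ' : Space d) - x • (θ : Space d) - y • (v : Space d))
      have h4 : inner ℝ (θ' : Space d) (θ' : Space d) = (1 : ℝ) := by
        rw [real_inner_self_eq_norm_sq, norm_sphere]; norm_num
      have h5 : inner ℝ (θ' : Space d) (θ : Space d) = x := by rw [real_inner_comm]
      have h6 : inner ℝ (θ' : Space d) (v : Space d) = y := by rw [real_inner_comm]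
      simp only [inner_sub_left, inner_sub_right, inner_smul_left, inner_smul_right, hθθ, hvv, hv,
        hv', conj_trivial, ← hx, ← hy, h4, h5, h6] at h3
      linarith
    rw [hg'] at hg
    obtain ⟨k1, k2⟩ := rotation_perturbation hμ hab ha hb hzw hw hxy hg
    have hgx : gap θ θ' = 1 - x := rfl
    have h7 : gap θ θ' ∈ Icc (μ ^ 2 / 8) (8 * μ ^ 2) := by
      rw [hgx]
      rw [abs_le] at k2
      constructor <;> linarith
    have h8 := hθ' h7
    have h9 : inner ℝ (θ' : Space d) (e : Space d) = z * x + w * y := by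
      rw [he, inner_add_right, inner_smul_right, inner_smul_right, real_inner_comm, ← hx,
        real_inner_comm, ← hy]
    rw [h9] at h8
    have h10 : a * z + b * w - τ = (z * x + w * y - τ) - (z * x + w * y - (a * z + b * w)) := by
      ring
    rw [h10]
    refine (abs_sub _ _).trans_lt ?_
    linarith
  exact strip_contradiction hμ hμ1 hzw hw key

/-- A fixed proportion of every annulus lies off a strip. -/
theorem exists_annulus_off_strip (hd : 3 ≤ d) : ∃ c : ℝ, 0 < c ∧ ∀ (e : Sphere d) (τ : ℝ),
    ∀ μ ∈ Ioc (0 : ℝ) (1 / 2), ∀ ε ≤ μ ^ 2 / 64, ∀ θ : Sphere d,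
      c * μ ^ ((d : ℝ) - 1) ≤ ∫ θ', annulus μ (gap θ θ') *
        {θ' : Sphere d | |inner ℝ (θ' : Space d) (e : Space d) - τ| < ε}ᶜ.indicator 1 θ'
          ∂(surface d) := by
  obtain ⟨c, hc0, hc⟩ := exists_le_surface_annulus hd
  refine ⟨c * (1 / 8192) ^ (((d : ℝ) - 1) / 2), by positivity, fun e τ μ hμ ε hε θ => ?_⟩
  obtain ⟨p, hp⟩ := exists_cap_off_strip hd θ e τ hμ.1 hμ.2
  have hμ2 : 0 < μ ^ 2 := pow_pos hμ.1 2
  -- The shell with `gap` between a quarter of `μ²/8192` and `μ²/8192` around `p` lies in the good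
  -- cap and already has measure of order `μ^(d-1)`.
  have h1 := hc (1 / 8192 * μ ^ 2) (by positivity) (by nlinarith [hμ.1, hμ.2]) p
  rw [Real.mul_rpow (by norm_num) hμ2.le, sq_rpow_half hμ.1, ← mul_assoc] at h1
  set B : Set (Sphere d) := {θ' | gap p θ' ∈ Ioo (1 / 8192 * μ ^ 2 / 4) (1 / 8192 * μ ^ 2)}
  have hB : MeasurableSet B := (continuous_gap_left p).measurable measurableSet_Ioo
  set Z : Set (Sphere d) := {θ' | |inner ℝ (θ' : Space d) (e : Space d) - τ| < ε}
  have hZ : MeasurableSet Z := by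
    have : Continuous fun θ' : Sphere d => |inner ℝ (θ' : Space d) (e : Space d) - τ| := by fun_prop
    exact (isOpen_lt this continuous_const).measurableSet
  rw [ENNReal.ofReal_le_iff_le_toReal (measure_ne_top _ _), ← measureReal_def,
    ← integral_indicator_one hB] at h1
  refine h1.trans (integral_mono ((integrable_const (1 : ℝ)).indicator hB) ?_ fun θ' => ?_)
  · refine Integrable.of_bound (C := 1) (((measurable_annulus μ).comp
      (continuous_gap_left θ).measurable).mul
      (measurable_one.indicator hZ.compl)).aestronglyMeasurable (ae_of_all _ fun θ' => ?_)
    rw [norm_mul]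
    exact mul_le_one₀ (abs_annulus_le_one _ _) (norm_nonneg _) (by
      by_cases h : θ' ∈ Zᶜ <;> simp [h])
  · by_cases h : θ' ∈ B
    · obtain ⟨h2, h3⟩ := hp θ' (by have := h.2; linarith)
      have h4 : θ' ∈ Zᶜ := fun hz => absurd (show _ < ε from hz) (by linarith)
      rw [indicator_of_mem h, indicator_of_mem h4, annulus, indicator_of_mem h2]
      simp
    · rw [indicator_of_notMem h]
      exact mul_nonneg (annulus_nonneg _ _) (Set.indicator_nonneg (fun _ _ => zero_le_one) _)

end

end

/-! ### The resolvent equation: averaging and hypoelliptic gain -/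

section

open scoped ENNReal ComplexConjugate

section

variable {d : ℕ} {s c₁ M : ℝ} {k e : ℝ → ℝ}

theorem integrable_mul_conj {f g : Sphere d → ℂ} (hg : MemLp g 2 (surface d))
    (hf : MemLp f 2 (surface d)) : Integrable (fun θ => g θ * conj (f θ)) (surface d) :=
  MemLp.integrable_mul hg hf.star

theorem MemLp.continuous_mul {χ : Sphere d → ℝ} (hχ : Continuous χ) {f : Sphere d → ℂ}
    (hf : MemLp f 2 (surface d)) : MemLp (fun θ => (χ θ : ℂ) * f θ) 2 (surface d) := by
  have hχc : Continuous fun θ => (χ θ : ℂ) := by fun_prop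
  obtain ⟨B, hB⟩ := isCompact_univ.exists_bound_of_continuousOn hχc.continuousOn
  exact hf.mul (MemLp.of_bound hχc.aestronglyMeasurable B (ae_of_all _ fun θ => hB θ (mem_univ _)) :
    MemLp _ ⊤ (surface d))

theorem integral_resolvent_mul_conj {a χ : Sphere d → ℝ} (ha : Continuous a) (hχ : Continuous χ)
    {f g : Sphere d → ℂ} (hf : MemLp f 2 (surface d)) (hg : MemLp g 2 (surface d)) :
    ∫ θ, (Complex.I * ((a θ : ℂ) * f θ) - g θ) * conj ((χ θ : ℂ) * f θ) ∂(surface d) =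
      Complex.I * (∫ θ, a θ * χ θ * ‖f θ‖ ^ 2 ∂(surface d) : ℝ) -
        ∫ θ, g θ * conj ((χ θ : ℂ) * f θ) ∂(surface d) := by
  have h1 : ∀ θ, (Complex.I * ((a θ : ℂ) * f θ) - g θ) * conj ((χ θ : ℂ) * f θ) =
      Complex.I * ((a θ * χ θ * ‖f θ‖ ^ 2 : ℝ) : ℂ) - g θ * conj ((χ θ : ℂ) * f θ) := by
    intro θ
    have e1 : ((‖f θ‖ ^ 2 : ℝ) : ℂ) = f θ * conj (f θ) := by
      rw [Complex.mul_conj, Complex.normSq_eq_norm_sq]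
    rw [Complex.ofReal_mul, e1]
    simp only [map_mul, Complex.conj_ofReal]
    push_cast
    ring
  have hac : Continuous fun θ => a θ * χ θ := ha.mul hχ
  obtain ⟨B, hB⟩ := isCompact_univ.exists_bound_of_continuousOn hac.continuousOn
  have hi : Integrable (fun θ => a θ * χ θ * ‖f θ‖ ^ 2) (surface d) :=
    (hf.integrable_norm_pow two_ne_zero).bdd_mul hac.aestronglyMeasurable
      (ae_of_all _ fun θ => hB θ (mem_univ _))
  have hi' : Integrable (fun θ => ((a θ * χ θ * ‖f θ‖ ^ 2 : ℝ) : ℂ)) (surface d) := hi.ofReal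
  simp only [h1]
  rw [integral_sub (hi'.const_mul _) (integrable_mul_conj hg (MemLp.continuous_mul hχ hf)),
    integral_const_mul, integral_complex_ofReal]

/-- The transport symbol is real, so `i a f` paired with `f` is purely imaginary and does not enter
the dissipation. This makes angular smoothing uniform in both frequencies. -/
theorem dissip_resolvent {a : Sphere d → ℝ} (ha : Continuous a)
    {f g : Sphere d → ℂ} (hf : MemLp f 2 (surface d)) (hg : MemLp g 2 (surface d)) :
    dissip d f (fun θ => Complex.I * ((a θ : ℂ) * f θ) - g θ) =
      (∫ θ, g θ * conj (f θ) ∂(surface d)).re := by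
  have h := integral_resolvent_mul_conj ha (χ := fun _ => 1) continuous_const hf hg
  simp only [Complex.ofReal_one, one_mul] at h
  rw [dissip, h]
  simp

theorem memLp_resolvent {a : Sphere d → ℝ} (ha : Continuous a)
    {f g : Sphere d → ℂ} (hf : MemLp f 2 (surface d)) (hg : MemLp g 2 (surface d)) :
    MemLp (fun θ => Complex.I * ((a θ : ℂ) * f θ) - g θ) 2 (surface d) :=
  ((MemLp.continuous_mul ha hf).const_mul Complex.I).sub hg

/-- Smoothing on the sphere for the resolvent equation. -/
theorem IsKernel.exists_resolvent_smoothing (hk : IsKernel d s c₁ M k e) : ∃ C : ℝ, 0 < C ∧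
    ∀ {a : Sphere d → ℝ} {f g : Sphere d → ℂ}, Continuous a → MemLp f 2 (surface d) →
      MemLp g 2 (surface d) → WeakScat d k f (fun θ => Complex.I * ((a θ : ℂ) * f θ) - g θ) →
      0 ≤ (∫ θ, g θ * conj (f θ) ∂(surface d)).re ∧ ∀ μ ∈ Ioc (0 : ℝ) 1,
        energy d (annulus μ) f ≤ C * μ ^ (2 * s + ((d : ℝ) - 1)) *
          ((∫ θ, g θ * conj (f θ) ∂(surface d)).re + ∫ θ, ‖f θ‖ ^ 2 ∂(surface d)) := by
  obtain ⟨C, hC0, hC⟩ := hk.exists_energy_annulus_le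
  refine ⟨C, hC0, fun {a f g} ha hf hg h => ⟨?_, fun μ hμ => ?_⟩⟩
  · rw [← dissip_resolvent ha hf hg]
    exact h.dissip_nonneg hk hf (memLp_resolvent ha hf hg)
  · rw [← dissip_resolvent ha hf hg]
    exact hC h hf (memLp_resolvent ha hf hg) μ hμ

/-- The multiplier `aδ / (a² + δ²)`. -/
noncomputable def cutMul (δ a : ℝ) : ℝ := a * δ / (a ^ 2 + δ ^ 2)

theorem cutMul_sub_sq_le {δ : ℝ} (hδ : 0 < δ) (a b : ℝ) :
    (cutMul δ a - cutMul δ b) ^ 2 ≤ (a - b) ^ 2 / δ ^ 2 := by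
  have hA : 0 < a ^ 2 + δ ^ 2 := by positivity
  have hB : 0 < b ^ 2 + δ ^ 2 := by positivity
  have h1 : (cutMul δ a - cutMul δ b) ^ 2 =
      δ ^ 2 * (a - b) ^ 2 * (δ ^ 2 - a * b) ^ 2 / ((a ^ 2 + δ ^ 2) * (b ^ 2 + δ ^ 2)) ^ 2 := by
    rw [cutMul, cutMul, div_sub_div _ _ hA.ne' hB.ne', div_pow]
    congr 1
    ring
  have h2 : (δ ^ 2 - a * b) ^ 2 ≤ (a ^ 2 + δ ^ 2) * (b ^ 2 + δ ^ 2) := by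
    have : (a ^ 2 + δ ^ 2) * (b ^ 2 + δ ^ 2) - (δ ^ 2 - a * b) ^ 2 = δ ^ 2 * (a + b) ^ 2 := by ring
    nlinarith [mul_nonneg (sq_nonneg δ) (sq_nonneg (a + b))]
  have h3 : δ ^ 2 * δ ^ 2 ≤ (a ^ 2 + δ ^ 2) * (b ^ 2 + δ ^ 2) :=
    mul_le_mul (by linarith [sq_nonneg a]) (by linarith [sq_nonneg b]) (sq_nonneg δ) hA.le
  rw [h1, div_le_div_iff₀ (by positivity) (by positivity)]
  set D := (a ^ 2 + δ ^ 2) * (b ^ 2 + δ ^ 2)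
  have hD : 0 < D := by positivity
  calc δ ^ 2 * (a - b) ^ 2 * (δ ^ 2 - a * b) ^ 2 * δ ^ 2
      = (a - b) ^ 2 * ((δ ^ 2 - a * b) ^ 2 * (δ ^ 2 * δ ^ 2)) := by ring
    _ ≤ (a - b) ^ 2 * (D * D) := by gcongr
    _ = (a - b) ^ 2 * D ^ 2 := by ring

theorem abs_cutMul_le {δ : ℝ} (hδ : 0 < δ) (a : ℝ) : |cutMul δ a| ≤ 1 := by
  have hA : 0 < a ^ 2 + δ ^ 2 := by positivity
  rw [cutMul, abs_div, abs_of_pos hA, div_le_one hA, abs_mul, abs_of_pos hδ]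
  nlinarith [sq_nonneg (|a| - δ), sq_abs a, abs_nonneg a, mul_nonneg (abs_nonneg a) hδ.le]

theorem mul_cutMul_nonneg {δ : ℝ} (hδ : 0 < δ) (a : ℝ) : 0 ≤ a * cutMul δ a := by
  have : a * cutMul δ a = a ^ 2 * δ / (a ^ 2 + δ ^ 2) := by rw [cutMul]; ring
  rw [this]
  positivity

/-- For `|a| ≥ δ` one has `a² + δ² ≤ 2a²`. This lower bound converts the imaginary part of the
paired equation into mass off the strip. -/
theorem half_le_mul_cutMul {δ : ℝ} (hδ : 0 < δ) {a : ℝ} (ha : δ ≤ |a|) :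
    δ / 2 ≤ a * cutMul δ a := by
  have : a * cutMul δ a = a ^ 2 * δ / (a ^ 2 + δ ^ 2) := by rw [cutMul]; ring
  rw [this, div_le_div_iff₀ (by norm_num) (by positivity)]
  have h1 : δ ^ 2 ≤ a ^ 2 := by rw [← sq_abs a]; exact pow_le_pow_left₀ hδ.le ha 2
  nlinarith [mul_le_mul_of_nonneg_left h1 hδ.le]

theorem contDiff_cutMul {δ : ℝ} (hδ : 0 < δ) {a : Space d → ℝ} (ha : ContDiff ℝ ∞ a) :
    ContDiff ℝ ∞ fun x => cutMul δ (a x) :=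
  (ha.mul contDiff_const).div ((ha.pow 2).add contDiff_const) fun x => by positivity

/-- The symbol `2π (τ + θ·ξ)`. -/
noncomputable def symbol (d : ℕ) (τ : ℝ) (ξ : Space d) (θ : Space d) : ℝ :=
  2 * Real.pi * (τ + inner ℝ θ ξ)

theorem contDiff_symbol (τ : ℝ) (ξ : Space d) : ContDiff ℝ ∞ (symbol d τ ξ) :=
  contDiff_const.mul (contDiff_const.add (contDiff_id.inner ℝ contDiff_const))

theorem continuous_symbol (τ : ℝ) (ξ : Space d) :
    Continuous fun θ : Sphere d => symbol d τ ξ θ :=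
  (contDiff_symbol τ ξ).continuous.comp continuous_subtype_val

theorem norm_integral_mul_conj_le {χ : Sphere d → ℝ} (hχ : ∀ θ, |χ θ| ≤ 1)
    {f g : Sphere d → ℂ} (hf : MemLp f 2 (surface d)) (hg : MemLp g 2 (surface d)) :
    ‖∫ θ, g θ * conj ((χ θ : ℂ) * f θ) ∂(surface d)‖ ≤ ∫ θ, ‖g θ‖ * ‖f θ‖ ∂(surface d) := by
  refine norm_integral_le_of_norm_le (MemLp.integrable_mul hg.norm hf.norm)
    (ae_of_all _ fun θ => ?_)
  rw [norm_mul, RCLike.norm_conj, norm_mul, Complex.norm_real]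
  exact mul_le_mul_of_nonneg_left (mul_le_of_le_one_left (norm_nonneg _) (hχ θ)) (norm_nonneg _)

theorem integral_mul_le_sq {f g : Sphere d → ℂ} (hf : MemLp f 2 (surface d))
    (hg : MemLp g 2 (surface d)) (A : ℝ) :
    2 * A * ∫ θ, ‖g θ‖ * ‖f θ‖ ∂(surface d) ≤
      ∫ θ, ‖f θ‖ ^ 2 ∂(surface d) + A ^ 2 * ∫ θ, ‖g θ‖ ^ 2 ∂(surface d) := by
  have h1 := hf.integrable_norm_pow two_ne_zero
  have h2 := hg.integrable_norm_pow two_ne_zero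
  rw [← integral_const_mul, ← integral_const_mul, ← integral_add h1 (h2.const_mul _)]
  refine integral_mono ((MemLp.integrable_mul hg.norm hf.norm).const_mul _)
    (h1.add (h2.const_mul _)) fun θ => ?_
  simp only
  nlinarith [sq_nonneg (‖f θ‖ - A * ‖g θ‖)]

/-- The symbol is Lipschitz in `θ` with constant `2π‖ξ‖` and the multiplier is Lipschitz with the
inverse of `2π‖ξ‖ε`. Their composition has constant `1/ε`, independent of the frequency, which fits
the commutator bound with `L = 1/ε`. -/
theorem cutMul_symbol_sub_sq_le {τ : ℝ} {ξ : Space d} (hξ : ξ ≠ 0) {ε : ℝ} (hε : 0 < ε)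
    (θ θ' : Sphere d) :
    (cutMul (2 * Real.pi * ‖ξ‖ * ε) (symbol d τ ξ θ) -
      cutMul (2 * Real.pi * ‖ξ‖ * ε) (symbol d τ ξ θ')) ^ 2 ≤
      min 4 (2 * (1 / ε) ^ 2 * gap θ θ') := by
  have hξ0 : 0 < ‖ξ‖ := norm_pos_iff.2 hξ
  have hδ : 0 < 2 * Real.pi * ‖ξ‖ * ε := by positivity
  refine le_min ?_ ((cutMul_sub_sq_le hδ _ _).trans ?_)
  · have h1 := abs_le.1 (abs_cutMul_le hδ (symbol d τ ξ θ))
    have h2 := abs_le.1 (abs_cutMul_le hδ (symbol d τ ξ θ'))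
    have h3 : (4 : ℝ) = 2 ^ 2 := by norm_num
    rw [h3]
    exact sq_le_sq' (by linarith) (by linarith)
  · have h1 : symbol d τ ξ θ - symbol d τ ξ θ' =
        2 * Real.pi * inner ℝ ((θ : Space d) - θ') ξ := by
      rw [symbol, symbol, inner_sub_left]; ring
    have h2 : (inner ℝ ((θ : Space d) - θ') ξ) ^ 2 ≤ 2 * gap θ θ' * ‖ξ‖ ^ 2 := by
      rw [← norm_sub_sq_eq_gap, ← mul_pow, ← sq_abs]
      exact pow_le_pow_left₀ (abs_nonneg _) (abs_real_inner_le_norm _ _) 2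
    rw [h1, div_le_iff₀ (by positivity)]
    have h3 : 2 * (1 / ε) ^ 2 * gap θ θ' * (2 * Real.pi * ‖ξ‖ * ε) ^ 2 =
        (2 * Real.pi) ^ 2 * (2 * gap θ θ' * ‖ξ‖ ^ 2) := by
      field_simp
    rw [h3, mul_pow]
    exact mul_le_mul_of_nonneg_left h2 (by positivity)

theorem le_symbol_mul_cutMul {τ : ℝ} {ξ : Space d} (hξ : ξ ≠ 0) {ε : ℝ} (hε : 0 < ε)
    {θ : Sphere d} (h : ε ≤ |inner ℝ (θ : Space d) (‖ξ‖⁻¹ • ξ) - -τ / ‖ξ‖|) :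
    Real.pi * ‖ξ‖ * ε ≤ symbol d τ ξ θ * cutMul (2 * Real.pi * ‖ξ‖ * ε) (symbol d τ ξ θ) := by
  have hξ0 : 0 < ‖ξ‖ := norm_pos_iff.2 hξ
  have k2 : symbol d τ ξ θ =
      2 * Real.pi * ‖ξ‖ * (inner ℝ (θ : Space d) (‖ξ‖⁻¹ • ξ) - -τ / ‖ξ‖) := by
    rw [symbol, inner_smul_right]
    field_simp
    ring
  have k3 : 2 * Real.pi * ‖ξ‖ * ε ≤ |symbol d τ ξ θ| := by
    rw [k2, abs_mul, abs_of_pos (by positivity : 0 < 2 * Real.pi * ‖ξ‖)]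
    exact mul_le_mul_of_nonneg_left h (by positivity)
  refine le_trans (le_of_eq ?_) (half_le_mul_cutMul (by positivity) k3)
  ring

/-- The set of directions that are nearly resonant. -/
def strip (d : ℕ) (τ : ℝ) (ξ : Space d) (ε : ℝ) : Set (Sphere d) :=
  {θ : Sphere d | |inner ℝ (θ : Space d) (‖ξ‖⁻¹ • ξ) - -τ / ‖ξ‖| < ε}

theorem measurableSet_strip (τ : ℝ) (ξ : Space d) (ε : ℝ) : MeasurableSet (strip d τ ξ ε) := by
  have : Continuous fun θ : Sphere d => |inner ℝ (θ : Space d) (‖ξ‖⁻¹ • ξ) - -τ / ‖ξ‖| := by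
    fun_prop
  exact (isOpen_lt this continuous_const).measurableSet

theorem integral_off_strip_le {ξ : Space d} {τ : ℝ} {f : Sphere d → ℂ} (hξ : ξ ≠ 0)
    (hf : MemLp f 2 (surface d)) {ε : ℝ} (hε : 0 < ε) :
    Real.pi * ‖ξ‖ * ε * (∫ θ in (strip d τ ξ ε)ᶜ, ‖f θ‖ ^ 2 ∂(surface d)) ≤
      ∫ θ : Sphere d, symbol d τ ξ θ * cutMul (2 * Real.pi * ‖ξ‖ * ε) (symbol d τ ξ θ) *
        ‖f θ‖ ^ 2 ∂(surface d) := by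
  have hξ0 : 0 < ‖ξ‖ := norm_pos_iff.2 hξ
  have hδ : 0 < 2 * Real.pi * ‖ξ‖ * ε := by positivity
  have hac := continuous_symbol (d := d) τ ξ
  have hχc : Continuous fun θ : Sphere d => cutMul (2 * Real.pi * ‖ξ‖ * ε) (symbol d τ ξ θ) :=
    (contDiff_cutMul hδ (contDiff_symbol τ ξ)).continuous.comp continuous_subtype_val
  have hf2 := hf.integrable_norm_pow two_ne_zero
  have hint : Integrable (fun θ : Sphere d => symbol d τ ξ θ *
      cutMul (2 * Real.pi * ‖ξ‖ * ε) (symbol d τ ξ θ) * ‖f θ‖ ^ 2) (surface d) := by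
    obtain ⟨B, hB⟩ := isCompact_univ.exists_bound_of_continuousOn (hac.mul hχc).continuousOn
    exact hf2.bdd_mul (hac.mul hχc).aestronglyMeasurable (ae_of_all _ fun θ => hB θ (mem_univ _))
  rw [← integral_const_mul]
  refine le_trans (setIntegral_mono_on (hf2.const_mul _).integrableOn hint.integrableOn
    (measurableSet_strip τ ξ ε).compl fun θ hθ => ?_) (setIntegral_le_integral hint
      (ae_of_all _ fun θ => mul_nonneg (mul_cutMul_nonneg hδ _) (sq_nonneg _)))
  exact mul_le_mul_of_nonneg_right (le_symbol_mul_cutMul hξ hε (not_lt.1 hθ)) (sq_nonneg _)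

/-- Velocity averaging: the mass off the resonant strip. -/
theorem IsKernel.exists_off_strip_le (hk : IsKernel d s c₁ M k e) : ∃ C : ℝ, 0 < C ∧
    ∀ {ξ : Space d} {τ : ℝ} {f g : Sphere d → ℂ}, ξ ≠ 0 → MemLp f 2 (surface d) →
      MemLp g 2 (surface d) →
      WeakScat d k f (fun θ => Complex.I * ((symbol d τ ξ θ : ℂ) * f θ) - g θ) →
      ∀ ε ∈ Ioc (0 : ℝ) 1, ∀ l : ℝ, 0 < l →
      Real.pi * ‖ξ‖ * ε * (∫ θ in (strip d τ ξ ε)ᶜ, ‖f θ‖ ^ 2 ∂(surface d)) ≤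
        (1 + l) * (∫ θ, ‖g θ‖ * ‖f θ‖ ∂(surface d)) +
          C * (1 / ε) ^ (2 * s) / l * ∫ θ, ‖f θ‖ ^ 2 ∂(surface d) := by
  obtain ⟨C, hC0, hC⟩ := hk.exists_commutator_le
  refine ⟨C, hC0, fun {ξ τ f g} hξ hf hg h ε hε l hl => (integral_off_strip_le hξ hf hε.1).trans ?_⟩
  have hξ0 : 0 < ‖ξ‖ := norm_pos_iff.2 hξ
  have hδ : 0 < 2 * Real.pi * ‖ξ‖ * ε := by have := hε.1; positivity
  have hac := continuous_symbol (d := d) τ ξ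
  have hχ := contDiff_cutMul hδ (contDiff_symbol τ ξ)
  have hχc : Continuous fun θ : Sphere d => cutMul (2 * Real.pi * ‖ξ‖ * ε) (symbol d τ ξ θ) :=
    hχ.continuous.comp continuous_subtype_val
  have h1 := hC h hf (memLp_resolvent hac hf hg) hχ (1 / ε)
    ((le_div_iff₀ hε.1).2 (by rw [one_mul]; exact hε.2)) (cutMul_symbol_sub_sq_le hξ hε.1) l hl
  -- In the pairing with `χ f` the transport term becomes `i ∫ a χ |f|²`, so the imaginary part
  -- isolates the nonnegative quantity that dominates the mass off the strip.
  rw [dissip_resolvent hac hf hg, integral_resolvent_mul_conj hac hχc hf hg] at h1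
  have h3 := (Complex.abs_im_le_norm _).trans (norm_integral_mul_conj_le
    (χ := fun θ : Sphere d => cutMul (2 * Real.pi * ‖ξ‖ * ε) (symbol d τ ξ θ))
    (fun θ => abs_cutMul_le hδ (symbol d τ ξ θ)) hf hg)
  have h4 := (Complex.re_le_norm _).trans (norm_integral_mul_conj_le (χ := fun _ => 1)
    (fun θ => by simp) hf hg)
  simp only [Complex.ofReal_one, one_mul] at h4
  rw [Complex.sub_im, Complex.I_mul_im, Complex.ofReal_re] at h1
  have k1 := (abs_le.1 h1).2
  have k2 := (abs_le.1 h3).2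
  have k3 := mul_le_mul_of_nonneg_left h4 hl.le
  linarith

/-- Hypoelliptic gain for the resolvent equation at frequency `ξ`. -/
theorem IsKernel.exists_resolvent_gain (hk : IsKernel d s c₁ M k e) : ∃ C ε₀ : ℝ, 0 < C ∧ 0 < ε₀ ∧
    ∀ {ξ : Space d} {τ : ℝ} {f g : Sphere d → ℂ} {ε : ℝ}, ε ∈ Ioc 0 ε₀ →
      ‖ξ‖ * (ε * (ε ^ (s / 2)) ^ 3) = 1 → MemLp f 2 (surface d) → MemLp g 2 (surface d) →
      WeakScat d k f (fun θ => Complex.I * ((symbol d τ ξ θ : ℂ) * f θ) - g θ) →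
      ∫ θ, ‖f θ‖ ^ 2 ∂(surface d) ≤ C * (ε ^ s) ^ 2 * ∫ θ, ‖g θ‖ ^ 2 ∂(surface d) := by
  obtain ⟨c, hc0, hc⟩ := exists_annulus_off_strip hk.dim
  obtain ⟨C₁, hC₁0, hC₁⟩ := exists_integral_le_off hk.dim hc0
  obtain ⟨C₂, hC₂0, hC₂⟩ := hk.exists_resolvent_smoothing
  obtain ⟨C₃, hC₃0, hC₃⟩ := hk.exists_off_strip_le
  have hs := hk.s_pos
  have hs1 := hk.s_lt
  set B := 4 * C₁ * C₃ with hB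
  set A := 4 * (C₁ * (1 + B) + 64 * C₁ * C₂) with hA
  have hB0 : 0 < B := by positivity
  have hA0 : 0 < A := by positivity
  -- The first bound on `ε` gives `μ ≤ 1/2` for `μ² = 64ε`; the second makes the energy term absorb
  -- at most a quarter of `F`.
  refine ⟨A ^ 2, min (1 / 256) ((1 / (256 * C₁ * C₂)) ^ (1 / s)), by positivity, by positivity,
    fun {ξ τ f g ε} hε hξε hf hg h => ?_⟩
  have hε0 := hε.1
  have hε1 : ε ≤ 1 / 256 := hε.2.trans (min_le_left _ _)
  have hεs : ε ^ s ≤ 1 / (256 * C₁ * C₂) := by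
    have := Real.rpow_le_rpow hε0.le (hε.2.trans (min_le_right _ _)) hs.le
    rwa [← Real.rpow_mul (by positivity), one_div_mul_cancel hs.ne', Real.rpow_one] at this
  have hξ : ξ ≠ 0 := by
    rintro rfl
    simp at hξε
  have hξ0 : 0 < ‖ξ‖ := norm_pos_iff.2 hξ
  set x := ε ^ (s / 2) with hx
  have hx0 : 0 < x := Real.rpow_pos_of_pos hε0 _
  have hx1 : x ≤ 1 := Real.rpow_le_one hε0.le (by linarith) (by linarith)
  have hxs : ε ^ s = x ^ 2 := by
    rw [hx, ← Real.rpow_natCast, ← Real.rpow_mul hε0.le]; congr 1; push_cast; ring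
  have hx4 : (1 / ε) ^ (2 * s) = (x ^ 4)⁻¹ := by
    rw [Real.div_rpow zero_le_one hε0.le, Real.one_rpow, one_div, hx, ← Real.rpow_natCast,
      ← Real.rpow_mul hε0.le]; congr 2; push_cast; ring
  rw [hxs] at hεs ⊢
  set F := ∫ θ, ‖f θ‖ ^ 2 ∂(surface d) with hF
  set G := ∫ θ, ‖g θ‖ ^ 2 ∂(surface d) with hG
  set P := ∫ θ, ‖g θ‖ * ‖f θ‖ ∂(surface d) with hP
  have hF0 : 0 ≤ F := integral_nonneg fun _ => sq_nonneg _
  have hP0 : 0 ≤ P := integral_nonneg fun _ => mul_nonneg (norm_nonneg _) (norm_nonneg _)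
  -- The strip of width `ε` is exactly at the admissible threshold `μ²/64` for annuli of size `μ`.
  set μ := 8 * Real.sqrt ε with hμd
  have hμ2 : μ ^ 2 = 64 * ε := by rw [hμd, mul_pow, Real.sq_sqrt hε0.le]; norm_num
  have hμ0 : 0 < μ := by positivity
  have hμ1 : μ ≤ 1 / 2 := by
    refine (sq_le_sq₀ hμ0.le (by norm_num)).1 ?_
    rw [hμ2]; linarith
  have hμs : μ ^ (2 * s) ≤ 64 * x ^ 2 := by
    have e1 : μ ^ (2 * s) = (μ ^ 2) ^ s := by
      rw [← Real.rpow_natCast μ 2, ← Real.rpow_mul hμ0.le]; norm_num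
    rw [e1, hμ2, Real.mul_rpow (by norm_num) hε0.le, hxs]
    have : (64 : ℝ) ^ s ≤ 64 := by
      conv_rhs => rw [← Real.rpow_one 64]
      exact Real.rpow_le_rpow_of_exponent_le (by norm_num) hs1.le
    gcongr
  set u : Sphere d := ⟨‖ξ‖⁻¹ • ξ, by
    rw [mem_sphere_zero_iff_norm, norm_smul, norm_inv, norm_norm, inv_mul_cancel₀ hξ0.ne']⟩ with hu
  set Z := strip d τ ξ ε with hZ
  have hZm : MeasurableSet Z := measurableSet_strip τ ξ ε
  have h1 := hC₁ hf μ ⟨hμ0, by linarith⟩ Z hZm (fun θ => hc u (-τ / ‖ξ‖) μ ⟨hμ0, hμ1⟩ ε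
    (by rw [hμ2]; linarith) θ)
  have h2 := (hC₂ (continuous_symbol τ ξ) hf hg h).2 μ ⟨hμ0, by linarith⟩
  -- With `x = ε^(s/2)` the scaling assumption reads `‖ξ‖ε = x⁻³`. The weight `l = B/x` balances the
  -- two terms: the coefficient of `P` becomes of order `x² = ε^s`, and that of `F` becomes the
  -- constant `C₃/B`. The value `B = 4C₁C₃` then turns it into `1/4` after multiplication by `C₁`.
  have h3 := hC₃ hξ hf hg h ε ⟨hε0, by linarith⟩ (B / x) (by positivity)
  rw [← hF, ← hP, hx4, ← hZ] at h3
  rw [← hF] at h1 h2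
  have h4 : (∫ θ, g θ * conj (f θ) ∂(surface d)).re ≤ P := by
    have := (Complex.re_le_norm _).trans (norm_integral_mul_conj_le (χ := fun _ => 1)
      (fun θ => by simp) hf hg)
    simpa only [Complex.ofReal_one, one_mul] using this
  set O := ∫ θ in Zᶜ, ‖f θ‖ ^ 2 ∂(surface d) with hO
  have hO0 : 0 ≤ O := integral_nonneg fun _ => sq_nonneg _
  have h5 : μ ^ (-((d : ℝ) - 1)) * energy d (annulus μ) f ≤ C₂ * (64 * x ^ 2) * (P + F) := by
    have hp : 0 < μ ^ (-((d : ℝ) - 1)) := Real.rpow_pos_of_pos hμ0 _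
    calc _ ≤ μ ^ (-((d : ℝ) - 1)) * (C₂ * μ ^ (2 * s + ((d : ℝ) - 1)) * (P + F)) := by
          refine mul_le_mul_of_nonneg_left (h2.trans ?_) hp.le
          gcongr
      _ = C₂ * μ ^ (2 * s) * (P + F) := by
          rw [Real.rpow_add hμ0, Real.rpow_neg hμ0.le]
          have : μ ^ ((d : ℝ) - 1) ≠ 0 := (Real.rpow_pos_of_pos hμ0 _).ne'
          field_simp
      _ ≤ _ := by gcongr
  have h6 : O ≤ x ^ 2 * (1 + B) * P + C₃ / B * F := by
    have e1 : ‖ξ‖ * ε = (x ^ 3)⁻¹ := by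
      rw [eq_comm, inv_eq_one_div, div_eq_iff (by positivity)]; linarith
    have e2 : (x ^ 3)⁻¹ * O ≤ Real.pi * ‖ξ‖ * ε * O := by
      rw [mul_assoc Real.pi, e1]
      gcongr
      exact le_mul_of_one_le_left (by positivity) (by linarith [Real.pi_gt_three])
    have e3 := e2.trans h3
    have e4 : O ≤ x ^ 3 * ((1 + B / x) * P + C₃ * (x ^ 4)⁻¹ / (B / x) * F) := by
      rwa [inv_mul_le_iff₀ (by positivity)] at e3
    have e5 : x ^ 3 * ((1 + B / x) * P + C₃ * (x ^ 4)⁻¹ / (B / x) * F) =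
        x ^ 2 * (x + B) * P + C₃ / B * F := by
      field_simp
    rw [e5] at e4
    refine e4.trans ?_
    gcongr
  have h7 : F ≤ A / 2 * x ^ 2 * P := by
    have e1 : C₁ * (C₃ / B * F) = F / 4 := by rw [hB]; field_simp
    have e2 : 64 * C₁ * C₂ * x ^ 2 * F ≤ 1 / 4 * F := by
      refine mul_le_mul_of_nonneg_right ?_ hF0
      rw [le_div_iff₀ (by positivity)] at hεs
      linarith
    have e3 := mul_le_mul_of_nonneg_left h6 hC₁0.le
    have e4 := mul_le_mul_of_nonneg_left h5 hC₁0.le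
    rw [mul_add, e1] at e3
    rw [hA]
    linarith
  -- Young's inequality trades the product `P` for the squared norm of `g`, at the cost of a part of
  -- `F` that is absorbed.
  have h8 := integral_mul_le_sq hf hg (A * x ^ 2)
  rw [← hF, ← hG, ← hP] at h8
  have h9 : 0 ≤ A * x ^ 2 * P := by positivity
  linarith

end

end

/-! ### Plancherel in time with a parameter -/

section

open scoped ENNReal ComplexConjugate FourierTransform

theorem memLp_two_iff_lintegral {α : Type*} [MeasurableSpace α] {μ : Measure α} {f : α → ℂ}
    (hf : AEStronglyMeasurable f μ) : MemLp f 2 μ ↔ ∫⁻ x, ‖f x‖ₑ ^ 2 ∂μ < ⊤ := by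
  rw [← eLpNorm_two_sq]
  constructor
  · intro h
    exact ENNReal.pow_lt_top h.2
  · intro h
    refine ⟨hf, ?_⟩
    by_contra hc
    rw [not_lt_top_iff] at hc
    simp [hc] at h

theorem ofReal_integral_norm_sq {α : Type*} [MeasurableSpace α] {μ : Measure α} {f : α → ℂ}
    (hf : MemLp f 2 μ) : ENNReal.ofReal (∫ x, ‖f x‖ ^ 2 ∂μ) = ∫⁻ x, ‖f x‖ₑ ^ 2 ∂μ := by
  rw [ofReal_integral_eq_lintegral_ofReal (hf.integrable_norm_pow two_ne_zero)
    (ae_of_all _ fun _ => sq_nonneg _)]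
  refine lintegral_congr fun x => ?_
  rw [ENNReal.ofReal_pow (norm_nonneg _), ofReal_norm]

theorem integral_norm_sq_eq_toReal {α : Type*} [MeasurableSpace α] {μ : Measure α} {f : α → ℂ}
    (hf : AEStronglyMeasurable f μ) : ∫ x, ‖f x‖ ^ 2 ∂μ = (∫⁻ x, ‖f x‖ₑ ^ 2 ∂μ).toReal := by
  rw [integral_eq_lintegral_of_nonneg_ae (ae_of_all _ fun _ => sq_nonneg _) (hf.norm.pow 2)]
  congr 1
  refine lintegral_congr fun x => ?_
  rw [ENNReal.ofReal_pow (norm_nonneg _), ofReal_norm]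

theorem fourier_add_apply {f g : ℝ → ℂ} (hf : Integrable f) (hg : Integrable g) (w : ℝ) :
    𝓕 (fun t => f t + g t) w = 𝓕 f w + 𝓕 g w := by
  simp only [Real.fourier_eq, smul_add]
  exact integral_add ((Real.fourierIntegral_convergent_iff w).2 hf)
    ((Real.fourierIntegral_convergent_iff w).2 hg)

theorem fourier_sub_apply {f g : ℝ → ℂ} (hf : Integrable f) (hg : Integrable g) (w : ℝ) :
    𝓕 (fun t => f t - g t) w = 𝓕 f w - 𝓕 g w := by
  simp only [Real.fourier_eq, smul_sub]
  exact integral_sub ((Real.fourierIntegral_convergent_iff w).2 hf)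
    ((Real.fourierIntegral_convergent_iff w).2 hg)

section

variable {α : Type*} [MeasurableSpace α] {ν : Measure α} [SFinite ν]

theorem measurable_fourier_fst {G : ℝ × α → ℂ} (hG : Measurable G) :
    Measurable fun p : ℝ × α => 𝓕 (fun t => G (t, p.2)) p.1 := by
  simp only [Real.fourier_eq']
  have : StronglyMeasurable fun q : (ℝ × α) × ℝ =>
      Complex.exp (((-2 * Real.pi * inner ℝ q.2 q.1.1 : ℝ) : ℂ) * Complex.I) • G (q.2, q.1.2) := by
    have h1 : Measurable fun q : (ℝ × α) × ℝ => G (q.2, q.1.2) := hG.comp (by fun_prop)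
    exact Measurable.stronglyMeasurable (by fun_prop)
  exact this.integral_prod_right.measurable

/-- The Plancherel identity in one variable. -/
theorem lintegral_fourier_fst_sq {G : ℝ × α → ℂ} (hG : Measurable G)
    (hi : ∀ᵐ a ∂ν, Integrable fun t => G (t, a)) :
    ∫⁻ p : ℝ × α, ‖𝓕 (fun t => G (t, p.2)) p.1‖ₑ ^ 2 ∂(volume.prod ν) =
      ∫⁻ p, ‖G p‖ₑ ^ 2 ∂(volume.prod ν) := by
  rw [lintegral_prod_symm _ ((measurable_fourier_fst hG).enorm.pow_const 2).aemeasurable,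
    lintegral_prod_symm _ (hG.enorm.pow_const 2).aemeasurable]
  refine lintegral_congr_ae ?_
  filter_upwards [hi] with a ha
  exact lintegral_fourier_sq ha

theorem memLp_fourier_fst {G : ℝ × α → ℂ} (hG : Measurable G)
    (hi : ∀ᵐ a ∂ν, Integrable fun t => G (t, a)) (h2 : MemLp G 2 (volume.prod ν)) :
    MemLp (fun p : ℝ × α => 𝓕 (fun t => G (t, p.2)) p.1) 2 (volume.prod ν) := by
  rw [memLp_two_iff_lintegral (measurable_fourier_fst hG).aestronglyMeasurable,
    lintegral_fourier_fst_sq hG hi, ← memLp_two_iff_lintegral h2.1]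
  exact h2

theorem integral_fourier_fst_sq {G : ℝ × α → ℂ} (hG : Measurable G)
    (hi : ∀ᵐ a ∂ν, Integrable fun t => G (t, a)) :
    ∫ p : ℝ × α, ‖𝓕 (fun t => G (t, p.2)) p.1‖ ^ 2 ∂(volume.prod ν) =
      ∫ p, ‖G p‖ ^ 2 ∂(volume.prod ν) := by
  rw [integral_norm_sq_eq_toReal (measurable_fourier_fst hG).aestronglyMeasurable,
    integral_norm_sq_eq_toReal hG.aestronglyMeasurable, lintegral_fourier_fst_sq hG hi]

/-- Polarisation: it reduces the bilinear Plancherel identity to the quadratic one for the sum and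
the difference. -/
theorem integral_re_mul_conj {μ : Measure α} {f g : α → ℂ} (hf : MemLp f 2 μ) (hg : MemLp g 2 μ) :
    ∫ x, (g x * conj (f x)).re ∂μ =
      (∫ x, ‖f x + g x‖ ^ 2 ∂μ - ∫ x, ‖f x - g x‖ ^ 2 ∂μ) / 4 := by
  have h1 : Integrable (fun x => ‖f x + g x‖ ^ 2) μ := (hf.add hg).integrable_norm_pow two_ne_zero
  have h2 : Integrable (fun x => ‖f x - g x‖ ^ 2) μ := (hf.sub hg).integrable_norm_pow two_ne_zero
  rw [← integral_sub h1 h2, ← integral_div]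
  congr 1
  ext x
  rw [← Complex.normSq_eq_norm_sq, ← Complex.normSq_eq_norm_sq, Complex.normSq_add,
    Complex.normSq_sub, ← Complex.conj_re (f x * conj (g x))]
  simp only [map_mul, Complex.conj_conj]
  rw [mul_comm (g x)]
  ring

/-- The polarised Plancherel identity in one variable. -/
theorem integral_re_fourier_fst_mul {F G : ℝ × α → ℂ} (hF : Measurable F) (hG : Measurable G)
    (hFi : ∀ᵐ a ∂ν, Integrable fun t => F (t, a)) (hGi : ∀ᵐ a ∂ν, Integrable fun t => G (t, a))
    (hF2 : MemLp F 2 (volume.prod ν)) (hG2 : MemLp G 2 (volume.prod ν)) :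
    ∫ p : ℝ × α, (𝓕 (fun t => G (t, p.2)) p.1 * conj (𝓕 (fun t => F (t, p.2)) p.1)).re
      ∂(volume.prod ν) = ∫ p, (G p * conj (F p)).re ∂(volume.prod ν) := by
  rw [integral_re_mul_conj (memLp_fourier_fst hF hFi hF2) (memLp_fourier_fst hG hGi hG2),
    integral_re_mul_conj hF2 hG2]
  have h1 := integral_fourier_fst_sq (hF.add hG) (ν := ν) (by
    filter_upwards [hFi, hGi] with a h1 h2 using h1.add h2)
  have h2 := integral_fourier_fst_sq (hF.sub hG) (ν := ν) (by
    filter_upwards [hFi, hGi] with a h1 h2 using h1.sub h2)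
  have hae : ∀ᵐ p : ℝ × α ∂(volume.prod ν), (Integrable fun t => F (t, p.2)) ∧
      Integrable fun t => G (t, p.2) :=
    Measure.quasiMeasurePreserving_snd.ae (hFi.and hGi)
  simp only [Pi.add_apply, Pi.sub_apply] at h1 h2
  rw [← h1, ← h2]
  congr 2
  · refine integral_congr_ae ?_
    filter_upwards [hae] with p hp
    rw [fourier_add_apply hp.1 hp.2]
  · refine integral_congr_ae ?_
    filter_upwards [hae] with p hp
    rw [fourier_sub_apply hp.1 hp.2]

end

end

/-! ### Fourier modes localised in time -/

section

open scoped ENNReal ComplexConjugate FourierTransform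

/-- Smooth functions with compact support in `(0,T)`. -/
structure IsCutoff (T : ℝ) (η : ℝ → ℝ) : Prop where
  contDiff : ContDiff ℝ ∞ η
  hasCompactSupport : HasCompactSupport η
  tsupport_subset : tsupport η ⊆ Ioo 0 T

theorem IsCutoff.deriv {T : ℝ} {η : ℝ → ℝ} (h : IsCutoff T η) : IsCutoff T (deriv η) where
  contDiff := (contDiff_infty_iff_deriv.1 h.contDiff).2
  hasCompactSupport := h.hasCompactSupport.deriv
  tsupport_subset := (tsupport_deriv_subset (𝕜 := ℝ) (f := η)).trans h.tsupport_subset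

theorem IsCutoff.exists_Icc {T : ℝ} {η : ℝ → ℝ} (h : IsCutoff T η) :
    ∃ a b : ℝ, 0 < a ∧ b < T ∧ ∀ t, η t ≠ 0 → t ∈ Icc a b := by
  rcases (tsupport η).eq_empty_or_nonempty with h0 | h0
  · exact ⟨1, T - 1, one_pos, by linarith, fun t ht => absurd (subset_tsupport η ht) (by simp [h0])⟩
  · have hc : IsCompact (tsupport η) := h.hasCompactSupport
    refine ⟨sInf (tsupport η), sSup (tsupport η), (h.tsupport_subset (hc.sInf_mem h0)).1,
      (h.tsupport_subset (hc.sSup_mem h0)).2, fun t ht => ?_⟩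
    exact ⟨csInf_le hc.bddBelow (subset_tsupport η ht), le_csSup hc.bddAbove (subset_tsupport η ht)⟩

theorem IsCutoff.exists_bound {T : ℝ} {η : ℝ → ℝ} (h : IsCutoff T η) : ∃ B : ℝ, ∀ t, ‖η t‖ ≤ B :=
  h.contDiff.continuous.bounded_above_of_compact_support h.hasCompactSupport

/-- A function of `(t,θ)` localised in time. -/
noncomputable def cut {d : ℕ} (W : ℝ → Sphere d → ℂ) (η : ℝ → ℝ) (p : ℝ × Sphere d) : ℂ :=
  (η p.1 : ℂ) * W p.1 p.2

/-- The Fourier transform in time of a function localised in time. -/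
noncomputable def timeFourier {d : ℕ} (W : ℝ → Sphere d → ℂ) (η : ℝ → ℝ) (p : ℝ × Sphere d) : ℂ :=
  𝓕 (fun t => cut W η (t, p.2)) p.1

/-- The Fourier modes in space of a solution, at frequency `ξ`. -/
structure IsFiber (d : ℕ) (k : ℝ → ℝ) (T : ℝ) (ξ : Space d) (m : ℝ) (W : ℝ → Sphere d → ℂ) :
    Prop where
  mass_nonneg : 0 ≤ m
  measurable : Measurable fun p : ℝ × Sphere d => W p.1 p.2
  mass : ∀ t, ∫⁻ θ, ‖W t θ‖ₑ ∂(surface d) ≤ ENNReal.ofReal m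
  square : ∀ a b, 0 < a → b < T → ∫⁻ t in Icc a b, ∫⁻ θ, ‖W t θ‖ₑ ^ 2 ∂(surface d) < ⊤
  equation : ∀ η, IsCutoff T η → ∀ τ, WeakScat d k (fun θ => timeFourier W η (τ, θ))
    (fun θ => Complex.I * ((symbol d τ ξ θ : ℂ) * timeFourier W η (τ, θ)) -
      timeFourier W (deriv η) (τ, θ))

/-- The squared norm at time `t`. -/
noncomputable def sqNorm {d : ℕ} (W : ℝ → Sphere d → ℂ) (t : ℝ) : ℝ :=
  ∫ θ, ‖W t θ‖ ^ 2 ∂(surface d)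

theorem sqNorm_nonneg {d : ℕ} (W : ℝ → Sphere d → ℂ) (t : ℝ) : 0 ≤ sqNorm W t :=
  integral_nonneg fun _ => sq_nonneg _

theorem ae_memLp_two_of_prod {α β : Type*} [MeasurableSpace α] [MeasurableSpace β] {μ : Measure α}
    {ν : Measure β} [SFinite ν] [SFinite μ] {F : α × β → ℂ} (hF : Measurable F)
    (h : MemLp F 2 (μ.prod ν)) : ∀ᵐ x ∂μ, MemLp (fun y => F (x, y)) 2 ν := by
  have h1 := (memLp_two_iff_lintegral h.1).1 h
  rw [lintegral_prod _ (hF.enorm.pow_const 2).aemeasurable] at h1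
  filter_upwards [ae_lt_top (hF.enorm.pow_const 2).lintegral_prod_right' h1.ne] with x hx
  exact (memLp_two_iff_lintegral (hF.comp measurable_prodMk_left).aestronglyMeasurable).2 hx

section

variable {d : ℕ} {s c₁ M : ℝ} {k e : ℝ → ℝ} {T : ℝ} {ξ : Space d} {m : ℝ} {W : ℝ → Sphere d → ℂ}

namespace IsFiber

theorem measurable_cut (h : IsFiber d k T ξ m W) {η : ℝ → ℝ} (hη : IsCutoff T η) :
    Measurable (cut W η) :=
  (Complex.measurable_ofReal.comp (hη.contDiff.continuous.measurable.comp measurable_fst)).mul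
    h.measurable

theorem measurable_apply (h : IsFiber d k T ξ m W) (t : ℝ) : Measurable (W t) :=
  h.measurable.comp measurable_prodMk_left

theorem measurable_timeFourier (h : IsFiber d k T ξ m W) {η : ℝ → ℝ} (hη : IsCutoff T η) :
    Measurable (timeFourier W η) := measurable_fourier_fst (h.measurable_cut hη)

theorem ae_integrable_cut (h : IsFiber d k T ξ m W) {η : ℝ → ℝ} (hη : IsCutoff T η) :
    ∀ᵐ θ ∂(surface d), Integrable fun t => cut W η (t, θ) := by
  have hm := h.measurable_cut hη
  have h1 : ∫⁻ p, ‖cut W η p‖ₑ ∂(volume.prod (surface d)) < ⊤ := by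
    rw [lintegral_prod _ hm.enorm.aemeasurable]
    calc _ ≤ ∫⁻ t, ‖η t‖ₑ * ENNReal.ofReal m := by
          refine lintegral_mono fun t => ?_
          simp only [cut, enorm_mul]
          rw [lintegral_const_mul _ (h.measurable_apply t).enorm]
          have : ‖((η t : ℝ) : ℂ)‖ₑ = ‖η t‖ₑ := by rw [← ofReal_norm, Complex.norm_real, ofReal_norm]
          rw [this]
          exact mul_le_mul_right (h.mass t) _
      _ < ⊤ := by
          rw [lintegral_mul_const _ hη.contDiff.continuous.measurable.enorm]
          exact ENNReal.mul_lt_top (hη.contDiff.continuous.integrable_of_hasCompactSupport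
            hη.hasCompactSupport).2 ENNReal.ofReal_lt_top
  rw [lintegral_prod_symm _ hm.enorm.aemeasurable] at h1
  filter_upwards [ae_lt_top hm.enorm.lintegral_prod_left' h1.ne] with θ hθ
  exact ⟨(hm.comp measurable_prodMk_right).aestronglyMeasurable, hθ⟩

theorem memLp_cut (h : IsFiber d k T ξ m W) {η : ℝ → ℝ} (hη : IsCutoff T η) :
    MemLp (cut W η) 2 (volume.prod (surface d)) := by
  have hm := h.measurable_cut hη
  rw [memLp_two_iff_lintegral hm.aestronglyMeasurable,
    lintegral_prod _ (hm.enorm.pow_const 2).aemeasurable]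
  obtain ⟨a, b, ha, hb, hab⟩ := hη.exists_Icc
  obtain ⟨B, hB⟩ := hη.exists_bound
  have hW := (h.measurable.enorm.pow_const 2).lintegral_prod_right' (ν := surface d)
  calc _ ≤ ∫⁻ t, (Icc a b).indicator (fun t => ENNReal.ofReal B ^ 2 *
        ∫⁻ θ, ‖W t θ‖ₑ ^ 2 ∂(surface d)) t := by
        refine lintegral_mono fun t => ?_
        by_cases ht : η t = 0
        · simp [cut, ht]
        · rw [indicator_of_mem (hab t ht)]
          simp only [cut, enorm_mul, mul_pow]
          rw [lintegral_const_mul _ ((h.measurable_apply t).enorm.pow_const 2)]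
          gcongr
          rw [← ofReal_norm, Complex.norm_real]
          exact ENNReal.ofReal_le_ofReal (hB t)
    _ = ENNReal.ofReal B ^ 2 * ∫⁻ t in Icc a b, ∫⁻ θ, ‖W t θ‖ₑ ^ 2 ∂(surface d) := by
        rw [lintegral_indicator measurableSet_Icc, lintegral_const_mul _ hW]
    _ < ⊤ := ENNReal.mul_lt_top (ENNReal.pow_lt_top ENNReal.ofReal_lt_top) (h.square a b ha hb)

theorem memLp_timeFourier (h : IsFiber d k T ξ m W) {η : ℝ → ℝ} (hη : IsCutoff T η) :
    MemLp (timeFourier W η) 2 (volume.prod (surface d)) :=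
  memLp_fourier_fst (h.measurable_cut hη) (h.ae_integrable_cut hη) (h.memLp_cut hη)

theorem integrable_sq_mul (h : IsFiber d k T ξ m W) {η : ℝ → ℝ} (hη : IsCutoff T η) :
    Integrable fun t => η t ^ 2 * sqNorm W t := by
  refine ((h.memLp_cut hη).integrable_norm_pow two_ne_zero).integral_prod_left.congr
    (ae_of_all _ fun t => ?_)
  simp only [cut, norm_mul, mul_pow, Complex.norm_real, Real.norm_eq_abs, sq_abs]
  rw [integral_const_mul, sqNorm]

theorem integral_sq_mul (h : IsFiber d k T ξ m W) {η : ℝ → ℝ} (hη : IsCutoff T η) :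
    ∫ p, ‖timeFourier W η p‖ ^ 2 ∂(volume.prod (surface d)) = ∫ t, η t ^ 2 * sqNorm W t := by
  rw [show timeFourier W η = fun p => 𝓕 (fun t => cut W η (t, p.2)) p.1 from rfl,
    integral_fourier_fst_sq (h.measurable_cut hη) (h.ae_integrable_cut hη),
    integral_prod _ ((h.memLp_cut hη).integrable_norm_pow two_ne_zero)]
  refine integral_congr_ae (ae_of_all _ fun t => ?_)
  simp only [cut, norm_mul, mul_pow, Complex.norm_real, Real.norm_eq_abs, sq_abs]
  rw [integral_const_mul, sqNorm]

theorem integrable_mul_conj_prod {F G : ℝ × Sphere d → ℂ}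
    (hG : MemLp G 2 (volume.prod (surface d))) (hF : MemLp F 2 (volume.prod (surface d))) :
    Integrable (fun p => (G p * conj (F p)).re) (volume.prod (surface d)) :=
  (MemLp.integrable_mul hG hF.star).re

theorem cut_mul_conj_re (W : ℝ → Sphere d → ℂ) (η ζ : ℝ → ℝ) (p : ℝ × Sphere d) :
    (cut W ζ p * conj (cut W η p)).re = η p.1 * ζ p.1 * ‖W p.1 p.2‖ ^ 2 := by
  have : cut W ζ p * conj (cut W η p) = ((η p.1 * ζ p.1 : ℝ) : ℂ) * (W p.1 p.2 * conj (W p.1 p.2)) := by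
    simp only [cut, map_mul, Complex.conj_ofReal]
    push_cast
    ring
  rw [this, Complex.mul_conj, Complex.normSq_eq_norm_sq, ← Complex.ofReal_mul, Complex.ofReal_re]

theorem integrable_mul (h : IsFiber d k T ξ m W) {η ζ : ℝ → ℝ} (hη : IsCutoff T η)
    (hζ : IsCutoff T ζ) : Integrable fun t => η t * ζ t * sqNorm W t := by
  refine (integrable_mul_conj_prod (h.memLp_cut hζ) (h.memLp_cut hη)).integral_prod_left.congr
    (ae_of_all _ fun t => ?_)
  simp only [cut_mul_conj_re]
  rw [integral_const_mul, sqNorm]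

theorem integral_mul (h : IsFiber d k T ξ m W) {η ζ : ℝ → ℝ} (hη : IsCutoff T η)
    (hζ : IsCutoff T ζ) :
    ∫ p, (timeFourier W ζ p * conj (timeFourier W η p)).re ∂(volume.prod (surface d)) =
      ∫ t, η t * ζ t * sqNorm W t := by
  have h1 := integral_re_fourier_fst_mul (h.measurable_cut hη) (h.measurable_cut hζ)
    (h.ae_integrable_cut hη) (h.ae_integrable_cut hζ) (h.memLp_cut hη) (h.memLp_cut hζ)
  refine h1.trans ?_
  rw [integral_prod _ (integrable_mul_conj_prod (h.memLp_cut hζ) (h.memLp_cut hη))]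
  refine integral_congr_ae (ae_of_all _ fun t => ?_)
  simp only [cut_mul_conj_re]
  rw [integral_const_mul, sqNorm]

theorem ae_memLp_timeFourier (h : IsFiber d k T ξ m W) {η : ℝ → ℝ} (hη : IsCutoff T η) :
    ∀ᵐ τ, MemLp (fun θ => timeFourier W η (τ, θ)) 2 (surface d) :=
  ae_memLp_two_of_prod (h.measurable_timeFourier hη) (h.memLp_timeFourier hη)

/-- The energy of the localised modes, before and after the Fourier transform. -/
theorem integral_energy (h : IsFiber d k T ξ m W) {η : ℝ → ℝ} (hη : IsCutoff T η) (μ : ℝ) :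
    (Integrable fun τ => energy d (annulus μ) fun θ => timeFourier W η (τ, θ)) ∧
    (Integrable fun t => η t ^ 2 * energy d (annulus μ) (W t)) ∧
    ∫ τ, energy d (annulus μ) (fun θ => timeFourier W η (τ, θ)) =
      ∫ t, η t ^ 2 * energy d (annulus μ) (W t) := by
  have hm := h.measurable_cut hη
  -- The annulus indicator equals its own square, so the energy is the squared `L²` norm of this
  -- family over pairs of directions, to which Plancherel in time applies.
  set G : ℝ × (Sphere d × Sphere d) → ℂ := fun q =>
    (annulus μ (gap q.2.1 q.2.2) : ℂ) * (cut W η (q.1, q.2.1) - cut W η (q.1, q.2.2)) with hG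
  have hann : Measurable fun q : ℝ × (Sphere d × Sphere d) => (annulus μ (gap q.2.1 q.2.2) : ℂ) :=
    Complex.measurable_ofReal.comp ((measurable_annulus_gap μ).comp measurable_snd)
  have hm1 : Measurable fun q : ℝ × (Sphere d × Sphere d) => cut W η (q.1, q.2.1) :=
    hm.comp (by fun_prop)
  have hm2 : Measurable fun q : ℝ × (Sphere d × Sphere d) => cut W η (q.1, q.2.2) :=
    hm.comp (by fun_prop)
  have hGm : Measurable G := hann.mul (hm1.sub hm2)
  have hae1 : ∀ᵐ p ∂((surface d).prod (surface d)), Integrable fun t => cut W η (t, p.1) :=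
    Measure.quasiMeasurePreserving_fst.ae (h.ae_integrable_cut hη)
  have hae2 : ∀ᵐ p ∂((surface d).prod (surface d)), Integrable fun t => cut W η (t, p.2) :=
    Measure.quasiMeasurePreserving_snd.ae (h.ae_integrable_cut hη)
  have hGi : ∀ᵐ p ∂((surface d).prod (surface d)), Integrable fun t => G (t, p) := by
    filter_upwards [hae1, hae2] with p h1 h2
    exact (h1.sub h2).const_mul (annulus μ (gap p.1 p.2) : ℂ)
  have h2 := (memLp_two_iff_lintegral hm.aestronglyMeasurable).1 (h.memLp_cut hη)
  rw [lintegral_prod _ (hm.enorm.pow_const 2).aemeasurable] at h2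
  have k1 : MemLp (fun q : ℝ × (Sphere d × Sphere d) => cut W η (q.1, q.2.1)) 2
      (volume.prod ((surface d).prod (surface d))) := by
    rw [memLp_two_iff_lintegral hm1.aestronglyMeasurable,
      lintegral_prod _ (hm1.enorm.pow_const 2).aemeasurable]
    have : ∀ t, ∫⁻ p : Sphere d × Sphere d, ‖cut W η (t, p.1)‖ₑ ^ 2 ∂((surface d).prod (surface d)) =
        (∫⁻ θ, ‖cut W η (t, θ)‖ₑ ^ 2 ∂(surface d)) * surface d univ := fun t => by
      have hmt : Measurable fun p : Sphere d × Sphere d => cut W η (t, p.1) := hm.comp (by fun_prop)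
      rw [lintegral_prod _ (hmt.enorm.pow_const 2).aemeasurable]
      simp only [lintegral_const]
      have hmt' : Measurable fun θ : Sphere d => cut W η (t, θ) := hm.comp (by fun_prop)
      rw [lintegral_mul_const _ (hmt'.enorm.pow_const 2)]
    simp only [this]
    rw [lintegral_mul_const _ (hm.enorm.pow_const 2).lintegral_prod_right']
    exact ENNReal.mul_lt_top h2 (measure_lt_top _ _)
  have k2 : MemLp (fun q : ℝ × (Sphere d × Sphere d) => cut W η (q.1, q.2.2)) 2
      (volume.prod ((surface d).prod (surface d))) := by
    rw [memLp_two_iff_lintegral hm2.aestronglyMeasurable,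
      lintegral_prod _ (hm2.enorm.pow_const 2).aemeasurable]
    have : ∀ t, ∫⁻ p : Sphere d × Sphere d, ‖cut W η (t, p.2)‖ₑ ^ 2 ∂((surface d).prod (surface d)) =
        (∫⁻ θ, ‖cut W η (t, θ)‖ₑ ^ 2 ∂(surface d)) * surface d univ := fun t => by
      have hmt : Measurable fun p : Sphere d × Sphere d => cut W η (t, p.2) := hm.comp (by fun_prop)
      rw [lintegral_prod _ (hmt.enorm.pow_const 2).aemeasurable]
      simp only [lintegral_const]
    simp only [this]
    rw [lintegral_mul_const _ (hm.enorm.pow_const 2).lintegral_prod_right']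
    exact ENNReal.mul_lt_top h2 (measure_lt_top _ _)
  have hG2 : MemLp G 2 (volume.prod ((surface d).prod (surface d))) :=
    (k1.sub k2).mul (memLp_top_of_bound hann.aestronglyMeasurable 1 (ae_of_all _ fun q => by
      rw [Complex.norm_real]; exact abs_annulus_le_one _ _))
  have hsq : ∀ w : ℝ, annulus μ w ^ 2 = annulus μ w := fun w => by
    rw [annulus, indicator]; split_ifs <;> simp
  have e1 : ∀ᵐ q : ℝ × (Sphere d × Sphere d) ∂(volume.prod ((surface d).prod (surface d))),
      ‖𝓕 (fun t => G (t, q.2)) q.1‖ ^ 2 = annulus μ (gap q.2.1 q.2.2) *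
        ‖timeFourier W η (q.1, q.2.1) - timeFourier W η (q.1, q.2.2)‖ ^ 2 := by
    filter_upwards [Measure.quasiMeasurePreserving_snd.ae (hae1.and hae2)] with q hq
    have : 𝓕 (fun t => G (t, q.2)) q.1 = (annulus μ (gap q.2.1 q.2.2) : ℂ) *
        𝓕 (fun t => cut W η (t, q.2.1) - cut W η (t, q.2.2)) q.1 := by
      simp only [Real.fourier_eq, hG, Circle.smul_def, smul_eq_mul,
        mul_left_comm _ (annulus μ (gap q.2.1 q.2.2) : ℂ)]
      rw [integral_const_mul]
    rw [this, fourier_sub_apply hq.1 hq.2, norm_mul, mul_pow, Complex.norm_real, Real.norm_eq_abs,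
      sq_abs, hsq]
    rfl
  have hFG := ((memLp_fourier_fst hGm hGi hG2).integrable_norm_pow two_ne_zero).congr e1
  have e2 : ∀ t, ∫ p, ‖G (t, p)‖ ^ 2 ∂((surface d).prod (surface d)) =
      η t ^ 2 * energy d (annulus μ) (W t) := by
    intro t
    rw [energy, ← integral_const_mul]
    congr 1
    ext p
    simp only [hG, cut]
    rw [← mul_sub, norm_mul, norm_mul, mul_pow, mul_pow, Complex.norm_real, Complex.norm_real,
      Real.norm_eq_abs, Real.norm_eq_abs, sq_abs, sq_abs, hsq]
    ring
  refine ⟨hFG.integral_prod_left, ?_, ?_⟩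
  · refine (hG2.integrable_norm_pow two_ne_zero).integral_prod_left.congr (ae_of_all _ e2)
  · have h3 := integral_fourier_fst_sq hGm hGi
    rw [integral_congr_ae e1, integral_prod _ hFG,
      integral_prod _ (hG2.integrable_norm_pow two_ne_zero)] at h3
    simp only [e2] at h3
    exact h3

end IsFiber

theorem integral_re_eq {f g : Sphere d → ℂ} (hf : MemLp f 2 (surface d))
    (hg : MemLp g 2 (surface d)) :
    ∫ θ, (g θ * conj (f θ)).re ∂(surface d) = (∫ θ, g θ * conj (f θ) ∂(surface d)).re :=
  integral_re (integrable_mul_conj hg hf)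

/-- The Nash inequality is applied at each time, where the `L¹` norm is at most `m`. The mass bound
lives in the time variable, whereas the dissipation is known after the Fourier transform in time;
`IsFiber.integral_energy` links the two. -/
theorem exists_nash_fiber (hd : 3 ≤ d) : ∃ c : ℝ, 0 < c ∧
    ∀ {k : ℝ → ℝ} {T : ℝ} {ξ : Space d} {m : ℝ} {W : ℝ → Sphere d → ℂ}, IsFiber d k T ξ m W →
      ∀ {η : ℝ → ℝ}, IsCutoff T η → ∀ μ ∈ Ioc (0 : ℝ) 1,
      c * μ ^ ((d : ℝ) - 1) * ∫ t, η t ^ 2 * sqNorm W t ≤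
        (∫ t, η t ^ 2 * energy d (annulus μ) (W t)) / 2 + m ^ 2 * ∫ t, η t ^ 2 := by
  obtain ⟨c, hc0, hc⟩ := exists_nash hd
  refine ⟨c, hc0, fun {k T ξ m W} h {η} hη μ hμ => ?_⟩
  have hη2 : Integrable fun t => η t ^ 2 := by
    simp only [sq]
    exact (hη.contDiff.continuous.mul hη.contDiff.continuous).integrable_of_hasCompactSupport
      hη.hasCompactSupport.mul_left
  have i2 := (h.integral_energy hη μ).2.1
  have i3 := (i2.div_const 2).add (hη2.const_mul (m ^ 2))
  have key : ∀ᵐ t, c * μ ^ ((d : ℝ) - 1) * (η t ^ 2 * sqNorm W t) ≤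
      η t ^ 2 * energy d (annulus μ) (W t) / 2 + m ^ 2 * η t ^ 2 := by
    filter_upwards [ae_memLp_two_of_prod (h.measurable_cut hη) (h.memLp_cut hη)] with t ht
    by_cases h0 : η t = 0
    · simp [h0]
    have hWt : MemLp (W t) 2 (surface d) := by
      have := ht.const_mul ((η t : ℂ)⁻¹)
      refine (memLp_congr_ae (ae_of_all _ fun θ => ?_)).1 this
      simp only [cut]
      rw [inv_mul_cancel_left₀ (by exact_mod_cast h0)]
    have h3 := hc hWt μ hμ
    have h4 : ∫ θ, ‖W t θ‖ ∂(surface d) ≤ m := by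
      rw [integral_norm_eq_lintegral_enorm hWt.1]
      exact ENNReal.toReal_le_of_le_ofReal h.mass_nonneg (h.mass t)
    have h5 : (∫ θ, ‖W t θ‖ ∂(surface d)) ^ 2 ≤ m ^ 2 :=
      pow_le_pow_left₀ (integral_nonneg fun _ => norm_nonneg _) h4 2
    have h6 := mul_le_mul_of_nonneg_left (h3.trans (add_le_add le_rfl h5)) (sq_nonneg (η t))
    rw [← sqNorm] at h6
    linarith
  have h7 := integral_mono_ae ((h.integrable_sq_mul hη).const_mul _) i3 key
  rw [integral_const_mul] at h7
  refine h7.trans (le_of_eq ?_)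
  rw [← integral_div, ← integral_const_mul, ← integral_add (i2.div_const 2) (hη2.const_mul _)]
  rfl

/-- The basic energy inequalities for the Fourier modes. -/
theorem IsKernel.exists_fiber_smoothing (hk : IsKernel d s c₁ M k e) : ∃ C : ℝ, 0 < C ∧
    ∀ {T : ℝ} {ξ : Space d} {m : ℝ} {W : ℝ → Sphere d → ℂ}, IsFiber d k T ξ m W →
      ∀ {η : ℝ → ℝ}, IsCutoff T η → 0 ≤ ∫ t, η t * deriv η t * sqNorm W t ∧
      ∀ μ ∈ Ioc (0 : ℝ) 1, ∫ t, η t ^ 2 * sqNorm W t ≤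
        C * μ ^ (2 * s) * ((∫ t, η t * deriv η t * sqNorm W t) + ∫ t, η t ^ 2 * sqNorm W t) +
          C * μ ^ (-((d : ℝ) - 1)) * m ^ 2 * ∫ t, η t ^ 2 := by
  obtain ⟨C, hC0, hC⟩ := hk.exists_resolvent_smoothing
  obtain ⟨c, hc0, hc⟩ := exists_nash_fiber hk.dim
  refine ⟨C / c + 1 / c, by positivity, fun {T ξ m W} h {η} hη => ?_⟩
  have hη' := hη.deriv
  have hint := IsFiber.integrable_mul_conj_prod (h.memLp_timeFourier hη') (h.memLp_timeFourier hη)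
  have e1 := h.integral_mul hη hη'
  rw [integral_prod _ hint] at e1
  have e2 := h.integral_sq_mul hη
  have hint2 := (h.memLp_timeFourier hη).integrable_norm_pow two_ne_zero
  rw [integral_prod _ hint2] at e2
  have hae : ∀ᵐ τ, 0 ≤ ∫ θ, (timeFourier W (deriv η) (τ, θ) * conj (timeFourier W η (τ, θ))).re
      ∂(surface d) ∧ ∀ μ ∈ Ioc (0 : ℝ) 1,
        energy d (annulus μ) (fun θ => timeFourier W η (τ, θ)) ≤ C * μ ^ (2 * s + ((d : ℝ) - 1)) *
          (∫ θ, (timeFourier W (deriv η) (τ, θ) * conj (timeFourier W η (τ, θ))).re ∂(surface d) +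
            ∫ θ, ‖timeFourier W η (τ, θ)‖ ^ 2 ∂(surface d)) := by
    filter_upwards [h.ae_memLp_timeFourier hη, h.ae_memLp_timeFourier hη'] with τ h1 h2
    rw [integral_re_eq h1 h2]
    exact hC (continuous_symbol τ ξ) h1 h2 (h.equation η hη τ)
  -- By Plancherel this integral is the total dissipation over all time frequencies. Its sign is the
  -- weak form of the monotonicity of the energy.
  have hpos : 0 ≤ ∫ t, η t * deriv η t * sqNorm W t := by
    rw [← e1]
    exact integral_nonneg_of_ae (hae.mono fun τ hτ => hτ.1)
  refine ⟨hpos, fun μ hμ => ?_⟩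
  obtain ⟨i1, i2, i3⟩ := h.integral_energy hη μ
  set X := ∫ t, η t * deriv η t * sqNorm W t with hX
  set Y := ∫ t, η t ^ 2 * sqNorm W t with hY
  have hY0 : 0 ≤ Y := integral_nonneg fun t => mul_nonneg (sq_nonneg _) (sqNorm_nonneg W t)
  have h1 : ∫ t, η t ^ 2 * energy d (annulus μ) (W t) ≤ C * μ ^ (2 * s + ((d : ℝ) - 1)) * (X + Y) := by
    rw [← i3, ← e1, ← e2, ← integral_add hint.integral_prod_left hint2.integral_prod_left,
      ← integral_const_mul]
    refine integral_mono_ae i1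
      ((hint.integral_prod_left.add hint2.integral_prod_left).const_mul _) ?_
    filter_upwards [hae] with τ hτ
    exact hτ.2 μ hμ
  have h2 := hc h hη μ hμ
  rw [← hY] at h2
  have hμd : 0 < μ ^ ((d : ℝ) - 1) := Real.rpow_pos_of_pos hμ.1 _
  have hμs : 0 < μ ^ (2 * s) := Real.rpow_pos_of_pos hμ.1 _
  have hN : 0 ≤ ∫ t, η t ^ 2 := integral_nonneg fun _ => sq_nonneg _
  rw [Real.rpow_add hμ.1] at h1
  rw [Real.rpow_neg hμ.1.le]
  have h3 : Y ≤ C / c * μ ^ (2 * s) * (X + Y) +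
      1 / c * (μ ^ ((d : ℝ) - 1))⁻¹ * m ^ 2 * ∫ t, η t ^ 2 := by
    rw [← mul_le_mul_iff_right₀ (mul_pos hc0 hμd)]
    have hXY : 0 ≤ C * (μ ^ (2 * s) * μ ^ ((d : ℝ) - 1)) * (X + Y) := by positivity
    calc c * μ ^ ((d : ℝ) - 1) * Y ≤ C * (μ ^ (2 * s) * μ ^ ((d : ℝ) - 1)) * (X + Y) +
          m ^ 2 * ∫ t, η t ^ 2 := by linarith
      _ = _ := by field_simp
  refine h3.trans ?_
  gcongr
  · have : 0 < 1 / c := by positivity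
    linarith
  · have : 0 < C / c := by positivity
    linarith

/-- The resolvent gain is uniform in `τ`, so it integrates over `τ` and returns to time by
Plancherel. -/
theorem IsKernel.exists_fiber_gain (hk : IsKernel d s c₁ M k e) : ∃ C ε₀ : ℝ, 0 < C ∧ 0 < ε₀ ∧
    ∀ {T : ℝ} {ξ : Space d} {m : ℝ} {W : ℝ → Sphere d → ℂ}, IsFiber d k T ξ m W →
      ∀ {ε : ℝ}, ε ∈ Ioc 0 ε₀ → ‖ξ‖ * (ε * (ε ^ (s / 2)) ^ 3) = 1 →
      ∀ {η : ℝ → ℝ}, IsCutoff T η →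
      ∫ t, η t ^ 2 * sqNorm W t ≤ C * (ε ^ s) ^ 2 * ∫ t, deriv η t ^ 2 * sqNorm W t := by
  obtain ⟨C, ε₀, hC0, hε₀, hC⟩ := hk.exists_resolvent_gain
  refine ⟨C, ε₀, hC0, hε₀, fun {T ξ m W} h {ε} hε hξ {η} hη => ?_⟩
  have hη' := hη.deriv
  have i1 := (h.memLp_timeFourier hη).integrable_norm_pow two_ne_zero
  have i2 := (h.memLp_timeFourier hη').integrable_norm_pow two_ne_zero
  rw [← h.integral_sq_mul hη, ← h.integral_sq_mul hη', integral_prod _ i1, integral_prod _ i2,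
    ← integral_const_mul]
  refine integral_mono_ae i1.integral_prod_left (i2.integral_prod_left.const_mul _) ?_
  filter_upwards [h.ae_memLp_timeFourier hη, h.ae_memLp_timeFourier hη'] with τ h1 h2
  exact hC hε hξ h1 h2 (h.equation η hη τ)

end

end

/-! ### Time cutoffs and decay of the modes in time -/

section

open scoped ENNReal

theorem exists_deriv_smoothTransition_le : ∃ D : ℝ, 0 < D ∧
    ∀ x, |deriv Real.smoothTransition x| ≤ D := by
  have hc : Continuous (deriv Real.smoothTransition) :=
    (Real.smoothTransition.contDiff (n := 1)).continuous_deriv le_rfl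
  obtain ⟨B, hB⟩ := (isCompact_Icc (a := (0 : ℝ)) (b := 1)).exists_bound_of_continuousOn hc.continuousOn
  refine ⟨max B 1, by positivity, fun x => ?_⟩
  by_cases hx : x ∈ Icc (0 : ℝ) 1
  · exact (hB x hx).trans (le_max_left _ _)
  · have : deriv Real.smoothTransition x = 0 := by
      rw [mem_Icc, not_and_or, not_le, not_le] at hx
      rcases hx with hx | hx
      · refine ((hasDerivAt_const x (0 : ℝ)).congr_of_eventuallyEq ?_).deriv
        filter_upwards [Iio_mem_nhds hx] with y hy using Real.smoothTransition.zero_of_nonpos hy.le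
      · refine ((hasDerivAt_const x (1 : ℝ)).congr_of_eventuallyEq ?_).deriv
        filter_upwards [Ioi_mem_nhds hx] with y hy using Real.smoothTransition.one_of_one_le hy.le
    rw [this, abs_zero]
    positivity

/-- A smooth function rising from `0` to `1` on `[a - ρ, a]` and falling on `[b, b + σ]`. -/
noncomputable def plateau (a ρ b σ t : ℝ) : ℝ :=
  Real.smoothTransition ((t - (a - ρ)) / ρ) * Real.smoothTransition ((b + σ - t) / σ)

section

variable {a b ρ σ t : ℝ}

theorem plateau_nonneg : 0 ≤ plateau a ρ b σ t :=
  mul_nonneg (Real.smoothTransition.nonneg _) (Real.smoothTransition.nonneg _)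

theorem plateau_le_one : plateau a ρ b σ t ≤ 1 :=
  mul_le_one₀ (Real.smoothTransition.le_one _) (Real.smoothTransition.nonneg _)
    (Real.smoothTransition.le_one _)

theorem contDiff_plateau : ContDiff ℝ ∞ (plateau a ρ b σ) :=
  (Real.smoothTransition.contDiff.comp ((contDiff_id.sub contDiff_const).div_const _)).mul
    (Real.smoothTransition.contDiff.comp ((contDiff_const.sub contDiff_id).div_const _))

theorem plateau_of_notMem (hρ : 0 < ρ) (hσ : 0 < σ) (h : t ∉ Icc (a - ρ) (b + σ)) :
    plateau a ρ b σ t = 0 := by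
  rw [mem_Icc, not_and_or, not_le, not_le] at h
  rcases h with h | h
  · rw [plateau, Real.smoothTransition.zero_of_nonpos
      (div_nonpos_of_nonpos_of_nonneg (by linarith) hρ.le), zero_mul]
  · rw [plateau, Real.smoothTransition.zero_of_nonpos (x := (b + σ - t) / σ)
      (div_nonpos_of_nonpos_of_nonneg (by linarith) hσ.le), mul_zero]

theorem plateau_of_le (hρ : 0 < ρ) (h : a ≤ t) :
    plateau a ρ b σ t = Real.smoothTransition ((b + σ - t) / σ) := by
  rw [plateau, Real.smoothTransition.one_of_one_le ((one_le_div hρ).2 (by linarith)), one_mul]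

theorem plateau_of_ge (hσ : 0 < σ) (h : t ≤ b) :
    plateau a ρ b σ t = Real.smoothTransition ((t - (a - ρ)) / ρ) := by
  rw [plateau, Real.smoothTransition.one_of_one_le (x := (b + σ - t) / σ)
    ((one_le_div hσ).2 (by linarith)), mul_one]

theorem plateau_of_mem (hρ : 0 < ρ) (hσ : 0 < σ) (h : t ∈ Icc a b) : plateau a ρ b σ t = 1 := by
  rw [plateau_of_le hρ h.1, Real.smoothTransition.one_of_one_le ((one_le_div hσ).2 (by linarith [h.2]))]

theorem isCutoff_plateau {T : ℝ} (hρ : 0 < ρ) (hσ : 0 < σ) (ha : 0 < a - ρ) (hb : b + σ < T) :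
    IsCutoff T (plateau a ρ b σ) := by
  have hsub : tsupport (plateau a ρ b σ) ⊆ Icc (a - ρ) (b + σ) :=
    closure_minimal (fun t ht => by_contra fun h => ht (plateau_of_notMem hρ hσ h)) isClosed_Icc
  exact ⟨contDiff_plateau, HasCompactSupport.intro isCompact_Icc fun t ht => plateau_of_notMem hρ hσ ht,
    hsub.trans fun t ht => ⟨ha.trans_le ht.1, ht.2.trans_lt hb⟩⟩

theorem deriv_plateau_of_notMem (hρ : 0 < ρ) (hσ : 0 < σ) (h : t ∉ Icc (a - ρ) (b + σ)) :
    deriv (plateau a ρ b σ) t = 0 := by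
  refine ((hasDerivAt_const t (0 : ℝ)).congr_of_eventuallyEq ?_).deriv
  filter_upwards [isClosed_Icc.isOpen_compl.mem_nhds h] with y hy using plateau_of_notMem hρ hσ hy

theorem exists_deriv_plateau_le : ∃ D : ℝ, 0 < D ∧ ∀ {a b ρ σ : ℝ}, 0 < ρ → 0 < σ → ∀ t,
    |deriv (plateau a ρ b σ) t| ≤ D / ρ + D / σ := by
  obtain ⟨D, hD0, hD⟩ := exists_deriv_smoothTransition_le
  refine ⟨D, hD0, fun {a b ρ σ} hρ hσ t => ?_⟩
  have hS : ∀ x, HasDerivAt Real.smoothTransition (deriv Real.smoothTransition x) x := fun x =>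
    ((Real.smoothTransition.contDiff (n := 1)).differentiable one_ne_zero x).hasDerivAt
  have h1 : HasDerivAt (fun t => Real.smoothTransition ((t - (a - ρ)) / ρ))
      (deriv Real.smoothTransition ((t - (a - ρ)) / ρ) * (1 / ρ)) t :=
    (hS _).comp t (((hasDerivAt_id t).sub_const _).div_const _)
  have h2 : HasDerivAt (fun t => Real.smoothTransition ((b + σ - t) / σ))
      (deriv Real.smoothTransition ((b + σ - t) / σ) * (-1 / σ)) t :=
    (hS _).comp t (((hasDerivAt_id t).const_sub _).div_const _)
  have h3 : deriv (plateau a ρ b σ) t = _ := (h1.mul h2).deriv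
  rw [h3]
  refine (abs_add_le _ _).trans (add_le_add ?_ ?_)
  · rw [abs_mul, abs_mul, abs_of_pos (by positivity : 0 < 1 / ρ),
      abs_of_nonneg (Real.smoothTransition.nonneg _)]
    calc _ ≤ D * (1 / ρ) * 1 := by
          gcongr
          · exact Real.smoothTransition.nonneg _
          · exact hD _
          · exact Real.smoothTransition.le_one _
      _ = _ := by ring
  · rw [abs_mul, abs_mul, abs_div, abs_neg, abs_one, abs_of_pos hσ,
      abs_of_nonneg (Real.smoothTransition.nonneg _)]
    calc _ ≤ 1 * (D * (1 / σ)) := by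
          gcongr
          · exact Real.smoothTransition.le_one _
          · exact hD _
      _ = _ := by ring

end

/-- Unrolling the recursion, the source terms form a geometric series of ratio `κR ≤ 1/2`, hence the
factor `2`, and the uniform bound makes the residual `κⁿ f(n)` vanish. -/
theorem le_of_absorb {f : ℕ → ℝ} {κ R A B : ℝ} (hκ0 : 0 ≤ κ) (hκ : κ ≤ 1 / 2) (hR0 : 0 ≤ R)
    (hκR : κ * R ≤ 1 / 2) (hA : 0 ≤ A) (hB : ∀ n, f n ≤ B) (hB0 : 0 ≤ B)
    (h : ∀ n, f n ≤ κ * f (n + 1) + A * R ^ n) :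
    f 0 ≤ 2 * A := by
  have key : ∀ n, f 0 ≤ κ ^ n * f n + A * (2 - 2 * (1 / 2) ^ n) := by
    intro n
    induction n with
    | zero => simp
    | succ n ih =>
      have h1 := mul_le_mul_of_nonneg_left (h n) (pow_nonneg hκ0 n)
      have h2 : (κ * R) ^ n ≤ (1 / 2) ^ n := pow_le_pow_left₀ (by positivity) hκR n
      have h3 := mul_le_mul_of_nonneg_left h2 hA
      rw [mul_pow] at h3
      rw [pow_succ, pow_succ]
      linarith
  have h1 : ∀ n : ℕ, f 0 ≤ (1 / 2) ^ n * B + 2 * A := by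
    intro n
    have h2 : κ ^ n * f n ≤ (1 / 2) ^ n * B :=
      (mul_le_mul_of_nonneg_left (hB n) (pow_nonneg hκ0 n)).trans
        (mul_le_mul_of_nonneg_right (pow_le_pow_left₀ hκ0 hκ n) hB0)
    have h3 : 0 ≤ A * (1 / 2) ^ n := by positivity
    linarith [key n]
  have h2 : Tendsto (fun n : ℕ => (1 / 2 : ℝ) ^ n * B + 2 * A) atTop (𝓝 (0 * B + 2 * A)) :=
    ((tendsto_pow_atTop_nhds_zero_of_lt_one (by norm_num) (by norm_num)).mul_const B).add_const _
  rw [zero_mul, zero_add] at h2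
  exact ge_of_tendsto' h2 h1

section

variable {d : ℕ} {s c₁ M : ℝ} {k e : ℝ → ℝ} {T : ℝ} {ξ : Space d} {m : ℝ} {W : ℝ → Sphere d → ℂ}

theorem IsFiber.integrableOn_sqNorm (h : IsFiber d k T ξ m W) {a b : ℝ} (ha : 0 < a) (hb : b < T) :
    IntegrableOn (sqNorm W) (Icc a b) := by
  have hσ : 0 < (T - b) / 2 := by linarith
  have hc := isCutoff_plateau (T := T) (a := a) (b := b) (ρ := a / 2) (σ := (T - b) / 2) (by linarith)
    hσ (by linarith) (by linarith)
  refine (h.integrable_sq_mul hc).integrableOn.congr_fun (fun t ht => ?_) measurableSet_Icc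
  simp only
  rw [plateau_of_mem (by linarith) hσ ht, one_pow, one_mul]

theorem IsFiber.integral_le_integral_sq (h : IsFiber d k T ξ m W) {a b ρ : ℝ} (hρ : 0 < ρ)
    (ha : 0 < a - ρ) (hb : b + ρ < T) :
    ∫ t in Icc a b, sqNorm W t ≤ ∫ t, plateau a ρ b ρ t ^ 2 * sqNorm W t := by
  have hc := isCutoff_plateau (T := T) hρ hρ ha hb
  rw [← integral_indicator measurableSet_Icc]
  refine integral_mono ((h.integrableOn_sqNorm (by linarith) (by linarith)).integrable_indicator
    measurableSet_Icc) (h.integrable_sq_mul hc) fun t => ?_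
  by_cases ht : t ∈ Icc a b
  · rw [indicator_of_mem ht, plateau_of_mem hρ hρ ht, one_pow, one_mul]
  · rw [indicator_of_notMem ht]
    exact mul_nonneg (sq_nonneg _) (sqNorm_nonneg W t)

/-- Only an upper bound on `g` is needed, because `sqNorm` is nonnegative; the weight `η η'` may
take both signs. -/
theorem IsFiber.integral_mul_le (h : IsFiber d k T ξ m W) {a b : ℝ} (ha : 0 < a) (hb : b < T)
    {g : ℝ → ℝ} {B : ℝ} (hg : Integrable fun t => g t * sqNorm W t) (hB : ∀ t, g t ≤ B)
    (h0 : ∀ t, t ∉ Icc a b → g t = 0) :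
    ∫ t, g t * sqNorm W t ≤ B * ∫ t in Icc a b, sqNorm W t := by
  rw [← integral_const_mul, ← integral_indicator measurableSet_Icc]
  refine integral_mono hg ((integrable_indicator_iff measurableSet_Icc).2
    ((h.integrableOn_sqNorm ha hb).const_mul B)) fun t => ?_
  by_cases ht : t ∈ Icc a b
  · rw [indicator_of_mem ht]
    exact mul_le_mul_of_nonneg_right (hB t) (sqNorm_nonneg W t)
  · simp only [indicator_of_notMem ht, h0 t ht, zero_mul, le_refl]

/-- Decay in time of the modes. -/
theorem IsKernel.exists_fiber_decay (hk : IsKernel d s c₁ M k e) : ∃ C : ℝ, 0 < C ∧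
    ∀ {T : ℝ} {ξ : Space d} {m : ℝ} {W : ℝ → Sphere d → ℂ}, IsFiber d k T ξ m W →
      ∀ {a b ρ : ℝ}, 0 < ρ → ρ ≤ 1 → 0 < a - ρ → a ≤ b → b + ρ < T →
      ∫ t in Icc a b, sqNorm W t ≤
        C * m ^ 2 * ρ ^ (-(((d : ℝ) - 1) / (2 * s))) * (b - a + 2 * ρ) := by
  obtain ⟨C, hC0, hC⟩ := hk.exists_fiber_smoothing
  obtain ⟨D, hD0, hD⟩ := exists_deriv_plateau_le
  have hs := hk.s_pos
  have hd := hk.dim_real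
  set q := ((d : ℝ) - 1) / (2 * s) with hq
  have hq0 : 0 < q := div_pos (by linarith) (by linarith)
  -- Halving the margin at each step multiplies the source by `2^q`; this choice gives `κ·2^q =
  -- 1/2`, as absorption requires.
  set κ : ℝ := 2 ^ (-(q + 1)) with hκ
  have hκ0 : 0 < κ := by positivity
  have hκ1 : κ ≤ 1 / 2 := by
    rw [hκ, show (1 / 2 : ℝ) = 2 ^ (-1 : ℝ) by rw [Real.rpow_neg_one]; norm_num]
    exact Real.rpow_le_rpow_of_exponent_le (by norm_num) (by linarith)
  set C' := (C + 1) * (2 * D + 1) with hC'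
  have hC'1 : 1 ≤ C' := by
    rw [hC']; nlinarith [mul_pos hC0 hD0]
  refine ⟨2 * (C * (κ / C') ^ (-q) * 2 ^ q), by positivity,
    fun {T ξ m W} h {a b ρ} hρ hρ1 ha hab hb => ?_⟩
  have hm := h.mass_nonneg
  -- one step
  have step : ∀ a b ρ : ℝ, 0 < ρ → ρ ≤ 1 → 0 < a - ρ → a ≤ b → b + ρ < T →
      ∫ t in Icc a b, sqNorm W t ≤ κ * (∫ t in Icc (a - ρ) (b + ρ), sqNorm W t) +
        C * (κ / C') ^ (-q) * m ^ 2 * ρ ^ (-q) * (b - a + 2 * ρ) := by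
    intro a b ρ hρ hρ1 ha hab hb
    have hc := isCutoff_plateau (T := T) hρ hρ ha hb
    -- The scale is chosen with `μ^(2s)` proportional to `ρ`, so that `μ^(2s)` times the size `2D/ρ`
    -- of the cutoff derivative is small. The price `μ^(-(d-1))` in the mass term is then a multiple
    -- of `ρ^(-q)`.
    set μ : ℝ := (κ / C' * ρ) ^ (1 / (2 * s)) with hμ
    have hx : 0 < κ / C' * ρ := by positivity
    have hμ0 : 0 < μ := Real.rpow_pos_of_pos hx _
    have hμ1 : μ ≤ 1 := by
      refine Real.rpow_le_one hx.le ?_ (by positivity)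
      have h1 : κ / C' ≤ 1 := (div_le_one (by linarith)).2 (by linarith)
      exact mul_le_one₀ h1 hρ.le hρ1
    have hμs : μ ^ (2 * s) = κ / C' * ρ := by
      rw [hμ, ← Real.rpow_mul hx.le, one_div_mul_cancel (by positivity), Real.rpow_one]
    have hμd : μ ^ (-((d : ℝ) - 1)) = (κ / C') ^ (-q) * ρ ^ (-q) := by
      rw [hμ, ← Real.rpow_mul hx.le, ← Real.mul_rpow (by positivity) hρ.le]
      congr 1
      rw [hq]; field_simp
    have h1 := (hC h hc).2 μ ⟨hμ0, hμ1⟩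
    rw [hμs, hμd] at h1
    set J := ∫ t in Icc (a - ρ) (b + ρ), sqNorm W t with hJ
    have hJ0 : 0 ≤ J := integral_nonneg fun t => sqNorm_nonneg W t
    have h2 : ∫ t, plateau a ρ b ρ t * deriv (plateau a ρ b ρ) t * sqNorm W t ≤ 2 * D / ρ * J := by
      refine h.integral_mul_le ha hb (h.integrable_mul hc hc.deriv) (fun t => ?_)
        (fun t ht => by rw [plateau_of_notMem hρ hρ ht, zero_mul])
      have e1 := hD (a := a) (b := b) hρ hρ t
      have e2 : D / ρ + D / ρ = 2 * D / ρ := by ring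
      rw [e2] at e1
      calc _ ≤ |plateau a ρ b ρ t * deriv (plateau a ρ b ρ) t| := le_abs_self _
        _ ≤ 1 * (2 * D / ρ) := by
            rw [abs_mul, abs_of_nonneg plateau_nonneg]
            exact mul_le_mul plateau_le_one e1 (abs_nonneg _) zero_le_one
        _ = _ := one_mul _
    have h3 : ∫ t, plateau a ρ b ρ t ^ 2 * sqNorm W t ≤ 1 * J :=
      h.integral_mul_le ha hb (h.integrable_sq_mul hc) (fun t => pow_le_one₀ plateau_nonneg plateau_le_one)
        (fun t ht => by rw [plateau_of_notMem hρ hρ ht]; norm_num)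
    have h4 : ∫ t, plateau a ρ b ρ t ^ 2 ≤ b - a + 2 * ρ := by
      have e1 : ∫ t, (Icc (a - ρ) (b + ρ)).indicator (1 : ℝ → ℝ) t = b - a + 2 * ρ := by
        rw [integral_indicator_one measurableSet_Icc, Real.volume_real_Icc_of_le (by linarith)]
        ring
      rw [← e1]
      refine integral_mono_of_nonneg (ae_of_all _ fun t => sq_nonneg _)
        ((integrable_indicator_iff measurableSet_Icc).2 (integrableOn_const (by simp)))
        (ae_of_all _ fun t => ?_)
      by_cases ht : t ∈ Icc (a - ρ) (b + ρ)
      · simp only [indicator_of_mem ht, Pi.one_apply]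
        exact pow_le_one₀ plateau_nonneg plateau_le_one
      · simp only [indicator_of_notMem ht, plateau_of_notMem hρ hρ ht]
        norm_num
    refine (h.integral_le_integral_sq hρ ha hb).trans (h1.trans (add_le_add ?_ ?_))
    · have e1 : C * (κ / C' * ρ) * (2 * D / ρ * J + 1 * J) ≤ κ * J := by
        have : C * (κ / C' * ρ) * (2 * D / ρ * J + 1 * J) =
          κ * (C * (2 * D + ρ) / C') * J := by field_simp
        rw [this]
        have h5 : C * (2 * D + ρ) / C' ≤ 1 := by
          rw [div_le_one (by linarith), hC']
          exact mul_le_mul (by linarith) (by linarith) (by positivity) (by linarith)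
        have := mul_le_mul_of_nonneg_left h5 hκ0.le
        rw [mul_one] at this
        exact mul_le_mul_of_nonneg_right this hJ0
      refine le_trans (mul_le_mul_of_nonneg_left (add_le_add h2 h3) (by positivity)) e1
    · calc _ ≤ C * ((κ / C') ^ (-q) * ρ ^ (-q)) * m ^ 2 * (b - a + 2 * ρ) := by gcongr
        _ = _ := by ring
  -- iteration
  set f : ℕ → ℝ := fun n => ∫ t in Icc (a - ρ * (1 - (1 / 2) ^ n)) (b + ρ * (1 - (1 / 2) ^ n)),
    sqNorm W t with hf
  have hpow : ∀ n : ℕ, 0 < (1 / 2 : ℝ) ^ n ∧ (1 / 2 : ℝ) ^ n ≤ 1 := fun n =>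
    ⟨by positivity, pow_le_one₀ (by norm_num) (by norm_num)⟩
  have hlow : ∀ n : ℕ, 0 ≤ ρ * (1 - (1 / 2) ^ n) ∧ ρ * (1 - (1 / 2) ^ n) ≤ ρ := fun n =>
    ⟨mul_nonneg hρ.le (by linarith [(hpow n).2]),
      mul_le_of_le_one_right hρ.le (by linarith [(hpow n).1])⟩
  -- Step `n` enlarges the interval by `ρ/2^(n+1)` on each side, so the total enlargement stays
  -- below `ρ` and all integrals are bounded by the one over the largest interval, which is finite
  -- by square integrability.
  have hconv := le_of_absorb (f := f) (κ := κ) (R := 2 ^ q)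
    (A := C * (κ / C') ^ (-q) * 2 ^ q * m ^ 2 * ρ ^ (-q) * (b - a + 2 * ρ))
    (B := ∫ t in Icc (a - ρ) (b + ρ), sqNorm W t) hκ0.le hκ1 (by positivity) ?_ ?_ ?_ ?_ ?_
  · have e0 : f 0 = ∫ t in Icc a b, sqNorm W t := by simp [hf]
    rw [e0] at hconv
    refine hconv.trans (le_of_eq ?_)
    ring
  · rw [hκ, ← Real.rpow_add (by norm_num), show -(q + 1) + q = -1 by ring, Real.rpow_neg_one]
    norm_num
  · have : 0 ≤ b - a + 2 * ρ := by linarith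
    positivity
  · intro n
    refine setIntegral_mono_set (h.integrableOn_sqNorm ha hb) (ae_of_all _ fun t => sqNorm_nonneg W t)
      (Icc_subset_Icc ?_ ?_).eventuallyLE <;> linarith [(hlow n).2]
  · exact integral_nonneg fun t => sqNorm_nonneg W t
  · intro n
    have hn := hlow n
    have hn' := hlow (n + 1)
    have e1 : ρ * (1 / 2) ^ (n + 1) ≤ 1 := mul_le_one₀ hρ1 (hpow _).1.le (hpow _).2
    have e2 : ρ * (1 - (1 / 2) ^ n) + ρ * (1 / 2) ^ (n + 1) = ρ * (1 - (1 / 2) ^ (n + 1)) := by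
      rw [pow_succ]; ring
    have h1 := step (a - ρ * (1 - (1 / 2) ^ n)) (b + ρ * (1 - (1 / 2) ^ n)) (ρ * (1 / 2) ^ (n + 1))
      (by positivity) e1 (by linarith) (by linarith) (by linarith)
    have e3 : a - ρ * (1 - (1 / 2) ^ n) - ρ * (1 / 2) ^ (n + 1) = a - ρ * (1 - (1 / 2) ^ (n + 1)) := by
      linarith
    have e4 : b + ρ * (1 - (1 / 2) ^ n) + ρ * (1 / 2) ^ (n + 1) = b + ρ * (1 - (1 / 2) ^ (n + 1)) := by
      linarith
    rw [e3, e4] at h1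
    refine h1.trans (add_le_add le_rfl ?_)
    have e5 : (ρ * (1 / 2) ^ (n + 1)) ^ (-q) = ρ ^ (-q) * (2 ^ q * (2 ^ q) ^ n) := by
      have : ((1 / 2 : ℝ) ^ (n + 1)) ^ (-q) = (2 ^ q) ^ (n + 1) := by
        rw [one_div, inv_pow, Real.inv_rpow (by positivity), Real.rpow_neg (by positivity), inv_inv,
          ← Real.rpow_natCast, ← Real.rpow_natCast, ← Real.rpow_mul (by norm_num),
          ← Real.rpow_mul (by norm_num), mul_comm q]
      rw [Real.mul_rpow hρ.le (hpow _).1.le, this, pow_succ']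
    rw [e5]
    have e6 : b + ρ * (1 - (1 / 2) ^ n) - (a - ρ * (1 - (1 / 2) ^ n)) + 2 * (ρ * (1 / 2) ^ (n + 1)) ≤
        b - a + 2 * ρ := by linarith
    calc _ ≤ C * (κ / C') ^ (-q) * m ^ 2 * (ρ ^ (-q) * (2 ^ q * (2 ^ q) ^ n)) * (b - a + 2 * ρ) := by
          gcongr
      _ = _ := by ring

end

end

/-! ### Decay in frequency and summation over frequencies -/

section

open scoped ENNReal

section

variable {d : ℕ} {s c₁ M : ℝ} {k e : ℝ → ℝ}

/-- The gain is used `j` times, each time enlarging the interval by `ρ/j`. One step costs the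
squared derivative of a cutoff, at most `(2Dj/ρ)²`, and earns `(ε^s)²`. -/
theorem IsKernel.exists_fiber_gain_pow (hk : IsKernel d s c₁ M k e) {j : ℕ} (hj : 0 < j) :
    ∃ C ε₀ : ℝ, 0 < C ∧ 0 < ε₀ ∧
    ∀ {T : ℝ} {ξ : Space d} {m : ℝ} {W : ℝ → Sphere d → ℂ}, IsFiber d k T ξ m W →
      ∀ {a b ρ ε : ℝ}, 0 < ρ → 0 < a - ρ → b + ρ < T → ε ∈ Ioc 0 ε₀ →
      ‖ξ‖ * (ε * (ε ^ (s / 2)) ^ 3) = 1 →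
      ∫ t in Icc a b, sqNorm W t ≤
        C * ((ε ^ s / ρ) ^ 2) ^ j * ∫ t in Icc (a - ρ) (b + ρ), sqNorm W t := by
  obtain ⟨C, ε₀, hC0, hε₀, hC⟩ := hk.exists_fiber_gain
  obtain ⟨D, hD0, hD⟩ := exists_deriv_plateau_le
  have hj' : (0 : ℝ) < j := by exact_mod_cast hj
  refine ⟨(C * (2 * D * j) ^ 2) ^ j, ε₀, by positivity, hε₀,
    fun {T ξ m W} h {a b ρ ε} hρ ha hb hε hξ => ?_⟩
  have step : ∀ a b ρ : ℝ, 0 < ρ → 0 < a - ρ → b + ρ < T →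
      ∫ t in Icc a b, sqNorm W t ≤
        C * (ε ^ s) ^ 2 * (2 * D / ρ) ^ 2 * ∫ t in Icc (a - ρ) (b + ρ), sqNorm W t := by
    intro a b ρ hρ ha hb
    have hc := isCutoff_plateau (T := T) hρ hρ ha hb
    refine (h.integral_le_integral_sq hρ ha hb).trans ((hC h hε hξ hc).trans ?_)
    rw [mul_assoc (C * (ε ^ s) ^ 2)]
    refine mul_le_mul_of_nonneg_left (h.integral_mul_le ha hb (h.integrable_sq_mul hc.deriv)
      (fun t => ?_) (fun t ht => by rw [deriv_plateau_of_notMem hρ hρ ht]; norm_num)) (by positivity)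
    have e1 := hD (a := a) (b := b) hρ hρ t
    rw [← sq_abs]
    refine pow_le_pow_left₀ (abs_nonneg _) (e1.trans (le_of_eq ?_)) 2
    ring
  set σ := ρ / j with hσ
  have hσ0 : 0 < σ := by positivity
  set A := C * (ε ^ s) ^ 2 * (2 * D / σ) ^ 2 with hA
  have hA0 : 0 ≤ A := by positivity
  have key : ∀ n : ℕ, n ≤ j → ∫ t in Icc a b, sqNorm W t ≤
      A ^ n * ∫ t in Icc (a - n * σ) (b + n * σ), sqNorm W t := by
    intro n hn
    induction n with
    | zero => simp
    | succ n ih =>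
      have h1 : ((n + 1 : ℕ) : ℝ) * σ ≤ ρ := by
        calc _ ≤ (j : ℝ) * σ := by gcongr
          _ = ρ := by rw [hσ]; field_simp
      push_cast at h1 ⊢
      have h2 := step (a - n * σ) (b + n * σ) σ hσ0 (by linarith) (by linarith)
      rw [show a - n * σ - σ = a - (n + 1) * σ by ring,
        show b + n * σ + σ = b + (n + 1) * σ by ring] at h2
      refine (ih (by omega)).trans ((mul_le_mul_of_nonneg_left h2 (pow_nonneg hA0 n)).trans ?_)
      rw [pow_succ A, hA]
      refine le_of_eq ?_
      ring
  have h1 := key j le_rfl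
  have h2 : (j : ℝ) * σ = ρ := by rw [hσ]; field_simp
  rw [h2] at h1
  refine h1.trans (le_of_eq ?_)
  congr 1
  rw [← mul_pow, hA, hσ]
  congr 1
  field_simp

/-- Decay of the modes in time and frequency. -/
theorem IsKernel.exists_fiber_decay_frequency (hk : IsKernel d s c₁ M k e) {j : ℕ} (hj : 0 < j) :
    ∃ C : ℝ, 0 < C ∧
    ∀ {T : ℝ} {ξ : Space d} {m : ℝ} {W : ℝ → Sphere d → ℂ}, IsFiber d k T ξ m W →
      ∀ {a b ρ : ℝ}, 0 < ρ → ρ ≤ 1 → 0 < a - 2 * ρ → a ≤ b → b + 2 * ρ < T →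
      ∫ t in Icc a b, sqNorm W t ≤
        C * m ^ 2 * ρ ^ (-(((d : ℝ) - 1) / (2 * s))) * (b - a + 4 * ρ) *
          (1 + ρ ^ (1 / s + 3 / 2) * ‖ξ‖) ^ (-(2 * j / (1 / s + 3 / 2))) := by
  obtain ⟨C₁, hC₁0, hC₁⟩ := hk.exists_fiber_decay
  obtain ⟨C₂, ε₀, hC₂0, hε₀, hC₂⟩ := hk.exists_fiber_gain_pow hj
  have hs := hk.s_pos
  set l := 1 / s + 3 / 2 with hl
  have hl0 : 0 < l := by positivity
  set r := 2 * j / l with hr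
  have hr0 : 0 ≤ r := by positivity
  set R := max ((ε₀ ^ (s * l))⁻¹) 1 with hR
  have hR0 : 0 < R := by positivity
  refine ⟨C₁ * (1 + R) ^ r + C₁ * C₂ * 2 ^ r, by positivity,
    fun {T ξ m W} h {a b ρ} hρ hρ1 ha hab hb => ?_⟩
  set q := ((d : ℝ) - 1) / (2 * s) with hq
  set X := ρ ^ l * ‖ξ‖ with hX
  have hX0 : 0 ≤ X := by positivity
  set P := m ^ 2 * ρ ^ (-q) * (b - a + 4 * ρ) with hP
  have hP0 : 0 ≤ P := by
    have : 0 ≤ b - a + 4 * ρ := by linarith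
    positivity
  have hbig : ∫ t in Icc (a - ρ) (b + ρ), sqNorm W t ≤ C₁ * P := by
    refine (hC₁ h hρ hρ1 (by linarith) (by linarith) (by linarith)).trans (le_of_eq ?_)
    rw [hP]; ring
  have hsm : ∫ t in Icc a b, sqNorm W t ≤ C₁ * P := by
    refine le_trans ?_ hbig
    exact setIntegral_mono_set (h.integrableOn_sqNorm (by linarith) (by linarith))
      (ae_of_all _ fun t => sqNorm_nonneg W t)
      (Icc_subset_Icc (by linarith) (by linarith)).eventuallyLE
  have hgoal : ∫ t in Icc a b, sqNorm W t ≤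
      (C₁ * (1 + R) ^ r + C₁ * C₂ * 2 ^ r) * P * (1 + X) ^ (-r) := by
    rw [Real.rpow_neg (by positivity), ← div_eq_mul_inv, le_div_iff₀ (by positivity)]
    -- At bounded rescaled frequency `X = ρ^l‖ξ‖` the decay in time alone suffices. Otherwise `ρ ≤
    -- 1` makes `‖ξ‖` large enough for the corresponding `ε` to lie below `ε₀`.
    by_cases hXR : X ≤ R
    · calc _ ≤ C₁ * P * (1 + R) ^ r := by gcongr
        _ ≤ _ := by
          have : 0 ≤ C₁ * C₂ * 2 ^ r * P := by positivity
          linarith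
    · push Not at hXR
      have hX1 : 1 < X := (le_max_right _ _).trans_lt hXR
      have hξX : X ≤ ‖ξ‖ :=
        mul_le_of_le_one_left (norm_nonneg _) (Real.rpow_le_one hρ.le hρ1 hl0.le)
      have hξ0 : 0 < ‖ξ‖ := by linarith
      have hξ1 : (ε₀ ^ (s * l))⁻¹ ≤ ‖ξ‖ := (le_max_left _ _).trans (hXR.le.trans hξX)
      -- Since `s l = 1 + 3s/2`, this is the solution of the balance `‖ξ‖ ε^(1+3s/2) = 1`.
      set ε := ‖ξ‖ ^ (-(1 / (s * l))) with hε
      have hsl : 0 < s * l := by positivity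
      have hε0 : 0 < ε := Real.rpow_pos_of_pos hξ0 _
      have hεle : ε ≤ ε₀ := by
        have h1 : ‖ξ‖⁻¹ ≤ ε₀ ^ (s * l) := inv_le_of_inv_le₀ (by positivity) hξ1
        have h2 := Real.rpow_le_rpow (by positivity) h1 (z := 1 / (s * l)) (by positivity)
        rw [← Real.rpow_mul hε₀.le, mul_one_div_cancel hsl.ne', Real.rpow_one,
          Real.inv_rpow hξ0.le, ← Real.rpow_neg hξ0.le] at h2
        exact h2
      have hεξ : ‖ξ‖ * (ε * (ε ^ (s / 2)) ^ 3) = 1 := by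
        have h1 : ε * (ε ^ (s / 2)) ^ 3 = ε ^ (s * l) := by
          rw [← Real.rpow_natCast, ← Real.rpow_mul hε0.le]
          nth_rewrite 1 [← Real.rpow_one ε]
          rw [← Real.rpow_add hε0]
          congr 1
          rw [hl]; push_cast; field_simp
        rw [h1, hε, ← Real.rpow_mul hξ0.le, neg_mul, one_div_mul_cancel hsl.ne', Real.rpow_neg_one,
          mul_inv_cancel₀ hξ0.ne']
      -- Here `ε^s = ‖ξ‖^(-1/l)`, so `ε^s/ρ = X^(-1/l)`: time resolution and frequency enter only
      -- through `X`.
      have hεX : ((ε ^ s / ρ) ^ 2) ^ j = (X ^ r)⁻¹ := by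
        rw [← pow_mul, hX, ← Real.rpow_neg (by positivity), Real.mul_rpow (by positivity) hξ0.le,
          hε, ← Real.rpow_mul hξ0.le, div_pow, ← Real.rpow_natCast, ← Real.rpow_mul hξ0.le,
          ← Real.rpow_mul hρ.le, div_eq_mul_inv, ← Real.rpow_natCast ρ, ← Real.rpow_neg hρ.le, mul_comm]
        congr 2
        · rw [hr]; push_cast; field_simp
        · rw [hr]; push_cast; field_simp
      have h3 := hC₂ h hρ (a := a) (b := b) (by linarith) (by linarith) ⟨hε0, hεle⟩ hεξ
      rw [hεX] at h3
      have hXr : 0 < X ^ r := by positivity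
      have h4 : (1 + X) ^ r ≤ 2 ^ r * X ^ r := by
        rw [← Real.mul_rpow (by norm_num) hX0]
        exact Real.rpow_le_rpow (by positivity) (by linarith) hr0
      calc _ ≤ (C₂ * (X ^ r)⁻¹ * (C₁ * P)) * (2 ^ r * X ^ r) := by
            refine mul_le_mul (h3.trans ?_) h4 (by positivity) (by positivity)
            exact mul_le_mul_of_nonneg_left hbig (by positivity)
        _ = C₁ * C₂ * 2 ^ r * P := by field_simp
        _ ≤ _ := by
          have : 0 ≤ C₁ * (1 + R) ^ r * P := by positivity
          linarith
  refine hgoal.trans (le_of_eq ?_)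
  rw [hP]; ring

end

/-- Scaling of Lebesgue measure. With `ρ^l` as the scale it produces the loss `ρ^(-d(1/s+3/2))` in
the total energy. -/
theorem lintegral_one_add_mul_norm (d : ℕ) {l r : ℝ} (hl : 0 < l) :
    ∫⁻ ξ : Space d, ENNReal.ofReal ((1 + l * ‖ξ‖) ^ (-r)) =
      ENNReal.ofReal (l ^ (-(d : ℝ))) * ∫⁻ ξ : Space d, ENNReal.ofReal ((1 + ‖ξ‖) ^ (-r)) := by
  have h1 : Measure.map (fun ξ : Space d => l • ξ) volume =
      ENNReal.ofReal |(l ^ Module.finrank ℝ (Space d))⁻¹| • (volume : Measure (Space d)) :=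
    Measure.map_addHaar_smul volume hl.ne'
  have h2 := lintegral_map (μ := (volume : Measure (Space d)))
    (f := fun ξ : Space d => ENNReal.ofReal ((1 + ‖ξ‖) ^ (-r))) (g := fun ξ => l • ξ)
    (by fun_prop) (by fun_prop)
  rw [h1, lintegral_smul_measure, smul_eq_mul] at h2
  rw [finrank_euclideanSpace_fin, abs_of_pos (by positivity), ← Real.rpow_natCast,
    ← Real.rpow_neg hl.le] at h2
  rw [h2]
  refine lintegral_congr fun ξ => ?_
  rw [norm_smul, Real.norm_of_nonneg hl.le]

/-- The total energy of a family of modes. -/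
theorem IsKernel.exists_total_decay {d : ℕ} {s c₁ M : ℝ} {k e : ℝ → ℝ}
    (hk : IsKernel d s c₁ M k e) : ∃ C : ℝ, 0 < C ∧
    ∀ {T m : ℝ} {W : Space d → ℝ → Sphere d → ℂ}, (∀ ξ, IsFiber d k T ξ m (W ξ)) →
      ∀ {a b ρ : ℝ}, 0 < ρ → ρ ≤ 1 → 0 < a - 2 * ρ → a ≤ b → b + 2 * ρ < T →
      ∫⁻ ξ, ENNReal.ofReal (∫ t in Icc a b, sqNorm (W ξ) t) ≤
        ENNReal.ofReal (C * m ^ 2 * (b - a + 4 * ρ) *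
          ρ ^ (-(((d : ℝ) - 1) / (2 * s) + d * (1 / s + 3 / 2)))) := by
  have hs := hk.s_pos
  set l := 1 / s + 3 / 2 with hl
  have hl0 : 0 < l := by positivity
  -- Enough iterations of the gain for the decay exponent `2j/l` to exceed `d`, which makes the
  -- bound integrable over all frequencies.
  obtain ⟨j, hj⟩ := exists_nat_gt ((d : ℝ) * l)
  have hj0 : 0 < j := by
    have : (0 : ℝ) < j := lt_of_le_of_lt (by positivity) hj
    exact_mod_cast this
  obtain ⟨C, hC0, hC⟩ := hk.exists_fiber_decay_frequency hj0
  set r := 2 * j / l with hr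
  have hdr : (d : ℝ) < r := by
    rw [hr, lt_div_iff₀ hl0]
    have : (0 : ℝ) < j := by exact_mod_cast hj0
    linarith
  set K := ∫⁻ ξ : Space d, ENNReal.ofReal ((1 + ‖ξ‖) ^ (-r)) with hK
  have hKt : K < ⊤ := finite_integral_one_add_norm (by rwa [finrank_euclideanSpace_fin])
  refine ⟨C * (K.toReal + 1), by positivity, fun {T m W} h {a b ρ} hρ hρ1 ha hab hb => ?_⟩
  set q := ((d : ℝ) - 1) / (2 * s) with hq
  have hba : 0 ≤ b - a + 4 * ρ := by linarith
  have hρl : 0 < ρ ^ l := by positivity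
  calc _ ≤ ∫⁻ ξ, ENNReal.ofReal (C * m ^ 2 * ρ ^ (-q) * (b - a + 4 * ρ)) *
        ENNReal.ofReal ((1 + ρ ^ l * ‖ξ‖) ^ (-r)) := by
        refine lintegral_mono fun ξ => ?_
        rw [← ENNReal.ofReal_mul (by positivity)]
        exact ENNReal.ofReal_le_ofReal (hC (h ξ) hρ hρ1 ha hab hb)
    _ = ENNReal.ofReal (C * m ^ 2 * ρ ^ (-q) * (b - a + 4 * ρ)) *
        (ENNReal.ofReal ((ρ ^ l) ^ (-(d : ℝ))) * K) := by
        rw [lintegral_const_mul _ (by fun_prop), lintegral_one_add_mul_norm d hρl]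
    _ ≤ _ := by
        obtain ⟨K', hK', hKK⟩ : ∃ K' : ℝ, K.toReal = K' ∧ K = ENNReal.ofReal K' :=
          ⟨_, rfl, (ENNReal.ofReal_toReal hKt.ne).symm⟩
        have hK'0 : 0 ≤ K' := hK' ▸ ENNReal.toReal_nonneg
        rw [hK', hKK, ← ENNReal.ofReal_mul (by positivity),
          ← ENNReal.ofReal_mul (by positivity)]
        refine ENNReal.ofReal_le_ofReal ?_
        have e1 : ρ ^ (-(q + d * l)) = ρ ^ (-q) * (ρ ^ l) ^ (-(d : ℝ)) := by
          rw [← Real.rpow_mul hρ.le, ← Real.rpow_add hρ]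
          congr 1; ring
        rw [e1]
        have h5 : 0 ≤ C * m ^ 2 * (b - a + 4 * ρ) * (ρ ^ (-q) * (ρ ^ l) ^ (-(d : ℝ))) := by positivity
        calc _ = K' * (C * m ^ 2 * (b - a + 4 * ρ) * (ρ ^ (-q) * (ρ ^ l) ^ (-(d : ℝ)))) := by ring
          _ ≤ (K' + 1) * (C * m ^ 2 * (b - a + 4 * ρ) * (ρ ^ (-q) * (ρ ^ l) ^ (-(d : ℝ)))) := by
            gcongr; linarith
          _ = _ := by ring

end

/-! ### Complex test functions in the weak formulation -/

section

open scoped ENNReal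

theorem re_scat {d : ℕ} {k : ℝ → ℝ} {ε C : ℝ} (hK : IsZonal d ((Ici ε).indicator k) C)
    {ψ : Space d → ℂ} (hψ : Continuous ψ) (θ : Sphere d) :
    (scat d k ε (fun θ => ψ θ) θ).re = ∫ θ', (Ici ε).indicator k (gap θ θ') *
      ((ψ θ').re - (ψ θ).re) ∂(surface d) ∧
    (scat d k ε (fun θ => ψ θ) θ).im = ∫ θ', (Ici ε).indicator k (gap θ θ') *
      ((ψ θ').im - (ψ θ).im) ∂(surface d) := by
  have hi := hK.integrable_mul (g := fun θ' => ψ θ' - ψ θ)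
    ((continuous_restrict hψ).sub continuous_const) θ
  have h1 := Complex.reCLM.integral_comp_comm hi
  have h2 := Complex.imCLM.integral_comp_comm hi
  simp only [Complex.reCLM_apply, Complex.imCLM_apply, Complex.re_ofReal_mul,
    Complex.im_ofReal_mul, Complex.sub_re, Complex.sub_im] at h1 h2
  exact ⟨h1.symm, h2.symm⟩

theorem truncatedScattering_eq {d : ℕ} {s : ℝ} {b k : ℝ → ℝ}
    (hker : ∀ θ : Sphere d, ∀ᵐ θ' ∂(surface d), kernel d s b θ θ' = k (gap θ θ'))
    (ε : ℝ) (ψ : Space d → ℝ) (θ : Sphere d) :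
    truncatedScattering d s b ε ψ θ = ∫ θ', (Ici ε).indicator k (gap θ θ') * (ψ θ' - ψ θ)
      ∂(surface d) := by
  have hm : MeasurableSet {θ' : Sphere d | ε ≤ 1 - inner ℝ (θ : Space d) (θ' : Space d)} :=
    (isClosed_le continuous_const (by fun_prop)).measurableSet
  rw [truncatedScattering, ← integral_indicator hm]
  refine integral_congr_ae ?_
  filter_upwards [hker θ] with θ' h
  by_cases hθ : ε ≤ gap θ θ'
  · rw [indicator_of_mem (show θ' ∈ {θ' : Sphere d | ε ≤ 1 - inner ℝ (θ : Space d) (θ' : Space d)}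
      from hθ), indicator_of_mem (show gap θ θ' ∈ Ici ε from hθ), h, mul_comm]
  · rw [indicator_of_notMem (show θ' ∉ {θ' : Sphere d | ε ≤ 1 - inner ℝ (θ : Space d) (θ' : Space d)}
      from hθ), indicator_of_notMem (show gap θ θ' ∉ Ici ε from hθ), zero_mul]

/-- The weak form of the scattering operator with complex test functions. -/
theorem IsScattering.weakScat {d : ℕ} {s s₁ c₁ M : ℝ} {b k e : ℝ → ℝ} (hk : IsKernel d s₁ c₁ M k e)
    (hker : ∀ θ : Sphere d, ∀ᵐ θ' ∂(surface d), kernel d s b θ θ' = k (gap θ θ'))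
    {f F : Sphere d → ℝ} (h : IsScattering d s b f F) (hf : Integrable f (surface d))
    (hF : Integrable F (surface d)) : WeakScat d k (fun θ => (f θ : ℂ)) (fun θ => (F θ : ℂ)) := by
  intro ψ hψ
  have hψ2 : ContDiff ℝ 2 ψ := contDiff_infty.1 hψ 2
  have hlim := hk.tendsto_integral_scat hψ2 (f := fun θ => (f θ : ℂ)) hf.ofReal
  obtain ⟨B, hB0, hB1, hB2⟩ := hk.exists_norm_Scat_le hψ2
  obtain ⟨B', hB'0, hB'⟩ := exists_bound_restrict (d := d) hψ.continuous
  have hFi : Integrable (fun θ => (F θ : ℂ) * ψ θ) (surface d) :=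
    hF.ofReal.mul_bdd (continuous_restrict hψ.continuous).aestronglyMeasurable (ae_of_all _ hB')
  have hev : ∀ᶠ ε in 𝓝[>] (0 : ℝ), ε ∈ Ioo (0 : ℝ) 1 := Ioo_mem_nhdsGT one_pos
  have hi : ∀ ε ∈ Ioo (0 : ℝ) 1,
      Integrable (fun θ => (f θ : ℂ) * scat d k ε (fun θ => ψ θ) θ) (surface d) := by
    intro ε hε
    obtain ⟨C, hC⟩ := hk.exists_isZonal hε.1
    exact hf.ofReal.mul_bdd (hC.measurable_zonalDiff (continuous_restrict hψ.continuous)).aestronglyMeasurable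
      (ae_of_all _ (hB2 ε hε))
  refine Complex.ext ?_ ?_
  · refine tendsto_nhds_unique ((Complex.continuous_re.tendsto _).comp hlim) ?_
    have h1 := h (fun x => (ψ x).re) (Complex.reCLM.contDiff.comp hψ)
    have h2 := Complex.reCLM.integral_comp_comm hFi
    simp only [Complex.reCLM_apply, Complex.re_ofReal_mul] at h2
    rw [← h2]
    refine h1.congr' ?_
    filter_upwards [hev] with ε hε
    obtain ⟨C, hC⟩ := hk.exists_isZonal hε.1
    have h3 := Complex.reCLM.integral_comp_comm (hi ε hε)
    simp only [Complex.reCLM_apply, Complex.re_ofReal_mul] at h3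
    rw [Function.comp_apply, ← h3]
    refine integral_congr_ae (ae_of_all _ fun θ => ?_)
    simp only
    rw [(re_scat hC hψ.continuous θ).1, truncatedScattering_eq hker]
  · refine tendsto_nhds_unique ((Complex.continuous_im.tendsto _).comp hlim) ?_
    have h1 := h (fun x => (ψ x).im) (Complex.imCLM.contDiff.comp hψ)
    have h2 := Complex.imCLM.integral_comp_comm hFi
    simp only [Complex.imCLM_apply, Complex.im_ofReal_mul] at h2
    rw [← h2]
    refine h1.congr' ?_
    filter_upwards [hev] with ε hε
    obtain ⟨C, hC⟩ := hk.exists_isZonal hε.1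
    have h3 := Complex.imCLM.integral_comp_comm (hi ε hε)
    simp only [Complex.imCLM_apply, Complex.im_ofReal_mul] at h3
    rw [Function.comp_apply, ← h3]
    refine integral_congr_ae (ae_of_all _ fun θ => ?_)
    simp only
    rw [(re_scat hC hψ.continuous θ).2, truncatedScattering_eq hker]

/-- The inclusion of `ℝ × ℝ^d × 𝕊^{d-1}` in the ambient space. -/
def ambient (d : ℕ) (p : ℝ × Space d × Sphere d) : ℝ × Space d × Space d :=
  (p.1, p.2.1, (p.2.2 : Space d))

theorem continuous_ambient (d : ℕ) : Continuous (ambient d) := by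
  unfold ambient; fun_prop

theorem isClosedEmbedding_ambient (d : ℕ) : Topology.IsClosedEmbedding (ambient d) := by
  have h : Topology.IsClosedEmbedding (Subtype.val : Sphere d → Space d) :=
    Metric.isClosed_sphere.isClosedEmbedding_subtypeVal
  exact Topology.IsClosedEmbedding.id.prodMap (Topology.IsClosedEmbedding.id.prodMap h)

/-- Real and imaginary parts of the test function are admissible separately. Complex tests are
needed for plane waves. -/
theorem HasWeakDeriv.integral_complex {d : ℕ} {T : ℝ} {w : ℝ × Space d}
    {u g : ℝ × Space d × Sphere d → ℝ} (h : HasWeakDeriv d T w u g)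
    (hu : Integrable u (slab d 0 T)) {Φ : ℝ × Space d × Space d → ℂ} (hΦ : ContDiff ℝ ∞ Φ)
    (hc : HasCompactSupport Φ) (hs : tsupport Φ ⊆ {p | p.1 ∈ Ioo 0 T})
    (hg : Integrable (fun p => (g p : ℂ) * Φ (ambient d p)) (slab d 0 T)) :
    ∫ p, (u p : ℂ) * fderiv ℝ Φ (ambient d p) (w.1, w.2, 0) ∂(slab d 0 T) =
      - ∫ p, (g p : ℂ) * Φ (ambient d p) ∂(slab d 0 T) := by
  have hD : Continuous fun p => fderiv ℝ Φ p (w.1, w.2, 0) :=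
    (hΦ.continuous_fderiv (by simp)).clm_apply continuous_const
  obtain ⟨B, hB⟩ := hD.bounded_above_of_compact_support (hc.fderiv_apply (𝕜 := ℝ) _)
  have hui : Integrable (fun p => (u p : ℂ) * fderiv ℝ Φ (ambient d p) (w.1, w.2, 0))
      (slab d 0 T) :=
    hu.ofReal.mul_bdd (hD.comp (continuous_ambient d)).aestronglyMeasurable
      (ae_of_all _ fun p => hB _)
  have hsub : ∀ L : ℂ →L[ℝ] ℝ, tsupport (fun p => L (Φ p)) ⊆ tsupport Φ := fun L =>
    closure_mono fun p hp h0 => hp (by simp [h0])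
  have hfd : ∀ (L : ℂ →L[ℝ] ℝ) (p), fderiv ℝ (fun p => L (Φ p)) p = L.comp (fderiv ℝ Φ p) :=
    fun L p => (L.hasFDerivAt.comp p (hΦ.differentiable (by simp) p).hasFDerivAt).fderiv
  refine Complex.ext ?_ ?_
  · have h1 := h (fun p => Complex.reCLM (Φ p)) (Complex.reCLM.contDiff.comp hΦ)
      (hc.comp_left (by simp)) ((hsub _).trans hs)
    have h2 := Complex.reCLM.integral_comp_comm hui
    have h3 := Complex.reCLM.integral_comp_comm hg
    simp only [hfd, ContinuousLinearMap.comp_apply] at h1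
    simp only [Complex.reCLM_apply, Complex.re_ofReal_mul] at h1 h2 h3
    rw [← h2, Complex.neg_re, ← h3]
    exact h1
  · have h1 := h (fun p => Complex.imCLM (Φ p)) (Complex.imCLM.contDiff.comp hΦ)
      (hc.comp_left (by simp)) ((hsub _).trans hs)
    have h2 := Complex.imCLM.integral_comp_comm hui
    have h3 := Complex.imCLM.integral_comp_comm hg
    simp only [hfd, ContinuousLinearMap.comp_apply] at h1
    simp only [Complex.imCLM_apply, Complex.im_ofReal_mul] at h1 h2 h3
    rw [← h2, Complex.neg_im, ← h3]
    exact h1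

instance (d : ℕ) : SFinite (phase d) := @Measure.prod.instSFinite _ _ _ _ _ inferInstance _ inferInstance

theorem slab_restrict {d : ℕ} {t₀ T : ℝ} (h : 0 ≤ t₀) :
    slab d t₀ T = (slab d 0 T).restrict (Ioi t₀ ×ˢ univ) := by
  rw [slab, slab, ← Measure.prod_restrict, Measure.restrict_univ,
    Measure.restrict_restrict measurableSet_Ioi]
  congr 2
  ext t
  simp only [mem_Ioo, mem_inter_iff, mem_Ioi]
  constructor
  · rintro ⟨h1, h2⟩; exact ⟨h1, by linarith, h2⟩
  · rintro ⟨h1, h2, h3⟩; exact ⟨h1, h3⟩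

/-- The derivatives are square integrable only away from `t = 0`. The support of the test function
is compact in `(0,T)`, so half of its earliest time serves as `t₀`. -/
theorem integrable_mul_test {d : ℕ} {T : ℝ} (hT : 0 < T) {g : ℝ × Space d × Sphere d → ℝ}
    (hg : ∀ t₀ ∈ Ioo 0 T, MemLp g 2 (slab d t₀ T)) {Φ : ℝ × Space d × Space d → ℂ}
    (hΦ : Continuous Φ) (hc : HasCompactSupport Φ) (hs : tsupport Φ ⊆ {p | p.1 ∈ Ioo 0 T}) :
    Integrable (fun p => (g p : ℂ) * Φ (ambient d p)) (slab d 0 T) := by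
  obtain ⟨t₀, ht₀, h0⟩ : ∃ t₀ ∈ Ioo 0 T, ∀ p, Φ p ≠ 0 → t₀ < p.1 := by
    rcases (tsupport Φ).eq_empty_or_nonempty with he | he
    · exact ⟨T / 2, ⟨by linarith, by linarith⟩, fun p hp => absurd (subset_tsupport Φ hp) (by simp [he])⟩
    · obtain ⟨p, hp, hpm⟩ := hc.isCompact.exists_isMinOn he continuous_fst.continuousOn
      have := hs hp
      simp only [mem_ofPred_eq, mem_Ioo] at this
      refine ⟨p.1 / 2, ⟨by linarith, by linarith⟩, fun q hq => ?_⟩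
      have h2 : p.1 ≤ q.1 := hpm (subset_tsupport Φ hq)
      linarith
  have h1 : MemLp (fun p => Φ (ambient d p)) 2 (slab d t₀ T) :=
    (hΦ.comp (continuous_ambient d)).memLp_of_hasCompactSupport
      (hc.comp_isClosedEmbedding (isClosedEmbedding_ambient d))
  have h2 : Integrable (fun p => (g p : ℂ) * Φ (ambient d p)) (slab d t₀ T) :=
    (hg t₀ ht₀).ofReal.integrable_mul h1
  rw [slab_restrict ht₀.1.le] at h2
  refine (integrableOn_iff_integrable_of_support_subset fun p hp => ?_).1 h2
  refine ⟨h0 (ambient d p) fun h => hp ?_, mem_univ _⟩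
  simp only [h, mul_zero]

end

/-! ### The transport equation tested on products -/

section

open scoped ENNReal

theorem fderiv_mul_mul {d : ℕ} {A : ℝ → ℂ} {X Y : Space d → ℂ} (hA : ContDiff ℝ ∞ A)
    (hX : ContDiff ℝ ∞ X) (hY : ContDiff ℝ ∞ Y) (p : ℝ × Space d × Space d) (r : ℝ) (v : Space d) :
    fderiv ℝ (fun q : ℝ × Space d × Space d => A q.1 * X q.2.1 * Y q.2.2) p (r, v, 0) =
      (r * deriv A p.1 * X p.2.1 + A p.1 * fderiv ℝ X p.2.1 v) * Y p.2.2 := by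
  have h1 : HasFDerivAt (fun q : ℝ × Space d × Space d => A q.1)
      ((fderiv ℝ A p.1).comp (ContinuousLinearMap.fst ℝ ℝ (Space d × Space d))) p :=
    (hA.differentiable (by simp) p.1).hasFDerivAt.comp p hasFDerivAt_fst
  have h2 : HasFDerivAt (fun q : ℝ × Space d × Space d => X q.2.1)
      ((fderiv ℝ X p.2.1).comp ((ContinuousLinearMap.fst ℝ (Space d) (Space d)).comp
        (ContinuousLinearMap.snd ℝ ℝ (Space d × Space d)))) p :=
    (hX.differentiable (by simp) p.2.1).hasFDerivAt.comp p
      (hasFDerivAt_fst.comp p hasFDerivAt_snd)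
  have h3 : HasFDerivAt (fun q : ℝ × Space d × Space d => Y q.2.2)
      ((fderiv ℝ Y p.2.2).comp ((ContinuousLinearMap.snd ℝ (Space d) (Space d)).comp
        (ContinuousLinearMap.snd ℝ ℝ (Space d × Space d)))) p :=
    (hY.differentiable (by simp) p.2.2).hasFDerivAt.comp p
      (hasFDerivAt_snd.comp p hasFDerivAt_snd)
  have h4 : fderiv ℝ A p.1 r = r * deriv A p.1 := by
    rw [← toSpanSingleton_deriv]
    simp
  have h5 : fderiv ℝ (fun q : ℝ × Space d × Space d => A q.1 * X q.2.1 * Y q.2.2) p = _ :=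
    ((h1.mul h2).mul h3).fderiv
  rw [h5]
  simp only [add_apply, smul_apply, ContinuousLinearMap.comp_apply, ContinuousLinearMap.coe_fst',
    ContinuousLinearMap.coe_snd', map_zero, smul_eq_mul, h4]
  ring

/-- A smooth function with compact support, equal to `1` on the ball of radius `2`. -/
noncomputable def unitBump (d : ℕ) : ContDiffBump (0 : Space d) := ⟨2, 3, by norm_num, by norm_num⟩

theorem unitBump_sphere {d : ℕ} (θ : Sphere d) : unitBump d (θ : Space d) = 1 :=
  (unitBump d).one_of_mem_closedBall (by
    rw [mem_closedBall_zero_iff, norm_sphere]; exact one_le_two)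

/-- Smooth complex functions with compact support in `(0,T)`. -/
structure IsComplexCutoff (T : ℝ) (A : ℝ → ℂ) : Prop where
  contDiff : ContDiff ℝ ∞ A
  hasCompactSupport : HasCompactSupport A
  tsupport_subset : tsupport A ⊆ Ioo 0 T

section

variable {d : ℕ} {T : ℝ} {A : ℝ → ℂ} {X Y : Space d → ℂ}

theorem IsComplexCutoff.tsupport_mul_subset (Y : Space d → ℂ) :
    tsupport (fun q : ℝ × Space d × Space d => A q.1 * X q.2.1 * Y q.2.2) ⊆
      tsupport A ×ˢ tsupport X ×ˢ tsupport Y := by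
  refine closure_minimal (fun q hq => ?_)
    ((isClosed_tsupport A).prod ((isClosed_tsupport X).prod (isClosed_tsupport Y)))
  refine ⟨subset_tsupport A fun h => hq (by simp [h]), subset_tsupport X fun h => hq (by simp [h]),
    subset_tsupport Y fun h => hq (by simp [h])⟩

theorem hasCompactSupport_mul_mul (hA : HasCompactSupport A) (hX : HasCompactSupport X)
    (hY : HasCompactSupport Y) :
    HasCompactSupport (fun q : ℝ × Space d × Space d => A q.1 * X q.2.1 * Y q.2.2) :=
  (hA.isCompact.prod (hX.isCompact.prod hY.isCompact)).of_isClosed_subset (isClosed_tsupport _)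
    (IsComplexCutoff.tsupport_mul_subset Y)

theorem contDiff_mul_mul (hA : ContDiff ℝ ∞ A) (hX : ContDiff ℝ ∞ X) (hY : ContDiff ℝ ∞ Y) :
    ContDiff ℝ ∞ (fun q : ℝ × Space d × Space d => A q.1 * X q.2.1 * Y q.2.2) :=
  ((hA.comp contDiff_fst).mul (hX.comp (contDiff_fst.comp contDiff_snd))).mul
    (hY.comp (contDiff_snd.comp contDiff_snd))

/-- The uniform mass bound and the finite length of the time interval give integrability on the
whole slab, up to `t = 0`. -/
theorem IsSolution.integrable {s : ℝ} {b : ℝ → ℝ} {u₀ : Space d × Sphere d → ℝ}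
    {u : ℝ → Space d × Sphere d → ℝ} (hu : IsSolution d s b T u₀ u) :
    Integrable (fun p : ℝ × Space d × Sphere d => u p.1 p.2) (slab d 0 T) := by
  obtain ⟨M, hM⟩ := hu.bounded
  rw [integrable_prod_iff hu.measurable]
  refine ⟨hM.mono fun t h => h.1, ?_⟩
  refine Integrable.of_bound hu.measurable.norm.integral_prod_right' M (hM.mono fun t h => ?_)
  rw [Real.norm_of_nonneg (integral_nonneg fun _ => norm_nonneg _)]
  exact h.2

theorem integral_slab {F : ℝ × Space d × Sphere d → ℂ} (hF : Integrable F (slab d 0 T)) :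
    ∫ p, F p ∂(slab d 0 T) = ∫ q, ∫ θ, F (q.1, q.2, θ) ∂(surface d)
      ∂(((volume : Measure ℝ).restrict (Ioo 0 T)).prod (volume : Measure (Space d))) := by
  have hmp : MeasurePreserving (MeasurableEquiv.prodAssoc : (ℝ × Space d) × Sphere d ≃ᵐ _)
      ((((volume : Measure ℝ).restrict (Ioo 0 T)).prod (volume : Measure (Space d))).prod (surface d))
      (slab d 0 T) := measurePreserving_prodAssoc _ _ _
  rw [← hmp.integral_comp']
  exact integral_prod _ ((hmp.integrable_comp_emb (MeasurableEquiv.measurableEmbedding _)).2 hF)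

theorem integrable_slab_fiber {F : ℝ × Space d × Sphere d → ℂ} (hF : Integrable F (slab d 0 T)) :
    ∀ᵐ q ∂(((volume : Measure ℝ).restrict (Ioo 0 T)).prod (volume : Measure (Space d))),
      Integrable (fun θ => F (q.1, q.2, θ)) (surface d) := by
  have hmp : MeasurePreserving (MeasurableEquiv.prodAssoc : (ℝ × Space d) × Sphere d ≃ᵐ _)
      ((((volume : Measure ℝ).restrict (Ioo 0 T)).prod (volume : Measure (Space d))).prod (surface d))
      (slab d 0 T) := measurePreserving_prodAssoc _ _ _
  exact ((hmp.integrable_comp_emb (MeasurableEquiv.measurableEmbedding _)).2 hF).prod_right_ae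

/-- The weak formulation of the equation, for product test functions. -/
theorem IsSolution.transport {s s₁ c₁ M : ℝ} {b k e : ℝ → ℝ} (hT : 0 < T)
    (hk : IsKernel d s₁ c₁ M k e)
    (hker : ∀ θ : Sphere d, ∀ᵐ θ' ∂(surface d), kernel d s b θ θ' = k (gap θ θ'))
    {u₀ : Space d × Sphere d → ℝ} {u : ℝ → Space d × Sphere d → ℝ} (hu : IsSolution d s b T u₀ u)
    (hA : IsComplexCutoff T A) (hX : ContDiff ℝ ∞ X) (hXc : HasCompactSupport X)
    {ψ : Space d → ℂ} (hψ : ContDiff ℝ ∞ ψ) :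
    ∫ p, (u p.1 p.2 : ℂ) * ((deriv A p.1 * X p.2.1 + A p.1 * fderiv ℝ X p.2.1 p.2.2) * ψ p.2.2)
        ∂(slab d 0 T) =
      - ∫ p, (u p.1 p.2 : ℂ) * (A p.1 * X p.2.1 * Scat d k (fun θ => ψ θ) p.2.2)
        ∂(slab d 0 T) := by
  obtain ⟨ut, Du, Iu, hL2, hut, hDu, hIu, heq⟩ := hu.equation
  have hui := hu.integrable
  -- Test functions must have compact support in the ambient space of `θ` too. This factor provides
  -- it without changing anything on the sphere.
  set χ : Space d → ℂ := fun y => (unitBump d y : ℂ) with hχ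
  have hχs : ContDiff ℝ ∞ χ := Complex.ofRealCLM.contDiff.comp (unitBump d).contDiff
  have hχc : HasCompactSupport χ := (unitBump d).hasCompactSupport.comp_left Complex.ofReal_zero
  have hχ1 : ∀ θ : Sphere d, χ θ = 1 := fun θ => by rw [hχ]; simp [unitBump_sphere]
  -- the test functions
  have test : ∀ Y : Space d → ℂ, ContDiff ℝ ∞ Y → HasCompactSupport Y →
      ∀ g : ℝ × Space d × Sphere d → ℝ, (∀ t₀ ∈ Ioo 0 T, MemLp g 2 (slab d t₀ T)) →
      Integrable (fun p : ℝ × Space d × Sphere d => (g p : ℂ) * (A p.1 * X p.2.1 * Y p.2.2))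
        (slab d 0 T) := fun Y hY hYc g hg =>
    integrable_mul_test hT hg (Φ := fun q => A q.1 * X q.2.1 * Y q.2.2)
      (contDiff_mul_mul hA.contDiff hX hY).continuous
      (hasCompactSupport_mul_mul hA.hasCompactSupport hXc hYc)
      ((IsComplexCutoff.tsupport_mul_subset Y).trans fun q hq => hA.tsupport_subset hq.1)
  have weak : ∀ Y : Space d → ℂ, ContDiff ℝ ∞ Y → HasCompactSupport Y →
      ∀ (w : ℝ × Space d) (g : ℝ × Space d × Sphere d → ℝ),
      HasWeakDeriv d T w (fun p => u p.1 p.2) g → (∀ t₀ ∈ Ioo 0 T, MemLp g 2 (slab d t₀ T)) →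
      Integrable (fun p : ℝ × Space d × Sphere d => (u p.1 p.2 : ℂ) *
        ((w.1 * deriv A p.1 * X p.2.1 + A p.1 * fderiv ℝ X p.2.1 w.2) * Y p.2.2)) (slab d 0 T) ∧
      ∫ p, (u p.1 p.2 : ℂ) *
        ((w.1 * deriv A p.1 * X p.2.1 + A p.1 * fderiv ℝ X p.2.1 w.2) * Y p.2.2) ∂(slab d 0 T) =
      - ∫ p, (g p : ℂ) * (A p.1 * X p.2.1 * Y p.2.2) ∂(slab d 0 T) := by
    intro Y hY hYc w g hw hg
    have hsm := contDiff_mul_mul hA.contDiff hX hY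
    have hcs := hasCompactSupport_mul_mul hA.hasCompactSupport hXc hYc
    have h1 := hw.integral_complex hui hsm hcs
      ((IsComplexCutoff.tsupport_mul_subset Y).trans fun q hq => hA.tsupport_subset hq.1)
      (test Y hY hYc g hg)
    have hD : Continuous fun p => fderiv ℝ
        (fun q : ℝ × Space d × Space d => A q.1 * X q.2.1 * Y q.2.2) p (w.1, w.2, 0) :=
      (hsm.continuous_fderiv (by simp)).clm_apply continuous_const
    obtain ⟨B, hB⟩ := hD.bounded_above_of_compact_support (hcs.fderiv_apply (𝕜 := ℝ) _)
    have h2 : Integrable (fun p => (u p.1 p.2 : ℂ) * fderiv ℝ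
        (fun q : ℝ × Space d × Space d => A q.1 * X q.2.1 * Y q.2.2) (ambient d p) (w.1, w.2, 0))
        (slab d 0 T) :=
      hui.ofReal.mul_bdd (hD.comp (continuous_ambient d)).aestronglyMeasurable
        (ae_of_all _ fun p => hB _)
    simp only [fderiv_mul_mul hA.contDiff hX hY] at h1 h2
    exact ⟨h2, h1⟩
  have hψχ : ContDiff ℝ ∞ fun y => ψ y * χ y := hψ.mul hχs
  have hψχc : HasCompactSupport fun y => ψ y * χ y := hχc.mul_left
  -- time derivative
  obtain ⟨i1, e1⟩ := weak _ hψχ hψχc _ _ hut fun t₀ h => (hL2 t₀ h).1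
  have j1 := test _ hψχ hψχc ut fun t₀ h => (hL2 t₀ h).1
  simp only [hχ1, mul_one, Complex.ofReal_one, one_mul, map_zero, mul_zero, add_zero] at i1 e1 j1
  -- space derivatives
  set E : Fin d → Space d := fun i => EuclideanSpace.single i 1 with hE
  have hcoord : ∀ i, ContDiff ℝ ∞ fun y : Space d => ((y i : ℝ) : ℂ) * (ψ y * χ y) := fun i =>
    (Complex.ofRealCLM.contDiff.comp (EuclideanSpace.proj i : Space d →L[ℝ] ℝ).contDiff).mul hψχ
  have hDL : ∀ i, ∀ t₀ ∈ Ioo 0 T, MemLp (fun p => inner ℝ (Du p) (E i)) 2 (slab d t₀ T) :=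
    fun i t₀ h => (hL2 t₀ h).2.1.inner_const (E i)
  have hsp := fun i => weak _ (hcoord i) hψχc.mul_left (0, E i) _ (hDu (E i)) (hDL i)
  have jsp := fun i => test _ (hcoord i) hψχc.mul_left _ (hDL i)
  simp only [hχ1, mul_one, Complex.ofReal_zero, zero_mul, zero_add] at hsp jsp
  -- The weak derivatives are known in fixed directions, whereas transport acts along `θ`. Expanding
  -- in coordinates moves each `θᵢ` into the angular test function.
  have hsum : ∀ (L : Space d →L[ℝ] ℂ) (y : Space d), L y = ∑ i, ((y i : ℝ) : ℂ) * L (E i) := by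
    intro L y
    conv_lhs => rw [← (EuclideanSpace.basisFun (Fin d) ℝ).sum_repr y]
    rw [map_sum]
    refine Finset.sum_congr rfl fun i _ => ?_
    rw [map_smul, Complex.real_smul, EuclideanSpace.basisFun_apply, EuclideanSpace.basisFun_repr]
  have hin : ∀ (v y : Space d), ((inner ℝ y v : ℝ) : ℂ) =
      ∑ i, ((inner ℝ v (E i) : ℝ) : ℂ) * ((y i : ℝ) : ℂ) := by
    intro v y
    have := hsum (Complex.ofRealCLM.comp (innerSL ℝ v)) y
    simp only [ContinuousLinearMap.comp_apply, innerSL_apply_apply, Complex.ofRealCLM_apply] at this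
    rw [real_inner_comm, this]
    exact Finset.sum_congr rfl fun i _ => mul_comm _ _
  have e2 : ∫ p, (u p.1 p.2 : ℂ) * (A p.1 * fderiv ℝ X p.2.1 p.2.2 * ψ p.2.2) ∂(slab d 0 T) =
      - ∫ p, ((inner ℝ (p.2.2 : Space d) (Du p) : ℝ) : ℂ) * (A p.1 * X p.2.1 * ψ p.2.2)
        ∂(slab d 0 T) := by
    have a1 : (fun p : ℝ × Space d × Sphere d =>
        (u p.1 p.2 : ℂ) * (A p.1 * fderiv ℝ X p.2.1 p.2.2 * ψ p.2.2)) = fun p => ∑ i,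
        (u p.1 p.2 : ℂ) * (A p.1 * fderiv ℝ X p.2.1 (E i) * (((p.2.2 : Space d) i : ℂ) * ψ p.2.2)) := by
      funext p
      rw [hsum (fderiv ℝ X p.2.1) p.2.2, Finset.mul_sum, Finset.sum_mul, Finset.mul_sum]
      exact Finset.sum_congr rfl fun i _ => by ring
    have a2 : (fun p : ℝ × Space d × Sphere d =>
        ((inner ℝ (p.2.2 : Space d) (Du p) : ℝ) : ℂ) * (A p.1 * X p.2.1 * ψ p.2.2)) = fun p => ∑ i,
        ((inner ℝ (Du p) (E i) : ℝ) : ℂ) *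
          (A p.1 * X p.2.1 * (((p.2.2 : Space d) i : ℂ) * ψ p.2.2)) := by
      funext p
      rw [hin (Du p) p.2.2, Finset.sum_mul]
      exact Finset.sum_congr rfl fun i _ => by ring
    rw [a1, a2, integral_finsetSum _ fun i _ => (hsp i).1, integral_finsetSum _ fun i _ => jsp i,
      ← Finset.sum_neg_distrib]
    exact Finset.sum_congr rfl fun i _ => (hsp i).2
  have i2 : Integrable (fun p : ℝ × Space d × Sphere d =>
      (u p.1 p.2 : ℂ) * (A p.1 * fderiv ℝ X p.2.1 p.2.2 * ψ p.2.2)) (slab d 0 T) := by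
    have := integrable_finsetSum Finset.univ fun i _ => (hsp i).1
    refine this.congr (ae_of_all _ fun p => ?_)
    simp only
    rw [hsum (fderiv ℝ X p.2.1) p.2.2, Finset.mul_sum, Finset.sum_mul, Finset.mul_sum]
    exact Finset.sum_congr rfl fun i _ => by ring
  have j2 : Integrable (fun p : ℝ × Space d × Sphere d =>
      ((inner ℝ (p.2.2 : Space d) (Du p) : ℝ) : ℂ) * (A p.1 * X p.2.1 * ψ p.2.2)) (slab d 0 T) := by
    have := integrable_finsetSum Finset.univ fun i _ => jsp i
    refine this.congr (ae_of_all _ fun p => ?_)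
    simp only
    rw [hin (Du p) p.2.2, Finset.sum_mul]
    exact Finset.sum_congr rfl fun i _ => by ring
  -- the equation
  have j3 := test _ hψχ hψχc Iu fun t₀ h => (hL2 t₀ h).2.2
  have j4 := test _ hχs hχc Iu fun t₀ h => (hL2 t₀ h).2.2
  simp only [hχ1, mul_one] at j3 j4
  have e3 : ∫ p, (u p.1 p.2 : ℂ) *
      ((deriv A p.1 * X p.2.1 + A p.1 * fderiv ℝ X p.2.1 p.2.2) * ψ p.2.2) ∂(slab d 0 T) =
      - ∫ p, (Iu p : ℂ) * (A p.1 * X p.2.1 * ψ p.2.2) ∂(slab d 0 T) := by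
    have a1 : ∫ p, (Iu p : ℂ) * (A p.1 * X p.2.1 * ψ p.2.2) ∂(slab d 0 T) =
        ∫ p, (ut p : ℂ) * (A p.1 * X p.2.1 * ψ p.2.2) ∂(slab d 0 T) +
        ∫ p, ((inner ℝ (p.2.2 : Space d) (Du p) : ℝ) : ℂ) * (A p.1 * X p.2.1 * ψ p.2.2)
          ∂(slab d 0 T) := by
      rw [← integral_add j1 j2]
      refine integral_congr_ae ?_
      filter_upwards [heq] with p hp
      rw [← hp]
      push_cast
      ring
    rw [a1, neg_add, ← e1, ← e2, ← integral_add i1 i2]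
    exact integral_congr_ae (ae_of_all _ fun p => by ring)
  rw [e3, neg_inj]
  obtain ⟨B, hB0, hB1, hB2⟩ := hk.exists_norm_Scat_le (contDiff_infty.1 hψ 2)
  have hSm := hk.measurable_Scat (contDiff_infty.1 hψ 2)
  obtain ⟨BA, hBA⟩ := hA.contDiff.continuous.bounded_above_of_compact_support hA.hasCompactSupport
  obtain ⟨BX, hBX⟩ := hX.continuous.bounded_above_of_compact_support hXc
  have j5 : Integrable (fun p : ℝ × Space d × Sphere d =>
      (u p.1 p.2 : ℂ) * (A p.1 * X p.2.1 * Scat d k (fun θ => ψ θ) p.2.2)) (slab d 0 T) := by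
    refine hui.ofReal.mul_bdd (c := BA * BX * B) ?_ (ae_of_all _ fun p => ?_)
    · refine Measurable.aestronglyMeasurable ?_
      have h1 := hA.contDiff.continuous.measurable
      have h2 := hX.continuous.measurable
      fun_prop
    · rw [norm_mul, norm_mul]
      have := (norm_nonneg _).trans (hBA 0)
      have := (norm_nonneg _).trans (hBX 0)
      gcongr
      · exact hBA _
      · exact hBX _
      · exact hB1 _
  rw [integral_slab j3, integral_slab j5]
  refine integral_congr_ae ?_
  filter_upwards [hIu, integrable_slab_fiber j4, integrable_slab_fiber hui.ofReal] with q h1 h2 h3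
  -- Integrability of `Iu` on a fibre is known only after multiplication by the test function. Where
  -- the latter vanishes there is nothing to prove, and elsewhere it can be divided out.
  by_cases h0 : A q.1 * X q.2 = 0
  · simp only [h0, zero_mul, mul_zero]
  · have hF : Integrable (fun θ => Iu (q.1, q.2, θ)) (surface d) := by
      have := (h2.mul_const (A q.1 * X q.2)⁻¹).re
      refine this.congr (ae_of_all _ fun θ => ?_)
      simp only [mul_assoc, mul_inv_cancel₀ h0]
      simp
    have hf : Integrable (fun θ => u q.1 (q.2, θ)) (surface d) := h3.re
    have h4 := h1.weakScat hk hker hf hF ψ hψ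
    have a1 : ∀ θ, (Iu (q.1, q.2, θ) : ℂ) * (A q.1 * X q.2 * ψ θ) =
        A q.1 * X q.2 * (Iu (q.1, q.2, θ) * ψ θ) := fun θ => by ring
    have a2 : ∀ θ : Sphere d, (u q.1 (q.2, θ) : ℂ) * (A q.1 * X q.2 * Scat d k (fun θ => ψ θ) θ) =
        A q.1 * X q.2 * (u q.1 (q.2, θ) * Scat d k (fun θ => ψ θ) θ) := fun θ => by ring
    simp only [a1, a2]
    rw [integral_const_mul, integral_const_mul, h4]

end

end

/-! ### Monotone cutoffs and one-sided weak derivative bounds -/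

section

open scoped ENNReal

/-- The rising part of a plateau. -/
noncomputable def rise (a ρ t : ℝ) : ℝ := Real.smoothTransition ((t - (a - ρ)) / ρ)

/-- The falling part of a plateau. -/
noncomputable def fall (b σ t : ℝ) : ℝ := Real.smoothTransition ((b + σ - t) / σ)

section

variable {a b ρ σ t : ℝ}

theorem contDiff_rise : ContDiff ℝ ∞ (rise a ρ) :=
  Real.smoothTransition.contDiff.comp ((contDiff_id.sub contDiff_const).div_const _)

theorem contDiff_fall : ContDiff ℝ ∞ (fall b σ) :=
  Real.smoothTransition.contDiff.comp ((contDiff_const.sub contDiff_id).div_const _)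

theorem rise_of_le (hρ : 0 < ρ) (h : t ≤ a - ρ) : rise a ρ t = 0 :=
  Real.smoothTransition.zero_of_nonpos (div_nonpos_of_nonpos_of_nonneg (by linarith) hρ.le)

theorem rise_of_ge (hρ : 0 < ρ) (h : a ≤ t) : rise a ρ t = 1 :=
  Real.smoothTransition.one_of_one_le ((one_le_div hρ).2 (by linarith))

theorem fall_of_le (hσ : 0 < σ) (h : t ≤ b) : fall b σ t = 1 :=
  Real.smoothTransition.one_of_one_le ((one_le_div hσ).2 (by linarith))

theorem fall_of_ge (hσ : 0 < σ) (h : b + σ ≤ t) : fall b σ t = 0 :=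
  Real.smoothTransition.zero_of_nonpos (div_nonpos_of_nonpos_of_nonneg (by linarith) hσ.le)

theorem monotone_rise (hρ : 0 < ρ) : Monotone (rise a ρ) := fun x y h =>
  Real.smoothTransition.monotone (by gcongr)

theorem antitone_fall (hσ : 0 < σ) : Antitone (fall b σ) := fun x y h =>
  Real.smoothTransition.monotone (by gcongr)

theorem deriv_rise_nonneg (hρ : 0 < ρ) : 0 ≤ deriv (rise a ρ) t := (monotone_rise hρ).deriv_nonneg

theorem deriv_fall_nonpos (hσ : 0 < σ) : deriv (fall b σ) t ≤ 0 := (antitone_fall hσ).deriv_nonpos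

theorem deriv_rise_of_notMem (hρ : 0 < ρ) (h : t ∉ Icc (a - ρ) a) : deriv (rise a ρ) t = 0 := by
  rw [mem_Icc, not_and_or, not_le, not_le] at h
  rcases h with h | h
  · refine ((hasDerivAt_const t (0 : ℝ)).congr_of_eventuallyEq ?_).deriv
    filter_upwards [Iio_mem_nhds h] with y hy using rise_of_le hρ (le_of_lt hy)
  · refine ((hasDerivAt_const t (1 : ℝ)).congr_of_eventuallyEq ?_).deriv
    filter_upwards [Ioi_mem_nhds h] with y hy using rise_of_ge hρ (le_of_lt hy)

theorem deriv_fall_of_notMem (hσ : 0 < σ) (h : t ∉ Icc b (b + σ)) : deriv (fall b σ) t = 0 := by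
  rw [mem_Icc, not_and_or, not_le, not_le] at h
  rcases h with h | h
  · refine ((hasDerivAt_const t (1 : ℝ)).congr_of_eventuallyEq ?_).deriv
    filter_upwards [Iio_mem_nhds h] with y hy using fall_of_le hσ (le_of_lt hy)
  · refine ((hasDerivAt_const t (0 : ℝ)).congr_of_eventuallyEq ?_).deriv
    filter_upwards [Ioi_mem_nhds h] with y hy using fall_of_ge hσ (le_of_lt hy)

theorem hasDerivAt_rise : HasDerivAt (rise a ρ) (deriv (rise a ρ) t) t :=
  (contDiff_rise.differentiable (by simp) t).hasDerivAt

theorem hasDerivAt_fall : HasDerivAt (fall b σ) (deriv (fall b σ) t) t :=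
  (contDiff_fall.differentiable (by simp) t).hasDerivAt

theorem continuous_deriv_rise : Continuous (deriv (rise a ρ)) := contDiff_rise.continuous_deriv (by simp)

theorem continuous_deriv_fall : Continuous (deriv (fall b σ)) := contDiff_fall.continuous_deriv (by simp)

theorem integral_deriv_rise (hρ : 0 < ρ) :
    Integrable (deriv (rise a ρ)) ∧ ∫ t, deriv (rise a ρ) t = 1 := by
  have hi : Integrable (deriv (rise a ρ)) :=
    continuous_deriv_rise.integrable_of_hasCompactSupport
      (HasCompactSupport.intro isCompact_Icc fun t ht => deriv_rise_of_notMem hρ ht)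
  refine ⟨hi, ?_⟩
  rw [integral_of_hasDerivAt_of_tendsto (f := rise a ρ) (m := 0) (n := 1)
    (fun t => hasDerivAt_rise) hi, sub_zero]
  · refine tendsto_const_nhds.congr' ?_
    filter_upwards [eventually_le_atBot (a - ρ)] with t ht using (rise_of_le hρ ht).symm
  · refine tendsto_const_nhds.congr' ?_
    filter_upwards [eventually_ge_atTop a] with t ht using (rise_of_ge hρ ht).symm

theorem integral_deriv_fall (hσ : 0 < σ) :
    Integrable (deriv (fall b σ)) ∧ ∫ t, deriv (fall b σ) t = -1 := by
  have hi : Integrable (deriv (fall b σ)) :=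
    continuous_deriv_fall.integrable_of_hasCompactSupport
      (HasCompactSupport.intro isCompact_Icc fun t ht => deriv_fall_of_notMem hσ ht)
  refine ⟨hi, ?_⟩
  rw [integral_of_hasDerivAt_of_tendsto (f := fall b σ) (m := 1) (n := 0)
    (fun t => hasDerivAt_fall) hi, zero_sub]
  · refine tendsto_const_nhds.congr' ?_
    filter_upwards [eventually_le_atBot b] with t ht using (fall_of_le hσ ht).symm
  · refine tendsto_const_nhds.congr' ?_
    filter_upwards [eventually_ge_atTop (b + σ)] with t ht using (fall_of_ge hσ ht).symm

/-- For `a ≤ b` at least one factor of the plateau equals `1` at every time, so the product is the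
sum minus one and the two slopes separate. -/
theorem deriv_plateau_eq (hρ : 0 < ρ) (hσ : 0 < σ) (hab : a ≤ b) :
    deriv (plateau a ρ b σ) t = deriv (rise a ρ) t + deriv (fall b σ) t := by
  have : plateau a ρ b σ = fun t => rise a ρ t + fall b σ t - 1 := by
    funext t
    rcases le_total a t with h | h
    · rw [plateau_of_le hρ h, rise_of_ge hρ h, fall]; ring
    · rw [plateau_of_ge hσ (h.trans hab), fall_of_le hσ (h.trans hab), rise]; ring
  rw [this]
  exact ((hasDerivAt_rise.add hasDerivAt_fall).sub_const 1).deriv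

theorem integral_plateau_le (hρ : 0 < ρ) (hσ : 0 < σ) (hab : a ≤ b) :
    ∫ t, plateau a ρ b σ t ≤ b - a + ρ + σ := by
  have e1 : ∫ t, (Icc (a - ρ) (b + σ)).indicator (1 : ℝ → ℝ) t = b - a + ρ + σ := by
    rw [integral_indicator_one measurableSet_Icc, Real.volume_real_Icc_of_le (by linarith)]
    ring
  rw [← e1]
  refine integral_mono_of_nonneg (ae_of_all _ fun t => plateau_nonneg)
    ((integrable_indicator_iff measurableSet_Icc).2 (integrableOn_const (by simp)))
    (ae_of_all _ fun t => ?_)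
  by_cases ht : t ∈ Icc (a - ρ) (b + σ)
  · simp only [indicator_of_mem ht, Pi.one_apply]
    exact plateau_le_one
  · simp only [indicator_of_notMem ht, plateau_of_notMem hρ hσ ht, le_refl]

end

/-- A continuous function whose weak derivative is bounded is Lipschitz. -/
theorem le_add_of_weak_deriv_le {T L : ℝ} {g : ℝ → ℝ} (hg : ContinuousOn g (Ioo 0 T)) (hL0 : 0 ≤ L)
    (hL : ∀ η, IsCutoff T η → (∀ t, 0 ≤ η t) → -(L * ∫ t, η t) ≤ ∫ t, deriv η t * g t)
    {a b : ℝ} (ha : 0 < a) (hab : a ≤ b) (hb : b < T) : g b ≤ g a + L * (b - a) := by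
  have key : ∀ ε > 0, g b ≤ g a + L * (b - a) + (2 + 2 * L) * ε := by
    intro ε hε
    have hga := (hg.continuousAt (Ioo_mem_nhds ha (hab.trans_lt hb)))
    have hgb := (hg.continuousAt (Ioo_mem_nhds (ha.trans_le hab) hb))
    obtain ⟨δ₁, hδ₁, h1⟩ := Metric.continuousAt_iff.1 hga ε hε
    obtain ⟨δ₂, hδ₂, h2⟩ := Metric.continuousAt_iff.1 hgb ε hε
    obtain ⟨ρ, hρ, hρm⟩ := exists_between (show 0 < min (min δ₁ δ₂) (min (min a (T - b)) ε) by
      have : 0 < T - b := by linarith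
      positivity)
    simp only [lt_min_iff] at hρm
    obtain ⟨⟨hr1, hr2⟩, ⟨hr3, hr4⟩, hr5⟩ := hρm
    -- The derivative of a narrow plateau approximates a unit mass at `a` minus a unit mass at `b`,
    -- so the weak inequality compares `g a` with `g b`.
    have hc := isCutoff_plateau (T := T) (a := a) (b := b) hρ hρ (by linarith) (by linarith)
    have h3 := hL _ hc fun t => plateau_nonneg
    have h4 := mul_le_mul_of_nonneg_left (integral_plateau_le hρ hρ hab) hL0
    obtain ⟨i1, e1⟩ := integral_deriv_rise (a := a) hρ
    obtain ⟨i2, e2⟩ := integral_deriv_fall (b := b) hρ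
    have hgi : Integrable fun t => deriv (plateau a ρ b ρ) t * g t := by
      have hK : IsCompact (Icc (a - ρ) (b + ρ)) := isCompact_Icc
      have hsub : Icc (a - ρ) (b + ρ) ⊆ Ioo 0 T := fun t ht =>
        ⟨by linarith [ht.1], by linarith [ht.2]⟩
      have h5 : IntegrableOn (fun t => deriv (plateau a ρ b ρ) t * g t) (Icc (a - ρ) (b + ρ)) :=
        (((hc.deriv).contDiff.continuous.continuousOn).mul (hg.mono hsub)).integrableOn_compact hK
      refine (integrableOn_iff_integrable_of_support_subset fun t ht => ?_).1 h5
      by_contra h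
      exact ht (by simp only [deriv_plateau_of_notMem hρ hρ h, zero_mul])
    have h6 : ∫ t, deriv (plateau a ρ b ρ) t * g t ≤
        ∫ t, (deriv (rise a ρ) t * (g a + ε) + deriv (fall b ρ) t * (g b - ε)) := by
      refine integral_mono hgi ((i1.mul_const _).add (i2.mul_const _)) fun t => ?_
      simp only
      rw [deriv_plateau_eq hρ hρ hab, add_mul]
      refine add_le_add ?_ ?_
      · by_cases ht : t ∈ Icc (a - ρ) a
        · refine mul_le_mul_of_nonneg_left ?_ (deriv_rise_nonneg hρ)
          have := h1 (x := t) (by rw [Real.dist_eq, abs_lt]; constructor <;> linarith [ht.1, ht.2])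
          rw [Real.dist_eq, abs_lt] at this
          linarith
        · rw [deriv_rise_of_notMem hρ ht, zero_mul, zero_mul]
      · by_cases ht : t ∈ Icc b (b + ρ)
        · refine mul_le_mul_of_nonpos_left ?_ (deriv_fall_nonpos hρ)
          have := h2 (x := t) (by rw [Real.dist_eq, abs_lt]; constructor <;> linarith [ht.1, ht.2])
          rw [Real.dist_eq, abs_lt] at this
          linarith
        · rw [deriv_fall_of_notMem hρ ht, zero_mul, zero_mul]
    rw [integral_add (i1.mul_const _) (i2.mul_const _), integral_mul_const, integral_mul_const,
      e1, e2] at h6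
    have h7 := mul_le_mul_of_nonneg_left hr5.le hL0
    linarith
  have hlim : Tendsto (fun ε : ℝ => g a + L * (b - a) + (2 + 2 * L) * ε) (𝓝[>] 0)
      (𝓝 (g a + L * (b - a) + (2 + 2 * L) * 0)) :=
    (tendsto_nhdsWithin_of_tendsto_nhds tendsto_id).const_mul _ |>.const_add _
  rw [mul_zero, add_zero] at hlim
  exact ge_of_tendsto hlim (eventually_mem_nhdsWithin.mono fun ε hε => key ε hε)

end

/-! ### The mass does not increase -/

section

open scoped ENNReal

/-- The cutoff at scale `R` in space. -/
noncomputable def spaceCutoff (d : ℕ) (R : ℝ) (x : Space d) : ℝ := unitBump d (R⁻¹ • x)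

section

variable {d : ℕ} {R : ℝ}

theorem spaceCutoff_nonneg (x : Space d) : 0 ≤ spaceCutoff d R x := (unitBump d).nonneg

theorem spaceCutoff_le_one (x : Space d) : spaceCutoff d R x ≤ 1 := (unitBump d).le_one

theorem contDiff_spaceCutoff : ContDiff ℝ ∞ (spaceCutoff d R) :=
  (unitBump d).contDiff.comp (contDiff_const_smul _)

theorem spaceCutoff_of_notMem (hR : 0 < R) {x : Space d} (hx : x ∉ Metric.closedBall 0 (3 * R)) :
    spaceCutoff d R x = 0 := by
  refine (unitBump d).zero_of_le_dist ?_
  rw [mem_closedBall_zero_iff, not_le] at hx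
  rw [dist_zero_right, norm_smul, norm_inv, Real.norm_of_nonneg hR.le, ← div_eq_inv_mul]
  exact (le_div_iff₀ hR).2 hx.le

theorem hasCompactSupport_spaceCutoff (hR : 0 < R) : HasCompactSupport (spaceCutoff d R) :=
  HasCompactSupport.intro (isCompact_closedBall 0 (3 * R)) fun _ hx => spaceCutoff_of_notMem hR hx

theorem tendsto_spaceCutoff (x : Space d) :
    ∀ᶠ n : ℕ in atTop, spaceCutoff d ((n : ℝ) + 1) x = 1 := by
  obtain ⟨N, hN⟩ := exists_nat_gt ‖x‖
  filter_upwards [eventually_ge_atTop N] with n hn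
  refine (unitBump d).one_of_mem_closedBall ?_
  have h1 : (N : ℝ) ≤ n := by exact_mod_cast hn
  have h2 : (0 : ℝ) < (n : ℝ) + 1 := by positivity
  rw [mem_closedBall_zero_iff, norm_smul, norm_inv, Real.norm_of_nonneg h2.le, ← div_eq_inv_mul,
    div_le_iff₀ h2]
  change ‖x‖ ≤ 2 * _
  linarith

theorem exists_norm_fderiv_spaceCutoff_le (d : ℕ) : ∃ B : ℝ, 0 ≤ B ∧ ∀ {R : ℝ}, 0 < R → ∀ x : Space d,
    ‖fderiv ℝ (spaceCutoff d R) x‖ ≤ B / R := by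
  obtain ⟨B, hB⟩ := ((unitBump d).contDiff (n := 1)).continuous_fderiv one_ne_zero
    |>.bounded_above_of_compact_support ((unitBump d).hasCompactSupport.fderiv (𝕜 := ℝ))
  refine ⟨B, (norm_nonneg _).trans (hB 0), fun {R} hR x => ?_⟩
  have h1 : fderiv ℝ (spaceCutoff d R) x = R⁻¹ • fderiv ℝ (unitBump d) (R⁻¹ • x) :=
    fderiv_comp_smul _
  rw [h1, norm_smul, norm_inv, Real.norm_of_nonneg hR.le, ← div_eq_inv_mul]
  gcongr
  exact hB _

theorem Scat_const {k : ℝ → ℝ} (c : ℂ) (θ : Sphere d) : Scat d k (fun _ => c) θ = 0 := by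
  have : ∀ ε, scat d k ε (fun _ => c) θ = 0 := fun ε => by simp [scat, zonalDiff]
  rw [Scat]
  simp only [this]
  exact tendsto_const_nhds.limUnder_eq

section

variable {T : ℝ} {s : ℝ} {b : ℝ → ℝ} {u₀ : Space d × Sphere d → ℝ} {u : ℝ → Space d × Sphere d → ℝ}

/-- The mass of the solution seen by a cutoff in space. -/
noncomputable def localMass (d : ℕ) (R : ℝ) (f : Space d × Sphere d → ℝ) : ℝ :=
  ∫ z, f z * spaceCutoff d R z.1 ∂(phase d)

theorem IsSolution.integrableOn_compact (hu : IsSolution d s b T u₀ u) {t : ℝ} (ht : t ∈ Ico 0 T)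
    {K : Set (Space d × Sphere d)} (hK : IsCompact K) : IntegrableOn (u t) K (phase d) :=
  (hu.locallyIntegrable t ht).integrableOn_isCompact hK

theorem integrable_mul_spaceCutoff {f : Space d × Sphere d → ℝ} (hR : 0 < R)
    (hf : IntegrableOn f (Metric.closedBall 0 (3 * R) ×ˢ univ) (phase d)) :
    Integrable (fun z => f z * spaceCutoff d R z.1) (phase d) := by
  have hc : Continuous fun z : Space d × Sphere d => spaceCutoff d R z.1 :=
    contDiff_spaceCutoff.continuous.comp continuous_fst
  have h1 : IntegrableOn (fun z => f z * spaceCutoff d R z.1)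
      (Metric.closedBall 0 (3 * R) ×ˢ univ) (phase d) :=
    Integrable.mul_bdd hf hc.aestronglyMeasurable (c := 1) (ae_of_all _ fun z => by
      rw [Real.norm_of_nonneg (spaceCutoff_nonneg _)]; exact spaceCutoff_le_one _)
  refine (integrableOn_iff_integrable_of_support_subset fun z hz => ?_).1 h1
  refine ⟨?_, mem_univ _⟩
  by_contra h
  exact hz (by simp only [spaceCutoff_of_notMem hR h, mul_zero])

theorem isCompact_cylinder (d : ℕ) (R : ℝ) :
    IsCompact (Metric.closedBall (0 : Space d) (3 * R) ×ˢ (univ : Set (Sphere d))) :=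
  (isCompact_closedBall _ _).prod isCompact_univ

theorem IsSolution.continuousOn_localMass (hu : IsSolution d s b T u₀ u) (hR : 0 < R) :
    ContinuousOn (fun t => localMass d R (u t)) (Ico 0 T) := by
  intro t ht
  have h1 := hu.continuous t ht _ (isCompact_cylinder d R)
  refine tendsto_iff_norm_sub_tendsto_zero.2 ?_
  refine squeeze_zero' (Eventually.of_forall fun _ => norm_nonneg _) ?_ h1
  filter_upwards [eventually_mem_nhdsWithin] with τ hτ
  have i1 := hu.integrableOn_compact hτ (isCompact_cylinder d R)
  have i2 := hu.integrableOn_compact ht (isCompact_cylinder d R)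
  rw [localMass, localMass, ← integral_sub (integrable_mul_spaceCutoff hR i1)
    (integrable_mul_spaceCutoff hR i2),
    ← integral_indicator (isCompact_cylinder d R).isClosed.measurableSet]
  refine norm_integral_le_of_norm_le ((integrable_indicator_iff
    (isCompact_cylinder d R).isClosed.measurableSet).2 (i1.sub i2).abs) (ae_of_all _ fun z => ?_)
  rw [← sub_mul, norm_mul, Real.norm_of_nonneg (spaceCutoff_nonneg _)]
  by_cases hz : z ∈ Metric.closedBall (0 : Space d) (3 * R) ×ˢ (univ : Set (Sphere d))
  · rw [indicator_of_mem hz]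
    exact mul_le_of_le_one_right (norm_nonneg _) (spaceCutoff_le_one _)
  · have h0 : z.1 ∉ Metric.closedBall (0 : Space d) (3 * R) := fun h => hz ⟨h, mem_univ _⟩
    rw [indicator_of_notMem hz, spaceCutoff_of_notMem hR h0, mul_zero]

/-- The angular test function `1` is annihilated by scattering, so the local mass changes only
through transport across the spatial cutoff. The gradient of the cutoff is of order `1/R` and the
directions are unit vectors. -/
theorem IsSolution.exists_weak_deriv_localMass {s₁ c₁ M : ℝ} {k e : ℝ → ℝ} (hT : 0 < T)
    (hk : IsKernel d s₁ c₁ M k e)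
    (hker : ∀ θ : Sphere d, ∀ᵐ θ' ∂(surface d), kernel d s b θ θ' = k (gap θ θ'))
    (hu : IsSolution d s b T u₀ u) : ∃ L : ℝ, 0 ≤ L ∧ ∀ {R : ℝ}, 0 < R → ∀ η, IsCutoff T η →
      (∀ t, 0 ≤ η t) → -(L / R * ∫ t, η t) ≤ ∫ t, deriv η t * localMass d R (u t) := by
  obtain ⟨B, hB0, hB⟩ := exists_norm_fderiv_spaceCutoff_le d
  obtain ⟨M', hM'⟩ := hu.bounded
  have hui := hu.integrable
  refine ⟨B * max M' 0, by positivity, fun {R} hR η hη hη0 => ?_⟩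
  have hA : IsComplexCutoff T fun t => (η t : ℂ) :=
    ⟨Complex.ofRealCLM.contDiff.comp hη.contDiff, hη.hasCompactSupport.comp_left Complex.ofReal_zero,
      (closure_mono (s := Function.support fun t => (η t : ℂ)) (t := Function.support η)
        fun t ht h0 => ht (by simp [h0])).trans hη.tsupport_subset⟩
  have hdA : ∀ t, deriv (fun t => (η t : ℂ)) t = ((deriv η t : ℝ) : ℂ) := fun t =>
    ((hη.contDiff.differentiable (by simp) t).hasDerivAt.ofReal_comp).deriv
  have hX : ContDiff ℝ ∞ fun x => (spaceCutoff d R x : ℂ) :=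
    Complex.ofRealCLM.contDiff.comp contDiff_spaceCutoff
  have hdX : ∀ x v, fderiv ℝ (fun x => (spaceCutoff d R x : ℂ)) x v =
      ((fderiv ℝ (spaceCutoff d R) x v : ℝ) : ℂ) := fun x v => by
    have h1 : HasFDerivAt (fun x => (spaceCutoff d R x : ℂ))
        (Complex.ofRealCLM.comp (fderiv ℝ (spaceCutoff d R) x)) x :=
      Complex.ofRealCLM.hasFDerivAt.comp x (contDiff_spaceCutoff.differentiable (by simp) x).hasFDerivAt
    rw [h1.fderiv]
    rfl
  have h1 := hu.transport hT hk hker hA hX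
    ((hasCompactSupport_spaceCutoff hR).comp_left Complex.ofReal_zero) (ψ := fun _ => 1) contDiff_const
  simp only [Scat_const, mul_zero, integral_zero, neg_zero, mul_one, hdA, hdX] at h1
  have h2 : ∫ p, u p.1 p.2 * (deriv η p.1 * spaceCutoff d R p.2.1 +
      η p.1 * fderiv ℝ (spaceCutoff d R) p.2.1 p.2.2) ∂(slab d 0 T) = 0 := by
    rw [← Complex.ofReal_inj, ← integral_complex_ofReal, Complex.ofReal_zero, ← h1]
    exact integral_congr_ae (ae_of_all _ fun p => by push_cast; rfl)
  obtain ⟨Bη, hBη⟩ := hη.exists_bound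
  obtain ⟨Bη', hBη'⟩ := hη.deriv.exists_bound
  have hm1 := hη.deriv.contDiff.continuous
  have hm2 := hη.contDiff.continuous
  have hm3 := (contDiff_spaceCutoff (d := d) (R := R)).continuous
  have hm4 : Continuous fun p : Space d × Space d => fderiv ℝ (spaceCutoff d R) p.1 p.2 :=
    ((contDiff_spaceCutoff.continuous_fderiv (by simp)).comp continuous_fst).clm_apply continuous_snd
  have hfb : ∀ (x : Space d) (θ : Sphere d), ‖fderiv ℝ (spaceCutoff d R) x θ‖ ≤ B / R := fun x θ => by
    have := (fderiv ℝ (spaceCutoff d R) x).le_opNorm (θ : Space d)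
    rw [norm_sphere, mul_one] at this
    exact this.trans (hB hR x)
  have i1 : Integrable (fun p : ℝ × Space d × Sphere d =>
      u p.1 p.2 * (deriv η p.1 * spaceCutoff d R p.2.1)) (slab d 0 T) := by
    refine hui.mul_bdd (c := Bη' * 1) (Continuous.aestronglyMeasurable (by fun_prop))
      (ae_of_all _ fun p => ?_)
    rw [norm_mul, Real.norm_of_nonneg (spaceCutoff_nonneg _)]
    exact mul_le_mul (hBη' _) (spaceCutoff_le_one _) (spaceCutoff_nonneg _)
      ((norm_nonneg _).trans (hBη' 0))
  have hc5 : Continuous fun p : ℝ × Space d × Sphere d =>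
      η p.1 * fderiv ℝ (spaceCutoff d R) p.2.1 p.2.2 :=
    (hm2.comp continuous_fst).mul (hm4.comp (by fun_prop : Continuous
      fun p : ℝ × Space d × Sphere d => (p.2.1, (p.2.2 : Space d))))
  have i2 : Integrable (fun p : ℝ × Space d × Sphere d =>
      u p.1 p.2 * (η p.1 * fderiv ℝ (spaceCutoff d R) p.2.1 p.2.2)) (slab d 0 T) := by
    refine hui.mul_bdd (c := Bη * (B / R)) hc5.aestronglyMeasurable (ae_of_all _ fun p => ?_)
    rw [norm_mul]
    exact mul_le_mul (hBη _) (hfb _ _) (norm_nonneg _) ((norm_nonneg _).trans (hBη 0))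
  simp only [mul_add] at h2
  rw [integral_add i1 i2, integral_prod _ i1, integral_prod _ i2] at h2
  have e1 : ∀ t, ∫ z, u t z * (deriv η t * spaceCutoff d R z.1) ∂(phase d) =
      deriv η t * localMass d R (u t) := fun t => by
    rw [localMass, ← integral_const_mul]
    exact integral_congr_ae (ae_of_all _ fun z => by ring)
  simp only [e1] at h2
  have hset : ∀ t, t ∉ Ioo 0 T → η t = 0 ∧ deriv η t = 0 := fun t ht =>
    ⟨by_contra fun h => ht (hη.tsupport_subset (subset_tsupport _ h)),
      by_contra fun h => ht (hη.deriv.tsupport_subset (subset_tsupport _ h))⟩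
  have e2 : ∫ t in Ioo 0 T, deriv η t * localMass d R (u t) = ∫ t, deriv η t * localMass d R (u t) :=
    setIntegral_eq_integral_of_forall_compl_eq_zero fun t ht => by rw [(hset t ht).2, zero_mul]
  have e3 : ∫ t in Ioo 0 T, η t = ∫ t, η t :=
    setIntegral_eq_integral_of_forall_compl_eq_zero fun t ht => (hset t ht).1
  rw [e2] at h2
  have h3 : ∫ t in Ioo 0 T, ∫ z, u t z * (η t * fderiv ℝ (spaceCutoff d R) z.1 z.2) ∂(phase d) ≤
      ∫ t in Ioo 0 T, B * max M' 0 / R * η t := by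
    refine integral_mono_ae i2.integral_prod_left
      ((hη.contDiff.continuous.integrable_of_hasCompactSupport hη.hasCompactSupport).const_mul _
        |>.integrableOn) ?_
    filter_upwards [hM', i2.prod_right_ae] with t ht hti
    calc _ ≤ ∫ z, |u t z| * (η t * (B / R)) ∂(phase d) := by
          refine integral_mono hti (ht.1.abs.mul_const _) fun z => ?_
          refine (le_abs_self _).trans ?_
          rw [abs_mul, abs_mul, abs_of_nonneg (hη0 t)]
          have := hη0 t
          gcongr
          exact hfb _ _
      _ = (∫ z, |u t z| ∂(phase d)) * (η t * (B / R)) := integral_mul_const _ _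
      _ ≤ max M' 0 * (η t * (B / R)) := by
          have := hη0 t
          gcongr
          exact ht.2.trans (le_max_left _ _)
      _ = _ := by ring
  rw [integral_const_mul, e3] at h3
  linarith

/-- The mass does not increase. -/
theorem IsSolution.lintegral_le {s₁ c₁ M : ℝ} {k e : ℝ → ℝ}
    (hk : IsKernel d s₁ c₁ M k e)
    (hker : ∀ θ : Sphere d, ∀ᵐ θ' ∂(surface d), kernel d s b θ θ' = k (gap θ θ'))
    (hu₀ : Integrable u₀ (phase d)) (hu₀_nonneg : 0 ≤ᵐ[phase d] u₀)
    (hu : IsSolution d s b T u₀ u) {t : ℝ} (ht : t ∈ Ioo 0 T) :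
    ∫⁻ z, ‖u t z‖ₑ ∂(phase d) ≤ ENNReal.ofReal (∫ z, u₀ z ∂(phase d)) := by
  have hT : 0 < T := ht.1.trans ht.2
  obtain ⟨L, hL0, hL⟩ := hu.exists_weak_deriv_localMass hT hk hker
  have h1 : ∀ R : ℝ, 0 < R → localMass d R (u t) ≤ ∫ z, u₀ z ∂(phase d) + L / R * t := by
    intro R hR
    have hc := hu.continuousOn_localMass hR
    have h2 : ∀ a ∈ Ioo 0 t, localMass d R (u t) ≤ localMass d R (u a) + L / R * (t - a) :=
      fun a ha => le_add_of_weak_deriv_le (hc.mono Ioo_subset_Ico_self) (by positivity)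
        (fun η hη h0 => hL hR η hη h0) ha.1 ha.2.le ht.2
    -- The weak equation holds only for positive times; `L¹_loc` continuity at `0` connects it with
    -- the initial state.
    have h3 : Tendsto (fun a => localMass d R (u a) + L / R * (t - a)) (𝓝[>] 0)
        (𝓝 (localMass d R (u 0) + L / R * (t - 0))) := by
      have h4 := hc 0 ⟨le_rfl, hT⟩
      have h5 : 𝓝[>] (0 : ℝ) ≤ 𝓝[Ico 0 T] 0 := by
        rw [← nhdsWithin_Ioo_eq_nhdsGT hT]
        exact nhdsWithin_mono _ Ioo_subset_Ico_self
      refine Tendsto.add (h4.mono_left h5) ?_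
      exact (tendsto_nhdsWithin_of_tendsto_nhds (tendsto_id.const_sub t)).const_mul _
    have h6 : localMass d R (u t) ≤ localMass d R (u 0) + L / R * (t - 0) :=
      ge_of_tendsto h3 (eventually_of_mem (Ioo_mem_nhdsGT ht.1) h2)
    have h7 : localMass d R (u 0) ≤ ∫ z, u₀ z ∂(phase d) := by
      rw [localMass]
      refine integral_mono_ae (integrable_mul_spaceCutoff hR
        (hu.integrableOn_compact ⟨le_rfl, hT⟩ (isCompact_cylinder d R))) hu₀ ?_
      filter_upwards [hu.initial, hu₀_nonneg] with z h h'
      rw [h]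
      exact mul_le_of_le_one_right h' (spaceCutoff_le_one _)
    rw [sub_zero] at h6
    linarith
  have ht' : t ∈ Ico 0 T := Ioo_subset_Ico_self ht
  have hm : AEStronglyMeasurable (u t) (phase d) := (hu.locallyIntegrable t ht').aestronglyMeasurable
  have hcut : ∀ R : ℝ, AEStronglyMeasurable (fun z : Space d × Sphere d => spaceCutoff d R z.1)
      (phase d) := fun R =>
    (contDiff_spaceCutoff.continuous.comp continuous_fst).aestronglyMeasurable
  have h8 : ∫⁻ z, ‖u t z‖ₑ ∂(phase d) ≤
      -- Fatou's lemma as the cutoff exhausts space; the boundary flux `L t/R` disappears in the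
      -- limit.
      liminf (fun n : ℕ => ∫⁻ z, ‖u t z * spaceCutoff d ((n : ℝ) + 1) z.1‖ₑ ∂(phase d)) atTop := by
    refine le_trans (le_of_eq ?_) (lintegral_liminf_le' fun n => (hm.mul (hcut _)).enorm)
    refine lintegral_congr fun z => ?_
    refine ((tendsto_const_nhds.congr' ?_).liminf_eq).symm
    filter_upwards [tendsto_spaceCutoff z.1] with n hn
    rw [hn, mul_one]
  refine h8.trans ?_
  have h9 : ∀ n : ℕ, ∫⁻ z, ‖u t z * spaceCutoff d ((n : ℝ) + 1) z.1‖ₑ ∂(phase d) ≤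
      ENNReal.ofReal (∫ z, u₀ z ∂(phase d) + L * t * (1 / ((n : ℝ) + 1))) := by
    intro n
    have hR : (0 : ℝ) < (n : ℝ) + 1 := by positivity
    have h10 : ∫⁻ z, ‖u t z * spaceCutoff d ((n : ℝ) + 1) z.1‖ₑ ∂(phase d) =
        ENNReal.ofReal (localMass d ((n : ℝ) + 1) (u t)) := by
      rw [localMass, ofReal_integral_eq_lintegral_ofReal (integrable_mul_spaceCutoff hR
        (hu.integrableOn_compact ht' (isCompact_cylinder d _)))]
      · refine lintegral_congr_ae ?_
        filter_upwards [hu.nonneg t ht'] with z hz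
        exact Real.enorm_of_nonneg (mul_nonneg hz (spaceCutoff_nonneg _))
      · filter_upwards [hu.nonneg t ht'] with z hz using mul_nonneg hz (spaceCutoff_nonneg _)
    rw [h10]
    refine ENNReal.ofReal_le_ofReal ((h1 _ hR).trans (le_of_eq ?_))
    ring
  refine (liminf_le_liminf (Eventually.of_forall h9)).trans (le_of_eq ?_)
  refine Tendsto.liminf_eq (ENNReal.tendsto_ofReal ?_)
  have := (tendsto_one_div_add_atTop_nhds_zero_nat (𝕜 := ℝ)).const_mul (L * t)
  rw [mul_zero] at this
  simpa using this.const_add (∫ z, u₀ z ∂(phase d))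

end

end

end

/-! ### Measurable representatives and spatial Fourier modes -/

section

open scoped ENNReal FourierTransform

/-- A representative of a solution. -/
structure IsDensity (d : ℕ) (k : ℝ → ℝ) (T m : ℝ) (v : ℝ → Space d × Sphere d → ℝ) : Prop where
  mass_nonneg : 0 ≤ m
  measurable : Measurable fun p : ℝ × Space d × Sphere d => v p.1 p.2
  nonneg : ∀ t z, 0 ≤ v t z
  mass : ∀ t, ∫⁻ z, ‖v t z‖ₑ ∂(phase d) ≤ ENNReal.ofReal m
  transport : ∀ (A : ℝ → ℂ) (X ψ : Space d → ℂ), IsComplexCutoff T A → ContDiff ℝ ∞ X →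
    HasCompactSupport X → ContDiff ℝ ∞ ψ →
    ∫ p, (v p.1 p.2 : ℂ) * ((deriv A p.1 * X p.2.1 + A p.1 * fderiv ℝ X p.2.1 p.2.2) * ψ p.2.2)
        ∂(slab d 0 T) =
      - ∫ p, (v p.1 p.2 : ℂ) * (A p.1 * X p.2.1 * Scat d k (fun θ => ψ θ) p.2.2)
        ∂(slab d 0 T)

/-- The Fourier analysis needs joint measurability, and a sign and a mass bound at every time. The
absolute value of a measurable representative, set to zero at the times where the mass bound fails,
has these properties and agrees with `u` at almost every time. -/
theorem IsSolution.exists_isDensity {d : ℕ} {s s₁ c₁ M T : ℝ} {b k e : ℝ → ℝ} (hT : 0 < T)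
    (hk : IsKernel d s₁ c₁ M k e)
    (hker : ∀ θ : Sphere d, ∀ᵐ θ' ∂(surface d), kernel d s b θ θ' = k (gap θ θ'))
    {u₀ : Space d × Sphere d → ℝ} {u : ℝ → Space d × Sphere d → ℝ} (hu₀ : Integrable u₀ (phase d))
    (hu₀_nonneg : 0 ≤ᵐ[phase d] u₀) (hu : IsSolution d s b T u₀ u) :
    ∃ v : ℝ → Space d × Sphere d → ℝ, IsDensity d k T (∫ z, u₀ z ∂(phase d)) v ∧
      ∀ᵐ t ∂((volume : Measure ℝ).restrict (Ioo 0 T)), u t =ᵐ[phase d] v t := by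
  set m := ∫ z, u₀ z ∂(phase d) with hm
  set V : ℝ × Space d × Sphere d → ℝ := fun p => |hu.measurable.mk _ p| with hV
  have hVm : Measurable V := hu.measurable.stronglyMeasurable_mk.measurable.abs
  set G : Set ℝ := {t | ∫⁻ z, ‖V (t, z)‖ₑ ∂(phase d) ≤ ENNReal.ofReal m} with hG
  have hGm : MeasurableSet G := measurableSet_le hVm.enorm.lintegral_prod_right' measurable_const
  set v : ℝ → Space d × Sphere d → ℝ := fun t z => G.indicator (fun t => V (t, z)) t with hv
  have hvG : ∀ t ∈ G, v t = fun z => V (t, z) := fun t ht => by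
    funext z; simp only [hv, indicator_of_mem ht]
  have hvn : ∀ t, t ∉ G → v t = 0 := fun t ht => by
    funext z; simp only [hv, indicator_of_notMem ht, Pi.zero_apply]
  have hae : ∀ᵐ t ∂((volume : Measure ℝ).restrict (Ioo 0 T)), u t =ᵐ[phase d] v t := by
    filter_upwards [Measure.ae_ae_of_ae_prod hu.measurable.ae_eq_mk,
      ae_restrict_mem measurableSet_Ioo] with t h1 h2
    have h3 : u t =ᵐ[phase d] fun z => V (t, z) := by
      filter_upwards [h1, hu.nonneg t (Ioo_subset_Ico_self h2)] with z hz hz0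
      simp only [hV]
      rw [← hz]
      exact (abs_of_nonneg hz0).symm
    have h4 : t ∈ G := by
      have := hu.lintegral_le hk hker hu₀ hu₀_nonneg h2
      have h5 : ∫⁻ z, ‖V (t, z)‖ₑ ∂(phase d) = ∫⁻ z, ‖u t z‖ₑ ∂(phase d) :=
        lintegral_congr_ae (h3.mono fun z hz => by simp only [hz])
      exact h5.trans_le this
    rw [hvG t h4]
    exact h3
  refine ⟨v, ⟨integral_nonneg_of_ae hu₀_nonneg, ?_, fun t z => ?_, fun t => ?_, ?_⟩, hae⟩
  · exact (hVm.indicator (hGm.preimage measurable_fst) :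
      Measurable ((Prod.fst ⁻¹' G : Set (ℝ × Space d × Sphere d)).indicator V))
  · exact indicator_nonneg (fun _ _ => abs_nonneg _) _
  · by_cases ht : t ∈ G
    · rw [hvG t ht]; exact ht
    · rw [hvn t ht]; simp
  · intro A X ψ hA hX hXc hψ
    have hvm : Measurable fun p : ℝ × Space d × Sphere d => v p.1 p.2 :=
      (hVm.indicator (hGm.preimage measurable_fst) :
        Measurable ((Prod.fst ⁻¹' G : Set (ℝ × Space d × Sphere d)).indicator V))
    have hp : ∀ᵐ p ∂(slab d 0 T), u p.1 p.2 = v p.1 p.2 := by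
      have h5 : ∀ᵐ p ∂(slab d 0 T), hu.measurable.mk _ p = v p.1 p.2 :=
        (Measure.ae_prod_iff_ae_ae (measurableSet_eq_fun
          hu.measurable.stronglyMeasurable_mk.measurable hvm)).2 (by
            filter_upwards [hae, Measure.ae_ae_of_ae_prod hu.measurable.ae_eq_mk] with t h1 h2
            filter_upwards [h1, h2] with z h3 h4
            rw [← h4, h3])
      filter_upwards [h5, hu.measurable.ae_eq_mk] with p h1 h2
      rw [← h1, ← h2]
    have h1 := hu.transport hT hk hker hA hX hXc hψ
    have e1 : ∀ F : ℝ × Space d × Sphere d → ℂ, ∫ p, (u p.1 p.2 : ℂ) * F p ∂(slab d 0 T) =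
        ∫ p, (v p.1 p.2 : ℂ) * F p ∂(slab d 0 T) := fun F =>
      integral_congr_ae (hp.mono fun p h => by simp only [h])
    rw [e1 fun p => (deriv A p.1 * X p.2.1 + A p.1 * fderiv ℝ X p.2.1 p.2.2) * ψ p.2.2,
      e1 fun p => A p.1 * X p.2.1 * Scat d k (fun θ => ψ θ) p.2.2] at h1
    exact h1

/-- The Fourier modes in space of a density. -/
noncomputable def mode {d : ℕ} (v : ℝ → Space d × Sphere d → ℝ) (ξ : Space d) (t : ℝ) (θ : Sphere d) :
    ℂ :=
  𝓕 (fun x => (v t (x, θ) : ℂ)) ξ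

/-- A plane wave. -/
noncomputable def wave {V : Type*} [NormedAddCommGroup V] [InnerProductSpace ℝ V] (ξ x : V) : ℂ :=
  Complex.exp (((-2 * Real.pi * inner ℝ x ξ : ℝ) : ℂ) * Complex.I)

section

variable {V : Type*} [NormedAddCommGroup V] [InnerProductSpace ℝ V]

theorem norm_wave (ξ x : V) : ‖wave ξ x‖ = 1 := Complex.norm_exp_ofReal_mul_I _

theorem contDiff_wave (ξ : V) : ContDiff ℝ ∞ (wave ξ) := by
  unfold wave
  have h1 : ContDiff ℝ ∞ fun x : V => -2 * Real.pi * inner ℝ x ξ :=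
    contDiff_const.mul (contDiff_id.inner ℝ contDiff_const)
  exact ((Complex.ofRealCLM.contDiff.comp h1).mul contDiff_const).cexp

theorem fderiv_wave (ξ x w : V) :
    fderiv ℝ (wave ξ) x w = -(2 * Real.pi * inner ℝ w ξ : ℝ) * Complex.I * wave ξ x := by
  have h1 : HasFDerivAt (fun x : V => inner ℝ x ξ) (innerSL ℝ ξ) x := by
    simp only [real_inner_comm ξ]
    exact (innerSL ℝ ξ).hasFDerivAt
  have h2 := ((Complex.ofRealCLM.hasFDerivAt.comp x (h1.const_mul (-2 * Real.pi))).mul_const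
    Complex.I).cexp
  have h3 : fderiv ℝ (wave ξ) x = _ := h2.fderiv
  rw [h3]
  simp only [smul_apply, ContinuousLinearMap.comp_apply, innerSL_apply_apply,
    Complex.ofRealCLM_apply, smul_eq_mul, Function.comp_apply, wave, real_inner_comm ξ]
  push_cast
  ring

end

instance (d : ℕ) : SFinite ((surface d).prod (volume : Measure (Space d))) :=
  @Measure.prod.instSFinite _ _ _ _ _ inferInstance _ inferInstance

section

variable {d : ℕ} {k : ℝ → ℝ} {T m : ℝ} {v : ℝ → Space d × Sphere d → ℝ}

theorem mode_eq (v : ℝ → Space d × Sphere d → ℝ) (ξ : Space d) (t : ℝ) (θ : Sphere d) :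
    mode v ξ t θ = ∫ x, wave ξ x * v t (x, θ) := by
  rw [mode, Real.fourier_eq']
  rfl

theorem IsDensity.measurable_mode (hv : IsDensity d k T m v) :
    Measurable fun p : Space d × ℝ × Sphere d => mode v p.1 p.2.1 p.2.2 := by
  simp only [mode_eq]
  have h1 : Measurable fun q : (Space d × ℝ × Sphere d) × Space d => v q.1.2.1 (q.2, q.1.2.2) :=
    hv.measurable.comp (by fun_prop : Measurable fun q : (Space d × ℝ × Sphere d) × Space d =>
      (q.1.2.1, (q.2, q.1.2.2)))
  have h2 : Measurable fun q : (Space d × ℝ × Sphere d) × Space d => wave q.1.1 q.2 := by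
    unfold wave; fun_prop
  have h3 : StronglyMeasurable fun q : (Space d × ℝ × Sphere d) × Space d =>
      wave q.1.1 q.2 * (v q.1.2.1 (q.2, q.1.2.2) : ℂ) :=
    (h2.mul (Complex.measurable_ofReal.comp h1)).stronglyMeasurable
  exact h3.integral_prod_right'.measurable

/-- For a nonnegative function the Fourier transform is largest at frequency zero. Hence square
integrability of all modes follows from that of the spatial average. -/
theorem IsDensity.norm_mode_le (hv : IsDensity d k T m v) (ξ : Space d) (t : ℝ) (θ : Sphere d) :
    ‖mode v ξ t θ‖ ≤ ‖mode v 0 t θ‖ := by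
  have h0 : mode v 0 t θ = ((∫ x, v t (x, θ) : ℝ) : ℂ) := by
    rw [mode_eq, ← integral_complex_ofReal]
    simp [wave]
  rw [h0, mode_eq, Complex.norm_real, Real.norm_of_nonneg (integral_nonneg fun x => hv.nonneg _ _)]
  refine (norm_integral_le_integral_norm _).trans (le_of_eq ?_)
  refine integral_congr_ae (ae_of_all _ fun x => ?_)
  simp only [norm_mul, norm_wave, one_mul, Complex.norm_real, Real.norm_of_nonneg (hv.nonneg t (x, θ))]

theorem IsDensity.lintegral_mode_le (hv : IsDensity d k T m v) (ξ : Space d) (t : ℝ) :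
    ∫⁻ θ, ‖mode v ξ t θ‖ₑ ∂(surface d) ≤ ENNReal.ofReal m := by
  refine le_trans ?_ (hv.mass t)
  have hm : Measurable fun z : Space d × Sphere d => ‖v t z‖ₑ :=
    (hv.measurable.comp measurable_prodMk_left).enorm
  rw [lintegral_prod_symm _ hm.aemeasurable]
  refine lintegral_mono fun θ => ?_
  rw [mode_eq]
  refine (enorm_integral_le_lintegral_enorm _).trans (le_of_eq ?_)
  refine lintegral_congr fun x => ?_
  rw [enorm_mul, ← ofReal_norm, norm_wave, ENNReal.ofReal_one, one_mul, ← ofReal_norm,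
    Complex.norm_real, ofReal_norm]

theorem IsDensity.integrable (hv : IsDensity d k T m v) :
    Integrable (fun p : ℝ × Space d × Sphere d => v p.1 p.2) (slab d 0 T) := by
  refine ⟨hv.measurable.aestronglyMeasurable, ?_⟩
  rw [HasFiniteIntegral, lintegral_prod _ hv.measurable.enorm.aemeasurable]
  calc _ ≤ ∫⁻ t in Ioo 0 T, ENNReal.ofReal m := lintegral_mono fun t => hv.mass t
    _ < ⊤ := by simp [ENNReal.mul_lt_top_iff]

/-- Fubini with the integral over `x` innermost, where the plane wave turns the density into its
mode. -/
theorem integral_slab_modes {A : ℝ → ℂ} (hA : ∀ t, t ∉ Ioo 0 T → A t = 0) {G : Sphere d → ℂ}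
    {ξ : Space d} (hF : Integrable (fun p : ℝ × Space d × Sphere d =>
      (v p.1 p.2 : ℂ) * (A p.1 * wave ξ p.2.1 * G p.2.2)) (slab d 0 T)) :
    Integrable (fun θ => (∫ t, A t * mode v ξ t θ) * G θ) (surface d) ∧
    ∫ p, (v p.1 p.2 : ℂ) * (A p.1 * wave ξ p.2.1 * G p.2.2) ∂(slab d 0 T) =
      ∫ θ, (∫ t, A t * mode v ξ t θ) * G θ ∂(surface d) := by
  have hmp : MeasurePreserving
      (fun q : (ℝ × Sphere d) × Space d => (q.1.1, (q.2, q.1.2)))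
      ((((volume : Measure ℝ).restrict (Ioo 0 T)).prod (surface d)).prod (volume : Measure (Space d)))
      (slab d 0 T) :=
    ((MeasurePreserving.id _).prod Measure.measurePreserving_swap).comp
      (measurePreserving_prodAssoc _ _ _)
  have hF' := (hmp.integrable_comp hF.1).2 hF
  simp only [Function.comp_def] at hF'
  have key : ∀ θ, ∫ t in Ioo 0 T, ∫ x, (v t (x, θ) : ℂ) * (A t * wave ξ x * G θ) =
      (∫ t, A t * mode v ξ t θ) * G θ := by
    intro θ
    rw [← setIntegral_eq_integral_of_forall_compl_eq_zero (s := Ioo 0 T)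
      (f := fun t => A t * mode v ξ t θ) (fun t ht => by rw [hA t ht, zero_mul]), ← integral_mul_const]
    refine integral_congr_ae (ae_of_all _ fun t => ?_)
    simp only [mode_eq]
    rw [mul_right_comm, ← integral_const_mul]
    refine integral_congr_ae (ae_of_all _ fun x => ?_)
    simp only
    ring
  have h1 := hF'.integral_prod_left.integral_prod_right
  simp only [key] at h1
  refine ⟨h1, ?_⟩
  rw [← hmp.map_eq, integral_map hmp.measurable.aemeasurable (by rw [hmp.map_eq]; exact hF.1),
    integral_prod _ hF', integral_prod_symm _ hF'.integral_prod_left]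
  exact integral_congr_ae (ae_of_all _ fun θ => key θ)

end

end

/-! ### The equation satisfied by the modes -/

section

open scoped ENNReal FourierTransform

section

variable {d : ℕ} {s c₁ M : ℝ} {k e : ℝ → ℝ} {T m : ℝ} {v : ℝ → Space d × Sphere d → ℝ}

theorem timeFourier_eq (W : ℝ → Sphere d → ℂ) (η : ℝ → ℝ) (τ : ℝ) (θ : Sphere d) :
    timeFourier W η (τ, θ) = ∫ t, (η t : ℂ) * wave τ t * W t θ := by
  rw [timeFourier, Real.fourier_eq']
  refine integral_congr_ae (ae_of_all _ fun t => ?_)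
  simp only [cut, wave, smul_eq_mul]
  ring

theorem IsCutoff.mul_wave {η : ℝ → ℝ} (hη : IsCutoff T η) (τ : ℝ) :
    IsComplexCutoff T fun t => (η t : ℂ) * wave τ t where
  contDiff := (Complex.ofRealCLM.contDiff.comp hη.contDiff).mul (contDiff_wave τ)
  hasCompactSupport := (hη.hasCompactSupport.comp_left Complex.ofReal_zero).mul_right
  tsupport_subset := (closure_mono (s := Function.support fun t => (η t : ℂ) * wave τ t)
    (t := Function.support η) fun t ht h0 => ht (by simp [h0])).trans hη.tsupport_subset

theorem deriv_mul_wave {η : ℝ → ℝ} (hη : IsCutoff T η) (τ t : ℝ) :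
    deriv (fun t => (η t : ℂ) * wave τ t) t = ((deriv η t : ℝ) : ℂ) * wave τ t -
      ((2 * Real.pi * τ : ℝ) : ℂ) * Complex.I * ((η t : ℂ) * wave τ t) := by
  have h1 : HasDerivAt (fun t => (η t : ℂ)) ((deriv η t : ℝ) : ℂ) t :=
    (hη.contDiff.differentiable (by simp) t).hasDerivAt.ofReal_comp
  have h2 : HasDerivAt (wave τ) (deriv (wave τ) t) t :=
    ((contDiff_wave τ).differentiable (by simp) t).hasDerivAt
  have h3 : deriv (wave τ) t = -(2 * Real.pi * τ : ℝ) * Complex.I * wave τ t := by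
    rw [← fderiv_apply_one_eq_deriv, fderiv_wave]
    simp
  have h4 : deriv (fun t => (η t : ℂ) * wave τ t) t = _ := (h1.mul h2).deriv
  rw [h4, h3]
  ring

/-- The weak formulation for plane waves. -/
theorem IsDensity.transport_wave (hk : IsKernel d s c₁ M k e) (hv : IsDensity d k T m v) {A : ℝ → ℂ}
    (hA : IsComplexCutoff T A) (ξ : Space d) {ψ : Space d → ℂ} (hψ : ContDiff ℝ ∞ ψ) :
    ∫ p, (v p.1 p.2 : ℂ) * ((deriv A p.1 * wave ξ p.2.1 +
        A p.1 * (-(2 * Real.pi * inner ℝ (p.2.2 : Space d) ξ : ℝ) * Complex.I * wave ξ p.2.1)) * ψ p.2.2)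
        ∂(slab d 0 T) =
      - ∫ p, (v p.1 p.2 : ℂ) * (A p.1 * wave ξ p.2.1 * Scat d k (fun θ => ψ θ) p.2.2)
        ∂(slab d 0 T) := by
  obtain ⟨B, hB0, hB⟩ := exists_norm_fderiv_spaceCutoff_le d
  obtain ⟨BS, hBS0, hBS, -⟩ := hk.exists_norm_Scat_le (contDiff_infty.1 hψ 2)
  obtain ⟨Bψ, hBψ0, hBψ⟩ := exists_bound_restrict (d := d) hψ.continuous
  obtain ⟨BA, hBA⟩ := hA.contDiff.continuous.bounded_above_of_compact_support hA.hasCompactSupport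
  have hdAc : Continuous (deriv A) := hA.contDiff.continuous_deriv (by simp)
  obtain ⟨BA', hBA'⟩ := hdAc.bounded_above_of_compact_support hA.hasCompactSupport.deriv
  have hBA0 := (norm_nonneg _).trans (hBA 0)
  have hBA'0 := (norm_nonneg _).trans (hBA' 0)
  have hSm := hk.measurable_Scat (contDiff_infty.1 hψ 2)
  have hvi : Integrable (fun p : ℝ × Space d × Sphere d => ‖(v p.1 p.2 : ℂ)‖) (slab d 0 T) :=
    hv.integrable.ofReal.norm
  have hvm : Measurable fun p : ℝ × Space d × Sphere d => (v p.1 p.2 : ℂ) :=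
    Complex.measurable_ofReal.comp hv.measurable
  -- A plane wave lacks compact support. The truncated waves are bounded together with their
  -- derivatives, and the density is integrable, so dominated convergence applies.
  set X : ℕ → Space d → ℂ := fun n x => wave ξ x * (spaceCutoff d ((n : ℝ) + 1) x : ℂ) with hX
  have hn : ∀ n : ℕ, (0 : ℝ) < (n : ℝ) + 1 := fun n => by positivity
  have hXs : ∀ n, ContDiff ℝ ∞ (X n) := fun n =>
    (contDiff_wave ξ).mul (Complex.ofRealCLM.contDiff.comp contDiff_spaceCutoff)
  have hXc : ∀ n, HasCompactSupport (X n) := fun n =>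
    ((hasCompactSupport_spaceCutoff (hn n)).comp_left Complex.ofReal_zero).mul_left
  have hXd : ∀ n x w, fderiv ℝ (X n) x w =
      -(2 * Real.pi * inner ℝ w ξ : ℝ) * Complex.I * wave ξ x * (spaceCutoff d ((n : ℝ) + 1) x : ℂ) +
      wave ξ x * ((fderiv ℝ (spaceCutoff d ((n : ℝ) + 1)) x w : ℝ) : ℂ) := by
    intro n x w
    have h1 : HasFDerivAt (fun x => (spaceCutoff d ((n : ℝ) + 1) x : ℂ))
        (Complex.ofRealCLM.comp (fderiv ℝ (spaceCutoff d ((n : ℝ) + 1)) x)) x :=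
      Complex.ofRealCLM.hasFDerivAt.comp x
        (contDiff_spaceCutoff.differentiable (by simp) x).hasFDerivAt
    have h2 : HasFDerivAt (wave ξ) (fderiv ℝ (wave ξ) x) x :=
      ((contDiff_wave ξ).differentiable (by simp) x).hasFDerivAt
    have h3 : fderiv ℝ (X n) x = _ := (h2.mul h1).fderiv
    rw [h3]
    simp only [add_apply, smul_apply, ContinuousLinearMap.comp_apply, smul_eq_mul,
      Complex.ofRealCLM_apply, fderiv_wave]
    ring
  have hX1 : ∀ n x, ‖X n x‖ ≤ 1 := fun n x => by
    rw [hX]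
    simp only
    rw [norm_mul, norm_wave, one_mul, Complex.norm_real, Real.norm_of_nonneg (spaceCutoff_nonneg _)]
    exact spaceCutoff_le_one _
  have hXt : ∀ x, Tendsto (fun n => X n x) atTop (𝓝 (wave ξ x)) := fun x => by
    refine tendsto_const_nhds.congr' ?_
    filter_upwards [tendsto_spaceCutoff x] with n h
    simp only [hX, h, Complex.ofReal_one, mul_one]
  have hfd : ∀ (n : ℕ) x (θ : Sphere d), ‖((fderiv ℝ (spaceCutoff d ((n : ℝ) + 1)) x θ : ℝ) : ℂ)‖ ≤
      B * (1 / ((n : ℝ) + 1)) := fun n x θ => by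
    have := (fderiv ℝ (spaceCutoff d ((n : ℝ) + 1)) x).le_opNorm (θ : Space d)
    rw [norm_sphere, mul_one] at this
    rw [Complex.norm_real, mul_one_div]
    exact this.trans (hB (hn n) x)
  have hin : ∀ θ : Sphere d, ‖-((2 * Real.pi * inner ℝ (θ : Space d) ξ : ℝ) : ℂ)‖ ≤ 2 * Real.pi * ‖ξ‖ := by
    intro θ
    have := abs_real_inner_le_norm (θ : Space d) ξ
    rw [norm_sphere, one_mul] at this
    rw [norm_neg, Complex.norm_real, norm_mul, Real.norm_of_nonneg (by positivity), Real.norm_eq_abs]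
    gcongr
  have hDX : ∀ n x (θ : Sphere d), ‖fderiv ℝ (X n) x θ‖ ≤ 2 * Real.pi * ‖ξ‖ + B := by
    intro n x θ
    rw [hXd]
    refine (norm_add_le _ _).trans (add_le_add ?_ ?_)
    · rw [norm_mul, norm_mul, norm_mul, norm_wave, Complex.norm_I, mul_one, mul_one, Complex.norm_real,
        Real.norm_of_nonneg (spaceCutoff_nonneg _)]
      exact (mul_le_of_le_one_right (norm_nonneg _) (spaceCutoff_le_one _)).trans (hin θ)
    · rw [norm_mul, norm_wave, one_mul]
      refine (hfd n x θ).trans (mul_le_of_le_one_right hB0 ?_)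
      rw [div_le_one (hn n)]
      have : (0 : ℝ) ≤ n := by positivity
      linarith
  have hDXt : ∀ x (θ : Sphere d), Tendsto (fun n => fderiv ℝ (X n) x θ) atTop
      (𝓝 (-(2 * Real.pi * inner ℝ (θ : Space d) ξ : ℝ) * Complex.I * wave ξ x)) := by
    intro x θ
    have h1 : Tendsto (fun n : ℕ => ((fderiv ℝ (spaceCutoff d ((n : ℝ) + 1)) x θ : ℝ) : ℂ)) atTop (𝓝 0) := by
      refine squeeze_zero_norm (fun n => hfd n x θ) ?_
      have := (tendsto_one_div_add_atTop_nhds_zero_nat (𝕜 := ℝ)).const_mul B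
      rwa [mul_zero] at this
    have h2 : Tendsto (fun n : ℕ => (spaceCutoff d ((n : ℝ) + 1) x : ℂ)) atTop (𝓝 1) := by
      refine tendsto_const_nhds.congr' ?_
      filter_upwards [tendsto_spaceCutoff x] with n h
      rw [h, Complex.ofReal_one]
    have h3 := (h2.const_mul (-(2 * Real.pi * inner ℝ (θ : Space d) ξ : ℝ) * Complex.I * wave ξ x)).add
      (h1.const_mul (wave ξ x))
    rw [mul_one, mul_zero, add_zero] at h3
    exact h3.congr fun n => (hXd n x θ).symm
  have hAm := hA.contDiff.continuous.measurable
  have hdAm := hdAc.measurable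
  have hψm := hψ.continuous.measurable
  have hXm : ∀ n, Measurable (X n) := fun n => (hXs n).continuous.measurable
  have hDXm : ∀ n, Measurable fun p : ℝ × Space d × Sphere d => fderiv ℝ (X n) p.2.1 p.2.2 := fun n =>
    ((((hXs n).continuous_fderiv (by simp)).comp (by fun_prop : Continuous
      fun p : ℝ × Space d × Sphere d => p.2.1)).clm_apply (by fun_prop : Continuous
      fun p : ℝ × Space d × Sphere d => (p.2.2 : Space d))).measurable
  have lim1 : Tendsto (fun n => ∫ p, (v p.1 p.2 : ℂ) *
      ((deriv A p.1 * X n p.2.1 + A p.1 * fderiv ℝ (X n) p.2.1 p.2.2) * ψ p.2.2) ∂(slab d 0 T)) atTop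
      (𝓝 (∫ p, (v p.1 p.2 : ℂ) * ((deriv A p.1 * wave ξ p.2.1 +
        A p.1 * (-(2 * Real.pi * inner ℝ (p.2.2 : Space d) ξ : ℝ) * Complex.I * wave ξ p.2.1)) * ψ p.2.2)
        ∂(slab d 0 T))) := by
    refine tendsto_integral_of_dominated_convergence (fun p => ‖(v p.1 p.2 : ℂ)‖ *
      ((BA' * 1 + BA * (2 * Real.pi * ‖ξ‖ + B)) * Bψ)) (fun n => ?_) (hvi.mul_const _)
      (fun n => ae_of_all _ fun p => ?_) (ae_of_all _ fun p => ?_)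
    · have h1 := hXm n
      have h2 := hDXm n
      exact Measurable.aestronglyMeasurable (by fun_prop)
    · rw [norm_mul]
      refine mul_le_mul_of_nonneg_left ?_ (norm_nonneg _)
      rw [norm_mul]
      refine mul_le_mul ((norm_add_le _ _).trans (add_le_add ?_ ?_)) (hBψ _) (norm_nonneg _)
        (by positivity)
      · rw [norm_mul]
        exact mul_le_mul (hBA' _) (hX1 _ _) (norm_nonneg _) hBA'0
      · rw [norm_mul]
        exact mul_le_mul (hBA _) (hDX _ _ _) (norm_nonneg _) hBA0
    · exact ((((hXt _).const_mul _).add ((hDXt _ _).const_mul _)).mul_const _).const_mul _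
  have lim2 : Tendsto (fun n => ∫ p, (v p.1 p.2 : ℂ) *
      (A p.1 * X n p.2.1 * Scat d k (fun θ => ψ θ) p.2.2) ∂(slab d 0 T)) atTop
      (𝓝 (∫ p, (v p.1 p.2 : ℂ) * (A p.1 * wave ξ p.2.1 * Scat d k (fun θ => ψ θ) p.2.2)
        ∂(slab d 0 T))) := by
    refine tendsto_integral_of_dominated_convergence (fun p => ‖(v p.1 p.2 : ℂ)‖ *
      (BA * 1 * BS)) (fun n => ?_) (hvi.mul_const _)
      (fun n => ae_of_all _ fun p => ?_) (ae_of_all _ fun p => ?_)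
    · have h1 := hXm n
      exact Measurable.aestronglyMeasurable (by fun_prop)
    · rw [norm_mul]
      refine mul_le_mul_of_nonneg_left ?_ (norm_nonneg _)
      rw [norm_mul, norm_mul]
      exact mul_le_mul (mul_le_mul (hBA _) (hX1 _ _) (norm_nonneg _) hBA0) (hBS _) (norm_nonneg _)
        (by positivity)
    · exact (((hXt _).const_mul _).mul_const _).const_mul _
  refine tendsto_nhds_unique lim1 (lim2.neg.congr fun n => ?_)
  exact (hv.transport A (X n) ψ hA (hXs n) (hXc n) hψ).symm

theorem IsDensity.integrable_mul (hv : IsDensity d k T m v) {F : ℝ × Space d × Sphere d → ℂ} {B : ℝ}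
    (hF : Measurable F) (hB : ∀ p, ‖F p‖ ≤ B) :
    Integrable (fun p => (v p.1 p.2 : ℂ) * F p) (slab d 0 T) :=
  hv.integrable.ofReal.mul_bdd hF.aestronglyMeasurable (ae_of_all _ hB)

/-- The equation satisfied by the modes. -/
theorem IsDensity.weakScat_mode (hk : IsKernel d s c₁ M k e) (hv : IsDensity d k T m v) (ξ : Space d)
    {η : ℝ → ℝ} (hη : IsCutoff T η) (τ : ℝ) :
    Integrable (fun θ => timeFourier (mode v ξ) η (τ, θ)) (surface d) ∧
    Integrable (fun θ : Sphere d => Complex.I * ((symbol d τ ξ θ : ℂ) * timeFourier (mode v ξ) η (τ, θ)) -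
      timeFourier (mode v ξ) (deriv η) (τ, θ)) (surface d) ∧
    WeakScat d k (fun θ => timeFourier (mode v ξ) η (τ, θ))
      (fun θ : Sphere d => Complex.I * ((symbol d τ ξ θ : ℂ) * timeFourier (mode v ξ) η (τ, θ)) -
        timeFourier (mode v ξ) (deriv η) (τ, θ)) := by
  have hη' := hη.deriv
  have hz : ∀ {ζ : ℝ → ℝ}, IsCutoff T ζ → ∀ t, t ∉ Ioo 0 T → (ζ t : ℂ) * wave τ t = 0 :=
    fun {ζ} hζ t ht => by
      have : ζ t = 0 := by_contra fun h => ht (hζ.tsupport_subset (subset_tsupport _ h))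
      rw [this, Complex.ofReal_zero, zero_mul]
  have hsc : Continuous fun θ : Sphere d => (symbol d τ ξ θ : ℂ) :=
    Complex.continuous_ofReal.comp (continuous_symbol τ ξ)
  have hwm : ∀ {V : Type} [NormedAddCommGroup V] [InnerProductSpace ℝ V] (ξ : V), Continuous (wave ξ) :=
    fun ξ => (contDiff_wave ξ).continuous
  have hwt := (hwm τ).measurable
  have hwx := (hwm ξ).measurable
  -- Fubini for a bounded multiplier
  have fub : ∀ {ζ : ℝ → ℝ}, IsCutoff T ζ → ∀ {G : Sphere d → ℂ} {B : ℝ}, Measurable G →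
      (∀ θ, ‖G θ‖ ≤ B) →
      Integrable (fun p : ℝ × Space d × Sphere d =>
        (v p.1 p.2 : ℂ) * ((ζ p.1 : ℂ) * wave τ p.1 * wave ξ p.2.1 * G p.2.2)) (slab d 0 T) ∧
      Integrable (fun θ => timeFourier (mode v ξ) ζ (τ, θ) * G θ) (surface d) ∧
      ∫ p, (v p.1 p.2 : ℂ) * ((ζ p.1 : ℂ) * wave τ p.1 * wave ξ p.2.1 * G p.2.2) ∂(slab d 0 T) =
        ∫ θ, timeFourier (mode v ξ) ζ (τ, θ) * G θ ∂(surface d) := by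
    intro ζ hζ G B hG hB
    obtain ⟨Bζ, hBζ⟩ := hζ.exists_bound
    have hζm := hζ.contDiff.continuous.measurable
    have h1 : Integrable (fun p : ℝ × Space d × Sphere d =>
        (v p.1 p.2 : ℂ) * ((ζ p.1 : ℂ) * wave τ p.1 * wave ξ p.2.1 * G p.2.2)) (slab d 0 T) := by
      refine hv.integrable_mul (B := Bζ * B) (by fun_prop) fun p => ?_
      rw [norm_mul, norm_mul, norm_mul, norm_wave, norm_wave, mul_one, mul_one, Complex.norm_real]
      exact mul_le_mul (hBζ _) (hB _) (norm_nonneg _) ((norm_nonneg _).trans (hBζ 0))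
    have h2 := integral_slab_modes (A := fun t => (ζ t : ℂ) * wave τ t) (hz hζ) h1
    simp only [← timeFourier_eq] at h2
    exact ⟨h1, h2⟩
  have hcb : ∀ {G : Sphere d → ℂ}, Continuous G → ∃ B, ∀ θ, ‖G θ‖ ≤ B := fun {G} hG => by
    obtain ⟨B, hB⟩ := isCompact_univ.exists_bound_of_continuousOn hG.continuousOn
    exact ⟨B, fun θ => hB θ (mem_univ _)⟩
  have hint : ∀ {ζ : ℝ → ℝ}, IsCutoff T ζ → ∀ {G : Sphere d → ℂ}, Continuous G →
      Integrable (fun θ => timeFourier (mode v ξ) ζ (τ, θ) * G θ) (surface d) := fun {ζ} hζ {G} hG => by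
    obtain ⟨B, hB⟩ := hcb hG
    exact (fub hζ hG.measurable hB).2.1
  refine ⟨?_, ?_, fun ψ hψ => ?_⟩
  · have := hint hη (G := fun _ => 1) continuous_const
    simpa only [mul_one] using this
  · have h1 := hint hη' (G := fun _ => 1) continuous_const
    simp only [mul_one] at h1
    refine ((hint hη (continuous_const.mul hsc : Continuous fun θ : Sphere d => Complex.I *
      (symbol d τ ξ θ : ℂ))).sub h1).congr (ae_of_all _ fun θ => ?_)
    simp only [Pi.sub_apply, Pi.mul_apply]
    ring
  · have hψc := continuous_restrict (d := d) hψ.continuous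
    obtain ⟨B1, hB1⟩ := hcb hψc
    have hG2 : Continuous fun θ : Sphere d => -Complex.I * (symbol d τ ξ θ : ℂ) * ψ θ :=
      (continuous_const.mul hsc).mul hψc
    obtain ⟨B2, hB2⟩ := hcb hG2
    obtain ⟨BS, hBS0, hBS, -⟩ := hk.exists_norm_Scat_le (contDiff_infty.1 hψ 2)
    obtain ⟨i1, j1, e1⟩ := fub hη' hψc.measurable hB1
    obtain ⟨i2, j2, e2⟩ := fub hη hG2.measurable hB2
    obtain ⟨i3, j3, e3⟩ := fub hη (hk.measurable_Scat (contDiff_infty.1 hψ 2)) hBS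
    have h1 := hv.transport_wave hk (hη.mul_wave τ) ξ hψ
    rw [e3] at h1
    simp only
    rw [← neg_inj, ← h1]
    -- The derivatives of the waves in time and space contribute `-2πiτ` and `-2πi θ·ξ`, which add
    -- up to `-i` times the symbol; the derivative of the cutoff supplies the source.
    have h2 : ∀ p : ℝ × Space d × Sphere d, (v p.1 p.2 : ℂ) *
        ((deriv (fun t => (η t : ℂ) * wave τ t) p.1 * wave ξ p.2.1 + (η p.1 : ℂ) * wave τ p.1 *
        (-(2 * Real.pi * inner ℝ (p.2.2 : Space d) ξ : ℝ) * Complex.I * wave ξ p.2.1)) * ψ p.2.2) =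
        (v p.1 p.2 : ℂ) * (((deriv η p.1 : ℝ) : ℂ) * wave τ p.1 * wave ξ p.2.1 * ψ p.2.2) +
        (v p.1 p.2 : ℂ) * ((η p.1 : ℂ) * wave τ p.1 * wave ξ p.2.1 *
          (-Complex.I * (symbol d τ ξ p.2.2 : ℂ) * ψ p.2.2)) := by
      intro p
      rw [deriv_mul_wave hη, symbol]
      push_cast
      ring
    simp only [h2]
    rw [integral_add i1 i2, e1, e2, ← integral_add j1 j2, ← integral_neg]
    refine integral_congr_ae (ae_of_all _ fun θ => ?_)
    simp only
    ring

end

end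

/-! ### Square integrability of the modes -/

section

open scoped ENNReal FourierTransform

/-- Fatou's lemma needs convergence almost everywhere. A first extraction keeps the integrals below
any level above the liminf, and a second one turns convergence in measure into convergence almost
everywhere. -/
theorem lintegral_sq_le_liminf {α : Type*} [MeasurableSpace α] {μ : Measure α} {f : ℕ → α → ℂ}
    {g : α → ℂ} (hf : ∀ n, AEStronglyMeasurable (f n) μ) (h : TendstoInMeasure μ f atTop g) :
    ∫⁻ x, ‖g x‖ₑ ^ 2 ∂μ ≤ liminf (fun n => ∫⁻ x, ‖f n x‖ₑ ^ 2 ∂μ) atTop := by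
  refine le_of_forall_gt_imp_ge_of_dense fun L hL => ?_
  obtain ⟨φ, hφ, hφL⟩ := extraction_of_frequently_atTop (frequently_lt_of_liminf_lt (by isBoundedDefault) hL)
  obtain ⟨ψ, hψ, hae⟩ := (h.comp hφ.tendsto_atTop).exists_seq_tendsto_ae
  calc ∫⁻ x, ‖g x‖ₑ ^ 2 ∂μ ≤ ∫⁻ x, liminf (fun n => ‖f (φ (ψ n)) x‖ₑ ^ 2) atTop ∂μ := by
        refine lintegral_mono_ae (hae.mono fun x hx => ?_)
        exact (((ENNReal.continuous_pow 2).tendsto _).comp hx.enorm).liminf_eq.ge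
    _ ≤ liminf (fun n => ∫⁻ x, ‖f (φ (ψ n)) x‖ₑ ^ 2 ∂μ) atTop :=
        lintegral_liminf_le' fun n => (hf _).enorm.pow_const 2
    _ ≤ L := by
        refine (liminf_le_liminf (Eventually.of_forall fun n => (hφL (ψ n)).le)).trans ?_
        rw [liminf_const]

section

variable {d : ℕ} {s c₁ M : ℝ} {k e : ℝ → ℝ} {T m : ℝ} {v : ℝ → Space d × Sphere d → ℝ}

theorem measurable_section {α β : Type*} [MeasurableSpace α] [MeasurableSpace β] {F : α × β → ℂ}
    (h : Measurable F) (x : α) : Measurable fun y => F (x, y) :=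
  h.comp measurable_prodMk_left

theorem mol_const_mul (n : ℕ) (c : ℂ) (f : Sphere d → ℂ) :
    mol d n (fun θ => c * f θ) = fun θ => c * mol d n f θ := by
  funext θ
  simp only [mol, zonalInt]
  rw [← integral_const_mul]
  exact integral_congr_ae (ae_of_all _ fun θ' => by ring)

theorem IsDensity.measurable_mode_apply (hv : IsDensity d k T m v) (ξ : Space d) :
    Measurable fun p : ℝ × Sphere d => mode v ξ p.1 p.2 :=
  measurable_section (F := fun p : Space d × ℝ × Sphere d => mode v p.1 p.2.1 p.2.2) hv.measurable_mode ξ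

theorem IsDensity.measurable_mode_time (hv : IsDensity d k T m v) (ξ : Space d) (t : ℝ) :
    Measurable (mode v ξ t) :=
  have h : Measurable fun θ : Sphere d => (t, θ) := by fun_prop
  (hv.measurable_mode_apply ξ).comp h

theorem IsDensity.integrable_mode (hv : IsDensity d k T m v) (ξ : Space d) (t : ℝ) :
    Integrable (mode v ξ t) (surface d) :=
  ⟨(hv.measurable_mode_time ξ t).aestronglyMeasurable,
    (hv.lintegral_mode_le ξ t).trans_lt ENNReal.ofReal_lt_top⟩

theorem IsDensity.integrable_mul_mode (hv : IsDensity d k T m v) (ξ : Space d) {A : ℝ → ℂ}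
    (hA : Continuous A) (hc : HasCompactSupport A) :
    Integrable (fun p : ℝ × Sphere d => A p.1 * mode v ξ p.1 p.2) (volume.prod (surface d)) := by
  have hm := hv.measurable_mode_apply ξ
  have hmA := hA.measurable
  refine ⟨Measurable.aestronglyMeasurable (by fun_prop), ?_⟩
  rw [HasFiniteIntegral, lintegral_prod _ (by fun_prop)]
  calc _ ≤ ∫⁻ t, ‖A t‖ₑ * ENNReal.ofReal m := by
        refine lintegral_mono fun t => ?_
        simp only [enorm_mul]
        rw [lintegral_const_mul _ (hv.measurable_mode_time ξ t).enorm]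
        exact mul_le_mul_right (hv.lintegral_mode_le ξ t) _
    _ < ⊤ := by
        rw [lintegral_mul_const _ hmA.enorm]
        exact ENNReal.mul_lt_top (hA.integrable_of_hasCompactSupport hc).2 ENNReal.ofReal_lt_top

/-- Mollification acts on `θ` alone and the Fourier transform on `t` alone, so Fubini exchanges
them. -/
theorem IsDensity.timeFourier_mol (hv : IsDensity d k T m v) (n : ℕ) (ξ : Space d) {η : ℝ → ℝ}
    (hη : IsCutoff T η) (τ : ℝ) :
    (fun θ => timeFourier (fun t => mol d n (mode v ξ t)) η (τ, θ)) =
      mol d n fun θ => timeFourier (mode v ξ) η (τ, θ) := by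
  funext θ
  have hA := hη.mul_wave τ
  have h1 := hv.integrable_mul_mode ξ hA.contDiff.continuous hA.hasCompactSupport
  have hK : Continuous fun θ' : Sphere d => (molKernel d n (gap θ θ') : ℂ) := by fun_prop
  obtain ⟨B, hB⟩ := isCompact_univ.exists_bound_of_continuousOn hK.continuousOn
  have h2 : Integrable (fun p : ℝ × Sphere d =>
      (molKernel d n (gap θ p.2) : ℂ) * ((η p.1 : ℂ) * wave τ p.1 * mode v ξ p.1 p.2))
      (volume.prod (surface d)) :=
    h1.bdd_mul (hK.comp continuous_snd).aestronglyMeasurable (ae_of_all _ fun p => hB _ (mem_univ _))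
  simp only [timeFourier_eq, mol, zonalInt]
  have h3 : ∀ t, (η t : ℂ) * wave τ t * ∫ θ', (molKernel d n (gap θ θ') : ℂ) * mode v ξ t θ' ∂(surface d) =
      ∫ θ', (molKernel d n (gap θ θ') : ℂ) * ((η t : ℂ) * wave τ t * mode v ξ t θ') ∂(surface d) := by
    intro t
    rw [← integral_const_mul]
    exact integral_congr_ae (ae_of_all _ fun θ' => by ring)
  simp only [h3]
  rw [integral_integral_swap h2]
  exact integral_congr_ae (ae_of_all _ fun θ' => integral_const_mul _ _)

/-- The mollified spatial average of a solution. -/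
theorem IsDensity.isFiber_mol (hk : IsKernel d s c₁ M k e) (hv : IsDensity d k T m v) (n : ℕ) :
    IsFiber d k T 0 m (fun t => mol d n (mode v 0 t)) ∧
    ∃ B : ℝ, ∀ t θ, ‖mol d n (mode v 0 t) θ‖ ≤ B := by
  have hKc : Continuous fun p : Sphere d × Sphere d => molKernel d n (gap p.1 p.2) := by fun_prop
  obtain ⟨B, hB⟩ := isCompact_univ.exists_bound_of_continuousOn hKc.continuousOn
  have hb : ∀ t θ, ‖mol d n (mode v 0 t) θ‖ₑ ≤ ENNReal.ofReal B * ENNReal.ofReal m := by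
    intro t θ
    have hmm := (hv.measurable_mode_time 0 t).enorm
    calc _ ≤ _ := enorm_mol_le n _ θ
      _ ≤ ∫⁻ θ', ENNReal.ofReal B * ‖mode v 0 t θ'‖ₑ ∂(surface d) := by
          refine lintegral_mono fun θ' => ?_
          gcongr
          exact (le_abs_self _).trans (hB (θ, θ') (mem_univ _))
      _ = ENNReal.ofReal B * ∫⁻ θ', ‖mode v 0 t θ'‖ₑ ∂(surface d) := lintegral_const_mul _ hmm
      _ ≤ _ := by gcongr; exact hv.lintegral_mode_le 0 t
  have hm : Measurable fun p : ℝ × Sphere d => mol d n (mode v 0 p.1) p.2 := by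
    have h1 : Measurable fun q : (ℝ × Sphere d) × Sphere d =>
        (molKernel d n (gap q.1.2 q.2) : ℂ) * mode v 0 q.1.1 q.2 := by
      have h2 : Measurable fun q : (ℝ × Sphere d) × Sphere d => mode v 0 q.1.1 q.2 :=
        (hv.measurable_mode_apply 0).comp (by fun_prop : Measurable
          fun q : (ℝ × Sphere d) × Sphere d => (q.1.1, q.2))
      have h3 : Continuous fun q : (ℝ × Sphere d) × Sphere d => (molKernel d n (gap q.1.2 q.2) : ℂ) := by
        fun_prop
      exact h3.measurable.mul h2
    exact h1.stronglyMeasurable.integral_prod_right'.measurable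
  refine ⟨⟨hv.mass_nonneg, hm, fun t => ?_, fun a b ha hb' => ?_, fun η hη τ => ?_⟩,
    (ENNReal.ofReal B * ENNReal.ofReal m).toReal, fun t θ => ?_⟩
  · have h1 := eLpNorm_one_mol_le n (hv.integrable_mode 0 t).1
    rw [eLpNorm_one_eq_lintegral_enorm, eLpNorm_one_eq_lintegral_enorm] at h1
    exact h1.trans (hv.lintegral_mode_le 0 t)
  · calc _ ≤ ∫⁻ t in Icc a b, ∫⁻ θ : Sphere d, (ENNReal.ofReal B * ENNReal.ofReal m) ^ 2 ∂(surface d) := by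
          gcongr with t θ
          exact hb t θ
      _ < ⊤ := by
          rw [lintegral_const, lintegral_const]
          have h1 : (ENNReal.ofReal B * ENNReal.ofReal m) ^ 2 < ⊤ :=
            ENNReal.pow_lt_top (ENNReal.mul_lt_top ENNReal.ofReal_lt_top ENNReal.ofReal_lt_top)
          exact ENNReal.mul_lt_top (ENNReal.mul_lt_top h1 (measure_lt_top _ _)) (by simp)
  · obtain ⟨i1, i2, h1⟩ := hv.weakScat_mode hk 0 hη τ
    have h2 := h1.mol hk i1 i2 n
    have h3 := hv.timeFourier_mol n 0 hη τ
    have h4 := hv.timeFourier_mol n 0 hη.deriv τ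
    -- At `ξ = 0` the symbol does not depend on `θ`, so multiplication by it commutes with
    -- mollification and the mollified average solves the same equation. This fails for other
    -- frequencies, whence the detour through the spatial average.
    have hsym : ∀ θ : Sphere d, (symbol d τ 0 θ : ℂ) = (symbol d τ 0 0 : ℂ) := fun θ => by simp [symbol]
    have i3 : Integrable (fun θ : Sphere d => Complex.I * (symbol d τ 0 0 : ℂ) *
        timeFourier (mode v 0) η (τ, θ)) (surface d) := i1.const_mul _
    have i4 := hv.weakScat_mode hk 0 hη.deriv τ |>.1
    have h5 : mol d n (fun θ : Sphere d => Complex.I * ((symbol d τ 0 θ : ℂ) *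
        timeFourier (mode v 0) η (τ, θ)) - timeFourier (mode v 0) (deriv η) (τ, θ)) =
        fun θ : Sphere d => Complex.I * ((symbol d τ 0 θ : ℂ) *
          timeFourier (fun t => mol d n (mode v 0 t)) η (τ, θ)) -
          timeFourier (fun t => mol d n (mode v 0 t)) (deriv η) (τ, θ) := by
      simp only [hsym, ← mul_assoc]
      have h6 := mol_sub n i3 i4
      rw [mol_const_mul, ← h3, ← h4] at h6
      exact h6
    rw [← h3, h5] at h2
    exact h2
  · rw [← toReal_enorm]
    exact ENNReal.toReal_mono (ENNReal.mul_ne_top ENNReal.ofReal_ne_top ENNReal.ofReal_ne_top) (hb t θ)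

/-- The spatial average of a solution is square integrable. -/
theorem IsDensity.lintegral_mode_zero_lt_top (hk : IsKernel d s c₁ M k e) (hv : IsDensity d k T m v)
    {a b : ℝ} (ha : 0 < a) (hb : b < T) :
    ∫⁻ t in Icc a b, ∫⁻ θ, ‖mode v 0 t θ‖ₑ ^ 2 ∂(surface d) < ⊤ := by
  rcases lt_or_ge b a with hab | hab
  · rw [Icc_eq_empty (by linarith)]; simp
  obtain ⟨C, hC0, hC⟩ := hk.exists_fiber_decay
  obtain ⟨ρ, hρ, hρm⟩ := exists_between (show 0 < min 1 (min a (T - b)) by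
    have : 0 < T - b := by linarith
    positivity)
  simp only [lt_min_iff] at hρm
  set L := C * m ^ 2 * ρ ^ (-(((d : ℝ) - 1) / (2 * s))) * (b - a + 2 * ρ) with hL
  -- The mollified average is bounded, hence an admissible mode, and the decay estimate depends only
  -- on the mass. The bound is therefore uniform in `n` and survives the limit.
  have h1 : ∀ n, ∫⁻ t in Icc a b, ∫⁻ θ, ‖mol d n (mode v 0 t) θ‖ₑ ^ 2 ∂(surface d) ≤
      ENNReal.ofReal L := by
    intro n
    obtain ⟨hf, B, hB⟩ := hv.isFiber_mol hk n
    have h2 := hC hf hρ hρm.1.le (by linarith) hab (by linarith : b + ρ < T)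
    have h3 : ∀ t, MemLp (mol d n (mode v 0 t)) 2 (surface d) := fun t =>
      MemLp.of_bound (hf.measurable_apply t).aestronglyMeasurable B (ae_of_all _ (hB t))
    simp only [← ofReal_integral_norm_sq (h3 _)]
    change ∫⁻ t in Icc a b, ENNReal.ofReal (sqNorm (fun t => mol d n (mode v 0 t)) t) ≤ _
    rw [← ofReal_integral_eq_lintegral_ofReal (hf.integrableOn_sqNorm ha hb)
      (ae_of_all _ fun t => sqNorm_nonneg _ t)]
    exact ENNReal.ofReal_le_ofReal h2
  have h4 : ∀ t, ∫⁻ θ, ‖mode v 0 t θ‖ₑ ^ 2 ∂(surface d) ≤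
      liminf (fun n => ∫⁻ θ, ‖mol d n (mode v 0 t) θ‖ₑ ^ 2 ∂(surface d)) atTop := by
    intro t
    have hi := hv.integrable_mode 0 t
    have hcm : ∀ n, AEStronglyMeasurable (mol d n (mode v 0 t)) (surface d) := fun n =>
      (continuous_mol n hi).aestronglyMeasurable
    exact lintegral_sq_le_liminf hcm (tendstoInMeasure_of_tendsto_eLpNorm one_ne_zero hcm hi.1
      (tendsto_eLpNorm_mol le_rfl ENNReal.one_ne_top (fun n f hf => eLpNorm_one_mol_le n hf)
        (memLp_one_iff_integrable.2 hi)))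
  calc _ ≤ ∫⁻ t in Icc a b, liminf (fun n => ∫⁻ θ, ‖mol d n (mode v 0 t) θ‖ₑ ^ 2 ∂(surface d)) atTop :=
        lintegral_mono h4
    _ ≤ liminf (fun n => ∫⁻ t in Icc a b, ∫⁻ θ, ‖mol d n (mode v 0 t) θ‖ₑ ^ 2 ∂(surface d)) atTop :=
        lintegral_liminf_le fun n =>
          ((hv.isFiber_mol hk n).1.measurable.enorm.pow_const 2).lintegral_prod_right'
    _ ≤ ENNReal.ofReal L := by
        refine (liminf_le_liminf (Eventually.of_forall h1)).trans ?_
        rw [liminf_const]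
    _ < ⊤ := ENNReal.ofReal_lt_top

/-- Every frequency now enters the machinery above; square integrability is inherited from the zero
mode by domination. -/
theorem IsDensity.isFiber (hk : IsKernel d s c₁ M k e) (hv : IsDensity d k T m v) (ξ : Space d) :
    IsFiber d k T ξ m (mode v ξ) where
  mass_nonneg := hv.mass_nonneg
  measurable := hv.measurable_mode_apply ξ
  mass := hv.lintegral_mode_le ξ
  square a b ha hb := by
    refine lt_of_le_of_lt ?_ (hv.lintegral_mode_zero_lt_top hk ha hb)
    gcongr with t θ
    rw [← ofReal_norm, ← ofReal_norm]
    exact ENNReal.ofReal_le_ofReal (hv.norm_mode_le ξ t θ)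
  equation η hη τ := (hv.weakScat_mode hk ξ hη τ).2.2

end

end

/-! ### From the modes to the energy shortly after a given time -/

section

open scoped ENNReal FourierTransform

section

variable {d : ℕ} {s c₁ M : ℝ} {k e : ℝ → ℝ} {T m : ℝ} {v : ℝ → Space d × Sphere d → ℝ}

/-- Plancherel's theorem in the space variable. -/
theorem IsDensity.lintegral_mode_sq (hv : IsDensity d k T m v) (t : ℝ) :
    ∫⁻ ξ, ∫⁻ θ, ‖mode v ξ t θ‖ₑ ^ 2 ∂(surface d) = ∫⁻ z, ‖v t z‖ₑ ^ 2 ∂(phase d) := by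
  have hm : Measurable fun z : Space d × Sphere d => v t z := hv.measurable.comp measurable_prodMk_left
  have h1 : Measurable fun p : Space d × Sphere d => mode v p.1 t p.2 := by
    have h : Measurable fun p : Space d × Sphere d => (p.1, t, p.2) := by fun_prop
    exact Measurable.comp (g := fun p : Space d × ℝ × Sphere d => mode v p.1 p.2.1 p.2.2)
      (f := fun p : Space d × Sphere d => (p.1, t, p.2)) hv.measurable_mode h
  rw [lintegral_lintegral_swap (f := fun ξ θ => ‖mode v ξ t θ‖ₑ ^ 2) (h1.enorm.pow_const 2).aemeasurable,
    lintegral_prod_symm _ (hm.enorm.pow_const 2).aemeasurable]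
  have h2 : ∫⁻ θ : Sphere d, (∫⁻ x : Space d, ‖v t (x, θ)‖ₑ) ∂(surface d) < ⊤ := by
    rw [← lintegral_prod_symm (fun z => ‖v t z‖ₑ) hm.enorm.aemeasurable]
    exact (hv.mass t).trans_lt ENNReal.ofReal_lt_top
  refine lintegral_congr_ae ?_
  filter_upwards [ae_lt_top hm.enorm.lintegral_prod_left' h2.ne] with θ hθ
  have h3 : Integrable fun x => v t (x, θ) :=
    ⟨(hm.comp measurable_prodMk_right).aestronglyMeasurable, hθ⟩
  have h4 := lintegral_fourier_sq h3.ofReal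
  refine h4.trans (lintegral_congr fun x => ?_)
  exact congrArg (· ^ 2) (enorm_eq_iff_norm_eq.2 (RCLike.norm_ofReal _))

theorem exists_deriv_rise_le : ∃ D : ℝ, 0 < D ∧ ∀ {a ρ : ℝ}, 0 < ρ → ∀ t, deriv (rise a ρ) t ≤ D / ρ := by
  obtain ⟨D, hD0, hD⟩ := exists_deriv_smoothTransition_le
  refine ⟨D, hD0, fun {a ρ} hρ t => ?_⟩
  have hS : HasDerivAt Real.smoothTransition (deriv Real.smoothTransition ((t - (a - ρ)) / ρ))
      ((t - (a - ρ)) / ρ) :=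
    ((Real.smoothTransition.contDiff (n := 1)).differentiable one_ne_zero _).hasDerivAt
  have h1 : HasDerivAt (rise a ρ) (deriv Real.smoothTransition ((t - (a - ρ)) / ρ) * (1 / ρ)) t :=
    hS.comp t (((hasDerivAt_id t).sub_const _).div_const _)
  rw [h1.deriv, mul_one_div]
  gcongr
  exact (le_abs_self _).trans (hD _)

/-- The weight carried by the falling part of a plateau. -/
noncomputable def fallWeight (b σ t : ℝ) : ℝ := -(fall b σ t * deriv (fall b σ) t)

theorem fallWeight_nonneg {b σ : ℝ} (hσ : 0 < σ) (t : ℝ) : 0 ≤ fallWeight b σ t :=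
  neg_nonneg.2 (mul_nonpos_of_nonneg_of_nonpos (Real.smoothTransition.nonneg _) (deriv_fall_nonpos hσ))

theorem fallWeight_of_notMem {b σ t : ℝ} (hσ : 0 < σ) (h : t ∉ Icc b (b + σ)) : fallWeight b σ t = 0 := by
  rw [fallWeight, deriv_fall_of_notMem hσ h, mul_zero, neg_zero]

theorem continuous_fallWeight {b σ : ℝ} : Continuous (fallWeight b σ) :=
  (contDiff_fall.continuous.mul continuous_deriv_fall).neg

theorem integral_fallWeight {b σ : ℝ} (hσ : 0 < σ) :
    Integrable (fallWeight b σ) ∧ ∫ t, fallWeight b σ t = 1 / 2 := by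
  have hi : Integrable (fallWeight b σ) := continuous_fallWeight.integrable_of_hasCompactSupport
    (HasCompactSupport.intro isCompact_Icc fun t ht => fallWeight_of_notMem hσ ht)
  refine ⟨hi, ?_⟩
  rw [integral_of_hasDerivAt_of_tendsto (f := fun t => -(fall b σ t ^ 2 / 2)) (m := -(1 / 2)) (n := 0)
    (fun t => ?_) hi]
  · norm_num
  · refine tendsto_const_nhds.congr' ?_
    filter_upwards [eventually_le_atBot b] with t ht
    rw [fall_of_le hσ ht]; norm_num
  · refine tendsto_const_nhds.congr' ?_
    filter_upwards [eventually_ge_atTop (b + σ)] with t ht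
    rw [fall_of_ge hσ ht]; norm_num
  · have h := ((hasDerivAt_fall (b := b) (σ := σ) (t := t)).pow 2 |>.div_const 2).neg
    refine h.congr_deriv ?_
    rw [fallWeight]
    push_cast
    ring

/-- Propagation of the energy of a mode to later times. -/
theorem IsKernel.exists_fallWeight_le (hk : IsKernel d s c₁ M k e) : ∃ D : ℝ, 0 < D ∧
    ∀ {T : ℝ} {ξ : Space d} {m : ℝ} {W : ℝ → Sphere d → ℂ}, IsFiber d k T ξ m W →
      ∀ {a b ρ σ : ℝ}, 0 < ρ → 0 < σ → 0 < a - ρ → a ≤ b → b + σ < T →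
      ∫⁻ t, ENNReal.ofReal (fallWeight b σ t) * ∫⁻ θ, ‖W t θ‖ₑ ^ 2 ∂(surface d) ≤
        ENNReal.ofReal (D / ρ) * ENNReal.ofReal (∫ t in Icc (a - ρ) a, sqNorm W t) := by
  obtain ⟨C, -, hC⟩ := hk.exists_fiber_smoothing
  obtain ⟨D, hD0, hD⟩ := exists_deriv_rise_le
  refine ⟨D, hD0, fun {T ξ m W} h {a b ρ σ} hρ hσ ha hab hb => ?_⟩
  -- The inequality `0 ≤ ∫ η η' ‖W‖²` is used for a plateau with independent slopes. The falling
  -- slope weighs the energy after `b`, and it is at most what the rising slope sees on `[a-ρ, a]`.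
  have hc := isCutoff_plateau (T := T) hρ hσ ha hb
  have h1 := (hC h hc).1
  have hi := h.integrable_mul hc hc.deriv
  have hEi : IntegrableOn (sqNorm W) (Icc b (b + σ)) := h.integrableOn_sqNorm (by linarith) hb
  have hEa : IntegrableOn (sqNorm W) (Icc (a - ρ) a) := h.integrableOn_sqNorm ha (by linarith)
  obtain ⟨Bw, hBw⟩ := (continuous_fallWeight (b := b) (σ := σ)).bounded_above_of_compact_support
    (HasCompactSupport.intro isCompact_Icc fun t ht => fallWeight_of_notMem hσ ht)
  have hwi : Integrable fun t => fallWeight b σ t * sqNorm W t := by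
    have : IntegrableOn (fun t => fallWeight b σ t * sqNorm W t) (Icc b (b + σ)) :=
      Integrable.bdd_mul hEi continuous_fallWeight.aestronglyMeasurable (ae_of_all _ hBw)
    refine (integrableOn_iff_integrable_of_support_subset fun t ht => ?_).1 this
    by_contra h'
    exact ht (by simp only [fallWeight_of_notMem hσ h', zero_mul])
  have hri : Integrable ((Icc (a - ρ) a).indicator fun t => D / ρ * sqNorm W t) :=
    (integrable_indicator_iff measurableSet_Icc).2 (hEa.const_mul _)
  have h2 : ∫ t, fallWeight b σ t * sqNorm W t ≤ D / ρ * ∫ t in Icc (a - ρ) a, sqNorm W t := by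
    rw [← integral_const_mul, ← integral_indicator measurableSet_Icc, ← sub_nonneg,
      ← integral_sub hri hwi]
    refine h1.trans (integral_mono hi (hri.sub hwi) fun t => ?_)
    simp only
    have hE := sqNorm_nonneg W t
    have e1 : plateau a ρ b σ t * deriv (plateau a ρ b σ) t =
        plateau a ρ b σ t * deriv (rise a ρ) t - fallWeight b σ t := by
      rw [deriv_plateau_eq hρ hσ hab, fallWeight]
      by_cases ht : t ∈ Icc b (b + σ)
      · rw [plateau_of_le hρ (hab.trans ht.1), fall]; ring
      · rw [deriv_fall_of_notMem hσ ht]; ring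
    rw [e1, sub_mul]
    refine sub_le_sub_right ?_ _
    by_cases ht : t ∈ Icc (a - ρ) a
    · rw [indicator_of_mem ht]
      refine mul_le_mul_of_nonneg_right ?_ hE
      exact (mul_le_of_le_one_left (deriv_rise_nonneg hρ) plateau_le_one).trans (hD hρ t)
    · rw [indicator_of_notMem ht, deriv_rise_of_notMem hρ ht, mul_zero, zero_mul]
  have h3 : ∀ᵐ t, ENNReal.ofReal (fallWeight b σ t) * ∫⁻ θ, ‖W t θ‖ₑ ^ 2 ∂(surface d) =
      ENNReal.ofReal (fallWeight b σ t * sqNorm W t) := by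
    have h4 := ae_lt_top ((h.measurable.enorm.pow_const 2).lintegral_prod_right' (ν := surface d))
      (h.square b (b + σ) (by linarith) hb).ne
    rw [ae_restrict_iff' measurableSet_Icc] at h4
    filter_upwards [h4] with t ht
    by_cases hm : t ∈ Icc b (b + σ)
    · have h5 : MemLp (W t) 2 (surface d) :=
        (memLp_two_iff_lintegral (h.measurable_apply t).aestronglyMeasurable).2 (ht hm)
      rw [ENNReal.ofReal_mul (fallWeight_nonneg hσ t), sqNorm, ofReal_integral_norm_sq h5]
    · rw [fallWeight_of_notMem hσ hm]; simp
  rw [lintegral_congr_ae h3, ← ofReal_integral_eq_lintegral_ofReal hwi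
    (ae_of_all _ fun t => mul_nonneg (fallWeight_nonneg hσ t) (sqNorm_nonneg W t)),
    ← ENNReal.ofReal_mul (by positivity)]
  exact ENNReal.ofReal_le_ofReal h2

/-- The energy is controlled at some times shortly after `t`. -/
theorem IsKernel.exists_energy_le (hk : IsKernel d s c₁ M k e) : ∃ C : ℝ, 0 < C ∧
    ∀ {T m : ℝ} {v : ℝ → Space d × Sphere d → ℝ}, IsDensity d k T m v →
      ∀ {t σ : ℝ}, 0 < t → t < 1 → 0 < σ → t + σ < T → ∀ {N : Set ℝ}, volume N = 0 →
      ∃ τ ∈ Icc t (t + σ), τ ∉ N ∧ ∫⁻ z, ‖v τ z‖ₑ ^ 2 ∂(phase d) ≤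
        ENNReal.ofReal (C * m ^ 2 * t ^ (-(((d : ℝ) - 1) / (2 * s) + d * (1 / s + 3 / 2)))) := by
  obtain ⟨D, hD0, hD⟩ := hk.exists_fallWeight_le
  obtain ⟨C, hC0, hC⟩ := hk.exists_total_decay
  set P := ((d : ℝ) - 1) / (2 * s) + d * (1 / s + 3 / 2) with hP
  refine ⟨4 * D * C * 16 ^ P, by positivity, fun {T m v} hv {t σ} ht ht1 hσ hT {N} hN => ?_⟩
  set S : ℝ → ℝ≥0∞ := fun τ => ∫⁻ z, ‖v τ z‖ₑ ^ 2 ∂(phase d) with hS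
  have hSm : Measurable S := (hv.measurable.enorm.pow_const 2).lintegral_prod_right'
  have hgm : Measurable fun τ => ENNReal.ofReal (fallWeight t σ τ) :=
    continuous_fallWeight.measurable.ennreal_ofReal
  have key : ∫⁻ τ, ENNReal.ofReal (fallWeight t σ τ) * S τ ≤
      ENNReal.ofReal (2 * D * C * 16 ^ P * m ^ 2 * t ^ (-P)) := by
    have hmm : Measurable fun p : ℝ × Space d => ENNReal.ofReal (fallWeight t σ p.1) *
        ∫⁻ θ, ‖mode v p.2 p.1 θ‖ₑ ^ 2 ∂(surface d) := by
      have h1 : Measurable fun q : (ℝ × Space d) × Sphere d => mode v q.1.2 q.1.1 q.2 :=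
        Measurable.comp (g := fun p : Space d × ℝ × Sphere d => mode v p.1 p.2.1 p.2.2)
          (f := fun q : (ℝ × Space d) × Sphere d => (q.1.2, q.1.1, q.2)) hv.measurable_mode
          (by fun_prop)
      exact (hgm.comp measurable_fst).mul (h1.enorm.pow_const 2).lintegral_prod_right'
    calc _ = ∫⁻ τ, ∫⁻ ξ, ENNReal.ofReal (fallWeight t σ τ) *
          ∫⁻ θ, ‖mode v ξ τ θ‖ₑ ^ 2 ∂(surface d) := by
          refine lintegral_congr fun τ => ?_
          rw [hS]
          simp only
          rw [← hv.lintegral_mode_sq τ, lintegral_const_mul' _ _ ENNReal.ofReal_ne_top]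
      _ = ∫⁻ ξ, ∫⁻ τ, ENNReal.ofReal (fallWeight t σ τ) *
          ∫⁻ θ, ‖mode v ξ τ θ‖ₑ ^ 2 ∂(surface d) := lintegral_lintegral_swap hmm.aemeasurable
      _ ≤ ∫⁻ ξ, ENNReal.ofReal (D / (t / 4)) *
          ENNReal.ofReal (∫ τ in Icc (t / 4) (t / 2), sqNorm (mode v ξ) τ) := by
          refine lintegral_mono fun ξ => ?_
          -- The energy just after `t` is compared with the window `[t/4, t/2]`. The total decay is
          -- then applied there with margin `t/16`, which keeps the doubly enlarged window inside
          -- `(0,T)`.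
          have := hD (hv.isFiber hk ξ) (a := t / 2) (b := t) (ρ := t / 4) (σ := σ) (by positivity) hσ
            (by linarith) (by linarith) hT
          rwa [show t / 2 - t / 4 = t / 4 by ring] at this
      _ = ENNReal.ofReal (D / (t / 4)) *
          ∫⁻ ξ, ENNReal.ofReal (∫ τ in Icc (t / 4) (t / 2), sqNorm (mode v ξ) τ) :=
          lintegral_const_mul' _ _ ENNReal.ofReal_ne_top
      _ ≤ ENNReal.ofReal (D / (t / 4)) * ENNReal.ofReal (C * m ^ 2 * (t / 2 - t / 4 + 4 * (t / 16)) *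
          (t / 16) ^ (-P)) := by
          gcongr
          exact hC (fun ξ => hv.isFiber hk ξ) (by positivity) (by linarith) (by linarith) (by linarith)
            (by linarith)
      _ = _ := by
          rw [← ENNReal.ofReal_mul (by positivity)]
          congr 1
          rw [Real.div_rpow ht.le (by norm_num), Real.rpow_neg (by norm_num : (0 : ℝ) ≤ 16)]
          field_simp
          ring
  obtain ⟨hwi, hw1⟩ := integral_fallWeight (b := t) hσ
  -- The falling weight is a measure of total mass `1/2` carried by `[t, t+σ]`. Some time outside
  -- the null set has energy at most the average, which doubles the constant.
  set μ := (volume : Measure ℝ).withDensity fun τ => ENNReal.ofReal (fallWeight t σ τ) with hμ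
  have hμu : μ univ = ENNReal.ofReal (1 / 2) := by
    rw [hμ, withDensity_apply _ MeasurableSet.univ, Measure.restrict_univ,
      ← ofReal_integral_eq_lintegral_ofReal hwi (ae_of_all _ fun τ => fallWeight_nonneg hσ τ), hw1]
  have hfin : IsFiniteMeasure μ := ⟨by rw [hμu]; exact ENNReal.ofReal_lt_top⟩
  have hμ0 : μ ≠ 0 := fun h => by
    rw [h, Measure.coe_zero, Pi.zero_apply] at hμu
    exact (ENNReal.ofReal_pos.2 (by norm_num : (0 : ℝ) < 1 / 2)).ne hμu
  have hnull : μ (N ∪ (Icc t (t + σ))ᶜ) = 0 := by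
    refine measure_union_null (withDensity_absolutelyContinuous _ _ hN) ?_
    rw [hμ, withDensity_apply _ measurableSet_Icc.compl]
    refine (setLIntegral_congr_fun measurableSet_Icc.compl fun τ hτ => ?_).trans lintegral_zero
    simp only [fallWeight_of_notMem hσ hτ, ENNReal.ofReal_zero]
  obtain ⟨τ, hτN, hτ⟩ := exists_notMem_null_le_laverage hμ0 hSm.aemeasurable hnull
  simp only [mem_union, mem_compl_iff, not_or, not_not] at hτN
  refine ⟨τ, hτN.2, hτN.1, hτ.trans ?_⟩
  rw [laverage_eq, hμu, hμ, lintegral_withDensity_eq_lintegral_mul _ hgm hSm]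
  simp only [Pi.mul_apply]
  refine (ENNReal.div_le_div_right key _).trans (le_of_eq ?_)
  rw [← ENNReal.ofReal_div_of_pos (by norm_num)]
  congr 1
  ring

end

end

/-! ### Lower semicontinuity and comparison of the exponents -/

section

open scoped ENNReal

section

variable {d : ℕ} {s s₁ c₁ M T : ℝ} {b k e : ℝ → ℝ} {u₀ : Space d × Sphere d → ℝ}
  {u : ℝ → Space d × Sphere d → ℝ}

/-- Lower semicontinuity of the energy along the `L¹_loc`-continuous curve `u`. -/
theorem IsSolution.eLpNorm_two_le (hu : IsSolution d s b T u₀ u) {t : ℝ} (ht : t ∈ Ico 0 T) {τ : ℕ → ℝ}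
    (hτ : ∀ n, τ n ∈ Ico 0 T) (hlim : Tendsto τ atTop (𝓝 t)) {L : ℝ≥0∞}
    (hL : ∀ n, eLpNorm (u (τ n)) 2 (phase d) ≤ L) : eLpNorm (u t) 2 (phase d) ≤ L := by
  -- On a compact cylinder `L¹` convergence gives an almost everywhere convergent subsequence, and
  -- Fatou's lemma applies. Monotone exhaustion by cylinders removes the restriction.
  have hK : ∀ n : ℕ, eLpNorm (u t) 2 ((phase d).restrict
      (Metric.closedBall (0 : Space d) (3 * n) ×ˢ (univ : Set (Sphere d)))) ≤ L := fun n => by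
    have hc := isCompact_cylinder d n
    set K := Metric.closedBall (0 : Space d) (3 * n) ×ˢ (univ : Set (Sphere d))
    have hi : ∀ j, IntegrableOn (u (τ j) - u t) K (phase d) := fun j =>
      (hu.integrableOn_compact (hτ j) hc).sub (hu.integrableOn_compact ht hc)
    have h1 : Tendsto (fun j => eLpNorm (u (τ j) - u t) 1 ((phase d).restrict K)) atTop (𝓝 0) := by
      have h2 := (hu.continuous t ht K hc).comp (tendsto_nhdsWithin_iff.2 ⟨hlim, Eventually.of_forall hτ⟩)
      have h3 := ENNReal.tendsto_ofReal h2
      rw [ENNReal.ofReal_zero] at h3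
      refine h3.congr fun j => ?_
      rw [eLpNorm_one_eq_lintegral_enorm, ← ofReal_integral_norm_eq_lintegral_enorm (hi j)]
      rfl
    have h2 := tendstoInMeasure_of_tendsto_eLpNorm one_ne_zero
      (fun j => (hu.integrableOn_compact (hτ j) hc).aestronglyMeasurable)
      (hu.integrableOn_compact ht hc).aestronglyMeasurable h1
    obtain ⟨ns, -, hns⟩ := h2.exists_seq_tendsto_ae
    refine (Lp.eLpNorm_lim_le_liminf_eLpNorm
      (fun j => (hu.integrableOn_compact (hτ (ns j)) hc).aestronglyMeasurable) _ hns).trans ?_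
    refine (liminf_le_liminf (Eventually.of_forall fun j =>
      (eLpNorm_restrict_le _ _ _ _).trans (hL (ns j)))).trans ?_
    rw [liminf_const]
  simp only [eLpNorm_eq_lintegral_rpow_enorm_toReal (two_ne_zero (α := ℝ≥0∞)) ENNReal.ofNat_ne_top,
    ENNReal.toReal_ofNat, one_div, ENNReal.rpow_inv_le_iff (two_pos (α := ℝ))] at hK ⊢
  have hun : (⋃ n : ℕ, Metric.closedBall (0 : Space d) (3 * n) ×ˢ (univ : Set (Sphere d))) = univ := by
    refine eq_univ_of_forall fun z => mem_iUnion.2 ?_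
    obtain ⟨n, hn⟩ := exists_nat_ge ‖z.1‖
    exact ⟨n, mem_closedBall_zero_iff.2 (by linarith [norm_nonneg z.1]), mem_univ _⟩
  have hmono : Monotone fun n : ℕ =>
      Metric.closedBall (0 : Space d) (3 * n) ×ˢ (univ : Set (Sphere d)) := fun i j hij =>
    prod_mono_left (Metric.closedBall_subset_closedBall (by gcongr))
  rw [← setLIntegral_univ, ← hun, setLIntegral_iUnion_of_directed _ hmono.directed_le]
  exact iSup_le hK

/-- Decay of the energy of a solution. -/
theorem IsKernel.exists_eLpNorm_le (hk : IsKernel d s₁ c₁ M k e)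
    (hker : ∀ θ : Sphere d, ∀ᵐ θ' ∂(surface d), kernel d s b θ θ' = k (gap θ θ')) :
    ∃ C : ℝ, 0 < C ∧ ∀ {T : ℝ} {u₀ : Space d × Sphere d → ℝ} {u : ℝ → Space d × Sphere d → ℝ}, 0 < T →
      Integrable u₀ (phase d) → 0 ≤ᵐ[phase d] u₀ → IsSolution d s b T u₀ u →
      ∀ t, 0 < t → t < min T 1 → eLpNorm (u t) 2 (phase d) ≤
        ENNReal.ofReal (C * (∫ z, u₀ z ∂(phase d)) *
          t ^ (-((((d : ℝ) - 1) / (2 * s₁) + d * (1 / s₁ + 3 / 2)) / 2))) := by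
  obtain ⟨C, hC0, hC⟩ := hk.exists_energy_le
  set P := ((d : ℝ) - 1) / (2 * s₁) + d * (1 / s₁ + 3 / 2) with hP
  refine ⟨√C, by positivity, fun {T u₀ u} hT hu₀ hu₀_nonneg hu t ht htT => ?_⟩
  obtain ⟨v, hv, hvu⟩ := hu.exists_isDensity hT hk hker hu₀ hu₀_nonneg
  set m := ∫ z, u₀ z ∂(phase d)
  rw [lt_min_iff] at htT
  rw [ae_restrict_iff' measurableSet_Ioo, ae_iff] at hvu
  -- The energy bound holds for the representative at some time in each shrinking window, avoiding
  -- the null set of times where it differs from `u`. These times converge to `t`.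
  have h : ∀ n : ℕ, ∃ τ ∈ Icc t (t + (T - t) / (n + 2)), τ ∈ Ico 0 T ∧ eLpNorm (u τ) 2 (phase d) ≤
      ENNReal.ofReal (√C * m * t ^ (-(P / 2))) := fun n => by
    have hσ : 0 < (T - t) / (n + 2) := div_pos (by linarith) (by positivity)
    have hσT : t + (T - t) / (n + 2) < T := by
      have : (T - t) / (n + 2) < T - t := div_lt_self (by linarith) (by linarith [n.cast_nonneg (α := ℝ)])
      linarith
    obtain ⟨τ, hτ, hτN, hτe⟩ := hC hv ht htT.2 hσ hσT hvu
    have hτT : τ < T := hτ.2.trans_lt hσT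
    refine ⟨τ, hτ, ⟨ht.le.trans hτ.1, hτT⟩, ?_⟩
    have huv : u τ =ᵐ[phase d] v τ := not_not.1 fun h' => hτN fun h'' => h' (h'' ⟨ht.trans_le hτ.1, hτT⟩)
    rw [eLpNorm_congr_ae huv, eLpNorm_eq_lintegral_rpow_enorm_toReal (by norm_num) (by norm_num)]
    simp only [ENNReal.toReal_ofNat, ENNReal.rpow_ofNat]
    refine (ENNReal.rpow_le_rpow hτe (by norm_num)).trans (le_of_eq ?_)
    have hm := hv.mass_nonneg
    rw [ENNReal.ofReal_rpow_of_nonneg (by positivity) (by norm_num)]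
    congr 1
    rw [← Real.sqrt_eq_rpow, Real.sqrt_mul (by positivity), Real.sqrt_mul hC0.le, Real.sqrt_sq hm,
      Real.sqrt_eq_rpow (t ^ (-P)), ← Real.rpow_mul ht.le]
    congr 2
    ring
  choose τ h1 h2 h3 using h
  refine hu.eLpNorm_two_le ⟨ht.le, htT.1⟩ h2 ?_ h3
  refine tendsto_of_tendsto_of_tendsto_of_le_of_le tendsto_const_nhds ?_ (fun n => (h1 n).1) fun n => (h1 n).2
  have : Tendsto (fun n : ℕ => t + (T - t) / ((n : ℝ) + 2)) atTop (𝓝 (t + 0)) :=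
    tendsto_const_nhds.add (tendsto_const_nhds.div_atTop
      (tendsto_atTop_add_const_right _ _ tendsto_natCast_atTop_atTop))
  rwa [add_zero] at this

/-- A closed form of the exponent `ω`. -/
theorem omegaExp_sub_one {d : ℕ} {s s' : ℝ} (hd : 3 ≤ d) (hs : s ∈ Ioo (0 : ℝ) 1)
    (hs' : s' ∈ Ioc (0 : ℝ) 1) : omegaExp d s s' - 1 =
      (2 * s / (d - 1)) * (2 * s' / d) / (1 + 2 * s / (d - 1) + 2 * s' / d) := by
  have hd' : (3 : ℝ) ≤ d := by exact_mod_cast hd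
  -- In these variables `p_s = 2/(1-a)` and `q₂ = 2/(1-c)`, and the chain of definitions collapses
  -- to `ω - 1 = ac/(1+a+c)`.
  set a := 2 * s / ((d : ℝ) - 1) with ha
  set c := 2 * s' / (d : ℝ) with hc
  have ha0 : 0 < a := div_pos (by linarith [hs.1]) (by linarith)
  have hc0 : 0 < c := div_pos (by linarith [hs'.1]) (by linarith)
  have ha1 : a < 1 := by rw [ha, div_lt_one (by linarith)]; linarith [hs.2]
  have hc1 : c < 1 := by rw [hc, div_lt_one (by linarith)]; linarith [hs'.2]
  have hp : pExp d s = 2 / (1 - a) := by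
    rw [pExp, show 1 / 2 - s / ((d : ℝ) - 1) = (1 - a) / 2 by rw [ha]; ring, one_div_div]
  have hq : qExp d s' = 2 / (1 - c) := by
    rw [qExp, show 1 / 2 - s' / (d : ℝ) = (1 - c) / 2 by rw [hc]; ring, one_div_div]
  have h1 : (0 : ℝ) < 1 - a := by linarith
  have h2 : (0 : ℝ) < 1 - c := by linarith
  have h3 : 0 < 1 + a + c - a * c := by nlinarith
  have hα : alphaOne d s s' = (1 - a) * (1 + c) / (1 + a + c - a * c) := by
    have h4 : 2 / (1 - a) * (2 / (1 - c)) - 2 = 2 * (1 + a + c - a * c) / ((1 - a) * (1 - c)) := by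
      field_simp
      ring
    rw [alphaOne, hp, hq, h4]
    field_simp
    ring
  have hr : rExp d s s' = 2 * (1 + a + c) / (1 + a + c - a * c) := by
    rw [rExp, hα, hp]
    field_simp
    ring
  rw [omegaExp, hr]
  field_simp
  ring

/-- For `d ≥ 4`, `β₁ ≤ 1` and so `2β ≤ 1`. For `d = 3`, `β₁ = (1-δ)(1-s) ≤ 1 - s` and so `2β ≤
4/(4+s)`, a sharper bound. -/
theorem le_one_of_le_beta {d : ℕ} {s s' δ : ℝ} (hd : 3 ≤ d) (hs : s ∈ Ioo (0 : ℝ) 1) (hδ : IsDelta d δ)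
    (hs' : s' ∈ Ioc (0 : ℝ) (2 * beta d s δ)) :
    s' ≤ 1 ∧ (d = 3 → s' * (1 + s / 4) ≤ 1) := by
  obtain ⟨hs0, hs1⟩ := hs
  obtain ⟨hs'0, hs'1⟩ := hs'
  have hd' : (3 : ℝ) ≤ d := by exact_mod_cast hd
  have h1 : 2 * (1 - δ) / (((d : ℝ) - 1) / (1 - s)) = 2 * (1 - δ) * (1 - s) / (d - 1) := by
    rw [div_div_eq_mul_div]
  rw [beta, h1] at hs'1
  rcases hδ with ⟨rfl, hδ0, hδ1⟩ | ⟨h4, rfl⟩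
  · push_cast at hs'1
    rw [show 2 * (1 - δ) * (1 - s) / ((3 : ℝ) - 1) = (1 - δ) * (1 - s) by ring, ← mul_div_assoc] at hs'1
    have h2 : (1 - δ) * (1 - s) ≤ 1 - s := mul_le_of_le_one_left (by linarith) (by linarith)
    rw [le_div_iff₀ (by linarith)] at hs'1
    have h3 : s' * (1 + s / 4) ≤ 1 := by nlinarith
    exact ⟨by nlinarith, fun _ => h3⟩
  · have h4' : (4 : ℝ) ≤ d := by exact_mod_cast h4
    have h2 : 2 * (1 - 0) * (1 - s) / ((d : ℝ) - 1) ≤ 1 := by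
      rw [div_le_one (by linarith)]; linarith
    rw [← mul_div_assoc, le_div_iff₀ (by linarith)] at hs'1
    exact ⟨by nlinarith, fun h => by omega⟩

/-- The exponent `ω` exceeds one, and the decay rate of the energy is at least the one given by `ω`. -/
theorem one_lt_omegaExp {d : ℕ} {s s' δ : ℝ} (hd : 3 ≤ d) (hs : s ∈ Ioo (0 : ℝ) 1) (hδ : IsDelta d δ)
    (hs' : s' ∈ Ioc (0 : ℝ) (2 * beta d s δ)) :
    1 < omegaExp d s s' ∧
      (((d : ℝ) - 1) / (2 * s) + d * (1 / s + 3 / 2)) / 2 ≤ 1 / (omegaExp d s s' - 1) := by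
  obtain ⟨h1, h3⟩ := le_one_of_le_beta hd hs hδ hs'
  have hd' : (3 : ℝ) ≤ d := by exact_mod_cast hd
  have hd1 : (0 : ℝ) < d - 1 := by linarith
  obtain ⟨hs0, hs1⟩ := hs
  have hs'0 := hs'.1
  have hω := omegaExp_sub_one hd ⟨hs0, hs1⟩ ⟨hs'0, h1⟩
  refine ⟨sub_pos.1 (hω ▸ by positivity), ?_⟩
  rw [hω]
  -- This is the numerator of the difference of the two rates over `4 s s'`. For `d = 3` it reads
  -- `s'(4 + 9s) ≤ 6 + 6s`, which `s' ≤ 1` alone does not give when `s` is near `1`; the refined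
  -- bound on `s'` is needed there.
  have key : s' * (d + 1 + 3 * d * s) ≤ d * (d - 1) + 2 * d * s := by
    rcases hd.eq_or_lt with rfl | h4
    · have h5 := h3 rfl
      push_cast
      nlinarith [mul_nonneg hs0.le hs'0.le]
    · have h4 : (4 : ℝ) ≤ d := by exact_mod_cast h4
      refine (mul_le_of_le_one_left (by positivity) h1).trans ?_
      nlinarith [mul_le_mul_of_nonneg_left hs1.le (by linarith : (0 : ℝ) ≤ d)]
  have e : 1 / (2 * s / ((d : ℝ) - 1) * (2 * s' / d) / (1 + 2 * s / (d - 1) + 2 * s' / d)) -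
      (((d : ℝ) - 1) / (2 * s) + d * (1 / s + 3 / 2)) / 2 =
      (d * (d - 1) + 2 * d * s - s' * (d + 1 + 3 * d * s)) / (4 * s * s') := by
    field_simp
    ring
  rw [← sub_nonneg, e]
  exact div_nonneg (sub_nonneg.2 key) (by positivity)

end

end

end RadiativeTransfer

theorem mainTheorem5 (d : ℕ) (hd : 3 ≤ d) (s : ℝ) (hs : s ∈ Set.Ioo (0 : ℝ) 1)
    (b : ℝ → ℝ) (hb : RadiativeTransfer.IsForwardPeaked s b)
    (δ : ℝ) (hδ : RadiativeTransfer.IsDelta d δ)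
    (s' : ℝ) (hs' : s' ∈ Set.Ioc (0 : ℝ) (2 * RadiativeTransfer.beta d s δ)) :
    1 < RadiativeTransfer.omegaExp d s s' ∧
    ∃ c₃ : ℝ → ℝ, StrictMonoOn c₃ (Set.Ici 0) ∧
      ∀ (T : ℝ) (_hT : 0 < T)
        (u₀ : RadiativeTransfer.Space d × RadiativeTransfer.Sphere d → ℝ)
        (_hu₀ : Integrable u₀ (RadiativeTransfer.phase d))
        (_hu₀_nonneg : 0 ≤ᵐ[RadiativeTransfer.phase d] u₀)
        (u : ℝ → RadiativeTransfer.Space d × RadiativeTransfer.Sphere d → ℝ)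
        (_hu : RadiativeTransfer.IsSolution d s b T u₀ u),
        ∀ t : ℝ, 0 < t → t < min T 1 →
          MemLp (u t) 2 (RadiativeTransfer.phase d) ∧
          (eLpNorm (u t) 2 (RadiativeTransfer.phase d)).toReal ≤
            c₃ (∫ z, u₀ z ∂(RadiativeTransfer.phase d)) *
              t ^ (-(1 / (RadiativeTransfer.omegaExp d s s' - 1))) := by
  open RadiativeTransfer in
  obtain ⟨M, k, e, hk, hker⟩ := exists_isKernel hd hs hb
  obtain ⟨hω, hP⟩ := one_lt_omegaExp hd hs hδ hs'
  obtain ⟨C, hC0, hC⟩ := hk.exists_eLpNorm_le hker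
  -- The equation is linear and the modes are bounded by the mass, so `c₃` can be taken linear.
  refine ⟨hω, fun m => C * m, fun x _ y _ hxy => mul_lt_mul_of_pos_left hxy hC0, ?_⟩
  intro T hT u₀ hu₀ hu₀_nonneg u hu t ht htT
  have h := hC hT hu₀ hu₀_nonneg hu t ht htT
  have ht1 := lt_min_iff.1 htT
  have hm : 0 ≤ ∫ z, u₀ z ∂(phase d) := integral_nonneg_of_ae hu₀_nonneg
  refine ⟨⟨(hu.locallyIntegrable t ⟨ht.le, ht1.1⟩).aestronglyMeasurable,
    h.trans_lt ENNReal.ofReal_lt_top⟩, (ENNReal.toReal_le_of_le_ofReal (by positivity) h).trans ?_⟩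
  gcongr _ * ?_
  -- For `t < 1` the less singular rate obtained above is dominated by the rate with exponent
  -- `1/(ω-1)`.
  exact Real.rpow_le_rpow_of_exponent_ge ht ht1.2.le (neg_le_neg hP)
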